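/- Let $\mathcal W$ be a monoidal (strict) 2-category and let $G$ be a group acting on $\mathcal W$ by strong monoidal 2-functors $X\mapsto{}^gX$, with coherent monoidal 2-natural isomorphisms ${}^h({}^gX)\cong{}^{gh}X$ and ${}^1X\cong X$ (for instance identities). For a $\mathcal W$-enriched bicategory $\mathcal A$ let ${}^g\!\mathcal A$ have the same objects and homs ${}^g(\mathcal A(x,y))$. A *weak, strictly unital twisted $G$-action* on $\mathcal A$ consists of $\mathcal W$-functors ${}^g(-):{}^g\!\mathcal A\to\mathcal A$ ($g\in G$), the identity for $g=1$; $\mathcal W$-pseudonatural adjoint equivalences $\varphi_{g,h}$ with components ${}^{gh}x\to{}^h({}^gx)$, the identity if $g=1$ or $h=1$; and invertible $\mathcal W$-modifications $\zeta_{g,h,k}:\varphi_{h,k}\circ\varphi_{g,hk}\cong{}^k\varphi_{g,h}\circ\varphi_{gh,k}$, the identity (canonical constraint isomorphism) if $g$, $h$ or $k$ is $1$; such that for all $g,h,k,\ell\in G$ the 4-simplex diagram of instances of $\zeta$, between the two composites $\varphi_{k,\ell}\circ\varphi_{h,k\ell}\circ\varphi_{g,hk\ell}\cong{}^\ell({}^k\varphi_{g,h})\circ{}^\ell\varphi_{gh,k}\circ\varphi_{ghk,\ell}$,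 commutes. A *$\int_G\mathcal W$-enriched bicategory* $\mathfrak A$ (bicategory enriched in $G$-graded families of objects of $\mathcal W$ with the twisted convolution product) consists of objects; for all $x,y$ and $g\in G$ an object $\mathfrak A^g(x,y)$ of $\mathcal W$; units $\mathbb 1\to\mathfrak A^1(x,x)$; compositions $\mathfrak A^h(y,z)\otimes{}^h\mathfrak A^g(x,y)\to\mathfrak A^{gh}(x,z)$; and invertible associativity and unitality 2-cells satisfying the pentagon axiom (for all $g,h,k,\ell$) and the unitality axiom (for all $g,h$). A *copower of $x$ by the twisted unit* $\mathbb 1[g]$ is an object $x'$ with $\chi:\mathbb 1\to\mathfrak A^g(x,x')$ such that precomposition with $\chi$ is an equivalence $\mathfrak A^h(x',y)\to\mathfrak A^{gh}(x,y)$ in $\mathcal W$ for all $h\in G$ and all $y$. **Theorem.** (1) Let $\mathcal A$ be a $\mathcal W$-enriched bicategory with a weak, strictly unital twisted $G$-action. Put $\mathfrak A^g(x,y)=\mathcal A({}^gx,y)$, with the units of $\mathcal A$ and with the composition $$\mathcal A({}^hy,z)\otimes{}^h\mathcal A({}^gx,y)\to\mathcal A({}^hy,z)\otimes\mathcal A({}^h({}^gx),{}^hy)\to\mathcal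 A({}^h({}^gx),z)\to\mathcal A({}^{gh}x,z)$$ given by the functor ${}^h(-)$, the composition of $\mathcal A$, and precomposition with $\varphi_{g,h}$. Then, with suitable associativity and unitality 2-cells, $\mathfrak A$ is a $\int_G\mathcal W$-enriched bicategory, and it has copowers by all twisted units; namely ${}^gx$, with the identity of ${}^gx$ regarded as $\chi:\mathbb 1\to\mathfrak A^g(x,{}^gx)$, is a copower of $x$ by $\mathbb 1[g]$. (2) In particular, let $\mathcal B$ be a bicategory with a weak duality involution: a pseudofunctor $(-)^\circ:\mathcal B^{\mathrm{co}}\to\mathcal B$, a pseudonatural adjoint equivalence $\varphi_x:x\to x^{\circ\circ}$, and an invertible modification $\zeta_x:\varphi_{x^\circ}\cong(\varphi_x)^\circ$, such that for each $x$ the 2-cell $\zeta_{x^\circ}\varphi_x:\varphi_{x^{\circ\circ}}\circ\varphi_x\to(\varphi_{x^\circ})^\circ\circ\varphi_x$ is the composite of the naturality constraint $\varphi_{x^{\circ\circ}}\circ\varphi_x\cong(\varphi_x)^{\circ\circ}\circ\varphi_x$ with $(\zeta_x)^\circ\varphi_x$. Then $\mathfrak A^+(x,y)=\mathcal B(x,y)$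 and $\mathfrak A^-(x,y)=\mathcal B(x^\circ,y)$, with the identities of $\mathcal B$ and with the composition $(\beta,\alpha)\mapsto\beta\circ{}^h\alpha\circ\varphi_{g,h}$ (where ${}^+\alpha=\alpha$, ${}^-\alpha=\alpha^\circ$, $\varphi_{-,-}=\varphi$, and the other $\varphi_{g,h}$ are identities), underlie a bicategory with contravariance, that is, a $\int_{\{+,-\}}\mathrm{Cat}_g$-enriched bicategory, where $\mathrm{Cat}_g$ is the monoidal 2-category of categories, functors and natural isomorphisms with the cartesian product, on which $-$ acts by $C\mapsto C^{\mathrm{op}}$. In it every object $x$ has the weak opposite $x^\circ$, i.e. $x^\circ$ with the identity of $x^\circ$ is a copower of $x$ by $\mathbb 1[-]$. -/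

import Mathlib

open CategoryTheory
open scoped MonoidalCategory

universe w v u t s r w₁ v₁ u₁
set_option linter.unusedSimpArgs false

namespace TwistedBicat

local infixr:81 " ◃ " => Bicategory.whiskerLeft
local infixl:81 " ▹ " => Bicategory.whiskerRight

/-- A monoidal structure on a strict 2-category `W`: a monoidal structure on the underlying 1-category
whose tensor product extends to a strict 2-functor, with 2-natural associator and unitors
(a monoidal category enriched in `Cat`). The equalities of 1-cells which hold by strictness are
mediated by `eqToHom`. -/
class MonoidalTwoCategory (W : Type u) [Bicategory.{w, v} W] [Bicategory.Strict W]
    extends MonoidalCategory W where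
  tensor₂ {X X' Y Y' : W} {f f' : X ⟶ X'} {g g' : Y ⟶ Y'} (η : f ⟶ f') (θ : g ⟶ g') :
    (f ⊗ₘ g) ⟶ (f' ⊗ₘ g')
  tensor₂_id {X X' Y Y' : W} (f : X ⟶ X') (g : Y ⟶ Y') :
    tensor₂ (𝟙 f) (𝟙 g) = 𝟙 (f ⊗ₘ g)
  tensor₂_comp {X X' Y Y' : W} {f f' f'' : X ⟶ X'} {g g' g'' : Y ⟶ Y'}
    (η : f ⟶ f') (η' : f' ⟶ f'') (θ : g ⟶ g') (θ' : g' ⟶ g'') :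
    tensor₂ (η ≫ η') (θ ≫ θ') = tensor₂ η θ ≫ tensor₂ η' θ'
  tensor₂_whiskerLeft {X X' X'' Y Y' Y'' : W} (f : X ⟶ X') {k k' : X' ⟶ X''} (η : k ⟶ k')
    (g : Y ⟶ Y') {l l' : Y' ⟶ Y''} (θ : l ⟶ l') :
    tensor₂ (f ◃ η) (g ◃ θ) =
      eqToHom (by simp) ≫ (f ⊗ₘ g) ◃ tensor₂ η θ ≫ eqToHom (by simp)
  tensor₂_whiskerRight {X X' X'' Y Y' Y'' : W} {f f' : X ⟶ X'} (η : f ⟶ f') (k : X' ⟶ X'')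
    {g g' : Y ⟶ Y'} (θ : g ⟶ g') (l : Y' ⟶ Y'') :
    tensor₂ (η ▹ k) (θ ▹ l) =
      eqToHom (by simp) ≫ tensor₂ η θ ▹ (k ⊗ₘ l) ≫ eqToHom (by simp)
  associator_naturality₂ {X X' Y Y' Z Z' : W} {f f' : X ⟶ X'} {g g' : Y ⟶ Y'} {h h' : Z ⟶ Z'}
    (η : f ⟶ f') (θ : g ⟶ g') (κ : h ⟶ h') :
    tensor₂ (tensor₂ η θ) κ ▹ (α_ X' Y' Z').hom =
      eqToHom (by simp) ≫ (α_ X Y Z).hom ◃ tensor₂ η (tensor₂ θ κ) ≫ eqToHom (by simp)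
  leftUnitor_naturality₂ {X X' : W} {f f' : X ⟶ X'} (η : f ⟶ f') :
    tensor₂ (𝟙 (𝟙 (𝟙_ W))) η ▹ (λ_ X').hom =
      eqToHom (by simp) ≫ (λ_ X).hom ◃ η ≫ eqToHom (by simp)
  rightUnitor_naturality₂ {X X' : W} {f f' : X ⟶ X'} (η : f ⟶ f') :
    tensor₂ η (𝟙 (𝟙 (𝟙_ W))) ▹ (ρ_ X').hom =
      eqToHom (by simp) ≫ (ρ_ X).hom ◃ η ≫ eqToHom (by simp)

open MonoidalTwoCategory

/-- An action of the group `G` on the monoidal 2-category `W` by strong monoidal strict 2-functors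
`act g` (written `X ↦ ᵍX`). The composition law `ʰ(ᵍX) = ᵍʰX` and the unit law `¹X = X` hold up
to the coherent monoidal 2-natural isomorphisms `mulIso` and `oneIso`; an action for which these
laws are strict is the case in which all of their components are identities. (This is needed to
include the formation of opposite categories, as `(Cᵒᵖ)ᵒᵖ` is not literally `C`.) The isomorphism
`mulIso e` is indexed by an equation `e : g * h = k` to avoid transport along equations in `G`. -/
class TwistingAction (G : Type t) [Group G] (W : Type u) [Bicategory.{w, v} W]
    [Bicategory.Strict W] [MonoidalTwoCategory W] where
  act : G → W ⥤ W
  act₂ (g : G) {X Y : W} {f f' : X ⟶ Y} (η : f ⟶ f') : (act g).map f ⟶ (act g).map f'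
  act₂_id (g : G) {X Y : W} (f : X ⟶ Y) : act₂ g (𝟙 f) = 𝟙 ((act g).map f)
  act₂_comp (g : G) {X Y : W} {f f' f'' : X ⟶ Y} (η : f ⟶ f') (θ : f' ⟶ f'') :
    act₂ g (η ≫ θ) = act₂ g η ≫ act₂ g θ
  act₂_whiskerLeft (g : G) {X Y Z : W} (f : X ⟶ Y) {k k' : Y ⟶ Z} (η : k ⟶ k') :
    act₂ g (f ◃ η) = eqToHom (by simp) ≫ (act g).map f ◃ act₂ g η ≫ eqToHom (by simp)
  act₂_whiskerRight (g : G) {X Y Z : W} {f f' : X ⟶ Y} (η : f ⟶ f') (k : Y ⟶ Z) :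
    act₂ g (η ▹ k) = eqToHom (by simp) ≫ act₂ g η ▹ (act g).map k ≫ eqToHom (by simp)
  monoidal (g : G) : (act g).Monoidal
  μ_naturality₂ (g : G) {X X' Y Y' : W} {f f' : X ⟶ X'} {k k' : Y ⟶ Y'}
    (η : f ⟶ f') (θ : k ⟶ k') :
    tensor₂ (act₂ g η) (act₂ g θ) ▹ Functor.LaxMonoidal.μ (act g) X' Y' =
      eqToHom (by simp) ≫ Functor.LaxMonoidal.μ (act g) X Y ◃ act₂ g (tensor₂ η θ) ≫
        eqToHom (by simp)
  mulIso {g h k : G} (e : g * h = k) : act g ⋙ act h ≅ act k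
  mulIso_monoidal {g h k : G} (e : g * h = k) : NatTrans.IsMonoidal (mulIso e).hom
  mulIso_naturality₂ {g h k : G} (e : g * h = k) {X Y : W} {f f' : X ⟶ Y} (η : f ⟶ f') :
    act₂ h (act₂ g η) ▹ (mulIso e).hom.app Y =
      eqToHom ((mulIso e).hom.naturality f) ≫ (mulIso e).hom.app X ◃ act₂ k η ≫
        eqToHom ((mulIso e).hom.naturality f').symm
  oneIso : act 1 ≅ 𝟭 W
  oneIso_monoidal : NatTrans.IsMonoidal oneIso.hom
  oneIso_naturality₂ {X Y : W} {f f' : X ⟶ Y} (η : f ⟶ f') :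
    act₂ 1 η ▹ oneIso.hom.app Y =
      eqToHom (oneIso.hom.naturality f) ≫ oneIso.hom.app X ◃ η ≫
        eqToHom (oneIso.hom.naturality f').symm
  mulIso_assoc {g h k a b c : G} (e₁ : g * h = a) (e₂ : h * k = b) (e₃ : a * k = c)
    (e₄ : g * b = c) (X : W) :
    (act k).map ((mulIso e₁).hom.app X) ≫ (mulIso e₃).hom.app X =
      (mulIso e₂).hom.app ((act g).obj X) ≫ (mulIso e₄).hom.app X
  mulIso_one_left (h : G) (X : W) :
    (mulIso (one_mul h)).hom.app X = (act h).map (oneIso.hom.app X)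
  mulIso_one_right (g : G) (X : W) :
    (mulIso (mul_one g)).hom.app X = oneIso.hom.app ((act g).obj X)

attribute [reducible, instance] TwistingAction.monoidal
attribute [instance] TwistingAction.mulIso_monoidal TwistingAction.oneIso_monoidal

section Enriched

variable {W : Type u} [Bicategory.{w, v} W] [Bicategory.Strict W] [MonoidalTwoCategory W]

/-- The tensor product of invertible 2-cells. -/
def tensorIso₂ {X X' Y Y' : W} {f f' : X ⟶ X'} {g g' : Y ⟶ Y'} (η : f ≅ f') (θ : g ≅ g') :
    (f ⊗ₘ g) ≅ (f' ⊗ₘ g') where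
  hom := tensor₂ η.hom θ.hom
  inv := tensor₂ η.inv θ.inv
  hom_inv_id := by rw [← tensor₂_comp, Iso.hom_inv_id, Iso.hom_inv_id, tensor₂_id]
  inv_hom_id := by rw [← tensor₂_comp, Iso.inv_hom_id, Iso.inv_hom_id, tensor₂_id]

variable (W) in
/-- The data of a `W`-enriched bicategory on the objects `Obj`. -/
structure EnrichedData (Obj : Type s) where
  hom : Obj → Obj → W
  id (x : Obj) : 𝟙_ W ⟶ hom x x
  comp (x y z : Obj) : hom y z ⊗ hom x y ⟶ hom x z
  assoc (w x y z : Obj) :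
    (comp x y z ⊗ₘ 𝟙 (hom w x)) ≫ comp w x z ≅
      (α_ (hom y z) (hom x y) (hom w x)).hom ≫ (𝟙 (hom y z) ⊗ₘ comp w x y) ≫ comp w y z
  leftUnitor (x y : Obj) : (id y ⊗ₘ 𝟙 (hom x y)) ≫ comp x y y ≅ (λ_ (hom x y)).hom
  rightUnitor (x y : Obj) : (𝟙 (hom x y) ⊗ₘ id x) ≫ comp x x y ≅ (ρ_ (hom x y)).hom

variable (W) in
/-- A `W`-enriched bicategory: the data, the pentagon axiom, and the triangle axiom. -/
structure EnrichedBicategory (Obj : Type s) extends EnrichedData W Obj where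
  pentagon (v w x y z : Obj) :
    ((comp x y z ⊗ₘ 𝟙 (hom w x)) ⊗ₘ 𝟙 (hom v w)) ◃ (assoc v w x z).hom ≫
      eqToHom (by simp only [MonoidalCategory.tensorHom_id, MonoidalCategory.id_tensorHom,
        Category.assoc, MonoidalCategory.associator_naturality_left_assoc,
        MonoidalCategory.whisker_exchange_assoc]) ≫
      ((α_ (hom y z ⊗ hom x y) (hom w x) (hom v w)).hom ≫
        (𝟙 (hom y z ⊗ hom x y) ⊗ₘ comp v w x)) ◃ (assoc v x y z).hom =
    eqToHom (by simp) ≫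
      tensor₂ (assoc w x y z).hom (𝟙 (𝟙 (hom v w))) ▹ comp v w z ≫
      eqToHom (by simp) ≫
      (((α_ (hom y z) (hom x y) (hom w x)).hom ⊗ₘ 𝟙 (hom v w)) ≫
        ((𝟙 (hom y z) ⊗ₘ comp w x y) ⊗ₘ 𝟙 (hom v w))) ◃ (assoc v w y z).hom ≫
      eqToHom (by simp) ≫
      (((α_ (hom y z) (hom x y) (hom w x)).hom ⊗ₘ 𝟙 (hom v w)) ≫
        (α_ (hom y z) (hom x y ⊗ hom w x) (hom v w)).hom) ◃
          (tensor₂ (𝟙 (𝟙 (hom y z))) (assoc v w x y).hom ▹ comp v y z) ≫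
      eqToHom (by simp)
  triangle (x y z : Obj) :
    ((𝟙 (hom y z) ⊗ₘ id y) ⊗ₘ 𝟙 (hom x y)) ◃ (assoc x y y z).hom ≫
      eqToHom (by simp) ≫
      (α_ (hom y z) (𝟙_ W) (hom x y)).hom ◃
        (tensor₂ (𝟙 (𝟙 (hom y z))) (leftUnitor x y).hom ▹ comp x y z) =
    eqToHom (by simp) ≫
      tensor₂ (rightUnitor y z).hom (𝟙 (𝟙 (hom x y))) ▹ comp x y z ≫
      eqToHom (by simp)

namespace EnrichedData

variable {Obj : Type s} (A : EnrichedData W Obj)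

/-- The 1-cells `x ⟶ y` of the underlying bicategory. -/
abbrev El (x y : Obj) := 𝟙_ W ⟶ A.hom x y

variable {A}

/-- The identity 1-cell, along an equality of objects. -/
def eqTo {x y : Obj} (e : x = y) : A.El x y := e ▸ A.id x

/-- Postcomposition with the 1-cell `f`. -/
def post {x y : Obj} (f : A.El x y) (w : Obj) : A.hom w x ⟶ A.hom w y :=
  (λ_ (A.hom w x)).inv ≫ (f ⊗ₘ 𝟙 (A.hom w x)) ≫ A.comp w x y

/-- Precomposition with the 1-cell `f`. -/
def pre {x y : Obj} (f : A.El x y) (z : Obj) : A.hom y z ⟶ A.hom x z :=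
  (ρ_ (A.hom y z)).inv ≫ (𝟙 (A.hom y z) ⊗ₘ f) ≫ A.comp x y z

def postIso₂ {x y : Obj} {f f' : A.El x y} (η : f ≅ f') (w : Obj) : post f w ≅ post f' w :=
  Bicategory.whiskerLeftIso _
    (Bicategory.whiskerRightIso (tensorIso₂ η (Iso.refl (𝟙 (A.hom w x)))) (A.comp w x y))

def preIso₂ {x y : Obj} {f f' : A.El x y} (η : f ≅ f') (z : Obj) : pre f z ≅ pre f' z :=
  Bicategory.whiskerLeftIso _
    (Bicategory.whiskerRightIso (tensorIso₂ (Iso.refl (𝟙 (A.hom y z))) η) (A.comp x y z))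

/-- The composite `x ⟶ y ⟶ z` of 1-cells (in diagrammatic order). -/
def gcomp {x y z : Obj} (f : A.El x y) (g : A.El y z) : A.El x z := f ≫ post g x

def gcompIso₂ {x y z : Obj} {f f' : A.El x y} {g g' : A.El y z} (η : f ≅ f') (θ : g ≅ g') :
    gcomp f g ≅ gcomp f' g' :=
  Bicategory.whiskerRightIso η (post g x) ≪≫ Bicategory.whiskerLeftIso f' (postIso₂ θ x)

lemma gcomp_eq {x y z : Obj} (f : A.El x y) (g : A.El y z) : gcomp f g = g ≫ pre f z := by
  simp only [gcomp, post, pre, MonoidalCategory.tensorHom_id, MonoidalCategory.id_tensorHom,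
    MonoidalCategory.leftUnitor_inv_naturality_assoc,
    MonoidalCategory.rightUnitor_inv_naturality_assoc, MonoidalCategory.unitors_inv_equal,
    MonoidalCategory.whisker_exchange_assoc]

/-- Instances of the associator of `A`, rewritten in terms of `post`, `pre`, and `gcomp`:
here `f ∘ (b ∘ a) ≅ (f ∘ b) ∘ a`. -/
def postComp {x y : Obj} (f : A.El x y) (v w : Obj) :
    A.comp v w x ≫ post f v ≅ (post f w ⊗ₘ 𝟙 (A.hom v w)) ≫ A.comp v w y :=
  eqToIso (by
      simp only [post, MonoidalCategory.tensorHom_id, MonoidalCategory.id_tensorHom,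
        Category.assoc]
      rw [MonoidalCategory.leftUnitor_inv_naturality_assoc,
        MonoidalCategory.whisker_exchange_assoc,
        MonoidalCategory.associator_naturality_left_assoc]
      simp) ≪≫
    Bicategory.whiskerLeftIso
      (((λ_ (A.hom w x)).inv ⊗ₘ 𝟙 (A.hom v w)) ≫ ((f ⊗ₘ 𝟙 (A.hom w x)) ⊗ₘ 𝟙 (A.hom v w)))
      (A.assoc v w x y).symm ≪≫
    eqToIso (by simp [post])

/-- `b ∘ (a ∘ f) ≅ (b ∘ a) ∘ f`. -/
def preComp {x y : Obj} (f : A.El x y) (z t : Obj) :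
    (𝟙 (A.hom z t) ⊗ₘ pre f z) ≫ A.comp x z t ≅ A.comp y z t ≫ pre f t :=
  eqToIso (by simp [pre]) ≪≫
    Bicategory.whiskerLeftIso
      ((ρ_ (A.hom z t ⊗ A.hom y z)).inv ≫ (𝟙 (A.hom z t ⊗ A.hom y z) ⊗ₘ f))
      (A.assoc x y z t).symm ≪≫
    eqToIso (by
      simp only [pre, MonoidalCategory.tensorHom_id, MonoidalCategory.id_tensorHom,
        Category.assoc]
      rw [MonoidalCategory.whisker_exchange_assoc,
        MonoidalCategory.rightUnitor_inv_naturality_assoc])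

/-- `(b ∘ f) ∘ a ≅ b ∘ (f ∘ a)`. -/
def midComp {x y : Obj} (f : A.El x y) (w z : Obj) :
    (pre f z ⊗ₘ 𝟙 (A.hom w x)) ≫ A.comp w x z ≅
      (𝟙 (A.hom y z) ⊗ₘ post f w) ≫ A.comp w y z :=
  eqToIso (by simp [pre]) ≪≫
    Bicategory.whiskerLeftIso
      (((ρ_ (A.hom y z)).inv ⊗ₘ 𝟙 (A.hom w x)) ≫ ((𝟙 (A.hom y z) ⊗ₘ f) ⊗ₘ 𝟙 (A.hom w x)))
      (A.assoc w x y z) ≪≫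
    eqToIso (by simp [post])

/-- `g ∘ (a ∘ f) ≅ (g ∘ a) ∘ f`. -/
def prePost {x' x y y' : Obj} (f : A.El x' x) (g : A.El y y') :
    pre f y ≫ post g x' ≅ post g x ≫ pre f y' :=
  eqToIso (by simp [pre]) ≪≫
    Bicategory.whiskerLeftIso ((ρ_ (A.hom x y)).inv ≫ (𝟙 (A.hom x y) ⊗ₘ f)) (postComp g x' x) ≪≫
    eqToIso (by
      simp only [MonoidalCategory.tensorHom_id, MonoidalCategory.id_tensorHom, Category.assoc]
      rw [MonoidalCategory.whisker_exchange_assoc,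
        ← MonoidalCategory.rightUnitor_inv_naturality_assoc, pre,
        MonoidalCategory.id_tensorHom])

/-- `(g ∘ f) ∘ a ≅ g ∘ (f ∘ a)`. -/
def postGcomp {x y z : Obj} (f : A.El x y) (g : A.El y z) (w : Obj) :
    post (gcomp f g) w ≅ post f w ≫ post g w :=
  eqToIso (by simp [post, gcomp]) ≪≫
    Bicategory.whiskerLeftIso ((λ_ (A.hom w x)).inv ≫ (f ⊗ₘ 𝟙 (A.hom w x)))
      (postComp g w x).symm ≪≫
    eqToIso (by simp [post])

/-- `a ∘ (g ∘ f) ≅ (a ∘ g) ∘ f`. -/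
def preGcomp {x y z : Obj} (f : A.El x y) (g : A.El y z) (t : Obj) :
    pre (gcomp f g) t ≅ pre g t ≫ pre f t :=
  eqToIso (by simp [pre, gcomp]) ≪≫
    Bicategory.whiskerLeftIso ((ρ_ (A.hom z t)).inv ≫ (𝟙 (A.hom z t) ⊗ₘ f))
      (midComp g x t).symm ≪≫
    eqToIso (by
      simp only [MonoidalCategory.tensorHom_id, MonoidalCategory.id_tensorHom, Category.assoc]
      rw [MonoidalCategory.whisker_exchange_assoc,
        ← MonoidalCategory.rightUnitor_inv_naturality_assoc]
      simp [pre])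

def postId (x w : Obj) : post (A.id x) w ≅ 𝟙 (A.hom w x) :=
  Bicategory.whiskerLeftIso (λ_ (A.hom w x)).inv (A.leftUnitor w x) ≪≫ eqToIso (by simp)

def preId (x z : Obj) : pre (A.id x) z ≅ 𝟙 (A.hom x z) :=
  Bicategory.whiskerLeftIso (ρ_ (A.hom x z)).inv (A.rightUnitor x z) ≪≫ eqToIso (by simp)

def gcompId {x y : Obj} (f : A.El x y) : gcomp f (A.id y) ≅ f :=
  Bicategory.whiskerLeftIso f (postId y x) ≪≫ eqToIso (by simp)

def idGcomp {x y : Obj} (f : A.El x y) : gcomp (A.id x) f ≅ f :=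
  eqToIso (gcomp_eq _ _) ≪≫ Bicategory.whiskerLeftIso f (preId x y) ≪≫ eqToIso (by simp)

def gcompAssoc {w x y z : Obj} (f : A.El w x) (g : A.El x y) (h : A.El y z) :
    gcomp (gcomp f g) h ≅ gcomp f (gcomp g h) :=
  eqToIso (by simp [gcomp]) ≪≫ Bicategory.whiskerLeftIso f (postGcomp g h w).symm

end EnrichedData

open EnrichedData

/-- The data of a functor of `W`-enriched bicategories: a map on objects, 1-cells on homs, and the
invertible 2-cells expressing preservation of identities and of composition. -/
structure FunctorData {O : Type s} {O' : Type t} (A : EnrichedData W O)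
    (B : EnrichedData W O') where
  obj : O → O'
  map (x y : O) : A.hom x y ⟶ B.hom (obj x) (obj y)
  mapId (x : O) : A.id x ≫ map x x ≅ B.id (obj x)
  mapComp (x y z : O) :
    (map y z ⊗ₘ map x y) ≫ B.comp (obj x) (obj y) (obj z) ≅ A.comp x y z ≫ map x z

namespace FunctorData

variable {O : Type s} {O' : Type t} {O'' : Type r} {A : EnrichedData W O}
  {B : EnrichedData W O'} {C : EnrichedData W O''}

/-- The coherence axioms of a functor of `W`-enriched bicategories (compatibility with associators and
with the two unitors). -/
structure IsLawful (F : FunctorData A B) : Prop where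
  map_assoc (w x y z : O) :
    tensor₂ (F.mapComp x y z).hom (𝟙 (F.map w x)) ▹ B.comp _ _ _ ≫
      eqToHom (by
        simp only [MonoidalCategory.tensorHom_comp_tensorHom_assoc,
          MonoidalCategory.associator_naturality_assoc, Category.assoc, Category.comp_id,
          Category.id_comp]) ≫
      (A.comp x y z ⊗ₘ 𝟙 (A.hom w x)) ◃ (F.mapComp w x z).hom ≫
      eqToHom (by
        simp only [MonoidalCategory.tensorHom_comp_tensorHom_assoc,
          MonoidalCategory.associator_naturality_assoc, Category.assoc, Category.comp_id,
          Category.id_comp]) ≫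
      (A.assoc w x y z).hom ▹ F.map w z =
    eqToHom (by
        simp only [MonoidalCategory.tensorHom_comp_tensorHom_assoc,
          MonoidalCategory.associator_naturality_assoc, Category.assoc, Category.comp_id,
          Category.id_comp]) ≫
      ((F.map y z ⊗ₘ F.map x y) ⊗ₘ F.map w x) ◃ (B.assoc _ _ _ _).hom ≫
      eqToHom (by
        simp only [MonoidalCategory.tensorHom_comp_tensorHom_assoc,
          MonoidalCategory.associator_naturality_assoc, Category.assoc, Category.comp_id,
          Category.id_comp]) ≫
      (α_ (A.hom y z) (A.hom x y) (A.hom w x)).hom ◃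
        (tensor₂ (𝟙 (F.map y z)) (F.mapComp w x y).hom ▹ B.comp _ _ _) ≫
      eqToHom (by
        simp only [MonoidalCategory.tensorHom_comp_tensorHom_assoc,
          MonoidalCategory.associator_naturality_assoc, Category.assoc, Category.comp_id,
          Category.id_comp]) ≫
      ((α_ (A.hom y z) (A.hom x y) (A.hom w x)).hom ≫ (𝟙 (A.hom y z) ⊗ₘ A.comp w x y)) ◃
        (F.mapComp w y z).hom ≫
      eqToHom (by
        simp only [MonoidalCategory.tensorHom_comp_tensorHom_assoc,
          MonoidalCategory.associator_naturality_assoc, Category.assoc, Category.comp_id,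
          Category.id_comp])
  map_leftUnitor (x y : O) :
    (A.id y ⊗ₘ 𝟙 (A.hom x y)) ◃ (F.mapComp x y y).hom ≫
      eqToHom (by simp) ≫
      (A.leftUnitor x y).hom ▹ F.map x y =
    eqToHom (by
        simp only [MonoidalCategory.tensorHom_comp_tensorHom_assoc,
          MonoidalCategory.associator_naturality_assoc, Category.assoc, Category.comp_id,
          Category.id_comp]) ≫
      tensor₂ (F.mapId y).hom (𝟙 (F.map x y)) ▹ B.comp _ _ _ ≫
      eqToHom (by
        simp only [MonoidalCategory.tensorHom_comp_tensorHom_assoc,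
          MonoidalCategory.associator_naturality_assoc, Category.assoc, Category.comp_id,
          Category.id_comp]) ≫
      (𝟙 (𝟙_ W) ⊗ₘ F.map x y) ◃ (B.leftUnitor _ _).hom ≫
      eqToHom (by simp)
  map_rightUnitor (x y : O) :
    (𝟙 (A.hom x y) ⊗ₘ A.id x) ◃ (F.mapComp x x y).hom ≫
      eqToHom (by simp) ≫
      (A.rightUnitor x y).hom ▹ F.map x y =
    eqToHom (by
        simp only [MonoidalCategory.tensorHom_comp_tensorHom_assoc,
          MonoidalCategory.associator_naturality_assoc, Category.assoc, Category.comp_id,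
          Category.id_comp]) ≫
      tensor₂ (𝟙 (F.map x y)) (F.mapId x).hom ▹ B.comp _ _ _ ≫
      eqToHom (by
        simp only [MonoidalCategory.tensorHom_comp_tensorHom_assoc,
          MonoidalCategory.associator_naturality_assoc, Category.assoc, Category.comp_id,
          Category.id_comp]) ≫
      (F.map x y ⊗ₘ 𝟙 (𝟙_ W)) ◃ (B.rightUnitor _ _).hom ≫
      eqToHom (by simp)

/-- Composition of functors of `W`-enriched bicategories: first `F`, then `H`. -/
abbrev comp (F : FunctorData A B) (H : FunctorData B C) : FunctorData A C where
  obj x := H.obj (F.obj x)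
  map x y := F.map x y ≫ H.map (F.obj x) (F.obj y)
  mapId x := eqToIso (by simp) ≪≫ Bicategory.whiskerRightIso (F.mapId x) (H.map _ _) ≪≫
    H.mapId (F.obj x)
  mapComp x y z := eqToIso (by simp) ≪≫
    Bicategory.whiskerLeftIso (F.map y z ⊗ₘ F.map x y) (H.mapComp _ _ _) ≪≫
    eqToIso (by simp) ≪≫
    Bicategory.whiskerRightIso (F.mapComp x y z) (H.map _ _) ≪≫
    eqToIso (by simp)

/-- The action of a functor on 1-cells of the underlying bicategories. -/
def mapEl (F : FunctorData A B) {x y : O} (f : A.El x y) : B.El (F.obj x) (F.obj y) :=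
  f ≫ F.map x y

def mapElIso₂ (F : FunctorData A B) {x y : O} {f f' : A.El x y} (η : f ≅ f') :
    F.mapEl f ≅ F.mapEl f' :=
  Bicategory.whiskerRightIso η (F.map x y)

def mapPost (F : FunctorData A B) {x y : O} (f : A.El x y) (w : O) :
    F.map w x ≫ post (F.mapEl f) (F.obj w) ≅ post f w ≫ F.map w y :=
  eqToIso (by
      simp only [post, mapEl, MonoidalCategory.leftUnitor_inv_naturality_assoc,
        ← MonoidalCategory.id_tensorHom, MonoidalCategory.tensorHom_comp_tensorHom_assoc,
        Category.comp_id, Category.id_comp, Category.assoc]) ≪≫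
    Bicategory.whiskerLeftIso ((λ_ (A.hom w x)).inv ≫ (f ⊗ₘ 𝟙 (A.hom w x))) (F.mapComp w x y) ≪≫
    eqToIso (by simp [post])

def mapPre (F : FunctorData A B) {x y : O} (f : A.El x y) (z : O) :
    F.map y z ≫ pre (F.mapEl f) (F.obj z) ≅ pre f z ≫ F.map x z :=
  eqToIso (by
      simp only [pre, mapEl, MonoidalCategory.rightUnitor_inv_naturality_assoc,
        ← MonoidalCategory.tensorHom_id, MonoidalCategory.tensorHom_comp_tensorHom_assoc,
        Category.comp_id, Category.id_comp, Category.assoc]) ≪≫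
    Bicategory.whiskerLeftIso ((ρ_ (A.hom y z)).inv ≫ (𝟙 (A.hom y z) ⊗ₘ f)) (F.mapComp x y z) ≪≫
    eqToIso (by simp [pre])

def mapGcomp (F : FunctorData A B) {x y z : O} (f : A.El x y) (g : A.El y z) :
    gcomp (F.mapEl f) (F.mapEl g) ≅ F.mapEl (gcomp f g) :=
  eqToIso (by simp [gcomp, mapEl]) ≪≫ Bicategory.whiskerLeftIso f (F.mapPost g x) ≪≫
    eqToIso (by simp [gcomp, mapEl])

end FunctorData

/-- The data of a pseudonatural transformation `F ⟶ H` of functors of `W`-enriched bicategories: the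
components `app x : F x ⟶ H x` and the invertible 2-cells `app y ∘ F(a) ≅ H(a) ∘ app x`. -/
structure TransData {O : Type s} {O' : Type t} {A : EnrichedData W O} {B : EnrichedData W O'}
    (F H : FunctorData A B) where
  app (x : O) : B.El (F.obj x) (H.obj x)
  naturality (x y : O) :
    F.map x y ≫ post (app y) (F.obj x) ≅ H.map x y ≫ pre (app x) (H.obj y)

namespace TransData

variable {O : Type s} {O' : Type t} {O'' : Type r} {A : EnrichedData W O}
  {B : EnrichedData W O'} {C : EnrichedData W O''}

/-- The axioms of a pseudonatural transformation: compatibility with identities and composition. -/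
structure IsLawful {F H : FunctorData A B} (φ : TransData F H) : Prop where
  naturality_id (x : O) :
    A.id x ◃ (φ.naturality x x).hom ≫
      eqToHom (by simp) ≫
      (H.mapId x).hom ▹ pre (φ.app x) (H.obj x) ≫
      eqToHom (gcomp_eq _ _).symm ≫ (gcompId (φ.app x)).hom =
    eqToHom (by simp) ≫
      (F.mapId x).hom ▹ post (φ.app x) (F.obj x) ≫ (idGcomp (φ.app x)).hom
  naturality_comp (x y z : O) :
    (F.mapComp x y z).hom ▹ post (φ.app z) (F.obj x) ≫
      eqToHom (by
        simp only [MonoidalCategory.tensorHom_comp_tensorHom_assoc,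
          MonoidalCategory.associator_naturality_assoc, Category.assoc, Category.comp_id,
          Category.id_comp]) ≫
      A.comp x y z ◃ (φ.naturality x z).hom =
    eqToHom (by
        simp only [MonoidalCategory.tensorHom_comp_tensorHom_assoc,
          MonoidalCategory.associator_naturality_assoc, Category.assoc, Category.comp_id,
          Category.id_comp]) ≫
      (F.map y z ⊗ₘ F.map x y) ◃ (postComp (φ.app z) _ _).hom ≫
      eqToHom (by
        simp only [MonoidalCategory.tensorHom_comp_tensorHom_assoc,
          MonoidalCategory.associator_naturality_assoc, Category.assoc, Category.comp_id,
          Category.id_comp]) ≫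
      tensor₂ (φ.naturality y z).hom (𝟙 (F.map x y)) ▹ B.comp _ _ _ ≫
      eqToHom (by
        simp only [MonoidalCategory.tensorHom_comp_tensorHom_assoc,
          MonoidalCategory.associator_naturality_assoc, Category.assoc, Category.comp_id,
          Category.id_comp]) ≫
      (H.map y z ⊗ₘ F.map x y) ◃ (midComp (φ.app y) _ _).hom ≫
      eqToHom (by
        simp only [MonoidalCategory.tensorHom_comp_tensorHom_assoc,
          MonoidalCategory.associator_naturality_assoc, Category.assoc, Category.comp_id,
          Category.id_comp]) ≫
      tensor₂ (𝟙 (H.map y z)) (φ.naturality x y).hom ▹ B.comp _ _ _ ≫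
      eqToHom (by
        simp only [MonoidalCategory.tensorHom_comp_tensorHom_assoc,
          MonoidalCategory.associator_naturality_assoc, Category.assoc, Category.comp_id,
          Category.id_comp]) ≫
      (H.map y z ⊗ₘ H.map x y) ◃ (preComp (φ.app x) _ _).hom ≫
      eqToHom (by
        simp only [MonoidalCategory.tensorHom_comp_tensorHom_assoc,
          MonoidalCategory.associator_naturality_assoc, Category.assoc, Category.comp_id,
          Category.id_comp]) ≫
      (H.mapComp x y z).hom ▹ pre (φ.app x) (H.obj z) ≫
      eqToHom (by
        simp only [MonoidalCategory.tensorHom_comp_tensorHom_assoc,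
          MonoidalCategory.associator_naturality_assoc, Category.assoc, Category.comp_id,
          Category.id_comp])

/-- Vertical composition of transformations: first `φ`, then `ψ`. -/
abbrev vcomp {F H K : FunctorData A B} (φ : TransData F H) (ψ : TransData H K) : TransData F K where
  app x := gcomp (φ.app x) (ψ.app x)
  naturality x y :=
    Bicategory.whiskerLeftIso (F.map x y) (postGcomp (φ.app y) (ψ.app y) (F.obj x)) ≪≫
      eqToIso (by simp) ≪≫
      Bicategory.whiskerRightIso (φ.naturality x y) (post (ψ.app y) (F.obj x)) ≪≫
      eqToIso (by simp) ≪≫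
      Bicategory.whiskerLeftIso (H.map x y) (prePost (φ.app x) (ψ.app y)) ≪≫
      eqToIso (by simp) ≪≫
      Bicategory.whiskerRightIso (ψ.naturality x y) (pre (φ.app x) (K.obj y)) ≪≫
      eqToIso (by simp) ≪≫
      Bicategory.whiskerLeftIso (K.map x y) (preGcomp (φ.app x) (ψ.app x) (K.obj y)).symm

/-- Precomposition of a transformation with a functor. -/
abbrev whiskerLeft (K : FunctorData A B) {F H : FunctorData B C} (φ : TransData F H) :
    TransData (K.comp F) (K.comp H) where
  app x := φ.app (K.obj x)
  naturality x y :=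
    eqToIso (by simp [FunctorData.comp]) ≪≫
      Bicategory.whiskerLeftIso (K.map x y) (φ.naturality (K.obj x) (K.obj y)) ≪≫
      eqToIso (by simp [FunctorData.comp])

/-- Application of a functor to a transformation. -/
abbrev whiskerRight {F H : FunctorData A B} (φ : TransData F H) (K : FunctorData B C) :
    TransData (F.comp K) (H.comp K) where
  app x := K.mapEl (φ.app x)
  naturality x y :=
    eqToIso (by simp [FunctorData.comp]) ≪≫
      Bicategory.whiskerLeftIso (F.map x y) (K.mapPost (φ.app y) (F.obj x)) ≪≫
      eqToIso (by simp [FunctorData.comp]) ≪≫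
      Bicategory.whiskerRightIso (φ.naturality x y) (K.map (F.obj x) (H.obj y)) ≪≫
      eqToIso (by simp [FunctorData.comp]) ≪≫
      Bicategory.whiskerLeftIso (H.map x y) (K.mapPre (φ.app x) (H.obj y)).symm ≪≫
      eqToIso (by simp [FunctorData.comp])

/-- The pseudonaturality 2-cell at a 1-cell `f` of the underlying bicategory. -/
def naturalityEl {F H : FunctorData A B} (φ : TransData F H) {x y : O} (f : A.El x y) :
    gcomp (F.mapEl f) (φ.app y) ≅ gcomp (φ.app x) (H.mapEl f) :=
  eqToIso (by simp [gcomp, FunctorData.mapEl]) ≪≫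
    Bicategory.whiskerLeftIso f (φ.naturality x y) ≪≫
    eqToIso (by simp [gcomp_eq, FunctorData.mapEl])

end TransData

section Twisted

variable {G : Type t} [Group G] [TwistingAction G W]

open TwistingAction Functor.LaxMonoidal

/-- The action of `g` on an invertible 2-cell. -/
def actIso₂ (g : G) {X Y : W} {f f' : X ⟶ Y} (η : f ≅ f') : (act g).map f ≅ (act g).map f' where
  hom := act₂ g η.hom
  inv := act₂ g η.inv
  hom_inv_id := by rw [← act₂_comp, Iso.hom_inv_id, act₂_id]
  inv_hom_id := by rw [← act₂_comp, Iso.inv_hom_id, act₂_id]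

lemma ε_mulIso_inv {g h k : G} (e : g * h = k) :
    ε (act k) ≫ (mulIso (W := W) e).inv.app (𝟙_ W) =
      ε (act h) ≫ (act h).map (ε (act (W := W) g)) := by
  rw [← cancel_mono ((mulIso (W := W) e).hom.app (𝟙_ W))]
  simp

lemma μ_mulIso_inv {g h k : G} (e : g * h = k) (X Y : W) :
    μ (act k) X Y ≫ (mulIso e).inv.app (X ⊗ Y) =
      ((mulIso e).inv.app X ⊗ₘ (mulIso e).inv.app Y) ≫
        μ (act h) _ _ ≫ (act h).map (μ (act g) X Y) := by
  rw [← cancel_mono ((mulIso (W := W) e).hom.app (X ⊗ Y)),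
    ← cancel_epi ((mulIso e).hom.app X ⊗ₘ (mulIso e).hom.app Y)]
  have := NatTrans.IsMonoidal.tensor (τ := (mulIso (W := W) e).hom) X Y
  rw [Functor.LaxMonoidal.comp_μ, Category.assoc] at this
  simp only [Category.assoc, Iso.inv_hom_id_app, MonoidalCategory.tensorHom_comp_tensorHom_assoc,
    Iso.hom_inv_id_app]
  rw [this, Category.comp_id, MonoidalCategory.id_tensorHom_id, Category.id_comp]

namespace EnrichedData

variable {O : Type s}

/-- The hom-wise action `ᵍA`, with the same objects as `A` and homs `ᵍ(A(x,y))`. -/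
abbrev base (g : G) (A : EnrichedData W O) : EnrichedData W O where
  hom x y := (act g).obj (A.hom x y)
  id x := ε (act g) ≫ (act g).map (A.id x)
  comp x y z := μ (act g) _ _ ≫ (act g).map (A.comp x y z)
  assoc w x y z := eqToIso (by simp) ≪≫
    Bicategory.whiskerLeftIso
      ((μ (act g) _ _ ⊗ₘ 𝟙 ((act g).obj (A.hom w x))) ≫ μ (act g) _ _)
      (actIso₂ g (A.assoc w x y z)) ≪≫
    eqToIso (by simp)
  leftUnitor x y := eqToIso (by simp) ≪≫
    Bicategory.whiskerLeftIso ((ε (act g) ⊗ₘ 𝟙 ((act g).obj (A.hom x y))) ≫ μ (act g) _ _)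
      (actIso₂ g (A.leftUnitor x y)) ≪≫
    eqToIso (by simp)
  rightUnitor x y := eqToIso (by simp) ≪≫
    Bicategory.whiskerLeftIso ((𝟙 ((act g).obj (A.hom x y)) ⊗ₘ ε (act g)) ≫ μ (act g) _ _)
      (actIso₂ g (A.rightUnitor x y)) ≪≫
    eqToIso (by simp)

/-- The 1-cell of `ᵍA` determined by a 1-cell of `A`. -/
def baseEl (g : G) {A : EnrichedData W O} {x y : O} (f : A.El x y) :
    (A.base g).El x y :=
  ε (act g) ≫ (act g).map f

def baseElIso₂ (g : G) {A : EnrichedData W O} {x y : O} {f f' : A.El x y}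
    (η : f ≅ f') : baseEl g f ≅ baseEl g f' :=
  Bicategory.whiskerLeftIso (ε (act g)) (actIso₂ g η)

lemma base_post (g : G) {A : EnrichedData W O} {x y : O} (f : A.El x y)
    (w : O) : post (baseEl g f) w = (act g).map (post f w) := by
  simp only [post, baseEl, Functor.map_comp, MonoidalCategory.tensorHom_id,
    Functor.Monoidal.map_leftUnitor_inv, Functor.Monoidal.map_whiskerRight,
    MonoidalCategory.comp_whiskerRight, Category.assoc, Functor.Monoidal.μ_δ_assoc]

lemma base_pre (g : G) {A : EnrichedData W O} {x y : O} (f : A.El x y)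
    (z : O) : pre (baseEl g f) z = (act g).map (pre f z) := by
  simp only [pre, baseEl, Functor.map_comp, MonoidalCategory.id_tensorHom,
    Functor.Monoidal.map_rightUnitor_inv, Functor.Monoidal.map_whiskerLeft,
    MonoidalCategory.whiskerLeft_comp, Category.assoc, Functor.Monoidal.μ_δ_assoc]

lemma base_gcomp (g : G) {A : EnrichedData W O} {x y z : O} (f : A.El x y)
    (k : A.El y z) : gcomp (baseEl g f) (baseEl g k) = baseEl g (gcomp f k) := by
  rw [gcomp, base_post]
  simp [gcomp, baseEl]

end EnrichedData

namespace FunctorData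

variable {O : Type s} {O' : Type r} {A : EnrichedData W O} {B : EnrichedData W O'}

/-- The hom-wise action of `g` on a functor. -/
abbrev base (g : G) (F : FunctorData A B) : FunctorData (A.base g) (B.base g) where
  obj := F.obj
  map x y := (act g).map (F.map x y)
  mapId x := eqToIso (by simp [baseEl]) ≪≫ baseElIso₂ g (F.mapId x)
  mapComp x y z := eqToIso (by simp [EnrichedData.base]) ≪≫
    Bicategory.whiskerLeftIso (μ (act g) _ _) (actIso₂ g (F.mapComp x y z)) ≪≫
    eqToIso (by simp [EnrichedData.base])

variable (A) in
/-- The identification of `ᵏA` with `ʰ(ᵍA)` when `g * h = k`. -/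
abbrev baseMul {g h k : G} (e : g * h = k) : FunctorData (A.base k) ((A.base g).base h) where
  obj x := x
  map x y := (mulIso e).inv.app (A.hom x y)
  mapId x := eqToIso (by
    rw [Category.assoc, (mulIso e).inv.naturality, ← Category.assoc, ε_mulIso_inv]
    simp)
  mapComp x y z := eqToIso (by
    rw [Category.assoc, (mulIso e).inv.naturality, ← Category.assoc (μ _ _ _), μ_mulIso_inv]
    simp)

variable (G A) in
/-- The identification of `¹A` with `A`, which plays the role of the identity functor `¹A ⟶ A`. -/
abbrev baseOne : FunctorData (A.base (1 : G)) A where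
  obj x := x
  map x y := oneIso.hom.app (A.hom x y)
  mapId x := eqToIso (by
    have := NatTrans.IsMonoidal.unit (τ := (oneIso (G := G) (W := W)).hom)
    rw [Category.assoc, oneIso.hom.naturality, ← Category.assoc, this]
    exact Category.id_comp _)
  mapComp x y z := eqToIso (by
    have := NatTrans.IsMonoidal.tensor (τ := (oneIso (G := G) (W := W)).hom)
      (A.hom y z) (A.hom x y)
    rw [Category.assoc, oneIso.hom.naturality, ← Category.assoc, this, Category.assoc]
    exact congrArg _ (Category.id_comp _).symm)

/-- For `F : ᵍA ⟶ A`, `H : ʰA ⟶ A`, and `g * h = k`, the functor `ᵏA ⟶ A` with `x ↦ H (F x)`, given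
by `ʰF : ʰ(ᵍA) ⟶ ʰA` followed by `H`. -/
abbrev baseComp {g h k : G} (e : g * h = k) (F : FunctorData (A.base g) A)
    (H : FunctorData (A.base h) A) : FunctorData (A.base k) A :=
  (baseMul A e).comp ((F.base h).comp H)

/-- The action of a functor `F : ᵍA ⟶ A` on 1-cells of `A`. -/
def onEl {g : G} (F : FunctorData (A.base g) A) {x y : O} (f : A.El x y) :
    A.El (F.obj x) (F.obj y) :=
  F.mapEl (baseEl g f)

def onElIso₂ {g : G} (F : FunctorData (A.base g) A) {x y : O} {f f' : A.El x y}
    (η : f ≅ f') : F.onEl f ≅ F.onEl f' :=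
  F.mapElIso₂ (baseElIso₂ g η)

def onElComp {g : G} (F : FunctorData (A.base g) A) {x y z : O} (f : A.El x y)
    (k : A.El y z) : gcomp (F.onEl f) (F.onEl k) ≅ F.onEl (gcomp f k) :=
  F.mapGcomp (baseEl g f) (baseEl g k) ≪≫ eqToIso (by rw [base_gcomp]; rfl)

end FunctorData

namespace TransData

variable {O : Type s} {O' : Type r} {A : EnrichedData W O} {B : EnrichedData W O'}

/-- The hom-wise action of `g` on a transformation. -/
abbrev base (g : G) {F H : FunctorData A B} (φ : TransData F H) :
    TransData (F.base g) (H.base g) where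
  app x := baseEl g (φ.app x)
  naturality x y := eqToIso (by rw [base_post, ← Functor.map_comp]) ≪≫
    actIso₂ g (φ.naturality x y) ≪≫ eqToIso (by rw [base_pre, ← Functor.map_comp])

end TransData

namespace TransData

variable {O : Type s} {A : EnrichedData W O}

/-- The identity transformation of `F : ʰA ⟶ A`, with codomain regarded as the composite of `F` with
the identity functor of `A`. -/
def leftUnit {h : G} (F : FunctorData (A.base h) A) :
    TransData F (FunctorData.baseComp (one_mul h) (FunctorData.baseOne G A) F) where
  app x := A.id (F.obj x)
  naturality x y :=
    Bicategory.whiskerLeftIso (F.map x y) (postId (F.obj y) (F.obj x)) ≪≫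
      eqToIso (by
        change F.map x y ≫ 𝟙 _ = ((mulIso (one_mul h)).inv.app (A.hom x y) ≫
          (act h).map (oneIso.hom.app (A.hom x y)) ≫ F.map x y) ≫ 𝟙 _
        rw [← mulIso_one_left, Iso.inv_hom_id_app_assoc]) ≪≫
      Bicategory.whiskerLeftIso _ (preId (F.obj x) (F.obj y)).symm

/-- The identity transformation of `F : ᵍA ⟶ A`, with codomain regarded as the composite of the
identity functor of `A` with `F`. -/
def rightUnit {g : G} (F : FunctorData (A.base g) A) :
    TransData F (FunctorData.baseComp (mul_one g) F (FunctorData.baseOne G A)) where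
  app x := A.id (F.obj x)
  naturality x y :=
    Bicategory.whiskerLeftIso (F.map x y) (postId (F.obj y) (F.obj x)) ≪≫
      eqToIso (by
        have := (oneIso (G := G) (W := W)).hom.naturality (F.map x y)
        change F.map x y ≫ 𝟙 _ = ((mulIso (mul_one g)).inv.app (A.hom x y) ≫
          (act 1).map (F.map x y) ≫ oneIso.hom.app _) ≫ 𝟙 _
        rw [this, ← mulIso_one_right, Iso.inv_hom_id_app_assoc]
        rfl) ≪≫
      Bicategory.whiskerLeftIso _ (preId (F.obj x) (F.obj y)).symm

end TransData

namespace EnrichedData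

variable {O : Type s} {A : EnrichedData W O}

/-- A 1-cell is an adjoint equivalence if it has a weak inverse with invertible unit and counit
satisfying the triangle identity (the other triangle identity is then automatic). A pseudonatural
transformation is a pseudonatural adjoint equivalence precisely when its components are adjoint
equivalences, as the inverse and its pseudonaturality are determined by mates. -/
def IsAdjointEquivalence {x y : O} (f : A.El x y) : Prop :=
  ∃ (f' : A.El y x) (η : A.id x ≅ gcomp f f') (ε : gcomp f' f ≅ A.id y),
    η.hom ▹ post f x ≫ (gcompAssoc f f' f).hom ≫ (gcompIso₂ (Iso.refl f) ε).hom =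
      (idGcomp f).hom ≫ (gcompId f).inv

end EnrichedData

namespace FunctorData

variable {O : Type s} {A : EnrichedData W O}

lemma baseOne_onEl {x y : O} (f : A.El x y) : (baseOne G A).onEl f = f := by
  have h1 := (oneIso (G := G) (W := W)).hom.naturality f
  have h2 := NatTrans.IsMonoidal.unit (τ := (oneIso (G := G) (W := W)).hom)
  change (ε (act (1 : G)) ≫ (act (1 : G)).map f) ≫ oneIso.hom.app _ = f
  rw [Category.assoc, h1, ← Category.assoc, h2]
  exact Category.id_comp f

lemma baseComp_mapEl {h k b : G} (e : h * k = b) (F : FunctorData (A.base h) A)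
    (H : FunctorData (A.base k) A) {x y : O} (f : A.El x y) :
    (baseComp e F H).mapEl (baseEl b f) = H.onEl (F.onEl f) := by
  change (ε (act b) ≫ (act b).map f) ≫ (mulIso e).inv.app _ ≫ (act k).map (F.map x y) ≫
      H.map _ _ =
    (ε (act k) ≫ (act k).map ((ε (act h) ≫ (act h).map f) ≫ F.map x y)) ≫ H.map _ _
  rw [Category.assoc, (mulIso e).inv.naturality_assoc, ← Category.assoc, ε_mulIso_inv]
  simp

lemma baseComp_assoc_map {g h k a b c : G} (e₁ : g * h = a) (e₂ : h * k = b) (e₃ : a * k = c)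
    (e₄ : g * b = c) (F : FunctorData (A.base g) A) (H : FunctorData (A.base h) A)
    (K : FunctorData (A.base k) A) (x y : O) :
    (baseComp e₄ F (baseComp e₂ H K)).map x y = (baseComp e₃ (baseComp e₁ F H) K).map x y := by
  change (mulIso e₄).inv.app _ ≫ (act b).map (F.map x y) ≫ (mulIso e₂).inv.app _ ≫
      (act k).map (H.map _ _) ≫ K.map _ _ =
    (mulIso e₃).inv.app _ ≫ (act k).map ((mulIso e₁).inv.app _ ≫ (act h).map (F.map x y) ≫
      H.map _ _) ≫ K.map _ _
  rw [(mulIso e₂).inv.naturality_assoc]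
  have : (mulIso e₄).inv.app (A.hom x y) ≫ (mulIso e₂).inv.app ((act g).obj (A.hom x y)) =
      (mulIso e₃).inv.app (A.hom x y) ≫ (act k).map ((mulIso e₁).inv.app (A.hom x y)) := by
    have := mulIso_assoc e₁ e₂ e₃ e₄ (A.hom x y)
    rw [← cancel_mono ((mulIso e₂).hom.app ((act g).obj (A.hom x y))),
      ← cancel_mono ((mulIso e₄).hom.app (A.hom x y))]
    simp only [Category.assoc, ← this, Iso.inv_hom_id_app_assoc, Iso.inv_hom_id_app]
    rw [← Functor.map_comp_assoc]
    simp
  rw [reassoc_of% this]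
  simp

end FunctorData

variable (G) in
/-- A weak, strictly unital, twisted `G`-action on the `W`-enriched bicategory `A`. For objects we
write `ᵍx` for `(functor g).obj x`.
* `functor g : ᵍA ⟶ A` is a functor of `W`-enriched bicategories, and is the identity if `g = 1`;
* `φ : ᵍʰx ⟶ ʰ(ᵍx)` is a pseudonatural adjoint equivalence, the identity if `g = 1` or `h = 1`;
* `ζ : φ_{h,k} ∘ φ_{g,hk} ≅ ᵏ(φ_{g,h}) ∘ φ_{gh,k}` is an invertible modification, which is the identity
  (that is, the canonical coherence isomorphism between the two sides) if `g`, `h`, or `k` is `1`;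
* `ζ_simplex` is the 4-simplex axiom, an equality of 2-cells
  `φ_{k,l} ∘ (φ_{h,kl} ∘ φ_{g,hkl}) ≅ ˡ(ᵏ(φ_{g,h})) ∘ (ˡ(φ_{gh,k}) ∘ φ_{ghk,l})`. -/
structure TwistedAction {O : Type s} (A : EnrichedBicategory W O) where
  functor (g : G) : FunctorData (A.base g) A.toEnrichedData
  functor_isLawful (g : G) : (functor g).IsLawful
  functor_one : functor 1 = FunctorData.baseOne G A.toEnrichedData
  φ {g h k : G} (e : g * h = k) :
    TransData (functor k) (FunctorData.baseComp e (functor g) (functor h))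
  φ_isLawful {g h k : G} (e : g * h = k) : (φ e).IsLawful
  φ_equivalence {g h k : G} (e : g * h = k) (x : O) : IsAdjointEquivalence ((φ e).app x)
  φ_one_left (h : G) : HEq (φ (one_mul h)) (TransData.leftUnit (functor h))
  φ_one_right (g : G) : HEq (φ (mul_one g)) (TransData.rightUnit (functor g))
  ζ {g h k a b c : G} (e₁ : g * h = a) (e₂ : h * k = b) (e₃ : a * k = c) (e₄ : g * b = c) (x : O) :
    gcomp ((φ e₄).app x) ((φ e₂).app ((functor g).obj x)) ≅
      gcomp ((φ e₃).app x) ((functor k).onEl ((φ e₁).app x))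
  ζ_naturality {g h k a b c : G} (e₁ : g * h = a) (e₂ : h * k = b) (e₃ : a * k = c)
    (e₄ : g * b = c) (x y : O) :
    ((TransData.vcomp (φ e₄) (TransData.whiskerLeft (FunctorData.baseMul _ e₄)
        (TransData.whiskerLeft ((functor g).base b) (φ e₂)))).naturality x y).hom ≫
      Bicategory.whiskerLeft _ (preIso₂ (ζ e₁ e₂ e₃ e₄ x) _).hom ≫
      eqToHom (congrArg (· ≫ pre _ _)
        (FunctorData.baseComp_assoc_map e₁ e₂ e₃ e₄ (functor g) (functor h) (functor k) x y)) =
    (functor c).map x y ◃ (postIso₂ (ζ e₁ e₂ e₃ e₄ y) _).hom ≫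
      ((TransData.vcomp (φ e₃) (TransData.whiskerLeft (FunctorData.baseMul _ e₃)
        (TransData.whiskerRight ((φ e₁).base k) (functor k)))).naturality x y).hom
  ζ_one_left {h k b : G} (e : h * k = b) :
    HEq (fun x => ζ (one_mul h) e e (one_mul b) x)
      (fun x => idGcomp ((φ e).app x) ≪≫ (gcompId ((φ e).app x)).symm ≪≫
        gcompIso₂ (Iso.refl _) ((functor k).mapId ((functor h).obj x)).symm)
  ζ_one_middle {g k c : G} (e : g * k = c) :
    HEq (fun x => ζ (mul_one g) (one_mul k) e e x)
      (fun x => gcompIso₂ (Iso.refl ((φ e).app x))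
        ((functor k).mapId ((functor g).obj x)).symm)
  ζ_one_right {g h a : G} (e : g * h = a) :
    HEq (fun x => ζ e (mul_one h) (mul_one a) e x)
      (fun x => gcompId ((φ e).app x) ≪≫ (idGcomp ((φ e).app x)).symm ≪≫
        gcompIso₂ (Iso.refl _)
          (eqToIso (FunctorData.baseOne_onEl (G := G) ((φ e).app x)).symm))
  ζ_simplex {g h k l gh hk kl ghk hkl ghkl : G} (e_gh : g * h = gh) (e_hk : h * k = hk)
    (e_kl : k * l = kl) (e_gh_k : gh * k = ghk) (e_g_hk : g * hk = ghk) (e_hk_l : hk * l = hkl)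
    (e_h_kl : h * kl = hkl) (e_ghk_l : ghk * l = ghkl) (e_gh_kl : gh * kl = ghkl)
    (e_g_hkl : g * hkl = ghkl) (x : O) :
    (gcompIso₂ (ζ e_gh e_h_kl e_gh_kl e_g_hkl x)
        (Iso.refl ((φ e_kl).app ((functor h).obj ((functor g).obj x))))).hom ≫
      (gcompAssoc _ _ _).hom ≫
      (gcompIso₂ (Iso.refl ((φ e_gh_kl).app x))
        ((φ e_kl).naturalityEl (baseEl kl ((φ e_gh).app x)) ≪≫
          gcompIso₂ (Iso.refl _) (eqToIso
            (FunctorData.baseComp_mapEl e_kl (functor k) (functor l) ((φ e_gh).app x))))).hom ≫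
      (gcompAssoc _ _ _).inv ≫
      (gcompIso₂ (ζ e_gh_k e_kl e_ghk_l e_gh_kl x) (Iso.refl _)).hom =
    (gcompAssoc _ _ _).hom ≫
      (gcompIso₂ (Iso.refl ((φ e_g_hkl).app x))
        (ζ e_hk e_kl e_hk_l e_h_kl ((functor g).obj x))).hom ≫
      (gcompAssoc _ _ _).inv ≫
      (gcompIso₂ (ζ e_g_hk e_hk_l e_ghk_l e_g_hkl x) (Iso.refl _)).hom ≫
      (gcompAssoc _ _ _).hom ≫
      (gcompIso₂ (Iso.refl ((φ e_ghk_l).app x))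
        ((functor l).onElComp ((φ e_g_hk).app x) ((φ e_hk).app ((functor g).obj x)) ≪≫
          (functor l).onElIso₂ (ζ e_gh e_hk e_gh_k e_g_hk x) ≪≫
          ((functor l).onElComp ((φ e_gh_k).app x)
            ((functor k).onEl ((φ e_gh).app x))).symm)).hom ≫
      (gcompAssoc _ _ _).inv

end Twisted

end Enriched

section Variant

open TwistingAction Functor.LaxMonoidal

section

variable {G : Type t} [Group G] {W : Type u} [Bicategory.{w, v} W] [Bicategory.Strict W]
  [MonoidalTwoCategory W] [TwistingAction G W]

/-- The isomorphism `ᵏX ⟶ ʰ(ᵍX)` for `g * h = k`. -/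
def mulInv {g h k : G} (e : g * h = k) (X : W) : (act k).obj X ⟶ (act h).obj ((act g).obj X) :=
  (mulIso e).inv.app X

lemma mulInv_naturality {g h k : G} (e : g * h = k) {X Y : W} (f : X ⟶ Y) :
    (act k).map f ≫ mulInv e Y = mulInv e X ≫ (act h).map ((act g).map f) :=
  (mulIso e).inv.naturality f

lemma μ_mulInv {g h k : G} (e : g * h = k) (X Y : W) :
    μ (act k) X Y ≫ mulInv e (X ⊗ Y) =
      (mulInv e X ⊗ₘ mulInv e Y) ≫ μ (act h) _ _ ≫ (act h).map (μ (act g) X Y) :=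
  μ_mulIso_inv e X Y

lemma mulInv_assoc {g h k a b c : G} (e₁ : g * h = a) (e₂ : h * k = b) (e₃ : a * k = c)
    (e₄ : g * b = c) (X : W) :
    mulInv e₄ X ≫ mulInv e₂ ((act g).obj X) = mulInv e₃ X ≫ (act k).map (mulInv e₁ X) := by
  have := mulIso_assoc e₁ e₂ e₃ e₄ X
  change (mulIso e₄).inv.app X ≫ (mulIso e₂).inv.app ((act g).obj X) =
      (mulIso e₃).inv.app X ≫ (act k).map ((mulIso e₁).inv.app X)
  rw [← cancel_mono ((mulIso e₂).hom.app ((act g).obj X)),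
    ← cancel_mono ((mulIso e₄).hom.app X)]
  simp only [Category.assoc, ← this, Iso.inv_hom_id_app]
  rw [← Functor.map_comp_assoc]
  simp

lemma mulInv_one (h : G) (X : W) :
    mulInv (one_mul h) X ≫ (act h).map (oneIso.hom.app X) = 𝟙 _ := by
  rw [← mulIso_one_left, mulInv, Iso.inv_hom_id_app]

/-- The associativity 1-cell `(X ⊗ ᵏY) ⊗ ʰᵏZ ⟶ X ⊗ ᵏ(Y ⊗ ʰZ)`. -/
def twistedAssoc {h k b : G} (e : h * k = b) (X Y Z : W) :
    (X ⊗ (act k).obj Y) ⊗ (act b).obj Z ⟶ X ⊗ (act k).obj (Y ⊗ (act h).obj Z) :=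
  (𝟙 (X ⊗ (act k).obj Y) ⊗ₘ mulInv e Z) ≫
    (α_ X ((act k).obj Y) ((act k).obj ((act h).obj Z))).hom ≫
    (𝟙 X ⊗ₘ μ (act k) Y ((act h).obj Z))

lemma twistedAssoc_naturality {h k b : G} (e : h * k = b) {X X' Y Y' Z Z' : W} (f : X ⟶ X')
    (p : Y ⟶ Y') (q : Z ⟶ Z') :
    ((f ⊗ₘ (act k).map p) ⊗ₘ (act b).map q) ≫ twistedAssoc e X' Y' Z' =
      twistedAssoc e X Y Z ≫ (f ⊗ₘ (act k).map (p ⊗ₘ (act h).map q)) := by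
  simp only [twistedAssoc, Category.assoc, MonoidalCategory.tensorHom_comp_tensorHom_assoc,
    MonoidalCategory.tensorHom_comp_tensorHom, Category.comp_id, Category.id_comp,
    ← Functor.LaxMonoidal.μ_natural, mulInv_naturality]
  have h3 : (f ⊗ₘ (act k).map p) ⊗ₘ (mulInv e Z ≫ (act k).map ((act h).map q)) =
      (𝟙 (X ⊗ (act k).obj Y) ⊗ₘ mulInv e Z) ≫
        ((f ⊗ₘ (act k).map p) ⊗ₘ (act k).map ((act h).map q)) := by
    simp only [MonoidalCategory.tensorHom_comp_tensorHom, Category.id_comp]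
  rw [h3, Category.assoc, MonoidalCategory.associator_naturality_assoc,
    MonoidalCategory.tensorHom_comp_tensorHom, Category.comp_id]

lemma twistedAssoc_pentagon {h k l hk kl hkl : G} (e_hk : h * k = hk) (e_kl : k * l = kl)
    (e_hk_l : hk * l = hkl) (e_h_kl : h * kl = hkl) (X Y Z V : W) :
    (twistedAssoc e_kl X Y Z ⊗ₘ 𝟙 ((act hkl).obj V)) ≫
        twistedAssoc e_hk_l X (Y ⊗ (act k).obj Z) V ≫
        (𝟙 X ⊗ₘ (act l).map (twistedAssoc e_hk Y Z V)) =
      twistedAssoc e_h_kl (X ⊗ (act l).obj Y) Z V ≫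
        twistedAssoc e_kl X Y (Z ⊗ (act h).obj V) := by
  have h1 := mulInv_assoc (W := W) e_hk e_kl e_hk_l e_h_kl V
  have h2 := μ_mulInv (W := W) e_kl Z ((act h).obj V)
  have h3 : μ (act l) (Y ⊗ (act k).obj Z) ((act hk).obj V) ≫
      (act l).map ((Y ⊗ (act k).obj Z) ◁ mulInv e_hk V) =
      (act l).obj (Y ⊗ (act k).obj Z) ◁ (act l).map (mulInv e_hk V) ≫
      μ (act l) (Y ⊗ (act k).obj Z) _ := by
    simp
  have h4 := Functor.LaxMonoidal.associativity (act l) Y ((act k).obj Z) ((act k).obj ((act h).obj V))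
  have h5 : μ (act l) Y ((act k).obj Z ⊗ (act k).obj ((act h).obj V)) ≫
      (act l).map (Y ◁ μ (act k) Z ((act h).obj V)) =
      (act l).obj Y ◁ (act l).map (μ (act k) Z ((act h).obj V)) ≫ μ (act l) Y _ := by
    simp
  have hL : (twistedAssoc e_kl X Y Z ⊗ₘ 𝟙 ((act hkl).obj V)) ≫
        twistedAssoc e_hk_l X (Y ⊗ (act k).obj Z) V ≫
        (𝟙 X ⊗ₘ (act l).map (twistedAssoc e_hk Y Z V)) =
      (((X ⊗ (act l).obj Y) ◁ mulInv e_kl Z) ⊗ₘ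
        (mulInv e_hk_l V ≫ (act l).map (mulInv e_hk V))) ≫
      (α_ _ _ _).hom ▷ _ ≫ (α_ _ _ _).hom ≫
      X ◁ ((α_ _ _ _).hom ≫ (act l).obj Y ◁ μ (act l) _ _ ≫ μ (act l) _ _) ≫
      X ◁ (act l).map (Y ◁ μ (act k) Z ((act h).obj V)) := by
    rw [← h4]
    simp only [twistedAssoc, MonoidalCategory.id_tensorHom, MonoidalCategory.tensorHom_id,
      MonoidalCategory.comp_whiskerRight, Functor.map_comp, MonoidalCategory.whiskerLeft_comp,
      Category.assoc]
    rw [← MonoidalCategory.whiskerLeft_comp_assoc X (μ (act l) _ _), h3]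
    simp [MonoidalCategory.tensorHom_def]
    have h6 : (α_ _ _ _).inv ≫ μ (act l) Y ((act k).obj Z) ▷ (act hkl).obj V ≫
        (act l).obj (Y ⊗ (act k).obj Z) ◁ mulInv e_hk_l V ≫
        (act l).obj (Y ⊗ (act k).obj Z) ◁ (act l).map (mulInv e_hk V) =
        (act l).obj Y ◁ (act l).obj ((act k).obj Z) ◁ mulInv e_hk_l V ≫
        (act l).obj Y ◁ (act l).obj ((act k).obj Z) ◁ (act l).map (mulInv e_hk V) ≫
        (α_ _ _ _).inv ≫ μ (act l) Y ((act k).obj Z) ▷ _ := by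
      rw [MonoidalCategory.associator_inv_naturality_right_assoc,
        MonoidalCategory.associator_inv_naturality_right_assoc]
      simp only [MonoidalCategory.whisker_exchange, MonoidalCategory.whisker_exchange_assoc]
    have h7 := congrArg (fun t => X ◁ (act l).obj Y ◁ mulInv e_kl Z ▷ (act hkl).obj V ≫ X ◁ t ≫
      X ◁ μ (act l) (Y ⊗ (act k).obj Z) ((act k).obj ((act h).obj V)) ≫
      X ◁ (act l).map (α_ Y ((act k).obj Z) ((act k).obj ((act h).obj V))).hom ≫
                  X ◁ (act l).map (Y ◁ μ (act k) Z ((act h).obj V))) h6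
    simp only [MonoidalCategory.whiskerLeft_comp, Category.assoc] at h7
    refine Eq.trans ?_ h7
    rw [← MonoidalCategory.whiskerLeft_comp_assoc X
      ((act l).obj (Y ⊗ (act k).obj Z) ◁ (act l).map (mulInv e_hk V)), ← h3]
    simp
  rw [hL, ← h1]
  simp only [twistedAssoc, MonoidalCategory.id_tensorHom, Category.assoc]
  simp only [← MonoidalCategory.whiskerLeft_comp_assoc, ← MonoidalCategory.whiskerLeft_comp,
    Category.assoc]
  rw [h5, h2]
  simp only [MonoidalCategory.tensorHom_def, MonoidalCategory.whiskerLeft_comp,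
    MonoidalCategory.comp_whiskerRight, Category.assoc]
  conv_rhs =>
    simp
    rw [← MonoidalCategory.whiskerLeft_comp_assoc X, ← MonoidalCategory.whiskerLeft_comp,
      MonoidalCategory.whisker_exchange]
  simp

lemma twistedAssoc_triangle (h : G) (X Z : W) :
    ((𝟙 X ⊗ₘ ε (act h)) ⊗ₘ 𝟙 ((act h).obj Z)) ≫ twistedAssoc (one_mul h) X (𝟙_ W) Z ≫
        (𝟙 X ⊗ₘ (act h).map ((λ_ _).hom ≫ oneIso.hom.app Z)) =
      (ρ_ X).hom ⊗ₘ 𝟙 ((act h).obj Z) := by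
  have h1 := Functor.LaxMonoidal.left_unitality (act h) ((act (1 : G)).obj Z)
  have h2 := mulInv_one h Z
  simp only [twistedAssoc, MonoidalCategory.id_tensorHom, MonoidalCategory.tensorHom_id, Category.assoc, Functor.map_comp, MonoidalCategory.whiskerLeft_comp]
  rw [← MonoidalCategory.whisker_exchange_assoc, MonoidalCategory.associator_naturality_middle_assoc]
  simp only [← MonoidalCategory.whiskerLeft_comp_assoc, Category.assoc, ← MonoidalCategory.whiskerLeft_comp]
  have h3 : ε (act h) ▷ (act h).obj ((act (1 : G)).obj Z) ≫
      μ (act h) (𝟙_ W) ((act (1 : G)).obj Z) ≫ (act h).map (λ_ ((act (1 : G)).obj Z)).hom ≫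
      (act h).map ((oneIso (G := G)).hom.app Z) =
      (λ_ _).hom ≫ (act h).map ((oneIso (G := G)).hom.app Z) := by
    rw [h1]; simp only [Category.assoc]
  rw [h3]
  have h4 := congrArg (fun t => (X ◁ t)) h2
  simp only [MonoidalCategory.whiskerLeft_comp] at h4
  simp only [MonoidalCategory.whiskerLeft_comp, MonoidalCategory.triangle_assoc,
    MonoidalCategory.whisker_exchange_assoc, h4, MonoidalCategory.whiskerLeft_id, Category.comp_id]
lemma twistedAssoc_natural_left {h k b : G} (e : h * k = b) {X X' Y Z : W} (f : X ⟶ X') :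
    ((f ⊗ₘ 𝟙 ((act k).obj Y)) ⊗ₘ 𝟙 ((act b).obj Z)) ≫ twistedAssoc e X' Y Z =
      twistedAssoc e X Y Z ≫ (f ⊗ₘ 𝟙 ((act k).obj (Y ⊗ (act h).obj Z))) := by
  simpa using twistedAssoc_naturality e f (𝟙 Y) (𝟙 Z)

lemma twistedAssoc_natural_middle {h k b : G} (e : h * k = b) {X Y Y' Z : W} (p : Y ⟶ Y') :
    ((𝟙 X ⊗ₘ (act k).map p) ⊗ₘ 𝟙 ((act b).obj Z)) ≫ twistedAssoc e X Y' Z =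
      twistedAssoc e X Y Z ≫ (𝟙 X ⊗ₘ (act k).map (p ⊗ₘ 𝟙 ((act h).obj Z))) := by
  simpa using twistedAssoc_naturality e (𝟙 X) p (𝟙 Z)

lemma twistedAssoc_natural_right {h k b : G} (e : h * k = b) {X Y Z Z' : W} (q : Z ⟶ Z') :
    (𝟙 (X ⊗ (act k).obj Y) ⊗ₘ (act b).map q) ≫ twistedAssoc e X Y Z' =
      twistedAssoc e X Y Z ≫ (𝟙 X ⊗ₘ (act k).map (𝟙 Y ⊗ₘ (act h).map q)) := by
  simpa using twistedAssoc_naturality e (𝟙 X) (𝟙 Y) q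

end

variable (G : Type t) [Group G] (W : Type u) [Bicategory.{w, v} W] [Bicategory.Strict W]
  [MonoidalTwoCategory W] [TwistingAction G W]

/-- The objects, homs, identities, and composition of a `g`-variant `W`-bicategory: for all `g` and
`x y` an object `hom g x y = A^g(x, y)` of `W`, units `𝟙 ⟶ A^1(x, x)`, and composition
`A^h(y, z) ⊗ ʰ(A^g(x, y)) ⟶ A^{gh}(x, z)`. -/
structure VariantData (O : Type s) where
  hom (g : G) (x y : O) : W
  id (x : O) : 𝟙_ W ⟶ hom 1 x x
  comp {g h k : G} (e : g * h = k) (x y z : O) :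
    hom h y z ⊗ (act h).obj (hom g x y) ⟶ hom k x z

/-- A `g`-variant `W`-bicategory, that is, a bicategory enriched in the monoidal 2-category
`∫_G W` (of `G`-indexed families of objects of `W`, with the twisted convolution tensor product),
spelled out in components: associativity and unitality isomorphisms, the pentagon axiom, and the
unitality axiom. -/
structure VariantBicategory (O : Type s) extends VariantData G W O where
  assoc {g h k a b c : G} (e₁ : g * h = a) (e₂ : h * k = b) (e₃ : a * k = c) (e₄ : g * b = c)
      (w x y z : O) :
    (comp e₂ x y z ⊗ₘ 𝟙 ((act b).obj (hom g w x))) ≫ comp e₄ w x z ≅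
      twistedAssoc e₂ (hom k y z) (hom h x y) (hom g w x) ≫
        (𝟙 (hom k y z) ⊗ₘ (act k).map (comp e₁ w x y)) ≫ comp e₃ w y z
  leftUnitor (g : G) (x y : O) :
    (id y ⊗ₘ 𝟙 ((act 1).obj (hom g x y))) ≫ comp (mul_one g) x y y ≅
      (λ_ ((act 1).obj (hom g x y))).hom ≫ oneIso.hom.app (hom g x y)
  rightUnitor (g : G) (x y : O) :
    (𝟙 (hom g x y) ⊗ₘ (ε (act g) ≫ (act g).map (id x))) ≫ comp (one_mul g) x x y ≅
      (ρ_ (hom g x y)).hom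
  pentagon {g h k l gh hk kl ghk hkl ghkl : G} (e_gh : g * h = gh) (e_hk : h * k = hk)
      (e_kl : k * l = kl) (e_gh_k : gh * k = ghk) (e_g_hk : g * hk = ghk) (e_hk_l : hk * l = hkl)
      (e_h_kl : h * kl = hkl) (e_ghk_l : ghk * l = ghkl) (e_gh_kl : gh * kl = ghkl)
      (e_g_hkl : g * hkl = ghkl) (v w x y z : O) :
    ((comp e_kl x y z ⊗ₘ 𝟙 ((act kl).obj (hom h w x))) ⊗ₘ 𝟙 ((act hkl).obj (hom g v w))) ◃
        (assoc e_gh e_h_kl e_gh_kl e_g_hkl v w x z).hom ≫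
      eqToHom (by
        simp only [Category.assoc]
        rw [reassoc_of% twistedAssoc_natural_left e_h_kl (comp e_kl x y z)]
        simp only [MonoidalCategory.tensorHom_comp_tensorHom_assoc, Category.id_comp,
          Category.comp_id]) ≫
      (twistedAssoc e_h_kl (hom l y z ⊗ (act l).obj (hom k x y)) (hom h w x) (hom g v w) ≫
        (𝟙 (hom l y z ⊗ (act l).obj (hom k x y)) ⊗ₘ (act kl).map (comp e_gh v w x))) ◃
        (assoc e_gh_k e_kl e_ghk_l e_gh_kl v x y z).hom =
    eqToHom (by
        simp only [MonoidalCategory.tensorHom_comp_tensorHom_assoc, Category.comp_id]) ≫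
      tensor₂ (assoc e_hk e_kl e_hk_l e_h_kl w x y z).hom
        (𝟙 (𝟙 ((act hkl).obj (hom g v w)))) ▹ comp e_g_hkl v w z ≫
      eqToHom (by
        simp only [MonoidalCategory.tensorHom_comp_tensorHom_assoc, Category.comp_id,
          Category.assoc]) ≫
      ((twistedAssoc e_kl (hom l y z) (hom k x y) (hom h w x) ⊗ₘ
          𝟙 ((act hkl).obj (hom g v w))) ≫
        ((𝟙 (hom l y z) ⊗ₘ (act l).map (comp e_hk w x y)) ⊗ₘ
          𝟙 ((act hkl).obj (hom g v w)))) ◃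
        (assoc e_g_hk e_hk_l e_ghk_l e_g_hkl v w y z).hom ≫
      eqToHom (by
        simp only [Category.assoc]
        rw [reassoc_of% twistedAssoc_natural_middle e_hk_l (comp e_hk w x y)]
        simp only [MonoidalCategory.tensorHom_comp_tensorHom_assoc, Category.id_comp,
          Functor.map_comp]) ≫
      ((twistedAssoc e_kl (hom l y z) (hom k x y) (hom h w x) ⊗ₘ
          𝟙 ((act hkl).obj (hom g v w))) ≫
        twistedAssoc e_hk_l (hom l y z) (hom k x y ⊗ (act k).obj (hom h w x)) (hom g v w)) ◃
        (tensor₂ (𝟙 (𝟙 (hom l y z))) (act₂ l (assoc e_gh e_hk e_gh_k e_g_hk v w x y).hom) ▹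
          comp e_ghk_l v y z) ≫
      eqToHom (by
        have hp := twistedAssoc_pentagon e_hk e_kl e_hk_l e_h_kl (hom l y z) (hom k x y)
          (hom h w x) (hom g v w)
        have hr := twistedAssoc_natural_right e_kl (X := hom l y z) (Y := hom k x y)
          (comp e_gh v w x)
        simp only [Category.assoc, Functor.map_comp]
        rw [reassoc_of% hr, ← reassoc_of% hp]
        simp only [MonoidalCategory.tensorHom_comp_tensorHom_assoc, Category.id_comp,
          Category.assoc])
  triangle {g h k : G} (e : g * h = k) (x y z : O) :
    ((𝟙 (hom h y z) ⊗ₘ (ε (act h) ≫ (act h).map (id y))) ⊗ₘ 𝟙 ((act h).obj (hom g x y))) ◃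
        (assoc (mul_one g) (one_mul h) e e x y y z).hom ≫
      eqToHom (by
        have hm := twistedAssoc_natural_middle (one_mul h) (X := hom h y z) (Z := hom g x y) (id y)
        have : 𝟙 (hom h y z) ⊗ₘ (ε (act h) ≫ (act h).map (id y)) =
          (𝟙 _ ⊗ₘ ε (act h)) ≫ (𝟙 _ ⊗ₘ (act h).map (id y)) := by
          simp only [MonoidalCategory.tensorHom_comp_tensorHom, Category.id_comp]
        rw [this, ← Category.comp_id (𝟙 ((act h).obj (hom g x y))),
          ← MonoidalCategory.tensorHom_comp_tensorHom]
        simp only [Category.assoc]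
        rw [reassoc_of% hm]
        simp only [MonoidalCategory.tensorHom_comp_tensorHom_assoc, Category.id_comp,
          Functor.map_comp, Category.comp_id]) ≫
      (((𝟙 (hom h y z) ⊗ₘ ε (act h)) ⊗ₘ 𝟙 ((act h).obj (hom g x y))) ≫
        twistedAssoc (one_mul h) (hom h y z) (𝟙_ W) (hom g x y)) ◃
        (tensor₂ (𝟙 (𝟙 (hom h y z))) (act₂ h (leftUnitor g x y).hom) ▹ comp e x y z) =
    eqToHom (by
        simp only [MonoidalCategory.tensorHom_comp_tensorHom_assoc, Category.comp_id]) ≫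
      tensor₂ (rightUnitor h y z).hom (𝟙 (𝟙 ((act h).obj (hom g x y)))) ▹ comp e x y z ≫
      eqToHom (by
        simp only [Category.assoc]
        rw [reassoc_of% twistedAssoc_triangle h (hom h y z) (hom g x y)])

variable {G W}

namespace VariantData

variable {O : Type s} (P : VariantData G W O)

/-- The 1-cell `A^h(x', y) ⟶ A^{gh}(x, y)` given by precomposition with the `g`-variant 1-cell
`χ : x ⟶ x'`. -/
def precomp {g h k : G} (e : g * h = k) {x x' : O} (χ : 𝟙_ W ⟶ P.hom g x x') (y : O) :
    P.hom h x' y ⟶ P.hom k x y :=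
  (ρ_ (P.hom h x' y)).inv ≫
    (𝟙 (P.hom h x' y) ⊗ₘ (ε (act h) ≫ (act h).map χ)) ≫ P.comp e x x' y

/-- The `g`-variant 1-cell `χ ∈ A^g(x, x')` exhibits `x'` as a copower of `x` by the twisted unit
`𝟙[g]`: precomposition with it is an equivalence `A^h(x', y) ⟶ A^{gh}(x, y)` in `W` for all `h`
and `y`. -/
def IsTwistedCopower (g : G) (x x' : O) (χ : 𝟙_ W ⟶ P.hom g x x') : Prop :=
  ∀ ⦃h k : G⦄ (e : g * h = k) (y : O),
    ∃ E : Bicategory.Equivalence (P.hom h x' y) (P.hom k x y), E.hom = P.precomp e χ y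

/-- All copowers by twisted units exist. -/
def HasTwistedCopowers : Prop :=
  ∀ (g : G) (x : O), ∃ (x' : O) (χ : 𝟙_ W ⟶ P.hom g x x'), P.IsTwistedCopower g x x' χ

end VariantData

/-- The `g`-variant structure determined by a twisted action: `A^g(x, y) = A(ᵍx, y)`, with identities
those of `A`, and with composition
`A(ʰy, z) ⊗ ʰA(ᵍx, y) ⟶ A(ʰy, z) ⊗ A(ʰ(ᵍx), ʰy) ⟶ A(ʰ(ᵍx), z) ⟶ A(ᵍʰx, z)`
by the functor `functor h`, the composition of `A`, and precomposition with `φ_{g,h}`. -/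
def TwistedAction.toVariantData {O : Type s} {A : EnrichedBicategory W O}
    (T : TwistedAction G A) : VariantData G W O where
  hom g x y := A.hom ((T.functor g).obj x) y
  id x := EnrichedData.eqTo (A := A.toEnrichedData) (by rw [T.functor_one])
  comp {g h k} e x y z :=
    (𝟙 (A.hom ((T.functor h).obj y) z) ⊗ₘ (T.functor h).map ((T.functor g).obj x) y) ≫
      A.comp ((T.functor h).obj ((T.functor g).obj x)) ((T.functor h).obj y) z ≫
      EnrichedData.pre ((T.φ e).app x) z

end Variant

section Contravariance

open Opposite Bicategory

/-- The two-element group `{+, -}`. -/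
inductive Variance
  | pos
  | neg

namespace Variance

def mul : Variance → Variance → Variance
  | pos, h => h
  | neg, pos => neg
  | neg, neg => pos

instance : CommGroup Variance where
  mul := mul
  one := pos
  inv g := g
  mul_assoc := by rintro (_ | _) (_ | _) (_ | _) <;> rfl
  one_mul := by rintro (_ | _) <;> rfl
  mul_one := by rintro (_ | _) <;> rfl
  inv_mul_cancel := by rintro (_ | _) <;> rfl
  mul_comm := by rintro (_ | _) (_ | _) <;> rfl

end Variance

namespace CatG

/-- The 2-category `Pith Cat` of categories, functors, and natural isomorphisms is strict. -/
instance : Bicategory.Strict (Pith Cat.{v, u}) where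
  id_comp _ := rfl
  comp_id _ := rfl
  assoc _ _ _ := rfl
  leftUnitor_eqToIso _ := by ext; rfl
  rightUnitor_eqToIso _ := rfl
  associator_eqToIso _ _ _ := rfl

/-- Isomorphisms of categories are isomorphisms in `Pith Cat`. -/
def isoOfCat {X Y : Pith Cat.{v, u}} (e : X.as ≅ Y.as) : X ≅ Y where
  hom := ⟨e.hom⟩
  inv := ⟨e.inv⟩
  hom_inv_id := congrArg Core.mk e.hom_inv_id
  inv_hom_id := congrArg Core.mk e.inv_hom_id

/-- `Pith Cat` is a monoidal category with the cartesian product of categories. -/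
instance : MonoidalCategory (Pith Cat.{v, u}) where
  tensorObj X Y := ⟨X.as ⊗ Y.as⟩
  whiskerLeft X _ _ f := ⟨X.as ◁ f.of⟩
  whiskerRight f Y := ⟨f.of ▷ Y.as⟩
  tensorHom f g := ⟨f.of ⊗ₘ g.of⟩
  tensorUnit := ⟨𝟙_ Cat.{v, u}⟩
  associator X Y Z := isoOfCat (α_ X.as Y.as Z.as)
  leftUnitor X := isoOfCat (λ_ X.as)
  rightUnitor X := isoOfCat (ρ_ X.as)
  tensorHom_def _ _ := rfl
  id_tensorHom_id _ _ := rfl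
  tensorHom_comp_tensorHom _ _ _ _ := rfl
  whiskerLeft_id _ _ := rfl
  id_whiskerRight _ _ := rfl
  associator_naturality _ _ _ := rfl
  leftUnitor_naturality _ := rfl
  rightUnitor_naturality _ := rfl
  pentagon _ _ _ _ := rfl
  triangle _ _ := rfl

/-- The product of two natural isomorphisms. -/
def tensor₂Hom {X X' Y Y' : Pith Cat.{v, u}} {f f' : X ⟶ X'} {g g' : Y ⟶ Y'}
    (η : f ⟶ f') (θ : g ⟶ g') : (f ⊗ₘ g) ⟶ (f' ⊗ₘ g') :=
  ⟨Cat.Hom.isoMk (NatIso.prod (Cat.Hom.toNatIso η.iso) (Cat.Hom.toNatIso θ.iso))⟩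

lemma hom₂_ext {X Y : Pith Cat.{v, u}} {f g : X ⟶ Y} {η θ : f ⟶ g}
    (h : ∀ x : X.as, η.iso.hom.toNatTrans.app x = θ.iso.hom.toNatTrans.app x) : η = θ := by
  apply Pith.hom₂_ext
  apply Cat.Hom₂.ext
  exact NatTrans.ext (funext h)

lemma eqToHom_app {X Y : Pith Cat.{v, u}} {f g : X ⟶ Y} (e : f = g) (x : X.as) :
    (eqToHom e).iso.hom.toNatTrans.app x =
      eqToHom (congrArg (fun k : X ⟶ Y => k.of.toFunctor.obj x) e) := by
  subst e
  rfl

lemma comp_app {X Y : Pith Cat.{v, u}} {f g h : X ⟶ Y} (η : f ⟶ g) (θ : g ⟶ h) (x : X.as) :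
    (η ≫ θ).iso.hom.toNatTrans.app x =
      η.iso.hom.toNatTrans.app x ≫ θ.iso.hom.toNatTrans.app x := rfl

lemma eq_eqToHom_comp {X Y : Pith Cat.{v, u}} {f f' g g' : X ⟶ Y} {η : f ⟶ g} {θ : f' ⟶ g'}
    (e : f = f') (e' : g' = g)
    (h : ∀ x : X.as, HEq (η.iso.hom.toNatTrans.app x) (θ.iso.hom.toNatTrans.app x)) :
    η = eqToHom e ≫ θ ≫ eqToHom e' := by
  subst e
  subst e'
  rw [eqToHom_refl, eqToHom_refl, Category.id_comp, Category.comp_id]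
  exact hom₂_ext fun x => eq_of_heq (h x)

instance : MonoidalTwoCategory (Pith Cat.{v, u}) where
  tensor₂ := tensor₂Hom
  tensor₂_id _ _ := rfl
  tensor₂_comp _ _ _ _ := rfl
  tensor₂_whiskerLeft := by
    intros
    exact eq_eqToHom_comp _ _ fun _ => HEq.rfl
  tensor₂_whiskerRight := by
    intros
    exact eq_eqToHom_comp _ _ fun _ => HEq.rfl
  associator_naturality₂ _ _ _ := eq_eqToHom_comp _ _ fun _ => HEq.rfl
  leftUnitor_naturality₂ _ := eq_eqToHom_comp _ _ fun _ => HEq.rfl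
  rightUnitor_naturality₂ _ := eq_eqToHom_comp _ _ fun _ => HEq.rfl

attribute [local instance] uliftCategory in
/-- The 1-cell from the unit category to `C` determined by an object of `C`. -/
def ofObj {C : Cat.{v, u}} (c : C) : 𝟙_ (Pith Cat.{v, u}) ⟶ ⟨C⟩ :=
  ⟨((Functor.const (ULift (ULiftHom (Discrete Unit)))).obj c).toCatHom⟩

/-- The functor `C ↦ Cᵒᵖ`. -/
def opFunctor : Pith Cat.{v, u} ⥤ Pith Cat.{v, u} where
  obj X := ⟨Cat.of (X.as)ᵒᵖ⟩
  map f := ⟨f.of.toFunctor.op.toCatHom⟩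

/-- The action of `C ↦ Cᵒᵖ` on natural isomorphisms (the opposite of the inverse). -/
def opFunctor₂ {X Y : Pith Cat.{v, u}} {f f' : X ⟶ Y} (η : f ⟶ f') :
    opFunctor.map f ⟶ opFunctor.map f' :=
  ⟨Cat.Hom.isoMk (NatIso.op (Cat.Hom.toNatIso η.iso)).symm⟩

def opProd (C D : Type u) [Category.{v} C] [Category.{v} D] : Cᵒᵖ × Dᵒᵖ ⥤ (C × D)ᵒᵖ where
  obj p := op (p.1.unop, p.2.unop)
  map f := Quiver.Hom.op (Prod.mkHom f.1.unop f.2.unop)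

def prodOp (C D : Type u) [Category.{v} C] [Category.{v} D] : (C × D)ᵒᵖ ⥤ Cᵒᵖ × Dᵒᵖ where
  obj p := (op p.unop.1, op p.unop.2)
  map f := Prod.mkHom f.unop.1.op f.unop.2.op

attribute [local instance] uliftCategory in
def opFunctorMonoidal : opFunctor.{v, u}.CoreMonoidal where
  εIso := isoOfCat
    { hom := ((Functor.const _).obj (op ⟨⟨()⟩⟩)).toCatHom
      inv := ((Functor.const _).obj ⟨⟨()⟩⟩).toCatHom
      hom_inv_id := rfl
      inv_hom_id := rfl }
  μIso X Y := isoOfCat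
    { hom := (opProd X.as Y.as).toCatHom
      inv := (prodOp X.as Y.as).toCatHom
      hom_inv_id := rfl
      inv_hom_id := rfl }
  μIso_hom_natural_left _ _ := rfl
  μIso_hom_natural_right _ _ := rfl
  associativity _ _ _ := rfl
  left_unitality _ := rfl
  right_unitality _ := rfl

/-- The element `+` acts by the identity, and the element `-` acts by `C ↦ Cᵒᵖ`. -/
def act : Variance → (Pith Cat.{v, u} ⥤ Pith Cat.{v, u})
  | .pos => 𝟭 _
  | .neg => opFunctor

/-- The action on natural isomorphisms. -/
def act₂ : ∀ (g : Variance) {X Y : Pith Cat.{v, u}} {f f' : X ⟶ Y} (_ : f ⟶ f'),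
    (act g).map f ⟶ (act g).map f'
  | .pos, _, _, _, _, η => η
  | .neg, _, _, _, _, η => opFunctor₂ η

@[reducible]
instance actMonoidal : ∀ g : Variance, (act.{v, u} g).Monoidal
  | .pos => inferInstanceAs (𝟭 (Pith Cat.{v, u})).Monoidal
  | .neg => opFunctorMonoidal.toMonoidal

/-- The composition isomorphisms: identities, except for `(Cᵒᵖ)ᵒᵖ ≅ C`. -/
def actMul : ∀ {g h k : Variance} (_ : g * h = k), act.{v, u} g ⋙ act h ≅ act k
  | .pos, .pos, .pos, _ => Functor.leftUnitor _
  | .pos, .neg, .neg, _ => Functor.leftUnitor _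
  | .neg, .pos, .neg, _ => Functor.rightUnitor _
  | .neg, .neg, .pos, _ => NatIso.ofComponents (fun X => isoOfCat
      { hom := (unopUnop X.as).toCatHom
        inv := (opOp X.as).toCatHom
        hom_inv_id := rfl
        inv_hom_id := rfl }) fun _ => rfl

instance : TwistingAction Variance (Pith Cat.{v, u}) where
  act := act
  act₂ := act₂
  act₂_id := by rintro (_ | _) X Y f <;> rfl
  act₂_comp := by rintro (_ | _) X Y f f' f'' η θ <;> rfl
  act₂_whiskerLeft := by
    rintro (_ | _) <;> intros <;> exact eq_eqToHom_comp _ _ fun _ => HEq.rfl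
  act₂_whiskerRight := by
    rintro (_ | _) <;> intros <;> exact eq_eqToHom_comp _ _ fun _ => HEq.rfl
  monoidal := actMonoidal
  μ_naturality₂ := by
    rintro (_ | _) <;> intros <;> exact eq_eqToHom_comp _ _ fun _ => HEq.rfl
  mulIso := actMul
  mulIso_monoidal := by
    rintro (_ | _) (_ | _) (_ | _) e
    all_goals first
      | cases e; done
      | exact { unit := rfl, tensor := fun _ _ => rfl }
  mulIso_naturality₂ := by
    rintro (_ | _) (_ | _) (_ | _) e <;> cases e <;> intros <;>
      exact eq_eqToHom_comp _ _ fun _ => HEq.rfl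
  oneIso := Iso.refl _
  oneIso_monoidal := { unit := rfl, tensor := fun _ _ => rfl }
  oneIso_naturality₂ _ := eq_eqToHom_comp _ _ fun _ => HEq.rfl
  mulIso_assoc := by
    intro g h k a b c e₁ e₂ e₃ e₄ X
    subst e₁ e₂ e₃
    rcases g with _ | _ <;> rcases h with _ | _ <;> rcases k with _ | _ <;> rfl
  mulIso_one_left := by rintro (_ | _) X <;> rfl
  mulIso_one_right := by rintro (_ | _) X <;> rfl

end CatG



/-- The bicategory obtained from `B` by reversing the 2-cells but not the 1-cells. -/
structure Co (B : Type u₁) where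
  as : B

namespace Co

@[ext]
structure Hom₁ {B : Type u₁} [Bicategory.{w₁, v₁} B] (a b : Co B) where
  of : a.as ⟶ b.as

@[ext]
structure Hom₂ {B : Type u₁} [Bicategory.{w₁, v₁} B] {a b : Co B} (f g : Hom₁ a b) where
  of : g.of ⟶ f.of

variable {B : Type u₁} [Bicategory.{w₁, v₁} B]

instance : CategoryStruct (Co B) where
  Hom a b := Hom₁ a b
  id a := ⟨𝟙 a.as⟩
  comp f g := ⟨f.of ≫ g.of⟩

instance homCategory (a b : Co B) : Category.{w₁} (a ⟶ b) where
  Hom f g := Hom₂ f g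
  id f := ⟨𝟙 f.of⟩
  comp η θ := ⟨θ.of ≫ η.of⟩
  id_comp _ := Hom₂.ext (Category.comp_id _)
  comp_id _ := Hom₂.ext (Category.id_comp _)
  assoc _ _ _ := Hom₂.ext (Category.assoc _ _ _).symm

abbrev mkHom {a b : B} (f : a ⟶ b) : (⟨a⟩ : Co B) ⟶ ⟨b⟩ := Hom₁.mk f

abbrev mkHom₂ {a b : B} {f g : a ⟶ b} (η : f ⟶ g) : mkHom g ⟶ mkHom f := Hom₂.mk η

def isoMk {a b : Co B} {f g : a ⟶ b} (e : f.of ≅ g.of) : f ≅ g where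
  hom := ⟨e.inv⟩
  inv := ⟨e.hom⟩
  hom_inv_id := Hom₂.ext e.hom_inv_id
  inv_hom_id := Hom₂.ext e.inv_hom_id

def ofIso {a b : Co B} {f g : a ⟶ b} (e : f ≅ g) : f.of ≅ g.of where
  hom := e.inv.of
  inv := e.hom.of
  hom_inv_id := congrArg Hom₂.of e.hom_inv_id
  inv_hom_id := congrArg Hom₂.of e.inv_hom_id

instance : Bicategory.{w₁, v₁} (Co B) where
  homCategory := homCategory
  whiskerLeft f _ _ η := ⟨f.of ◃ η.of⟩
  whiskerRight η h := ⟨η.of ▹ h.of⟩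
  associator f g h := isoMk (Bicategory.associator f.of g.of h.of)
  leftUnitor f := isoMk (Bicategory.leftUnitor f.of)
  rightUnitor f := isoMk (Bicategory.rightUnitor f.of)
  whiskerLeft_id _ _ := Hom₂.ext (Bicategory.whiskerLeft_id _ _)
  whiskerLeft_comp _ _ _ _ _ _ := Hom₂.ext (Bicategory.whiskerLeft_comp _ _ _)
  id_whiskerLeft _ := Hom₂.ext
    ((Bicategory.id_whiskerLeft _).trans (Category.assoc _ _ _).symm)
  comp_whiskerLeft _ _ _ _ _ := Hom₂.ext
    ((Bicategory.comp_whiskerLeft _ _ _).trans (Category.assoc _ _ _).symm)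
  id_whiskerRight _ _ := Hom₂.ext (Bicategory.id_whiskerRight _ _)
  comp_whiskerRight _ _ _ := Hom₂.ext (Bicategory.comp_whiskerRight _ _ _)
  whiskerRight_id _ := Hom₂.ext
    ((Bicategory.whiskerRight_id _).trans (Category.assoc _ _ _).symm)
  whiskerRight_comp _ _ _ := Hom₂.ext
    ((Bicategory.whiskerRight_comp _ _ _).trans (Category.assoc _ _ _).symm)
  whisker_assoc _ _ _ _ _ := Hom₂.ext
    ((Bicategory.whisker_assoc _ _ _).trans (Category.assoc _ _ _).symm)
  whisker_exchange _ _ := Hom₂.ext (Bicategory.whisker_exchange _ _).symm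
  pentagon f g h i := Hom₂.ext ((Category.assoc _ _ _).trans
    (Bicategory.pentagon_inv f.of g.of h.of i.of))
  triangle f g := Hom₂.ext (Bicategory.triangle_assoc_comp_left_inv f.of g.of)

end Co

variable {B : Type u₁} [Bicategory.{w₁, v₁} B]

/-- The pseudofunctor `B ⟶ Bᶜᵒ` obtained from `D : Bᶜᵒ ⟶ B` by reversing 2-cells. -/
def coDual (D : Pseudofunctor (Co B) B) : Pseudofunctor B (Co B) where
  obj x := ⟨D.obj ⟨x⟩⟩
  map f := Co.mkHom (D.map (Co.mkHom f))
  map₂ η := Co.mkHom₂ (D.map₂ (Co.mkHom₂ η))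
  mapId x := Co.isoMk (D.mapId ⟨x⟩)
  mapComp f g := Co.isoMk (D.mapComp (Co.mkHom f) (Co.mkHom g))
  map₂_id _ := Co.Hom₂.ext (D.map₂_id _)
  map₂_comp _ _ := Co.Hom₂.ext (D.map₂_comp _ _)
  map₂_whisker_left f _ _ η := Co.Hom₂.ext
    ((D.map₂_whisker_left (Co.mkHom f) (Co.mkHom₂ η)).trans (Category.assoc _ _ _).symm)
  map₂_whisker_right η h := Co.Hom₂.ext
    ((D.map₂_whisker_right (Co.mkHom₂ η) (Co.mkHom h)).trans (Category.assoc _ _ _).symm)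
  map₂_associator f g h := Co.Hom₂.ext (by
    have h1 := D.map₂_associator (Co.mkHom f) (Co.mkHom g) (Co.mkHom h)
    have h2 : D.map₂ (Bicategory.associator (Co.mkHom f) (Co.mkHom g) (Co.mkHom h)).inv =
      ((((D.mapComp _ _).hom ≫ _ ◃ (D.mapComp _ _).hom) ≫
        (Bicategory.associator _ _ _).inv) ≫ (D.mapComp _ _).inv ▹ _) ≫ (D.mapComp _ _).inv := by
      rw [← IsIso.inv_eq_inv, ← D.map₂_inv, IsIso.Iso.inv_inv, h1]
      simp
    exact h2)
  map₂_left_unitor f := Co.Hom₂.ext (by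
    have h1 := D.map₂_left_unitor (Co.mkHom f)
    have h2 : D.map₂ (Bicategory.leftUnitor (Co.mkHom f)).inv =
      ((Bicategory.leftUnitor _).inv ≫ (D.mapId _).inv ▹ _) ≫ (D.mapComp _ _).inv := by
      rw [← IsIso.inv_eq_inv, ← D.map₂_inv, IsIso.Iso.inv_inv, h1]
      simp
    exact h2)
  map₂_right_unitor f := Co.Hom₂.ext (by
    have h1 := D.map₂_right_unitor (Co.mkHom f)
    have h2 : D.map₂ (Bicategory.rightUnitor (Co.mkHom f)).inv =
      ((Bicategory.rightUnitor _).inv ≫ _ ◃ (D.mapId _).inv) ≫ (D.mapComp _ _).inv := by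
      rw [← IsIso.inv_eq_inv, ← D.map₂_inv, IsIso.Iso.inv_inv, h1]
      simp
    exact h2)

open scoped Pseudofunctor.StrongTrans in
variable (B) in
/-- A weak duality involution on the bicategory `B`.
* `dual : Bᶜᵒ ⟶ B` is a pseudofunctor, written `x ↦ x°`;
* `φ : x ⟶ x°°` is a pseudonatural adjoint equivalence;
* `ζ : φ_{x°} ≅ (φ_x)°` is an invertible modification;
* `ζ_coherence` is an equality of 2-cells `φ_{x°°} ∘ φ_x ⟶ (φ_{x°})° ∘ φ_x`. -/
structure WeakDualityInvolution where
  dual : Pseudofunctor (Co B) B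
  φ : Bicategory.Equivalence (Pseudofunctor.id B) ((coDual dual).comp dual)
  ζ (x : B) : φ.hom.app (dual.obj ⟨x⟩) ≅ dual.map (Co.mkHom (φ.hom.app x))
  ζ_naturality {x y : B} (f : x ⟶ y) :
    dual.map (Co.mkHom f) ◃ (ζ y).hom ≫
      (dual.mapComp (Co.mkHom f) (Co.mkHom (φ.hom.app y))).inv ≫
      dual.map₂ (Co.mkHom₂ (φ.hom.naturality f).inv) ≫
      (dual.mapComp (Co.mkHom (φ.hom.app x))
        (Co.mkHom (dual.map (Co.mkHom (dual.map (Co.mkHom f)))))).hom =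
    (φ.hom.naturality (dual.map (Co.mkHom f))).hom ≫
      (ζ x).hom ▹ dual.map (Co.mkHom (dual.map (Co.mkHom (dual.map (Co.mkHom f)))))
  ζ_coherence (x : B) :
    φ.hom.app x ◃ (ζ (dual.obj ⟨x⟩)).hom =
      (φ.hom.naturality (φ.hom.app x)).hom ≫
        φ.hom.app x ◃ dual.map₂ (Co.mkHom₂ (ζ x).hom)

namespace WeakDualityInvolution

variable (D : WeakDualityInvolution B)

/-- The action of `{+, -}` on objects: `x` itself or `x°`. -/
def actObj : Variance → B → B
  | .pos, x => x
  | .neg, x => D.dual.obj ⟨x⟩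

/-- The action of `{+, -}` on hom-categories: the identity of `B(x, y)`, or `B(x, y)ᵒᵖ ⟶ B(x°, y°)`. -/
def actMap : ∀ (g : Variance) (x y : B),
    ((CatG.act g).obj ⟨Cat.of (x ⟶ y)⟩).as ⥤ (D.actObj g x ⟶ D.actObj g y)
  | .pos, x, y => 𝟭 (x ⟶ y)
  | .neg, x, y =>
    { obj := fun f : (x ⟶ y)ᵒᵖ => D.dual.map (Co.mkHom f.unop)
      map := fun η => D.dual.map₂ (Co.mkHom₂ η.unop)
      map_id := fun _ => D.dual.map₂_id _
      map_comp := fun η θ => D.dual.map₂_comp (Co.mkHom₂ η.unop) (Co.mkHom₂ θ.unop) }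

open scoped Pseudofunctor.StrongTrans in
/-- The 1-cells from `ᵍʰx` to `ʰ(ᵍx)`, which are identities except for `φ_x : x ⟶ x°°`. -/
def actφ : ∀ {g h k : Variance} (_ : g * h = k) (x : B),
    D.actObj k x ⟶ D.actObj h (D.actObj g x)
  | .pos, .pos, .pos, _, x => 𝟙 x
  | .pos, .neg, .neg, _, x => 𝟙 (D.dual.obj ⟨x⟩)
  | .neg, .pos, .neg, _, x => 𝟙 (D.dual.obj ⟨x⟩)
  | .neg, .neg, .pos, _, x => D.φ.hom.app x

/-- The composition functor `B(ʰy, z) × ʰB(ᵍx, y) ⟶ B(ᵍʰx, z)`, `(β, α) ↦ β ∘ ʰα ∘ φ_{g,h}`. -/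
def compFunctor {g h k : Variance} (e : g * h = k) (x y z : B) :
    (D.actObj h y ⟶ z) × ((CatG.act h).obj ⟨Cat.of (D.actObj g x ⟶ y)⟩).as ⥤
      (D.actObj k x ⟶ z) where
  obj p := D.actφ e x ≫ (D.actMap h (D.actObj g x) y).obj p.2 ≫ p.1
  map {p q} t := D.actφ e x ◃ ((D.actMap h (D.actObj g x) y).map t.2 ▹ p.1 ≫
    (D.actMap h (D.actObj g x) y).obj q.2 ◃ t.1)
  map_id p := by simp
  map_comp {p q r} s t := by
    have := Bicategory.whisker_exchange ((D.actMap h (D.actObj g x) y).map t.2) s.1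
    simp only [prod_comp, Functor.map_comp, Bicategory.comp_whiskerRight,
      Bicategory.whiskerLeft_comp, Category.assoc]
    rw [← Bicategory.whiskerLeft_comp_assoc _ (_ ◃ s.1), this,
      Bicategory.whiskerLeft_comp_assoc]

/-- The `{+, -}`-variant structure determined by a weak duality involution: the category of covariant
1-cells is `B(x, y)`, and the category of contravariant 1-cells is `B(x°, y)`. -/
def toVariantData : VariantData Variance (Pith Cat.{w₁, v₁}) B where
  hom g x y := ⟨Cat.of (D.actObj g x ⟶ y)⟩
  id x := CatG.ofObj (C := Cat.of (x ⟶ x)) (𝟙 x)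
  comp e x y z := ⟨(D.compFunctor e x y z).toCatHom⟩

/-- The identity of `x°`, as a contravariant 1-cell from `x` to `x°`. -/
def χ (x : B) : 𝟙_ (Pith Cat.{w₁, v₁}) ⟶ D.toVariantData.hom .neg x (D.dual.obj ⟨x⟩) :=
  CatG.ofObj (C := Cat.of (D.dual.obj ⟨x⟩ ⟶ D.dual.obj ⟨x⟩)) (𝟙 (D.dual.obj ⟨x⟩))

end WeakDualityInvolution

end Contravariance
end TwistedBicat

namespace TwistedBicat

local infixr:81 " ◃ " => Bicategory.whiskerLeft
local infixl:81 " ▹ " => Bicategory.whiskerRight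

open MonoidalTwoCategory

lemma sq_assoc {C : Type*} [Category* C] {a b c d e : C} {f : a ⟶ b} {g : b ⟶ c} {h : a ⟶ d}
    {k : d ⟶ c} (w : f ≫ g = h ≫ k) (z : c ⟶ e) : f ≫ g ≫ z = h ≫ k ≫ z := by
  rw [← Category.assoc, w, Category.assoc]

section Strict

variable {W : Type u} [Bicategory.{w, v} W] [Bicategory.Strict W]

lemma whiskerLeft_congr {X Y Z : W} {f f' : X ⟶ Y} (h : f = f') {k k' : Y ⟶ Z} (η : k ⟶ k') :
    f ◃ η = eqToHom (by rw [h]) ≫ f' ◃ η ≫ eqToHom (by rw [h]) := by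
  subst h; simp

lemma whiskerRight_congr {X Y Z : W} {f f' : X ⟶ Y} (η : f ⟶ f') {k k' : Y ⟶ Z} (h : k = k') :
    η ▹ k = eqToHom (by rw [h]) ≫ η ▹ k' ≫ eqToHom (by rw [h]) := by
  subst h; simp

lemma strict_comp_whiskerLeft {X Y Z T : W} (f : X ⟶ Y) (g : Y ⟶ Z) {k k' : Z ⟶ T} (η : k ⟶ k') :
    (f ≫ g) ◃ η = eqToHom (by simp) ≫ f ◃ g ◃ η ≫ eqToHom (by simp) := by
  rw [Bicategory.comp_whiskerLeft]
  simp [Bicategory.Strict.associator_eqToIso]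

lemma strict_whiskerRight_comp {X Y Z T : W} {f f' : X ⟶ Y} (η : f ⟶ f') (g : Y ⟶ Z) (k : Z ⟶ T) :
    η ▹ (g ≫ k) = eqToHom (by simp) ≫ η ▹ g ▹ k ≫ eqToHom (by simp) := by
  rw [Bicategory.whiskerRight_comp]
  simp [Bicategory.Strict.associator_eqToIso]

lemma strict_whisker_assoc {X Y Z T : W} (f : X ⟶ Y) {g g' : Y ⟶ Z} (η : g ⟶ g') (k : Z ⟶ T) :
    (f ◃ η) ▹ k = eqToHom (by simp) ≫ f ◃ η ▹ k ≫ eqToHom (by simp) := by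
  rw [Bicategory.whisker_assoc]
  simp [Bicategory.Strict.associator_eqToIso]

lemma strict_id_whiskerLeft {X Y : W} {f f' : X ⟶ Y} (η : f ⟶ f') :
    𝟙 X ◃ η = eqToHom (by simp) ≫ η ≫ eqToHom (by simp) := by
  rw [Bicategory.id_whiskerLeft]
  simp [Bicategory.Strict.leftUnitor_eqToIso]

lemma strict_whiskerRight_id {X Y : W} {f f' : X ⟶ Y} (η : f ⟶ f') :
    η ▹ 𝟙 Y = eqToHom (by simp) ≫ η ≫ eqToHom (by simp) := by
  rw [Bicategory.whiskerRight_id]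
  simp [Bicategory.Strict.rightUnitor_eqToIso]

/-- A generalized element of the object `X`: a 1-cell into `X`. -/
structure Elem (X : W) where
  src : W
  val : src ⟶ X

namespace Elem

/-- Morphisms of generalized elements: triangles filled by a 2-cell. -/
structure Hom {X : W} (a b : Elem X) where
  base : a.src ⟶ b.src
  cell : a.val ⟶ base ≫ b.val

lemma Hom.ext' {X : W} {a b : Elem X} {m n : Hom a b} (h : m.base = n.base)
    (h' : m.cell ≫ eqToHom (by rw [h]) = n.cell) : m = n := by
  obtain ⟨p, α⟩ := m
  obtain ⟨q, β⟩ := n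
  dsimp only at h
  subst h
  simpa using h'

instance {X : W} : Category (Elem X) where
  Hom a b := Hom a b
  id a := ⟨𝟙 _, eqToHom (by simp)⟩
  comp m n := ⟨m.base ≫ n.base, m.cell ≫ m.base ◃ n.cell ≫ eqToHom (by simp)⟩
  id_comp m := Hom.ext' (Category.id_comp _) (by simp [Bicategory.Strict.leftUnitor_eqToIso])
  comp_id m := Hom.ext' (Category.comp_id _) (by simp)
  assoc m n o := Hom.ext' (Category.assoc _ _ _) (by simp [Bicategory.Strict.associator_eqToIso])

variable {X Y Z : W}

@[simp] lemma id_base (a : Elem X) : Hom.base (𝟙 a) = 𝟙 a.src := rfl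
@[simp] lemma comp_base {a b c : Elem X} (m : a ⟶ b) (n : b ⟶ c) :
    (m ≫ n).base = m.base ≫ n.base := rfl
lemma id_cell (a : Elem X) : Hom.cell (𝟙 a) = eqToHom (by simp) := rfl
lemma comp_cell {a b c : Elem X} (m : a ⟶ b) (n : b ⟶ c) :
    (m ≫ n).cell = m.cell ≫ m.base ◃ n.cell ≫ eqToHom (by simp) := rfl

lemma hom_ext {a b : Elem X} {m n : a ⟶ b} (h : m.base = n.base)
    (h' : m.cell ≫ eqToHom (by rw [h]) = n.cell) : m = n := Hom.ext' h h'

/-- The morphism of generalized elements given by a commutative triangle. -/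
abbrev st (a b : Elem X) (p : a.src ⟶ b.src) (h : a.val = p ≫ b.val) : a ⟶ b := ⟨p, eqToHom h⟩

lemma st_congr {a b : Elem X} {p q : a.src ⟶ b.src} (e : p = q) (h : a.val = p ≫ b.val) :
    st a b p h = st a b q (by rw [h, e]) := by subst e; rfl

@[simp] lemma st_self (a : Elem X) (p : a.src ⟶ a.src) (h : a.val = p ≫ a.val) (hp : p = 𝟙 a.src) :
    st a a p h = 𝟙 a := by
  subst hp; rfl

lemma st_id (a : Elem X) (h : a.val = 𝟙 a.src ≫ a.val) : st a a (𝟙 a.src) h = 𝟙 a := rfl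

lemma st_comp_cell {a b c : Elem X} (p : a.src ⟶ b.src) (h : a.val = p ≫ b.val) (m : b ⟶ c) :
    (st a b p h ≫ m).cell = eqToHom h ≫ p ◃ m.cell ≫ eqToHom (by simp) := rfl

lemma comp_st_cell {a b c : Elem X} (m : a ⟶ b) (q : b.src ⟶ c.src) (h : b.val = q ≫ c.val) :
    (m ≫ st b c q h).cell = m.cell ≫ eqToHom (by simp [h]) := by
  simp [comp_cell]

@[simp] lemma st_st {a b c : Elem X} (p : a.src ⟶ b.src) (h : a.val = p ≫ b.val)
    (q : b.src ⟶ c.src) (h' : b.val = q ≫ c.val) :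
    st a b p h ≫ st b c q h' = st a c (p ≫ q) (by rw [h, h', Category.assoc]) :=
  hom_ext rfl (by simp [comp_cell])

@[simp] lemma st_st_assoc {a b c d : Elem X} (p : a.src ⟶ b.src) (h : a.val = p ≫ b.val)
    (q : b.src ⟶ c.src) (h' : b.val = q ≫ c.val) (m : c ⟶ d) :
    st a b p h ≫ st b c q h' ≫ m =
      st a c (p ≫ q) (by rw [h, h', Category.assoc]) ≫ m := by
  rw [← Category.assoc, st_st]

lemma st_conj {a b : Elem X} {m n : a ⟶ b} (e : m = n) (a' b' : Elem X) (p : a'.src ⟶ a.src)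
    (h : a'.val = p ≫ a.val) (q : b.src ⟶ b'.src) (h' : b.val = q ≫ b'.val) :
    st a' a p h ≫ m ≫ st b b' q h' = st a' a p h ≫ n ≫ st b b' q h' := by
  rw [e]

/-- Triangles filled by an identity 2-cell are cartesian. -/
lemma hom_ext_st {a b c : Elem X} {m n : a ⟶ b} (q : b.src ⟶ c.src) (h : b.val = q ≫ c.val)
    (e : m.base = n.base) (e' : m ≫ st b c q h = n ≫ st b c q h) : m = n := by
  refine hom_ext e ?_
  have h1 : ∀ {k l : a ⟶ c} (e : k = l), k.cell ≫ eqToHom (by rw [e]) = l.cell := by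
    rintro k l rfl; simp
  have h2 := h1 e'
  rw [comp_st_cell, comp_st_cell, Category.assoc, eqToHom_trans, comp_eqToHom_iff] at h2
  rw [h2]; simp

instance {a b : Elem X} (p : a.src ⟶ b.src) (h : a.val = p ≫ b.val) [IsIso p] :
    IsIso (st a b p h) :=
  ⟨st b a (inv p) (by simp [h]), by rw [st_st, ← st_id _ (by simp)]; exact st_congr (by simp) _,
    by rw [st_st, ← st_id _ (by simp)]; exact st_congr (by simp) _⟩

/-- The isomorphism of generalized elements given by a commutative triangle. -/
@[simps] def stIso (a b : Elem X) (p : a.src ≅ b.src) (h : a.val = p.hom ≫ b.val) : a ≅ b where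
  hom := st a b p.hom h
  inv := st b a p.inv (by simp [h])
  hom_inv_id := by rw [st_st, ← st_id _ (by simp)]; exact st_congr (by simp) _
  inv_hom_id := by rw [st_st, ← st_id _ (by simp)]; exact st_congr (by simp) _

/-- Postcomposition with a 1-cell. -/
abbrev pushObj (f : X ⟶ Y) (a : Elem X) : Elem Y := ⟨a.src, a.val ≫ f⟩

abbrev pushMap (f : X ⟶ Y) {a b : Elem X} (m : a ⟶ b) : pushObj f a ⟶ pushObj f b :=
  ⟨m.base, m.cell ▹ f ≫ eqToHom (by simp)⟩

@[simp] lemma pushMap_id (f : X ⟶ Y) (a : Elem X) : pushMap f (𝟙 a) = 𝟙 (pushObj f a) :=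
  hom_ext rfl (by simp [id_cell])

@[simp] lemma pushMap_comp (f : X ⟶ Y) {a b c : Elem X} (m : a ⟶ b) (n : b ⟶ c) :
    pushMap f (m ≫ n) = pushMap f m ≫ pushMap f n :=
  hom_ext rfl (by simp [comp_cell, Bicategory.Strict.associator_eqToIso])

@[simp] lemma pushMap_st (f : X ⟶ Y) {a b : Elem X} (p : a.src ⟶ b.src) (h : a.val = p ≫ b.val) :
    pushMap f (st a b p h) = st (pushObj f a) (pushObj f b) p (by simp [h]) :=
  hom_ext rfl (by simp)

lemma pushMap_pushMap (f : X ⟶ Y) (g : Y ⟶ Z) {a b : Elem X} (m : a ⟶ b) :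
    pushMap g (pushMap f m) ≫
        st (pushObj g (pushObj f b)) (pushObj (f ≫ g) b) (𝟙 b.src) (by simp) =
      st (pushObj g (pushObj f a)) (pushObj (f ≫ g) a) (𝟙 a.src) (by simp) ≫
        pushMap (f ≫ g) m :=
  hom_ext (by simp) (by
    simp [comp_cell, Bicategory.Strict.associator_eqToIso, Bicategory.Strict.leftUnitor_eqToIso])

lemma pushMap_congr {f g : X ⟶ Y} (e : f = g) {a b : Elem X} (m : a ⟶ b) :
    pushMap f m = st (pushObj f a) (pushObj g a) (𝟙 a.src) (by simp [e]) ≫ pushMap g m ≫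
      st (pushObj g b) (pushObj f b) (𝟙 b.src) (by simp [e]) := by
  subst e; exact ((Category.id_comp _).trans (Category.comp_id _)).symm

@[simp] lemma pushMap_pushMap_conj (f : X ⟶ Y) (g : Y ⟶ Z) {a b : Elem X} (m : a ⟶ b) :
    pushMap g (pushMap f m) =
      st (pushObj g (pushObj f a)) (pushObj (f ≫ g) a) (𝟙 a.src) (by simp) ≫
        pushMap (f ≫ g) m ≫
        st (pushObj (f ≫ g) b) (pushObj g (pushObj f b)) (𝟙 b.src) (by simp) := by
  rw [← sq_assoc (pushMap_pushMap f g m), st_st, st_congr (Category.id_comp _)]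
  exact (Category.comp_id _).symm

@[simp] lemma pushMap_comp_assoc {T : W} (f : X ⟶ Y) (g : Y ⟶ Z) (h : Z ⟶ T) {a b : Elem X}
    (m : a ⟶ b) :
    pushMap ((f ≫ g) ≫ h) m =
      st (pushObj ((f ≫ g) ≫ h) a) (pushObj (f ≫ g ≫ h) a) (𝟙 a.src) (by simp) ≫
        pushMap (f ≫ g ≫ h) m ≫
        st (pushObj (f ≫ g ≫ h) b) (pushObj ((f ≫ g) ≫ h) b) (𝟙 b.src) (by simp) :=
  pushMap_congr (Category.assoc f g h) m

lemma pushMap_one {a a' : Elem X} (m : a ⟶ a') :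
    pushMap (𝟙 X) m = st (pushObj (𝟙 X) a) a (𝟙 a.src) (by simp) ≫ m ≫
      st a' (pushObj (𝟙 X) a') (𝟙 a'.src) (by simp) :=
  hom_ext (by simp) (by simp [comp_cell, Bicategory.Strict.leftUnitor_eqToIso,
    Bicategory.Strict.rightUnitor_eqToIso, Bicategory.whiskerRight_id])

lemma eq_of_pushMap {X' : W} (e : X' ≅ X) {a a' : Elem X'} {b b' : Elem X} {m : a ⟶ a'}
    {n : b ⟶ b'} {p : a.src ⟶ b.src} {p' : a'.src ≅ b'.src} {h : a.val ≫ e.hom = p ≫ b.val}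
    {h' : a'.val ≫ e.hom = p'.hom ≫ b'.val}
    (w : pushMap e.hom m ≫ st (pushObj e.hom a') b' p'.hom h' = st (pushObj e.hom a) b p h ≫ n) :
    m = st a (pushObj e.inv b) p (by simp [← reassoc_of% h]) ≫ pushMap e.inv n ≫
      st (pushObj e.inv b') a' p'.inv (by
        rw [Iso.eq_inv_comp]; simp [← reassoc_of% h']) := by
  have h1 := congrArg (pushMap e.inv) w
  have h2 := pushMap_one m
  rw [pushMap_congr e.hom_inv_id.symm] at h2
  simp at h1
  have h3 := st_conj h2 a a' (𝟙 _) (by simp) (𝟙 _) (by simp)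
  have h4 := st_conj h1 a a' (𝟙 _) (by simp) p'.inv (by
        rw [Iso.eq_inv_comp]; simp [← reassoc_of% h'])
  simp at h3 h4
  rw [← h3, h4]

/-- The evaluation of a 2-cell at a generalized element. -/
abbrev ev {f g : X ⟶ Y} (η : f ⟶ g) (a : Elem X) : pushObj f a ⟶ pushObj g a :=
  ⟨𝟙 _, a.val ◃ η ≫ eqToHom (by simp)⟩

@[simp] lemma ev_id (f : X ⟶ Y) (a : Elem X) : ev (𝟙 f) a = 𝟙 _ := hom_ext rfl (by simp [id_cell])

lemma ev_comp {f g h : X ⟶ Y} (η : f ⟶ g) (θ : g ⟶ h) (a : Elem X) :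
    ev (η ≫ θ) a = ev η a ≫ ev θ a :=
  hom_ext (by simp) (by simp [comp_cell, Bicategory.Strict.leftUnitor_eqToIso])

lemma ev_eqToHom {f g : X ⟶ Y} (h : f = g) (a : Elem X) :
    ev (eqToHom h) a = st (pushObj f a) (pushObj g a) (𝟙 a.src) (by simp [h]) :=
  hom_ext rfl (by simp)

/-- Evaluation of an invertible 2-cell. -/
@[simps] def evIso {f g : X ⟶ Y} (η : f ≅ g) (a : Elem X) : pushObj f a ≅ pushObj g a where
  hom := ev η.hom a
  inv := ev η.inv a
  hom_inv_id := by rw [← ev_comp, Iso.hom_inv_id, ev_id]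
  inv_hom_id := by rw [← ev_comp, Iso.inv_hom_id, ev_id]

lemma ev_natural {f g : X ⟶ Y} (η : f ⟶ g) {a b : Elem X} (m : a ⟶ b) :
    pushMap f m ≫ ev η b = ev η a ≫ pushMap g m := by
  refine hom_ext (by simp) ?_
  have h := Bicategory.whisker_exchange m.cell η
  simp only [comp_cell]
  simp [Bicategory.Strict.leftUnitor_eqToIso, Bicategory.Strict.associator_eqToIso] at h ⊢
  rw [reassoc_of% h]
  simp

lemma ev_st {f g : X ⟶ Y} (η : f ⟶ g) {a b : Elem X} (p : a.src ⟶ b.src) (h : a.val = p ≫ b.val) :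
    st (pushObj f a) (pushObj f b) p (by simp [h]) ≫ ev η b =
      ev η a ≫ st (pushObj g a) (pushObj g b) p (by simp [h]) := by
  rw [← pushMap_st f p h, ← pushMap_st g p h, ev_natural]

lemma ev_eq {f g : X ⟶ Y} (η : f ⟶ g) {a b : Elem X} (p : a.src ≅ b.src)
    (h : a.val = p.hom ≫ b.val) :
    ev η b = st (pushObj f b) (pushObj f a) p.inv (by simp [h]) ≫ ev η a ≫
      st (pushObj g a) (pushObj g b) p.hom (by simp [h]) := by
  rw [← ev_st η p.hom h, st_st_assoc, st_congr (a := pushObj f b) (b := pushObj f b) p.inv_hom_id]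
  exact (Category.id_comp _).symm

lemma ev_whiskerLeft (f : X ⟶ Y) {g g' : Y ⟶ Z} (η : g ⟶ g') (a : Elem X) :
    ev (f ◃ η) a =
      st (pushObj (f ≫ g) a) (pushObj g (pushObj f a)) (𝟙 a.src) (by simp) ≫
        ev η (pushObj f a) ≫
        st (pushObj g' (pushObj f a)) (pushObj (f ≫ g') a) (𝟙 a.src) (by simp) :=
  hom_ext (by simp) (by
    simp [comp_cell, Bicategory.Strict.leftUnitor_eqToIso,
      Bicategory.Strict.associator_eqToIso])

lemma ev_whiskerRight {f f' : X ⟶ Y} (η : f ⟶ f') (g : Y ⟶ Z) (a : Elem X) :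
    ev (η ▹ g) a =
      st (pushObj (f ≫ g) a) (pushObj g (pushObj f a)) (𝟙 a.src) (by simp) ≫
        pushMap g (ev η a) ≫
        st (pushObj g (pushObj f' a)) (pushObj (f' ≫ g) a) (𝟙 a.src) (by simp) :=
  hom_ext (by simp) (by
    simp [comp_cell, Bicategory.Strict.leftUnitor_eqToIso,
      Bicategory.Strict.associator_eqToIso])

/-- The universal generalized element of `X`. -/
abbrev univ (X : W) : Elem X := ⟨X, 𝟙 X⟩

lemma ev_univ_injective {f g : X ⟶ Y} {η θ : f ⟶ g} (h : ev η (univ X) = ev θ (univ X)) :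
    η = θ := by
  have h1 : ∀ {a b : Elem Y} {k l : a ⟶ b} (e : k = l), k.cell ≫ eqToHom (by rw [e]) = l.cell := by
    rintro _ _ k l rfl; simp
  have h2 := h1 h
  simp only [strict_id_whiskerLeft] at h2
  simpa only [Category.assoc, eqToHom_trans, cancel_epi, cancel_mono] using h2

/-- The 2-cell `f ⟶ g` determined by a morphism of elements over the identity. -/
lemma exists_ev_univ {f g : X ⟶ Y} (m : pushObj f (univ X) ⟶ pushObj g (univ X))
    (h : m.base = 𝟙 X) : ∃ η : f ⟶ g, ev η (univ X) = m :=
  ⟨eqToHom (by simp) ≫ m.cell ≫ eqToHom (by simp [h]), hom_ext h.symm (by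
    simp [Bicategory.Strict.leftUnitor_eqToIso])⟩

end Elem
end Strict

section Monoidal

variable {W : Type u} [Bicategory.{w, v} W] [Bicategory.Strict W] [MonoidalTwoCategory W]

lemma tensor₂_eqToHom {X X' Y Y' : W} {f f' : X ⟶ X'} {g g' : Y ⟶ Y'} (h : f = f') (h' : g = g') :
    tensor₂ (eqToHom h) (eqToHom h') = eqToHom (by rw [h, h']) := by
  subst h h'; exact tensor₂_id f g

namespace Elem
variable {X X' Y Y' Z : W}

/-- The tensor product of generalized elements. -/
abbrev box (a : Elem X) (b : Elem Y) : Elem (X ⊗ Y) := ⟨a.src ⊗ b.src, a.val ⊗ₘ b.val⟩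

abbrev boxMap {a a' : Elem X} {b b' : Elem Y} (m : a ⟶ a') (n : b ⟶ b') : box a b ⟶ box a' b' :=
  ⟨m.base ⊗ₘ n.base, tensor₂ m.cell n.cell ≫ eqToHom (by simp)⟩

@[simp] lemma boxMap_id (a : Elem X) (b : Elem Y) : boxMap (𝟙 a) (𝟙 b) = 𝟙 (box a b) :=
  hom_ext (by simp) (by simp [id_cell, tensor₂_eqToHom])

@[simp] lemma boxMap_st {a a' : Elem X} {b b' : Elem Y} (p : a.src ⟶ a'.src) (h : a.val = p ≫ a'.val)
    (q : b.src ⟶ b'.src) (h' : b.val = q ≫ b'.val) :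
    boxMap (st a a' p h) (st b b' q h') = st (box a b) (box a' b') (p ⊗ₘ q) (by simp [h, h']) :=
  hom_ext rfl (by simp [tensor₂_eqToHom])

lemma boxMap_comp {a a' a'' : Elem X} {b b' b'' : Elem Y} (m : a ⟶ a') (m' : a' ⟶ a'')
    (n : b ⟶ b') (n' : b' ⟶ b'') :
    boxMap (m ≫ m') (n ≫ n') = boxMap m n ≫ boxMap m' n' :=
  hom_ext (by simp) (by simp [comp_cell, tensor₂_comp, tensor₂_whiskerLeft, tensor₂_eqToHom])

lemma boxMap_push {a a' : Elem X} {b b' : Elem Y} (m : a ⟶ a') (n : b ⟶ b') (f : X ⟶ X')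
    (g : Y ⟶ Y') :
    boxMap (pushMap f m) (pushMap g n) ≫
        st (box (pushObj f a') (pushObj g b')) (pushObj (f ⊗ₘ g) (box a' b'))
          (𝟙 (a'.src ⊗ b'.src)) (by simp) =
      st (box (pushObj f a) (pushObj g b)) (pushObj (f ⊗ₘ g) (box a b))
          (𝟙 (a.src ⊗ b.src)) (by simp) ≫ pushMap (f ⊗ₘ g) (boxMap m n) :=
  hom_ext (by simp) (by
    simp [comp_cell, tensor₂_comp, tensor₂_whiskerRight, tensor₂_eqToHom,
      Bicategory.Strict.leftUnitor_eqToIso])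

lemma ev_tensor₂ {f f' : X ⟶ X'} {g g' : Y ⟶ Y'} (η : f ⟶ f') (θ : g ⟶ g') (a : Elem X)
    (b : Elem Y) :
    ev (tensor₂ η θ) (box a b) =
      st (pushObj (f ⊗ₘ g) (box a b)) (box (pushObj f a) (pushObj g b))
          (𝟙 (a.src ⊗ b.src)) (by simp) ≫
        boxMap (ev η a) (ev θ b) ≫
        st (box (pushObj f' a) (pushObj g' b)) (pushObj (f' ⊗ₘ g') (box a b))
          (𝟙 (a.src ⊗ b.src)) (by simp) :=
  hom_ext (by simp) (by
    simp [comp_cell, tensor₂_comp, tensor₂_whiskerLeft, tensor₂_eqToHom,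
      Bicategory.Strict.leftUnitor_eqToIso])

/-- The associator, on generalized elements. -/
lemma boxMap_assoc {X Y Z : W} {a a' : Elem X} {b b' : Elem Y} {c c' : Elem Z} (m : a ⟶ a')
    (n : b ⟶ b') (o : c ⟶ c') :
    pushMap (α_ X Y Z).hom (boxMap (boxMap m n) o) ≫
        st (pushObj (α_ X Y Z).hom (box (box a' b') c')) (box a' (box b' c'))
          (α_ a'.src b'.src c'.src).hom (by simp) =
      st (pushObj (α_ X Y Z).hom (box (box a b) c)) (box a (box b c))
          (α_ a.src b.src c.src).hom (by simp) ≫ boxMap m (boxMap n o) := by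
  refine hom_ext (by simp) ?_
  have h := associator_naturality₂ m.cell n.cell o.cell
  have h1 : tensor₂ (tensor₂ m.cell n.cell ≫ eqToHom (by simp)) o.cell =
    tensor₂ (tensor₂ m.cell n.cell) o.cell ≫ eqToHom (show _ =
       ((m.base ⊗ₘ n.base) ≫ (a'.val ⊗ₘ b'.val)) ⊗ₘ (o.base ≫ c'.val) by simp) := by
    conv_lhs => rw [← Category.comp_id o.cell, tensor₂_comp]
    rw [← eqToHom_refl _ rfl, tensor₂_eqToHom]
  have h2 : tensor₂ m.cell (tensor₂ n.cell o.cell ≫ eqToHom (by simp)) =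
    tensor₂ m.cell (tensor₂ n.cell o.cell) ≫ eqToHom (show _ =
       (m.base ≫ a'.val) ⊗ₘ ((n.base ⊗ₘ o.base) ≫ (b'.val ⊗ₘ c'.val)) by simp) := by
    conv_lhs => rw [← Category.comp_id m.cell, tensor₂_comp]
    rw [← eqToHom_refl _ rfl, tensor₂_eqToHom]
  simp [comp_cell, h1, h2, h]

lemma boxMap_leftUnitor {a a' : Elem X} (m : a ⟶ a') :
    pushMap (λ_ X).hom (boxMap (𝟙 (univ (𝟙_ W))) m) ≫
        st (pushObj (λ_ X).hom (box (univ (𝟙_ W)) a')) a' (λ_ a'.src).hom (by simp) =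
      st (pushObj (λ_ X).hom (box (univ (𝟙_ W)) a)) a (λ_ a.src).hom (by simp) ≫ m := by
  refine hom_ext (by simp) ?_
  have h := leftUnitor_naturality₂ m.cell
  have h1 : tensor₂ (eqToHom (by simp) : 𝟙 (𝟙_ W) ⟶ 𝟙 (𝟙_ W) ≫ 𝟙 (𝟙_ W)) m.cell =
      tensor₂ (𝟙 _) m.cell ≫ eqToHom (by simp) := by
    conv_lhs => rw [← Category.comp_id m.cell, ← Category.id_comp (eqToHom _), tensor₂_comp]
    rw [← eqToHom_refl (m.base ≫ a'.val) rfl, tensor₂_eqToHom]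
  simp [comp_cell, id_cell, h1, h]

lemma boxMap_rightUnitor {a a' : Elem X} (m : a ⟶ a') :
    pushMap (ρ_ X).hom (boxMap m (𝟙 (univ (𝟙_ W)))) ≫
        st (pushObj (ρ_ X).hom (box a' (univ (𝟙_ W)))) a' (ρ_ a'.src).hom (by simp) =
      st (pushObj (ρ_ X).hom (box a (univ (𝟙_ W)))) a (ρ_ a.src).hom (by simp) ≫ m := by
  refine hom_ext (by simp) ?_
  have h := rightUnitor_naturality₂ m.cell
  have h1 : tensor₂ m.cell (eqToHom (by simp) : 𝟙 (𝟙_ W) ⟶ 𝟙 (𝟙_ W) ≫ 𝟙 (𝟙_ W)) =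
      tensor₂ m.cell (𝟙 _) ≫ eqToHom (by simp) := by
    conv_lhs => rw [← Category.comp_id m.cell, ← Category.id_comp (eqToHom _), tensor₂_comp]
    rw [← eqToHom_refl (m.base ≫ a'.val) rfl, tensor₂_eqToHom]
  simp [comp_cell, id_cell, h1, h]

end Elem
end Monoidal

section Twisted

open TwistingAction Functor.LaxMonoidal

variable {G : Type t} [Group G] {W : Type u} [Bicategory.{w, v} W] [Bicategory.Strict W]
  [MonoidalTwoCategory W] [TwistingAction G W]

lemma act₂_eqToHom (g : G) {X Y : W} {f f' : X ⟶ Y} (h : f = f') :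
    act₂ g (eqToHom h) = eqToHom (by rw [h]) := by
  subst h; exact act₂_id g f

namespace Elem
variable {X Y Z : W}

/-- The action of a group element on generalized elements. -/
abbrev actObj (g : G) (a : Elem X) : Elem ((act g).obj X) := ⟨(act g).obj a.src, (act g).map a.val⟩

abbrev actMap (g : G) {a b : Elem X} (m : a ⟶ b) : actObj g a ⟶ actObj g b :=
  ⟨(act g).map m.base, act₂ g m.cell ≫ eqToHom (by simp)⟩

@[simp] lemma actMap_id (g : G) (a : Elem X) : actMap g (𝟙 a) = 𝟙 (actObj g a) :=
  hom_ext (by simp) (by simp [id_cell, act₂_eqToHom])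

@[simp] lemma actMap_comp (g : G) {a b c : Elem X} (m : a ⟶ b) (n : b ⟶ c) :
    actMap g (m ≫ n) = actMap g m ≫ actMap g n :=
  hom_ext (by simp) (by simp [comp_cell, act₂_comp, act₂_whiskerLeft, act₂_eqToHom])

@[simp] lemma actMap_st (g : G) {a b : Elem X} (p : a.src ⟶ b.src) (h : a.val = p ≫ b.val) :
    actMap g (st a b p h) =
      st (actObj g a) (actObj g b) ((act g).map p) (by simp [h]) :=
  hom_ext rfl (by simp [act₂_eqToHom])

lemma actMap_pushMap (g : G) (f : X ⟶ Y) {a b : Elem X} (m : a ⟶ b) :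
    actMap g (pushMap f m) ≫
        st (actObj g (pushObj f b)) (pushObj ((act g).map f) (actObj g b)) (𝟙 _)
          (by simp) =
      st (actObj g (pushObj f a)) (pushObj ((act g).map f) (actObj g a)) (𝟙 _)
          (by simp) ≫ pushMap ((act g).map f) (actMap g m) :=
  hom_ext (by simp) (by
    simp [comp_cell, act₂_comp, act₂_whiskerRight, act₂_eqToHom,
      Bicategory.Strict.leftUnitor_eqToIso])

lemma ev_act₂ (g : G) {f f' : X ⟶ Y} (η : f ⟶ f') (a : Elem X) :
    ev (act₂ g η) (actObj g a) =
      st (pushObj ((act g).map f) (actObj g a)) (actObj g (pushObj f a)) (𝟙 _)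
          (by simp) ≫ actMap g (ev η a) ≫
        st (actObj g (pushObj f' a)) (pushObj ((act g).map f') (actObj g a)) (𝟙 _)
          (by simp) :=
  hom_ext (by simp) (by
    simp [comp_cell, act₂_comp, act₂_whiskerLeft, act₂_eqToHom,
      Bicategory.Strict.leftUnitor_eqToIso])

lemma actMap_boxMap (g : G) {a a' : Elem X} {b b' : Elem Y} (m : a ⟶ a') (n : b ⟶ b') :
    pushMap (μ (act g) X Y) (boxMap (actMap g m) (actMap g n)) ≫
        st (pushObj (μ (act g) X Y) (box (actObj g a') (actObj g b')))
          (actObj g (box a' b')) (μ (act g) a'.src b'.src) (by simp) =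
      st (pushObj (μ (act g) X Y) (box (actObj g a) (actObj g b)))
          (actObj g (box a b)) (μ (act g) a.src b.src) (by simp) ≫
        actMap g (boxMap m n) := by
  refine hom_ext (by simp) ?_
  have h := μ_naturality₂ g m.cell n.cell
  simp [comp_cell, tensor₂_comp, tensor₂_eqToHom, act₂_comp, act₂_eqToHom, h]

lemma actMap_mul {g h k : G} (e : g * h = k) {a b : Elem X} (m : a ⟶ b) :
    pushMap ((mulIso e).hom.app X) (actMap h (actMap g m)) ≫
        st (pushObj ((mulIso e).hom.app X) (actObj h (actObj g b)))
          (actObj k b) ((mulIso e).hom.app b.src) ((mulIso e).hom.naturality b.val) =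
      st (pushObj ((mulIso e).hom.app X) (actObj h (actObj g a)))
          (actObj k a) ((mulIso e).hom.app a.src) ((mulIso e).hom.naturality a.val) ≫
        actMap k m := by
  refine hom_ext ((mulIso e).hom.naturality m.base) ?_
  have h := mulIso_naturality₂ e m.cell
  simp [comp_cell, act₂_comp, act₂_eqToHom, h]

lemma actMap_one {a b : Elem X} (m : a ⟶ b) :
    pushMap ((oneIso (G := G)).hom.app X) (actMap (1 : G) m) ≫
        st (pushObj ((oneIso (G := G)).hom.app X) (actObj (1 : G) b)) b
          (oneIso.hom.app b.src) (oneIso.hom.naturality b.val) =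
      st (pushObj ((oneIso (G := G)).hom.app X) (actObj (1 : G) a)) a
          (oneIso.hom.app a.src) (oneIso.hom.naturality a.val) ≫ m := by
  refine hom_ext (oneIso.hom.naturality m.base) ?_
  have h := oneIso_naturality₂ (G := G) m.cell
  simp [comp_cell, act₂_comp, act₂_eqToHom, h]

end Elem
end Twisted
end TwistedBicat

namespace TwistedBicat

attribute [-simp] MonoidalCategory.tensorHom_id MonoidalCategory.id_tensorHom
  MonoidalCategory.associator_conjugation
attribute [local simp] MonoidalCategory.id_tensorHom_id MonoidalCategory.tensorHom_comp_tensorHom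
  MonoidalCategory.tensorHom_comp_tensorHom_assoc MonoidalCategory.associator_naturality
  MonoidalCategory.associator_naturality_assoc

local infixr:81 " ◃ " => Bicategory.whiskerLeft
local infixl:81 " ▹ " => Bicategory.whiskerRight

open MonoidalTwoCategory

section Underlying

variable {W : Type u} [Bicategory.{w, v} W] [Bicategory.Strict W] [MonoidalTwoCategory W]

lemma tensor₂_whiskerRight_left {X X' X'' Y Y' : W} {f f' : X ⟶ X'} (η : f ⟶ f') (k : X' ⟶ X'')
    {g g' : Y ⟶ Y'} (θ : g ⟶ g') :
    tensor₂ (η ▹ k) θ =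
      eqToHom (by simp) ≫ tensor₂ η θ ▹ (k ⊗ₘ 𝟙 Y') ≫ eqToHom (by simp) := by
  have h := tensor₂_whiskerRight η k θ (𝟙 Y')
  have h1 : tensor₂ (η ▹ k) (θ ▹ 𝟙 Y') = tensor₂ (eqToHom rfl ≫ η ▹ k ≫ eqToHom rfl)
    (eqToHom (Category.comp_id g) ≫ θ ≫ eqToHom (Category.comp_id g').symm) := by
    rw [strict_whiskerRight_id]; simp
  rw [h1, tensor₂_comp, tensor₂_comp, tensor₂_eqToHom, tensor₂_eqToHom] at h
  simpa [eqToHom_comp_iff, comp_eqToHom_iff] using h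

lemma tensor₂_whiskerRight_right {X X' Y Y' Y'' : W} {f f' : X ⟶ X'} (η : f ⟶ f')
    {g g' : Y ⟶ Y'} (θ : g ⟶ g') (k : Y' ⟶ Y'') :
    tensor₂ η (θ ▹ k) =
      eqToHom (by simp) ≫ tensor₂ η θ ▹ (𝟙 X' ⊗ₘ k) ≫ eqToHom (by simp) := by
  have h := tensor₂_whiskerRight η (𝟙 X') θ k
  have h1 : tensor₂ (η ▹ 𝟙 X') (θ ▹ k) = tensor₂ (eqToHom (Category.comp_id f) ≫ η ≫ eqToHom (Category.comp_id f').symm)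
    (eqToHom rfl ≫ θ ▹ k ≫ eqToHom rfl) := by
    rw [strict_whiskerRight_id]; simp
  rw [h1, tensor₂_comp, tensor₂_comp, tensor₂_eqToHom, tensor₂_eqToHom] at h
  simpa [eqToHom_comp_iff, comp_eqToHom_iff] using h

namespace Elem

variable {X X' Y Y' Z : W}

lemma boxMap_push_left {a a' : Elem X} {b b' : Elem Y} (m : a ⟶ a') (n : b ⟶ b') (f : X ⟶ X') :
    boxMap (pushMap f m) n ≫
        st (box (pushObj f a') b') (pushObj (f ⊗ₘ 𝟙 Y) (box a' b'))
          (𝟙 (a'.src ⊗ b'.src)) (by simp) =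
      st (box (pushObj f a) b) (pushObj (f ⊗ₘ 𝟙 Y) (box a b))
          (𝟙 (a.src ⊗ b.src)) (by simp) ≫ pushMap (f ⊗ₘ 𝟙 Y) (boxMap m n) := by
  refine hom_ext (by simp) ?_
  have h1 : tensor₂ (m.cell ▹ f ≫ eqToHom (Category.assoc _ _ _)) n.cell =
      tensor₂ (m.cell ▹ f) n.cell ≫
        eqToHom (show _ = (m.base ≫ a'.val ≫ f) ⊗ₘ (n.base ≫ b'.val) by simp) := by
    conv_lhs => rw [← Category.comp_id n.cell, tensor₂_comp]
    rw [← eqToHom_refl _ rfl, tensor₂_eqToHom]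
  simp [comp_cell, h1, tensor₂_whiskerRight_left, Bicategory.Strict.leftUnitor_eqToIso]

lemma boxMap_push_right {a a' : Elem X} {b b' : Elem Y} (m : a ⟶ a') (n : b ⟶ b') (f : Y ⟶ Y') :
    boxMap m (pushMap f n) ≫
        st (box a' (pushObj f b')) (pushObj (𝟙 X ⊗ₘ f) (box a' b'))
          (𝟙 (a'.src ⊗ b'.src)) (by simp) =
      st (box a (pushObj f b)) (pushObj (𝟙 X ⊗ₘ f) (box a b))
          (𝟙 (a.src ⊗ b.src)) (by simp) ≫ pushMap (𝟙 X ⊗ₘ f) (boxMap m n) := by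
  refine hom_ext (by simp) ?_
  have h1 : tensor₂ m.cell (n.cell ▹ f ≫ eqToHom (Category.assoc _ _ _)) =
      tensor₂ m.cell (n.cell ▹ f) ≫
        eqToHom (show _ = (m.base ≫ a'.val) ⊗ₘ (n.base ≫ b'.val ≫ f) by simp) := by
    conv_lhs => rw [← Category.comp_id m.cell, tensor₂_comp]
    rw [← eqToHom_refl _ rfl, tensor₂_eqToHom]
  simp [comp_cell, h1, tensor₂_whiskerRight_right, Bicategory.Strict.leftUnitor_eqToIso]

@[simp] lemma boxMap_push_left_conj {a a' : Elem X} {b b' : Elem Y} (m : a ⟶ a') (n : b ⟶ b')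
    (f : X ⟶ X') :
    boxMap (pushMap f m) n =
      st (box (pushObj f a) b) (pushObj (f ⊗ₘ 𝟙 Y) (box a b))
          (𝟙 (a.src ⊗ b.src)) (by simp) ≫ pushMap (f ⊗ₘ 𝟙 Y) (boxMap m n) ≫
        st (pushObj (f ⊗ₘ 𝟙 Y) (box a' b')) (box (pushObj f a') b')
          (𝟙 (a'.src ⊗ b'.src)) (by simp) := by
  rw [← sq_assoc (boxMap_push_left m n f), st_st, st_congr (Category.id_comp _)]
  exact (Category.comp_id _).symm

@[simp] lemma boxMap_push_right_conj {a a' : Elem X} {b b' : Elem Y} (m : a ⟶ a') (n : b ⟶ b')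
    (f : Y ⟶ Y') :
    boxMap m (pushMap f n) =
      st (box a (pushObj f b)) (pushObj (𝟙 X ⊗ₘ f) (box a b))
          (𝟙 (a.src ⊗ b.src)) (by simp) ≫ pushMap (𝟙 X ⊗ₘ f) (boxMap m n) ≫
        st (pushObj (𝟙 X ⊗ₘ f) (box a' b')) (box a' (pushObj f b'))
          (𝟙 (a'.src ⊗ b'.src)) (by simp) := by
  rw [← sq_assoc (boxMap_push_right m n f), st_st, st_congr (Category.id_comp _)]
  exact (Category.comp_id _).symm

@[simp] lemma boxMap_assoc_conj {X Y Z : W} {a a' : Elem X} {b b' : Elem Y} {c c' : Elem Z} (m : a ⟶ a')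
    (n : b ⟶ b') (o : c ⟶ c') :
    boxMap m (boxMap n o) =
      st (box a (box b c)) (pushObj (α_ X Y Z).hom (box (box a b) c))
          (α_ a.src b.src c.src).inv (by simp) ≫
        pushMap (α_ X Y Z).hom (boxMap (boxMap m n) o) ≫
        st (pushObj (α_ X Y Z).hom (box (box a' b') c')) (box a' (box b' c'))
          (α_ a'.src b'.src c'.src).hom (by simp) := by
  rw [boxMap_assoc, st_st_assoc, st_congr (Iso.inv_hom_id _)]
  exact (Category.id_comp _).symm

@[simp] lemma boxMap_st_comp {a a' a'' : Elem X} {b b' : Elem Y} (p : a.src ⟶ a'.src)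
    (h : a.val = p ≫ a'.val) (m : a' ⟶ a'') (n : b ⟶ b') :
    boxMap (st a a' p h ≫ m) n =
      st (box a b) (box a' b) (p ⊗ₘ 𝟙 b.src) (by simp [h]) ≫ boxMap m n := by
  conv_lhs => rw [← Category.id_comp n, boxMap_comp, ← st_id b (by simp), boxMap_st]

@[simp] lemma boxMap_comp_st {a a' a'' : Elem X} {b b' : Elem Y} (m : a ⟶ a') (p : a'.src ⟶ a''.src)
    (h : a'.val = p ≫ a''.val) (n : b ⟶ b') :
    boxMap (m ≫ st a' a'' p h) n =
      boxMap m n ≫ st (box a' b') (box a'' b') (p ⊗ₘ 𝟙 b'.src) (by simp [h]) := by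
  conv_lhs => rw [← Category.comp_id n, boxMap_comp, ← st_id b' (by simp), boxMap_st]

@[simp] lemma boxMap_st_comp_right {a a' : Elem X} {b b' b'' : Elem Y} (m : a ⟶ a') (p : b.src ⟶ b'.src)
    (h : b.val = p ≫ b'.val) (n : b' ⟶ b'') :
    boxMap m (st b b' p h ≫ n) =
      st (box a b) (box a b') (𝟙 a.src ⊗ₘ p) (by simp [h]) ≫ boxMap m n := by
  conv_lhs => rw [← Category.id_comp m, boxMap_comp, ← st_id a (by simp), boxMap_st]

@[simp] lemma boxMap_comp_st_right {a a' : Elem X} {b b' b'' : Elem Y} (m : a ⟶ a') (n : b ⟶ b')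
    (p : b'.src ⟶ b''.src) (h : b'.val = p ≫ b''.val) :
    boxMap m (n ≫ st b' b'' p h) =
      boxMap m n ≫ st (box a' b') (box a' b'') (𝟙 a'.src ⊗ₘ p) (by simp [h]) := by
  conv_lhs => rw [← Category.comp_id m, boxMap_comp, ← st_id a' (by simp), boxMap_st]


lemma ev_tensor₂_id {f f' : X ⟶ X'} (η : f ⟶ f') (a : Elem X) (b : Elem Y) :
    ev (tensor₂ η (𝟙 (𝟙 Y))) (box a b) =
      st (pushObj (f ⊗ₘ 𝟙 Y) (box a b)) (box (pushObj f a) b) (𝟙 (a.src ⊗ b.src)) (by simp) ≫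
        boxMap (ev η a) (𝟙 b) ≫
        st (box (pushObj f' a) b) (pushObj (f' ⊗ₘ 𝟙 Y) (box a b)) (𝟙 (a.src ⊗ b.src))
          (by simp) := by
  have h : ev (𝟙 (𝟙 Y)) b = st (pushObj (𝟙 Y) b) b (𝟙 _) (by simp) ≫ 𝟙 b ≫
      st b (pushObj (𝟙 Y) b) (𝟙 _) (by simp) := by simp
  rw [ev_tensor₂, h, boxMap_st_comp_right, boxMap_comp_st_right]
  simp

lemma ev_id_tensor₂ {g g' : Y ⟶ Y'} (η : g ⟶ g') (a : Elem X) (b : Elem Y) :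
    ev (tensor₂ (𝟙 (𝟙 X)) η) (box a b) =
      st (pushObj (𝟙 X ⊗ₘ g) (box a b)) (box a (pushObj g b)) (𝟙 (a.src ⊗ b.src)) (by simp) ≫
        boxMap (𝟙 a) (ev η b) ≫
        st (box a (pushObj g' b)) (pushObj (𝟙 X ⊗ₘ g') (box a b)) (𝟙 (a.src ⊗ b.src))
          (by simp) := by
  have h : ev (𝟙 (𝟙 X)) a = st (pushObj (𝟙 X) a) a (𝟙 _) (by simp) ≫ 𝟙 a ≫
      st a (pushObj (𝟙 X) a) (𝟙 _) (by simp) := by simp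
  rw [ev_tensor₂, h, boxMap_st_comp, boxMap_comp_st]
  simp

lemma boxMap_comp_id {a a' a'' : Elem X} (m : a ⟶ a') (n : a' ⟶ a'') (b : Elem Y) :
    boxMap (m ≫ n) (𝟙 b) = boxMap m (𝟙 b) ≫ boxMap n (𝟙 b) := by
  rw [← boxMap_comp, Category.comp_id]

lemma boxMap_id_comp (a : Elem X) {b b' b'' : Elem Y} (m : b ⟶ b') (n : b' ⟶ b'') :
    boxMap (𝟙 a) (m ≫ n) = boxMap (𝟙 a) m ≫ boxMap (𝟙 a) n := by
  rw [← boxMap_comp, Category.comp_id]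

@[simp] lemma boxMap_st_id {a a' : Elem X} (p : a.src ⟶ a'.src) (h : a.val = p ≫ a'.val) (b : Elem Y) :
    boxMap (st a a' p h) (𝟙 b) =
      st (box a b) (box a' b) (p ⊗ₘ 𝟙 b.src) (by simp [h]) := by
  rw [← st_id b (by simp), boxMap_st]

@[simp] lemma boxMap_id_st (a : Elem X) {b b' : Elem Y} (p : b.src ⟶ b'.src) (h : b.val = p ≫ b'.val) :
    boxMap (𝟙 a) (st b b' p h) =
      st (box a b) (box a b') (𝟙 a.src ⊗ₘ p) (by simp [h]) := by
  rw [← st_id a (by simp), boxMap_st]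

end Elem

open Elem

namespace EnrichedData
variable {O : Type s} (A : EnrichedData W O)

/-- The associativity isomorphism on generalized elements of the homs of `A`. -/
def elemAssoc {w x y z : O} (a : Elem (A.hom w x)) (b : Elem (A.hom x y)) (c : Elem (A.hom y z)) :
    pushObj (A.comp w x z) (box (pushObj (A.comp x y z) (box c b)) a) ≅
      pushObj (A.comp w y z) (box c (pushObj (A.comp w x y) (box b a))) :=
  stIso _ (pushObj ((A.comp x y z ⊗ₘ 𝟙 (A.hom w x)) ≫ A.comp w x z) (box (box c b) a))
      (Iso.refl _) (by simp) ≪≫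
    evIso (A.assoc w x y z) (box (box c b) a) ≪≫
    stIso _ _ (α_ c.src b.src a.src) (by simp)

lemma elemAssoc_hom {w x y z : O} (a : Elem (A.hom w x)) (b : Elem (A.hom x y))
    (c : Elem (A.hom y z)) :
    (A.elemAssoc a b c).hom =
      st (pushObj (A.comp w x z) (box (pushObj (A.comp x y z) (box c b)) a))
        (pushObj ((A.comp x y z ⊗ₘ 𝟙 (A.hom w x)) ≫ A.comp w x z) (box (box c b) a)) (𝟙 _)
        (by simp) ≫ ev (A.assoc w x y z).hom (box (box c b) a) ≫
      st (pushObj ((α_ (A.hom y z) (A.hom x y) (A.hom w x)).hom ≫ (𝟙 (A.hom y z) ⊗ₘ A.comp w x y) ≫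
        A.comp w y z) (box (box c b) a))
        (pushObj (A.comp w y z) (box c (pushObj (A.comp w x y) (box b a))))
        (α_ c.src b.src a.src).hom (by simp) := rfl

lemma elemAssoc_natural {w x y z : O} {a a' : Elem (A.hom w x)} {b b' : Elem (A.hom x y)}
    {c c' : Elem (A.hom y z)} (m : a ⟶ a') (n : b ⟶ b') (o : c ⟶ c') :
    pushMap (A.comp w x z) (boxMap (pushMap (A.comp x y z) (boxMap o n)) m) ≫
        (A.elemAssoc a' b' c').hom =
      (A.elemAssoc a b c).hom ≫
        pushMap (A.comp w y z) (boxMap o (pushMap (A.comp w x y) (boxMap n m))) := by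
  rw [elemAssoc_hom, elemAssoc_hom]
  simp
  rw [sq_assoc (ev_natural _ _)]

end EnrichedData

namespace EnrichedBicategory

variable {O : Type s} (A : EnrichedBicategory W O)

lemma elem_pentagon {v w x y z : O} (a : Elem (A.hom v w)) (b : Elem (A.hom w x))
    (c : Elem (A.hom x y)) (d : Elem (A.hom y z)) :
    (A.elemAssoc a b (pushObj (A.comp x y z) (box d c))).hom ≫
      (A.elemAssoc (pushObj (A.comp v w x) (box b a)) c d).hom =
    pushMap (A.comp v w z) (boxMap (A.elemAssoc b c d).hom (𝟙 a)) ≫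
      (A.elemAssoc a (pushObj (A.comp w x y) (box c b)) d).hom ≫
      pushMap (A.comp v y z) (boxMap (𝟙 d) (A.elemAssoc a b c).hom) := by
  have h := congrArg (fun η => ev η (box (box (box d c) b) a)) (A.pentagon v w x y z)
  simp only [ev_comp, ev_eqToHom, ev_whiskerLeft, ev_whiskerRight] at h
  rw [ev_eq (tensor₂ (𝟙 (𝟙 (A.hom y z))) (A.assoc v w x y).hom)
    (a := box d (box (box c b) a)) (b := pushObj _ (box (box (box d c) b) a))
    (((MonoidalCategory.tensorIso (α_ d.src c.src b.src) (Iso.refl a.src)) ≪≫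
      α_ d.src (c.src ⊗ b.src) a.src).symm) (by simp)] at h
  simp [ev_tensor₂_id, ev_id_tensor₂] at h
  have h' := st_conj h (pushObj (A.comp v w z)
      (box (pushObj (A.comp w x z) (box (pushObj (A.comp x y z) (box d c)) b)) a))
      (pushObj (A.comp v y z) (box d (pushObj (A.comp v x y) (box c
      (pushObj (A.comp v w x) (box b a)))))) (𝟙 _) (by simp)
      ((α_ (d.src ⊗ c.src) b.src a.src).hom ≫ (α_ d.src c.src (b.src ⊗ a.src)).hom) (by simp)
  simp only [EnrichedData.elemAssoc_hom]
  rw [ev_eq (A.assoc v w x z).hom (a := pushObj ((A.comp x y z ⊗ₘ 𝟙 (A.hom w x)) ⊗ₘ 𝟙 (A.hom v w))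
      (box (box (box d c) b) a)) (b := box (box (pushObj (A.comp x y z) (box d c)) b) a)
      (Iso.refl _) (by simp),
    ev_eq (A.assoc v x y z).hom (a := pushObj ((α_ (A.hom y z ⊗ A.hom x y) (A.hom w x) (A.hom v w)).hom ≫
        (𝟙 (A.hom y z ⊗ A.hom x y) ⊗ₘ A.comp v w x))
      (box (box (box d c) b) a)) (b := box (box d c) (pushObj (A.comp v w x) (box b a)))
      (α_ (d.src ⊗ c.src) b.src a.src) (by simp),
    ev_eq (A.assoc v w y z).hom (a := pushObj (((α_ (A.hom y z) (A.hom x y) (A.hom w x)).hom ⊗ₘ 𝟙 (A.hom v w)) ≫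
        ((𝟙 (A.hom y z) ⊗ₘ A.comp w x y) ⊗ₘ 𝟙 (A.hom v w)))
      (box (box (box d c) b) a)) (b := box (box d (pushObj (A.comp w x y) (box c b))) a)
      (MonoidalCategory.tensorIso (α_ d.src c.src b.src) (Iso.refl a.src)) (by simp)]
  have hp : (α_ d.src (c.src ⊗ b.src) a.src).inv ≫ ((α_ d.src c.src b.src).inv ⊗ₘ 𝟙 a.src) ≫
      (α_ (d.src ⊗ c.src) b.src a.src).hom ≫ (α_ d.src c.src (b.src ⊗ a.src)).hom =
      𝟙 d.src ⊗ₘ (α_ c.src b.src a.src).hom := by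
    rw [MonoidalCategory.tensorHom_id, MonoidalCategory.id_tensorHom]; simp
  simp [hp] at h' ⊢
  exact h'

end EnrichedBicategory
end Underlying
end TwistedBicat

namespace TwistedBicat

attribute [-simp] MonoidalCategory.tensorHom_id MonoidalCategory.id_tensorHom
  MonoidalCategory.associator_conjugation
attribute [local simp] MonoidalCategory.id_tensorHom_id MonoidalCategory.tensorHom_comp_tensorHom
  MonoidalCategory.tensorHom_comp_tensorHom_assoc MonoidalCategory.associator_naturality
  MonoidalCategory.associator_naturality_assoc

local infixr:81 " ◃ " => Bicategory.whiskerLeft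
local infixl:81 " ▹ " => Bicategory.whiskerRight

open MonoidalTwoCategory

section Underlying

variable {W : Type u} [Bicategory.{w, v} W] [Bicategory.Strict W] [MonoidalTwoCategory W]

namespace Elem

variable {X Y : W}

/-- The generalized element determined by a point. -/
abbrev point (f : 𝟙_ W ⟶ Y) : Elem Y := ⟨𝟙_ W, f⟩

lemma leftUnitor_inv_natural' {X Y : W} (f : X ⟶ Y) :
    f ≫ (λ_ Y).inv = (λ_ X).inv ≫ (𝟙 (𝟙_ W) ⊗ₘ f) := by
  rw [MonoidalCategory.id_tensorHom, MonoidalCategory.leftUnitor_inv_naturality]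

lemma rightUnitor_inv_natural' {X Y : W} (f : X ⟶ Y) :
    f ≫ (ρ_ Y).inv = (ρ_ X).inv ≫ (f ⊗ₘ 𝟙 (𝟙_ W)) := by
  rw [MonoidalCategory.tensorHom_id, MonoidalCategory.rightUnitor_inv_naturality]

lemma leftUnitor_natural' {X Y : W} (f : X ⟶ Y) :
    (𝟙 (𝟙_ W) ⊗ₘ f) ≫ (λ_ Y).hom = (λ_ X).hom ≫ f := by
  rw [MonoidalCategory.id_tensorHom, MonoidalCategory.leftUnitor_naturality]

lemma rightUnitor_natural' {X Y : W} (f : X ⟶ Y) :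
    (f ⊗ₘ 𝟙 (𝟙_ W)) ≫ (ρ_ Y).hom = (ρ_ X).hom ≫ f := by
  rw [MonoidalCategory.tensorHom_id, MonoidalCategory.rightUnitor_naturality]

lemma leftUnitor_inv_point {X Y Z : W} (f : 𝟙_ W ⟶ Y) (a : Z ⟶ X) :
    a ≫ (λ_ X).inv ≫ (f ⊗ₘ 𝟙 X) = (λ_ Z).inv ≫ (f ⊗ₘ a) := by
  rw [← Category.assoc, leftUnitor_inv_natural']; simp

lemma rightUnitor_inv_point {X Y Z : W} (f : 𝟙_ W ⟶ Y) (a : Z ⟶ X) :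
    a ≫ (ρ_ X).inv ≫ (𝟙 X ⊗ₘ f) = (ρ_ Z).inv ≫ (a ⊗ₘ f) := by
  rw [← Category.assoc, rightUnitor_inv_natural']; simp

@[simp] lemma boxMap_point_left (f : 𝟙_ W ⟶ Y) {a a' : Elem X} (m : a ⟶ a') :
    boxMap (𝟙 (point f)) m =
      st (box (point f) a) (pushObj ((λ_ X).inv ≫ (f ⊗ₘ 𝟙 X)) a) (λ_ a.src).hom
        (by simp [leftUnitor_inv_point]) ≫
        pushMap ((λ_ X).inv ≫ (f ⊗ₘ 𝟙 X)) m ≫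
        st (pushObj ((λ_ X).inv ≫ (f ⊗ₘ 𝟙 X)) a') (box (point f) a') (λ_ a'.src).inv
          (by simp [leftUnitor_inv_point]) := by
  have h : boxMap (𝟙 (point f)) m =
      st (box (point f) a) (pushObj (f ⊗ₘ 𝟙 X) (box (univ _) a)) (𝟙 _) (by simp) ≫
        pushMap (f ⊗ₘ 𝟙 X) (boxMap (𝟙 (univ (𝟙_ W))) m) ≫
        st (pushObj (f ⊗ₘ 𝟙 X) (box (univ _) a')) (box (point f) a') (𝟙 _) (by simp) := by
    have h1 : 𝟙 (point f) = st (point f) (pushObj f (univ _)) (𝟙 _) (by simp) ≫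
        pushMap f (𝟙 (univ _)) ≫ st (pushObj f (univ _)) (point f) (𝟙 _) (by simp) := by simp
    rw [h1, boxMap_st_comp, boxMap_comp_st, boxMap_push_left_conj]
    simp
  rw [h, eq_of_pushMap (λ_ X) (boxMap_leftUnitor m)]
  simp

@[simp] lemma boxMap_point_right (f : 𝟙_ W ⟶ Y) {a a' : Elem X} (m : a ⟶ a') :
    boxMap m (𝟙 (point f)) =
      st (box a (point f)) (pushObj ((ρ_ X).inv ≫ (𝟙 X ⊗ₘ f)) a) (ρ_ a.src).hom
        (by simp [rightUnitor_inv_point]) ≫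
        pushMap ((ρ_ X).inv ≫ (𝟙 X ⊗ₘ f)) m ≫
        st (pushObj ((ρ_ X).inv ≫ (𝟙 X ⊗ₘ f)) a') (box a' (point f)) (ρ_ a'.src).inv
          (by simp [rightUnitor_inv_point]) := by
  have h : boxMap m (𝟙 (point f)) =
      st (box a (point f)) (pushObj (𝟙 X ⊗ₘ f) (box a (univ _))) (𝟙 _) (by simp) ≫
        pushMap (𝟙 X ⊗ₘ f) (boxMap m (𝟙 (univ (𝟙_ W)))) ≫
        st (pushObj (𝟙 X ⊗ₘ f) (box a' (univ _))) (box a' (point f)) (𝟙 _) (by simp) := by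
    have h1 : 𝟙 (point f) = st (point f) (pushObj f (univ _)) (𝟙 _) (by simp) ≫
        pushMap f (𝟙 (univ _)) ≫ st (pushObj f (univ _)) (point f) (𝟙 _) (by simp) := by simp
    rw [h1, boxMap_st_comp_right, boxMap_comp_st_right, boxMap_push_right_conj]
    simp
  rw [h, eq_of_pushMap (ρ_ X) (boxMap_rightUnitor m)]
  simp

@[simp high] lemma boxMap_univ_left {a a' : Elem X} (m : a ⟶ a') :
    boxMap (𝟙 (univ (𝟙_ W))) m =
      st (box (univ (𝟙_ W)) a) (pushObj (λ_ X).inv a) (λ_ a.src).hom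
        (by simp [leftUnitor_inv_natural']) ≫
        pushMap (λ_ X).inv m ≫
        st (pushObj (λ_ X).inv a') (box (univ (𝟙_ W)) a') (λ_ a'.src).inv
          (by simp [leftUnitor_inv_natural']) :=
  eq_of_pushMap (λ_ X) (boxMap_leftUnitor m)

@[simp high] lemma boxMap_univ_right {a a' : Elem X} (m : a ⟶ a') :
    boxMap m (𝟙 (univ (𝟙_ W))) =
      st (box a (univ (𝟙_ W))) (pushObj (ρ_ X).inv a) (ρ_ a.src).hom
        (by simp [rightUnitor_inv_natural']) ≫
        pushMap (ρ_ X).inv m ≫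
        st (pushObj (ρ_ X).inv a') (box a' (univ (𝟙_ W))) (ρ_ a'.src).inv
          (by simp [rightUnitor_inv_natural']) :=
  eq_of_pushMap (ρ_ X) (boxMap_rightUnitor m)

lemma tensor_triangle {X X' Y Y' : W} (f : X ⟶ X') (g : Y ⟶ Y') :
    (α_ X (𝟙_ W) Y).hom ≫ (f ⊗ₘ ((𝟙 (𝟙_ W) ⊗ₘ g) ≫ (λ_ Y').hom)) =
      ((ρ_ X).hom ⊗ₘ 𝟙 Y) ≫ (f ⊗ₘ g) := by
  have h : f ⊗ₘ ((λ_ Y).hom ≫ g) = (𝟙 X ⊗ₘ (λ_ Y).hom) ≫ (f ⊗ₘ g) := by simp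
  rw [leftUnitor_natural', h, MonoidalCategory.id_tensorHom, MonoidalCategory.tensorHom_id,
    MonoidalCategory.triangle_assoc]

end Elem

open Elem

namespace EnrichedData
variable {O : Type s} (A : EnrichedData W O)

/-- The left unitor of `A`, on generalized elements. -/
def elemLeftUnitor {x y : O} (a : Elem (A.hom x y)) :
    pushObj (A.comp x y y) (box (point (A.id y)) a) ≅ a :=
  stIso _ (pushObj ((A.id y ⊗ₘ 𝟙 (A.hom x y)) ≫ A.comp x y y) (box (univ (𝟙_ W)) a))
      (Iso.refl _) (by simp) ≪≫
    evIso (A.leftUnitor x y) (box (univ (𝟙_ W)) a) ≪≫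
    stIso _ _ (λ_ a.src) (by simp [leftUnitor_natural'])

/-- The right unitor of `A`, on generalized elements. -/
def elemRightUnitor {x y : O} (a : Elem (A.hom x y)) :
    pushObj (A.comp x x y) (box a (point (A.id x))) ≅ a :=
  stIso _ (pushObj ((𝟙 (A.hom x y) ⊗ₘ A.id x) ≫ A.comp x x y) (box a (univ (𝟙_ W))))
      (Iso.refl _) (by simp) ≪≫
    evIso (A.rightUnitor x y) (box a (univ (𝟙_ W))) ≪≫
    stIso _ _ (ρ_ a.src) (by simp [rightUnitor_natural'])

lemma elemLeftUnitor_hom {x y : O} (a : Elem (A.hom x y)) :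
    (A.elemLeftUnitor a).hom =
      st (pushObj (A.comp x y y) (box (point (A.id y)) a))
        (pushObj ((A.id y ⊗ₘ 𝟙 (A.hom x y)) ≫ A.comp x y y) (box (univ (𝟙_ W)) a)) (𝟙 _)
        (by simp) ≫ ev (A.leftUnitor x y).hom (box (univ (𝟙_ W)) a) ≫
      st (pushObj (λ_ (A.hom x y)).hom (box (univ (𝟙_ W)) a)) a (λ_ a.src).hom
        (by simp [leftUnitor_natural']) := rfl

lemma elemRightUnitor_hom {x y : O} (a : Elem (A.hom x y)) :
    (A.elemRightUnitor a).hom =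
      st (pushObj (A.comp x x y) (box a (point (A.id x))))
        (pushObj ((𝟙 (A.hom x y) ⊗ₘ A.id x) ≫ A.comp x x y) (box a (univ (𝟙_ W)))) (𝟙 _)
        (by simp) ≫ ev (A.rightUnitor x y).hom (box a (univ (𝟙_ W))) ≫
      st (pushObj (ρ_ (A.hom x y)).hom (box a (univ (𝟙_ W)))) a (ρ_ a.src).hom
        (by simp [rightUnitor_natural']) := rfl

lemma elemLeftUnitor_natural {x y : O} {a a' : Elem (A.hom x y)} (m : a ⟶ a') :
    pushMap (A.comp x y y) (boxMap (𝟙 (point (A.id y))) m) ≫ (A.elemLeftUnitor a').hom =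
      (A.elemLeftUnitor a).hom ≫ m := by
  have h := ev_natural (A.leftUnitor x y).hom (boxMap (𝟙 (univ (𝟙_ W))) m)
  have h1 := boxMap_leftUnitor m
  rw [elemLeftUnitor_hom, elemLeftUnitor_hom, Category.assoc, Category.assoc, ← h1, ← sq_assoc h]
  simp

lemma elemRightUnitor_natural {x y : O} {a a' : Elem (A.hom x y)} (m : a ⟶ a') :
    pushMap (A.comp x x y) (boxMap m (𝟙 (point (A.id x)))) ≫ (A.elemRightUnitor a').hom =
      (A.elemRightUnitor a).hom ≫ m := by
  have h := ev_natural (A.rightUnitor x y).hom (boxMap m (𝟙 (univ (𝟙_ W))))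
  have h1 := boxMap_rightUnitor m
  rw [elemRightUnitor_hom, elemRightUnitor_hom, Category.assoc, Category.assoc, ← h1,
    ← sq_assoc h]
  simp

end EnrichedData

namespace EnrichedBicategory

variable {O : Type s} (A : EnrichedBicategory W O)

lemma elem_triangle {x y z : O} (a : Elem (A.hom x y)) (b : Elem (A.hom y z)) :
    (A.elemAssoc a (point (A.id y)) b).hom ≫
        pushMap (A.comp x y z) (boxMap (𝟙 b) (A.elemLeftUnitor a).hom) =
      pushMap (A.comp x y z) (boxMap (A.elemRightUnitor b).hom (𝟙 a)) := by
  have h := congrArg (fun η => ev η (box (box b (univ (𝟙_ W))) a)) (A.triangle x y z)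
  simp only [ev_comp, ev_eqToHom, ev_whiskerLeft, ev_whiskerRight] at h
  rw [ev_eq (tensor₂ (𝟙 (𝟙 (A.hom y z))) (A.leftUnitor x y).hom)
    (a := box b (box (univ (𝟙_ W)) a)) (b := pushObj _ (box (box b (univ (𝟙_ W))) a))
    (α_ _ _ _).symm (by simp)] at h
  simp [ev_tensor₂_id, ev_id_tensor₂] at h
  have h' := st_conj h (pushObj (A.comp x y z) (box (pushObj (A.comp y y z)
      (box b (point (A.id y)))) a))
      (pushObj (A.comp x y z) (box b a)) (𝟙 _) (by simp) ((ρ_ b.src).hom ⊗ₘ 𝟙 a.src)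
      (by have := reassoc_of% tensor_triangle b.val a.val; simp at this; simp [this])
  simp only [EnrichedData.elemAssoc_hom, EnrichedData.elemLeftUnitor_hom,
    EnrichedData.elemRightUnitor_hom]
  rw [ev_eq (A.assoc x y y z).hom (a := pushObj ((𝟙 (A.hom y z) ⊗ₘ A.id y) ⊗ₘ 𝟙 (A.hom x y))
      (box (box b (univ (𝟙_ W))) a)) (b := box (box b (point (A.id y))) a)
      (Iso.refl _) (by simp)]
  have hp : (α_ b.src (𝟙_ W) a.src).inv ≫ ((ρ_ b.src).hom ⊗ₘ 𝟙 a.src) =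
      𝟙 b.src ⊗ₘ (λ_ a.src).hom := by
    rw [MonoidalCategory.tensorHom_id, MonoidalCategory.id_tensorHom]; simp
  simp [hp] at h' ⊢
  exact h'

lemma elem_comp_whiskerLeft {w x y z : O} (f : Elem (A.hom w x)) (g : Elem (A.hom x y))
    {h h' : Elem (A.hom y z)} (η : h ⟶ h') :
    pushMap (A.comp w y z) (boxMap η (𝟙 (pushObj (A.comp w x y) (box g f)))) =
      (A.elemAssoc f g h).inv ≫ pushMap (A.comp w x z)
        (boxMap (pushMap (A.comp x y z) (boxMap η (𝟙 g))) (𝟙 f)) ≫ (A.elemAssoc f g h').hom := by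
  rw [Iso.eq_inv_comp, A.elemAssoc_natural, boxMap_id, pushMap_id]

lemma elem_whiskerRight_comp {w x y z : O} {f f' : Elem (A.hom w x)} (η : f ⟶ f')
    (g : Elem (A.hom x y)) (h : Elem (A.hom y z)) :
    pushMap (A.comp w x z) (boxMap (𝟙 (pushObj (A.comp x y z) (box h g))) η) =
      (A.elemAssoc f g h).hom ≫ pushMap (A.comp w y z)
        (boxMap (𝟙 h) (pushMap (A.comp w x y) (boxMap (𝟙 g) η))) ≫
          (A.elemAssoc f' g h).inv := by
  rw [← sq_assoc (A.elemAssoc_natural η (𝟙 g) (𝟙 h)), Iso.hom_inv_id, Category.comp_id,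
    boxMap_id, pushMap_id]

lemma elem_whisker_assoc {w x y z : O} (f : Elem (A.hom w x)) {g g' : Elem (A.hom x y)}
    (η : g ⟶ g') (h : Elem (A.hom y z)) :
    pushMap (A.comp w y z) (boxMap (𝟙 h) (pushMap (A.comp w x y) (boxMap η (𝟙 f)))) =
      (A.elemAssoc f g h).inv ≫ pushMap (A.comp w x z)
        (boxMap (pushMap (A.comp x y z) (boxMap (𝟙 h) η)) (𝟙 f)) ≫
          (A.elemAssoc f g' h).hom := by
  rw [Iso.eq_inv_comp, A.elemAssoc_natural]

lemma elem_whisker_exchange {x y z : O} {f f' : Elem (A.hom x y)} {g g' : Elem (A.hom y z)}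
    (η : f ⟶ f') (θ : g ⟶ g') :
    pushMap (A.comp x y z) (boxMap θ (𝟙 f)) ≫ pushMap (A.comp x y z) (boxMap (𝟙 g') η) =
      pushMap (A.comp x y z) (boxMap (𝟙 g) η) ≫ pushMap (A.comp x y z) (boxMap θ (𝟙 f')) := by
  rw [← pushMap_comp, ← pushMap_comp, ← boxMap_comp, ← boxMap_comp]
  simp only [Category.comp_id, Category.id_comp]

lemma elem_pentagon_inv {v w x y z : O} (a : Elem (A.hom v w)) (b : Elem (A.hom w x))
    (c : Elem (A.hom x y)) (d : Elem (A.hom y z)) :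
    pushMap (A.comp v y z) (boxMap (𝟙 d) (A.elemAssoc a b c).inv) ≫
      (A.elemAssoc a (pushObj (A.comp w x y) (box c b)) d).inv ≫
      pushMap (A.comp v w z) (boxMap (A.elemAssoc b c d).inv (𝟙 a)) =
    (A.elemAssoc (pushObj (A.comp v w x) (box b a)) c d).inv ≫
      (A.elemAssoc a b (pushObj (A.comp x y z) (box d c))).inv := by
  rw [← cancel_epi (A.elemAssoc (pushObj (A.comp v w x) (box b a)) c d).hom,
    ← cancel_epi (A.elemAssoc a b (pushObj (A.comp x y z) (box d c))).hom,
    Iso.hom_inv_id_assoc, Iso.hom_inv_id, sq_assoc (A.elem_pentagon a b c d), Category.assoc,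
    ← Category.assoc (pushMap _ (boxMap (𝟙 d) _)), ← pushMap_comp, ← boxMap_id_comp,
    Iso.hom_inv_id, boxMap_id, pushMap_id, Category.id_comp, Iso.hom_inv_id_assoc,
    ← pushMap_comp, ← boxMap_comp_id, Iso.hom_inv_id, boxMap_id, pushMap_id]

lemma elem_triangle_inv {x y z : O} (a : Elem (A.hom x y)) (b : Elem (A.hom y z)) :
    (A.elemAssoc a (point (A.id y)) b).inv ≫
        pushMap (A.comp x y z) (boxMap (A.elemRightUnitor b).hom (𝟙 a)) =
      pushMap (A.comp x y z) (boxMap (𝟙 b) (A.elemLeftUnitor a).hom) := by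
  rw [Iso.inv_comp_eq, A.elem_triangle]

/-- The objects of `A`, as the objects of the bicategory whose 1-cells are the generalized elements
of the homs of `A`. -/
def Generalized (_ : EnrichedBicategory W O) : Type s := O

variable {A}

instance : CategoryStruct A.Generalized where
  Hom x y := Elem (A.hom x y)
  id x := point (A.id x)
  comp {x y z} f g := pushObj (A.comp x y z) (box g f)

instance (x y : A.Generalized) : Category.{max v w} (x ⟶ y) :=
  inferInstanceAs (Category (Elem (A.hom x y)))

instance : Bicategory A.Generalized where
  homCategory x y := inferInstanceAs (Category (Elem (A.hom x y)))
  whiskerLeft {x y z} f g g' η := pushMap (A.comp x y z) (boxMap η (𝟙 f))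
  whiskerRight {x y z} f f' η g := pushMap (A.comp x y z) (boxMap (𝟙 g) η)
  associator f g h := (A.elemAssoc f g h).symm
  leftUnitor f := A.elemRightUnitor f
  rightUnitor f := A.elemLeftUnitor f
  whiskerLeft_id f g := (congrArg (pushMap _) (boxMap_id g f)).trans (pushMap_id _ _)
  whiskerLeft_comp f _ _ _ η θ :=
    (congrArg (pushMap _) (boxMap_comp_id η θ f)).trans (pushMap_comp _ _ _)
  id_whiskerLeft {x y f g} η := ((Iso.eq_comp_inv (A.elemRightUnitor g)).2
    (A.elemRightUnitor_natural η)).trans (Category.assoc _ _ _)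
  comp_whiskerLeft f g _ _ η := A.elem_comp_whiskerLeft f g η
  id_whiskerRight f g := (congrArg (pushMap _) (boxMap_id g f)).trans (pushMap_id _ _)
  comp_whiskerRight η θ i :=
    (congrArg (pushMap _) (boxMap_id_comp i η θ)).trans (pushMap_comp _ _ _)
  whiskerRight_id {x y f g} η := ((Iso.eq_comp_inv (A.elemLeftUnitor g)).2
    (A.elemLeftUnitor_natural η)).trans (Category.assoc _ _ _)
  whiskerRight_comp η g h := A.elem_whiskerRight_comp η g h
  whisker_assoc f _ _ η h := A.elem_whisker_assoc f η h
  whisker_exchange η θ := A.elem_whisker_exchange η θ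
  pentagon f g h i := A.elem_pentagon_inv f g h i
  triangle f g := A.elem_triangle_inv f g

end EnrichedBicategory
end Underlying
end TwistedBicat

namespace TwistedBicat

local infixr:81 " ◃ " => Bicategory.whiskerLeft
local infixl:81 " ▹ " => Bicategory.whiskerRight
local notation "𝒶" => Bicategory.associator
local notation "𝓁" => Bicategory.leftUnitor
local notation "𝓇" => Bicategory.rightUnitor

lemma sq_assoc₃ {C : Type*} [Category* C] {a b b' c d : C} {f : a ⟶ b} {g : b ⟶ b'} {h : b' ⟶ c}
    {k : a ⟶ c} (w : f ≫ g ≫ h = k) (z : c ⟶ d) : f ≫ g ≫ h ≫ z = k ≫ z := by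
  rw [← w, Category.assoc, Category.assoc]

section Lists

variable {B : Type u} [Bicategory.{w, v} B]

/-- Replacement of the first two 1-cells of a composite. -/
def rep {x y y' z t : B} {f : x ⟶ y} {g : y ⟶ z} {f' : x ⟶ y'} {g' : y' ⟶ z}
    (η : f ≫ g ⟶ f' ≫ g') (h : z ⟶ t) : f ≫ g ≫ h ⟶ f' ≫ g' ≫ h :=
  (𝒶 f g h).inv ≫ η ▹ h ≫ (𝒶 f' g' h).hom

/-- Replacement of the first two 1-cells of a composite by a single 1-cell. -/
def con {x y z t : B} {f : x ⟶ y} {g : y ⟶ z} {k : x ⟶ z} (θ : f ≫ g ⟶ k) (h : z ⟶ t) :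
    f ≫ g ≫ h ⟶ k ≫ h :=
  (𝒶 f g h).inv ≫ θ ▹ h

/-- Removal of the first two 1-cells of a composite. -/
def del {x y t : B} {f : x ⟶ y} {g : y ⟶ x} (θ : f ≫ g ⟶ 𝟙 x) (h : x ⟶ t) :
    f ≫ g ≫ h ⟶ h :=
  (𝒶 f g h).inv ≫ θ ▹ h ≫ (𝓁 h).hom

/-- Replacement of the first two 1-cells by an invertible 2-cell. -/
def repIso {x y y' z t : B} {f : x ⟶ y} {g : y ⟶ z} {f' : x ⟶ y'} {g' : y' ⟶ z}
    (η : f ≫ g ≅ f' ≫ g') (h : z ⟶ t) : f ≫ g ≫ h ≅ f' ≫ g' ≫ h :=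
  (𝒶 f g h).symm ≪≫ Bicategory.whiskerRightIso η h ≪≫ 𝒶 f' g' h

/-- Removal of the first two 1-cells by an invertible 2-cell. -/
def delIso {x y t : B} {f : x ⟶ y} {g : y ⟶ x} (θ : f ≫ g ≅ 𝟙 x) (h : x ⟶ t) :
    f ≫ g ≫ h ≅ h :=
  (𝒶 f g h).symm ≪≫ Bicategory.whiskerRightIso θ h ≪≫ 𝓁 h

section

variable {x y y' y'' z t t' : B} {f : x ⟶ y} {g : y ⟶ z} {f' : x ⟶ y'} {g' : y' ⟶ z}
  {f'' : x ⟶ y''} {g'' : y'' ⟶ z} {k : x ⟶ z}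

lemma rep_natural (η : f ≫ g ⟶ f' ≫ g') {h h' : z ⟶ t} (θ : h ⟶ h') :
    f ◃ g ◃ θ ≫ rep η h' = rep η h ≫ f' ◃ g' ◃ θ := by
  simp only [rep, Category.assoc]
  rw [← Bicategory.associator_naturality_right, Bicategory.associator_inv_naturality_right_assoc,
    Bicategory.whisker_exchange_assoc]

lemma rep_natural_assoc (η : f ≫ g ⟶ f' ≫ g') {h h' : z ⟶ t} (θ : h ⟶ h') {l : x ⟶ t}
    (X : f' ≫ g' ≫ h' ⟶ l) :
    f ◃ g ◃ θ ≫ rep η h' ≫ X = rep η h ≫ f' ◃ g' ◃ θ ≫ X :=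
  sq_assoc (rep_natural η θ) X

lemma whiskerLeft_rep_natural_assoc {s : B} (p : s ⟶ x) (η : f ≫ g ⟶ f' ≫ g') {h h' : z ⟶ t}
    (θ : h ⟶ h') {l : s ⟶ t} (X : p ≫ f' ≫ g' ≫ h' ⟶ l) :
    p ◃ f ◃ g ◃ θ ≫ p ◃ rep η h' ≫ X = p ◃ rep η h ≫ p ◃ f' ◃ g' ◃ θ ≫ X := by
  simp only [← Bicategory.whiskerLeft_comp_assoc, rep_natural]

lemma con_natural (η : f ≫ g ⟶ k) {h h' : z ⟶ t} (θ : h ⟶ h') :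
    f ◃ g ◃ θ ≫ con η h' = con η h ≫ k ◃ θ := by
  simp only [con, Category.assoc]
  rw [Bicategory.associator_inv_naturality_right_assoc, Bicategory.whisker_exchange]

lemma del_natural {g : y ⟶ x} (η : f ≫ g ⟶ 𝟙 x) {h h' : x ⟶ t} (θ : h ⟶ h') :
    f ◃ g ◃ θ ≫ del η h' = del η h ≫ θ := by
  simp only [del, Category.assoc]
  rw [Bicategory.associator_inv_naturality_right_assoc, Bicategory.whisker_exchange_assoc,
    Bicategory.id_whiskerLeft]
  simp

lemma rep_comp (η : f ≫ g ⟶ f' ≫ g') (θ : f' ≫ g' ⟶ f'' ≫ g'') (h : z ⟶ t) :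
    rep (η ≫ θ) h = rep η h ≫ rep θ h := by
  simp [rep]

lemma rep_con (η : f ≫ g ⟶ f' ≫ g') (θ : f' ≫ g' ⟶ k) (h : z ⟶ t) :
    rep η h ≫ con θ h = con (η ≫ θ) h := by
  simp [rep, con]

lemma con_whiskerRight {k' : x ⟶ z} (η : f ≫ g ⟶ k) (θ : k ⟶ k') (h : z ⟶ t) :
    con η h ≫ θ ▹ h = con (η ≫ θ) h := by
  simp [con]

lemma rep_id (h : z ⟶ t) : rep (𝟙 (f ≫ g)) h = 𝟙 _ := by
  simp [rep]

lemma con_whiskerLeft {g₁ : y ⟶ z} {η : g ⟶ g₁} (θ : f ≫ g₁ ⟶ k) (h : z ⟶ t) :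
    con (f ◃ η ≫ θ) h = f ◃ (η ▹ h) ≫ con θ h := by
  simp [con]

end

/-- The canonical isomorphism `F f ≫ F g ≫ h ⟶ F (f ≫ g) ≫ h`. -/
def merge {C : Type*} [Bicategory C] (F : Pseudofunctor C B) {x y z : C} (f : x ⟶ y) (g : y ⟶ z)
    {t : B} (h : F.obj z ⟶ t) : F.map f ≫ F.map g ≫ h ⟶ F.map (f ≫ g) ≫ h :=
  con (F.mapComp f g).inv h

/-- The invertible 2-cell `merge`. -/
def mergeIso {C : Type*} [Bicategory C] (F : Pseudofunctor C B) {x y z : C} (f : x ⟶ y)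
    (g : y ⟶ z) {t : B} (h : F.obj z ⟶ t) : F.map f ≫ F.map g ≫ h ≅ F.map (f ≫ g) ≫ h :=
  (𝒶 _ _ h).symm ≪≫ Bicategory.whiskerRightIso (F.mapComp f g).symm h

/-- A square of 1-cells filled by a 2-cell, mapped by a pseudofunctor. -/
def mapSq {C : Type*} [Bicategory C] (F : Pseudofunctor C B)
    {x y y' z : C} {f : x ⟶ y} {g : y ⟶ z} {f' : x ⟶ y'} {g' : y' ⟶ z} (η : f ≫ g ⟶ f' ≫ g') :
    F.map f ≫ F.map g ⟶ F.map f' ≫ F.map g' :=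
  (F.mapComp f g).inv ≫ F.map₂ η ≫ (F.mapComp f' g').hom

/-- A 2-cell from a composite to an identity, mapped by a pseudofunctor. -/
def mapUnit {C : Type*} [Bicategory C] (F : Pseudofunctor C B)
    {x y : C} {f : x ⟶ y} {g : y ⟶ x} (η : f ≫ g ⟶ 𝟙 x) :
    F.map f ≫ F.map g ⟶ 𝟙 (F.obj x) :=
  (F.mapComp f g).inv ≫ F.map₂ η ≫ (F.mapId x).hom

/-- `merge`, for a composite of two pseudofunctors. -/
def merge₂ {C D : Type*} [Bicategory C] [Bicategory D] (F : Pseudofunctor C D)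
    (H : Pseudofunctor D B) {x y z : C} (f : x ⟶ y) (g : y ⟶ z) {t : B}
    (h : H.obj (F.obj z) ⟶ t) :
    H.map (F.map f) ≫ H.map (F.map g) ≫ h ⟶ H.map (F.map (f ≫ g)) ≫ h :=
  con ((H.mapComp _ _).inv ≫ H.map₂ (F.mapComp f g).inv) h

section

variable {C : Type*} [Bicategory C] (F : Pseudofunctor C B) {x y y' z t : C} {s : B}

lemma merge_whiskerLeft (f : x ⟶ y) {g g' : y ⟶ z} (η : g ⟶ g') (h : F.obj z ⟶ s) :
    merge F f g h ≫ F.map₂ (f ◃ η) ▹ h = F.map f ◃ (F.map₂ η ▹ h) ≫ merge F f g' h := by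
  simp [merge, con]

lemma merge_whiskerRight {f f' : x ⟶ y} (η : f ⟶ f') (g : y ⟶ z) (h : F.obj z ⟶ s) :
    merge F f g h ≫ F.map₂ (η ▹ g) ▹ h = F.map₂ η ▹ (F.map g ≫ h) ≫ merge F f' g h := by
  simp [merge, con]

lemma merge_mapSq {f : x ⟶ y} {g : y ⟶ z} {f' : x ⟶ y'} {g' : y' ⟶ z}
    (η : f ≫ g ⟶ f' ≫ g') (k : F.obj z ⟶ s) :
    merge F f g k ≫ F.map₂ η ▹ k = rep (mapSq F η) k ≫ merge F f' g' k := by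
  simp [merge, con, rep, mapSq]

lemma merge_natural (f : x ⟶ y) (g : y ⟶ z) {h h' : F.obj z ⟶ s} (η : h ⟶ h') :
    F.map f ◃ F.map g ◃ η ≫ merge F f g h' = merge F f g h ≫ F.map (f ≫ g) ◃ η :=
  con_natural _ _

lemma merge_merge (f : x ⟶ y) (g : y ⟶ z) (h : z ⟶ t) (k : F.obj t ⟶ s) :
    F.map f ◃ merge F g h k ≫ merge F f (g ≫ h) k ≫ F.map₂ (𝒶 f g h).inv ▹ k =
      merge F f g (F.map h ≫ k) ≫ merge F (f ≫ g) h k := by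
  have w := congrArg (fun q => q ▹ k) (F.mapComp_assoc_left_inv f g h)
  simp only [Bicategory.comp_whiskerRight] at w
  calc
    _ = (𝒶 _ _ _).inv ≫ (𝒶 _ _ _).inv ≫ (𝒶 _ _ _).hom ▹ k ≫
        (F.map f ◃ (F.mapComp g h).inv) ▹ k ≫ (F.mapComp f (g ≫ h)).inv ▹ k ≫
        F.map₂ (𝒶 f g h).inv ▹ k := by
      simp only [merge, con]
      bicategory
    _ = _ := by
      simp only [merge, con]
      rw [← w]
      bicategory

lemma merge_rep {f : x ⟶ y} {g : y ⟶ z} {f' : x ⟶ y'} {g' : y' ⟶ z}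
    (η : f ≫ g ⟶ f' ≫ g') (h : z ⟶ t) (k : F.obj t ⟶ s) :
    F.map f ◃ merge F g h k ≫ merge F f (g ≫ h) k ≫ F.map₂ (rep η h) ▹ k =
      rep (mapSq F η) (F.map h ≫ k) ≫ F.map f' ◃ merge F g' h k ≫ merge F f' (g' ≫ h) k := by
  have h1 := merge_merge F f g h k
  have h2 : F.map f' ◃ merge F g' h k ≫ merge F f' (g' ≫ h) k =
      merge F f' g' (F.map h ≫ k) ≫ merge F (f' ≫ g') h k ≫ F.map₂ (𝒶 f' g' h).hom ▹ k := by
    have h3 : F.map₂ (𝒶 f' g' h).inv ▹ k ≫ F.map₂ (𝒶 f' g' h).hom ▹ k = 𝟙 _ := by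
      rw [← Bicategory.comp_whiskerRight, ← F.map₂_comp, Iso.inv_hom_id, F.map₂_id,
        Bicategory.id_whiskerRight]
    rw [← sq_assoc (merge_merge F f' g' h k), Category.assoc, h3, Category.comp_id]
  rw [rep, F.map₂_comp, Bicategory.comp_whiskerRight, h2, F.map₂_comp,
    Bicategory.comp_whiskerRight]
  simp only [← Category.assoc] at h1 ⊢
  rw [h1]
  simp [merge, con, rep, mapSq]

lemma merge_con {f : x ⟶ y} {g : y ⟶ z} {l : x ⟶ z}
    (η : f ≫ g ⟶ l) (h : z ⟶ t) (k : F.obj t ⟶ s) :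
    F.map f ◃ merge F g h k ≫ merge F f (g ≫ h) k ≫ F.map₂ (con η h) ▹ k =
      con ((F.mapComp f g).inv ≫ F.map₂ η) (F.map h ≫ k) ≫ merge F l h k := by
  have h1 := merge_merge F f g h k
  rw [con, F.map₂_comp, Bicategory.comp_whiskerRight]
  simp only [← Category.assoc] at h1 ⊢
  rw [h1]
  simp [merge, con]

lemma merge_del {f : x ⟶ y} {g : y ⟶ x}
    (η : f ≫ g ⟶ 𝟙 x) (h : x ⟶ t) (k : F.obj t ⟶ s) :
    F.map f ◃ merge F g h k ≫ merge F f (g ≫ h) k ≫ F.map₂ (del η h) ▹ k =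
      del (mapUnit F η) (F.map h ≫ k) := by
  have h1 := merge_merge F f g h k
  rw [del, F.map₂_comp, Bicategory.comp_whiskerRight]
  simp only [← Category.assoc] at h1 ⊢
  rw [h1]
  simp [merge, con, del, mapUnit]

end

end Lists
end TwistedBicat

namespace TwistedBicat

local infixr:81 " ◃ " => Bicategory.whiskerLeft
local infixl:81 " ▹ " => Bicategory.whiskerRight
local notation "𝒶" => Bicategory.associator
local notation "𝓁" => Bicategory.leftUnitor
local notation "𝓇" => Bicategory.rightUnitor
local infixr:80 " ⊚ " => bicategoricalComp


/-- A weak action of the group `G` on the bicategory `C` by pseudofunctors, with weak unitality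
constraints. -/
structure WeakAction (G : Type t) [Group G] (C : Type u) [Bicategory.{w, v} C] where
  functor (g : G) : Pseudofunctor C C
  φ {g h k : G} (e : g * h = k) (x : C) :
    (functor k).obj x ⟶ (functor h).obj ((functor g).obj x)
  ν {g h k : G} (e : g * h = k) {x y : C} (a : x ⟶ y) :
    (functor k).map a ≫ φ e y ≅ φ e x ≫ (functor h).map ((functor g).map a)
  ν_natural {g h k : G} (e : g * h = k) {x y : C} {a a' : x ⟶ y} (η : a ⟶ a') :
    (functor k).map₂ η ▹ φ e y ≫ (ν e a').hom =
      (ν e a).hom ≫ φ e x ◃ (functor h).map₂ ((functor g).map₂ η)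
  ν_comp {g h k : G} (e : g * h = k) {x y z : C} (a : x ⟶ y) (b : y ⟶ z) :
    ((functor k).mapComp a b).inv ▹ φ e z ≫ (ν e (a ≫ b)).hom =
      (𝒶 _ _ _).hom ≫ (functor k).map a ◃ (ν e b).hom ≫ (𝒶 _ _ _).inv ≫
        (ν e a).hom ▹ (functor h).map ((functor g).map b) ≫ (𝒶 _ _ _).hom ≫
        φ e x ◃ (((functor h).mapComp _ _).inv ≫
          (functor h).map₂ ((functor g).mapComp a b).inv)
  ζ {g h k a b c : G} (e₁ : g * h = a) (e₂ : h * k = b) (e₃ : a * k = c) (e₄ : g * b = c) (x : C) :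
    φ e₄ x ≫ φ e₂ ((functor g).obj x) ≅ φ e₃ x ≫ (functor k).map (φ e₁ x)
  ζ_natural {g h k a b c : G} (e₁ : g * h = a) (e₂ : h * k = b) (e₃ : a * k = c) (e₄ : g * b = c)
    {x y : C} (f : x ⟶ y) :
    (functor c).map f ◃ (ζ e₁ e₂ e₃ e₄ y).hom ≫ (𝒶 _ _ _).inv ≫
        (ν e₃ f).hom ▹ (functor k).map (φ e₁ y) ≫ (𝒶 _ _ _).hom ≫
        φ e₃ x ◃ mapSq (functor k) (ν e₁ f).hom ≫ (𝒶 _ _ _).inv =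
      (𝒶 _ _ _).inv ≫ (ν e₄ f).hom ▹ φ e₂ _ ≫ (𝒶 _ _ _).hom ≫
        φ e₄ x ◃ (ν e₂ ((functor g).map f)).hom ≫ (𝒶 _ _ _).inv ≫
        (ζ e₁ e₂ e₃ e₄ x).hom ▹ (functor k).map ((functor h).map ((functor g).map f))
  simplex {g h k l gh hk kl ghk hkl ghkl : G} (e_gh : g * h = gh) (e_hk : h * k = hk)
    (e_kl : k * l = kl) (e_gh_k : gh * k = ghk) (e_g_hk : g * hk = ghk) (e_hk_l : hk * l = hkl)
    (e_h_kl : h * kl = hkl) (e_ghk_l : ghk * l = ghkl) (e_gh_kl : gh * kl = ghkl)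
    (e_g_hkl : g * hkl = ghkl) (x : C) :
    (ζ e_gh e_h_kl e_gh_kl e_g_hkl x).hom ▹ φ e_kl _ ≫ (𝒶 _ _ _).hom ≫
        φ e_gh_kl x ◃ (ν e_kl (φ e_gh x)).hom ≫ (𝒶 _ _ _).inv ≫
        (ζ e_gh_k e_kl e_ghk_l e_gh_kl x).hom ▹ (functor l).map ((functor k).map (φ e_gh x)) =
      (𝒶 _ _ _).hom ≫ φ e_g_hkl x ◃ (ζ e_hk e_kl e_hk_l e_h_kl ((functor g).obj x)).hom ≫
        (𝒶 _ _ _).inv ≫ (ζ e_g_hk e_hk_l e_ghk_l e_g_hkl x).hom ▹ (functor l).map (φ e_hk _) ≫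
        (𝒶 _ _ _).hom ≫ φ e_ghk_l x ◃ mapSq (functor l) (ζ e_gh e_hk e_gh_k e_g_hk x).hom ≫
        (𝒶 _ _ _).inv
  ι (x : C) : (functor 1).obj x ⟶ x
  ν₁ {x y : C} (a : x ⟶ y) : (functor 1).map a ≫ ι y ≅ ι x ≫ a
  ν₁_natural {x y : C} {a a' : x ⟶ y} (η : a ⟶ a') :
    (functor 1).map₂ η ▹ ι y ≫ (ν₁ a').hom = (ν₁ a).hom ≫ ι x ◃ η
  ζl (g : G) (x : C) : φ (mul_one g) x ≫ ι ((functor g).obj x) ≅ 𝟙 ((functor g).obj x)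
  ζr (g : G) (x : C) : φ (one_mul g) x ≫ (functor g).map (ι x) ≅ 𝟙 ((functor g).obj x)
  ζr_natural (g : G) {x y : C} (a : x ⟶ y) :
    (functor g).map a ◃ (ζr g y).hom ≫ (𝓇 _).hom =
      (𝒶 _ _ _).inv ≫ (ν (one_mul g) a).hom ▹ (functor g).map (ι y) ≫ (𝒶 _ _ _).hom ≫
        φ (one_mul g) x ◃ mapSq (functor g) (ν₁ a).hom ≫ (𝒶 _ _ _).inv ≫
        (ζr g x).hom ▹ (functor g).map a ≫ (𝓁 _).hom
  ζ_unit {g h k : G} (e : g * h = k) (x : C) :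
    φ e x ◃ (ζr h ((functor g).obj x)).hom =
      (𝒶 _ _ _).inv ≫ (ζ (mul_one g) (one_mul h) e e x).hom ▹ (functor h).map (ι _) ≫
        (𝒶 _ _ _).hom ≫ φ e x ◃ mapUnit (functor h) (ζl g x).hom

namespace WeakAction

variable {G : Type t} [Group G] {C : Type u} [Bicategory.{w, v} C] (S : WeakAction G C)

section

variable {g h k a b c : G} (e₁ : g * h = a) (e₂ : h * k = b) (e₃ : a * k = c) (e₄ : g * b = c)

lemma rep_ν_natural {x y z : C} {f f' : x ⟶ y} (η : f ⟶ f')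
    (T : (S.functor h).obj ((S.functor g).obj y) ⟶ z) :
    (S.functor a).map₂ η ▹ (S.φ e₁ y ≫ T) ≫ rep (S.ν e₁ f').hom T =
      rep (S.ν e₁ f).hom T ≫ S.φ e₁ x ◃ (S.functor h).map₂ ((S.functor g).map₂ η) ▹ T := by
  have w := congrArg (fun q => q ▹ T) (S.ν_natural e₁ η)
  simp only [Bicategory.comp_whiskerRight] at w
  simp only [rep, Category.assoc]
  simp [reassoc_of% w]

lemma rep_ν_comp {x y z t : C} (f : x ⟶ y) (f' : y ⟶ z)
    (T : (S.functor h).obj ((S.functor g).obj z) ⟶ t) :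
    merge (S.functor a) f f' (S.φ e₁ z ≫ T) ≫ rep (S.ν e₁ (f ≫ f')).hom T =
      (S.functor a).map f ◃ rep (S.ν e₁ f').hom T ≫ rep (S.ν e₁ f).hom _ ≫
        S.φ e₁ x ◃ merge₂ (S.functor g) (S.functor h) f f' T := by
  have w := congrArg (fun q => q ▹ T) (S.ν_comp e₁ f f')
  simp only [Bicategory.comp_whiskerRight] at w
  simp only [rep, merge, merge₂, con, Category.assoc]
  simp [reassoc_of% w]

lemma rep_ζ_natural {x y z : C} (f : x ⟶ y)
    (T : (S.functor k).obj ((S.functor h).obj ((S.functor g).obj y)) ⟶ z) :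
    (S.functor c).map f ◃ rep (S.ζ e₁ e₂ e₃ e₄ y).hom T ≫
        rep (S.ν e₃ f).hom ((S.functor k).map (S.φ e₁ y) ≫ T) ≫
        S.φ e₃ x ◃ rep (mapSq (S.functor k) (S.ν e₁ f).hom) T =
      rep (S.ν e₄ f).hom (S.φ e₂ _ ≫ T) ≫
        S.φ e₄ x ◃ rep (S.ν e₂ ((S.functor g).map f)).hom T ≫
        rep (S.ζ e₁ e₂ e₃ e₄ x).hom
          ((S.functor k).map ((S.functor h).map ((S.functor g).map f)) ≫ T) := by
  calc
    _ = (𝟙 _ ⊚ ((S.functor c).map f ◃ (S.ζ e₁ e₂ e₃ e₄ y).hom ≫ (𝒶 _ _ _).inv ≫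
        (S.ν e₃ f).hom ▹ (S.functor k).map (S.φ e₁ y) ≫ (𝒶 _ _ _).hom ≫
        S.φ e₃ x ◃ mapSq (S.functor k) (S.ν e₁ f).hom ≫ (𝒶 _ _ _).inv) ▹ T ⊚ 𝟙 _) := by
      simp only [rep]
      bicategory
    _ = _ := by
      rw [S.ζ_natural]
      simp only [rep]
      bicategory

lemma rep_ζ_unit {x y : C} (T : (S.functor h).obj ((S.functor g).obj x) ⟶ y) :
    S.φ e₁ x ◃ del (S.ζr h ((S.functor g).obj x)).hom T =
      rep (S.ζ (mul_one g) (one_mul h) e₁ e₁ x).hom ((S.functor h).map (S.ι _) ≫ T) ≫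
        S.φ e₁ x ◃ del (mapUnit (S.functor h) (S.ζl g x).hom) T := by
  calc
    _ = (𝟙 _ ⊚ (S.φ e₁ x ◃ (S.ζr h ((S.functor g).obj x)).hom) ▹ T ⊚ 𝟙 _) := by
      simp only [del]
      bicategory
    _ = _ := by
      rw [S.ζ_unit]
      simp only [rep, del]
      bicategory

lemma rep_ζr_natural {x y z : C} (f : x ⟶ y) (T : (S.functor g).obj y ⟶ z) :
    (S.functor g).map f ◃ del (S.ζr g y).hom T =
      rep (S.ν (one_mul g) f).hom ((S.functor g).map (S.ι y) ≫ T) ≫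
        S.φ (one_mul g) x ◃ rep (mapSq (S.functor g) (S.ν₁ f).hom) T ≫
        del (S.ζr g x).hom ((S.functor g).map f ≫ T) := by
  calc
    _ = (𝟙 _ ⊚ ((S.functor g).map f ◃ (S.ζr g y).hom ≫ (𝓇 _).hom) ▹ T ⊚ 𝟙 _) := by
      simp only [del]
      bicategory
    _ = _ := by
      rw [S.ζr_natural]
      simp only [rep, del]
      bicategory

lemma rep_simplex {g h k l gh hk kl ghk hkl ghkl : G} (e_gh : g * h = gh) (e_hk : h * k = hk)
    (e_kl : k * l = kl) (e_gh_k : gh * k = ghk) (e_g_hk : g * hk = ghk) (e_hk_l : hk * l = hkl)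
    (e_h_kl : h * kl = hkl) (e_ghk_l : ghk * l = ghkl) (e_gh_kl : gh * kl = ghkl)
    (e_g_hkl : g * hkl = ghkl) (x : C) {y : C}
    (T : (S.functor l).obj ((S.functor k).obj ((S.functor h).obj ((S.functor g).obj x))) ⟶ y) :
    rep (S.ζ e_gh e_h_kl e_gh_kl e_g_hkl x).hom (S.φ e_kl _ ≫ T) ≫
        S.φ e_gh_kl x ◃ rep (S.ν e_kl (S.φ e_gh x)).hom T ≫
        rep (S.ζ e_gh_k e_kl e_ghk_l e_gh_kl x).hom
          ((S.functor l).map ((S.functor k).map (S.φ e_gh x)) ≫ T) =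
      S.φ e_g_hkl x ◃ rep (S.ζ e_hk e_kl e_hk_l e_h_kl ((S.functor g).obj x)).hom T ≫
        rep (S.ζ e_g_hk e_hk_l e_ghk_l e_g_hkl x).hom ((S.functor l).map (S.φ e_hk _) ≫ T) ≫
        S.φ e_ghk_l x ◃ rep (mapSq (S.functor l) (S.ζ e_gh e_hk e_gh_k e_g_hk x).hom) T := by
  calc
    _ = (𝟙 _ ⊚ ((S.ζ e_gh e_h_kl e_gh_kl e_g_hkl x).hom ▹ S.φ e_kl _ ≫ (𝒶 _ _ _).hom ≫
        S.φ e_gh_kl x ◃ (S.ν e_kl (S.φ e_gh x)).hom ≫ (𝒶 _ _ _).inv ≫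
        (S.ζ e_gh_k e_kl e_ghk_l e_gh_kl x).hom ▹
          (S.functor l).map ((S.functor k).map (S.φ e_gh x))) ▹ T ⊚ 𝟙 _) := by
      simp only [rep]
      bicategory
    _ = _ := by
      rw [S.simplex e_gh e_hk e_kl e_gh_k e_g_hk e_hk_l e_h_kl e_ghk_l e_gh_kl e_g_hkl]
      simp only [rep]
      bicategory

end

/-- The composition `b ∘ ʰa ∘ φ` of twisted 1-cells. -/
abbrev comp {g h k : G} (e : g * h = k) {x y z : C} (b : (S.functor h).obj y ⟶ z)
    (a : (S.functor g).obj x ⟶ y) : (S.functor k).obj x ⟶ z :=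
  S.φ e x ≫ (S.functor h).map a ≫ b

section

variable {g h k a b c : G} (e₁ : g * h = a) (e₂ : h * k = b) (e₃ : a * k = c) (e₄ : g * b = c)
  {w x y z : C}

/-- The associativity constraint for the composition of twisted 1-cells. -/
def assoc (f : (S.functor g).obj w ⟶ x) (f' : (S.functor h).obj x ⟶ y)
    (f'' : (S.functor k).obj y ⟶ z) :
    S.comp e₄ (S.comp e₂ f'' f') f ≅ S.comp e₃ f'' (S.comp e₁ f' f) :=
  Bicategory.whiskerLeftIso (S.φ e₄ w) (repIso (S.ν e₂ f) ((S.functor k).map f' ≫ f'')) ≪≫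
    repIso (S.ζ e₁ e₂ e₃ e₄ w) _ ≪≫
    Bicategory.whiskerLeftIso (S.φ e₃ w)
      (Bicategory.whiskerLeftIso _ (mergeIso (S.functor k) ((S.functor h).map f) f' f'') ≪≫
        mergeIso (S.functor k) (S.φ e₁ w) ((S.functor h).map f ≫ f') f'')

lemma assoc_hom (f : (S.functor g).obj w ⟶ x) (f' : (S.functor h).obj x ⟶ y)
    (f'' : (S.functor k).obj y ⟶ z) :
    (S.assoc e₁ e₂ e₃ e₄ f f' f'').hom =
      S.φ e₄ w ◃ rep (S.ν e₂ f).hom ((S.functor k).map f' ≫ f'') ≫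
      rep (S.ζ e₁ e₂ e₃ e₄ w).hom
        ((S.functor k).map ((S.functor h).map f) ≫ (S.functor k).map f' ≫ f'') ≫
      S.φ e₃ w ◃ ((S.functor k).map (S.φ e₁ w) ◃
          merge (S.functor k) ((S.functor h).map f) f' f'' ≫
        merge (S.functor k) (S.φ e₁ w) ((S.functor h).map f ≫ f') f'') := rfl

lemma merge_merge_natural {D : Type*} [Bicategory D] (F : Pseudofunctor C D) (p : w ⟶ x)
    {f f₁ : x ⟶ y} (η : f ⟶ f₁) {f' f₁' : y ⟶ z} (η' : f' ⟶ f₁') {t : D}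
    {f'' f₁'' : F.obj z ⟶ t} (η'' : f'' ⟶ f₁'') :
    F.map p ◃ (F.map₂ η ▹ (F.map f' ≫ f'') ≫ F.map f₁ ◃ (F.map₂ η' ▹ f'' ≫ F.map f₁' ◃ η'') ≫
        merge F f₁ f₁' f₁'') ≫ merge F p (f₁ ≫ f₁') f₁'' =
      F.map p ◃ merge F f f' f'' ≫ merge F p (f ≫ f') f'' ≫
        F.map₂ (p ◃ (η ▹ f' ≫ f₁ ◃ η')) ▹ f'' ≫ F.map (p ≫ f₁ ≫ f₁') ◃ η'' := by
  rw [sq_assoc (merge_whiskerLeft _ _ _ _), ← merge_natural,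
    ← Bicategory.whiskerLeft_comp_assoc, ← Bicategory.whiskerLeft_comp_assoc]
  congr 2
  simp only [F.map₂_comp, Bicategory.comp_whiskerRight, Bicategory.whiskerLeft_comp,
    Category.assoc]
  rw [sq_assoc (merge_whiskerRight _ _ _ _), sq_assoc (merge_whiskerLeft _ _ _ _), merge_natural]

lemma assoc_natural {f₁ f₂ : (S.functor g).obj w ⟶ x} (η : f₁ ⟶ f₂)
    {f₁' f₂' : (S.functor h).obj x ⟶ y} (η' : f₁' ⟶ f₂') {f₁'' f₂'' : (S.functor k).obj y ⟶ z}
    (η'' : f₁'' ⟶ f₂'') :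
    S.φ e₄ w ◃ ((S.functor b).map₂ η ▹ _ ≫
      _ ◃ S.φ e₂ x ◃ ((S.functor k).map₂ η' ▹ _ ≫ _ ◃ η'')) ≫ (S.assoc e₁ e₂ e₃ e₄ f₂ f₂' f₂'').hom =
    (S.assoc e₁ e₂ e₃ e₄ f₁ f₁' f₁'').hom ≫ S.φ e₃ w ◃
      ((S.functor k).map₂ (S.φ e₁ w ◃ ((S.functor h).map₂ η ▹ _ ≫ _ ◃ η')) ▹ _ ≫ _ ◃ η'') := by
  have h1 := congrArg (fun q => S.φ e₄ w ◃ q)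
    (S.rep_ν_natural e₂ η ((S.functor k).map f₁' ≫ f₁''))
  have h2 := congrArg (fun q => S.φ e₃ w ◃ q) (merge_merge_natural (S.functor k) (S.φ e₁ w)
    ((S.functor h).map₂ η) η' η'')
  simp only [assoc_hom, (S.functor k).map₂_comp, Bicategory.comp_whiskerRight, Category.assoc,
    Bicategory.whiskerLeft_comp] at h1 h2 ⊢
  rw [whiskerLeft_rep_natural_assoc, whiskerLeft_rep_natural_assoc, sq_assoc h1,
    rep_natural_assoc, rep_natural_assoc, rep_natural_assoc]
  rw [h2]

lemma map_assoc (f : (S.functor g).obj w ⟶ x) (f' : (S.functor h).obj x ⟶ y)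
    (f'' : (S.functor k).obj y ⟶ z) (F : Pseudofunctor C C) {t : C} (T : F.obj z ⟶ t) :
    F.map (S.φ e₄ w) ◃ (F.map ((S.functor b).map f) ◃
      (F.map (S.φ e₂ x) ◃ merge F ((S.functor k).map f') f'' T ≫ merge F (S.φ e₂ x) _ T) ≫
        merge F ((S.functor b).map f) _ T) ≫ merge F (S.φ e₄ w) _ T ≫
        F.map₂ (S.assoc e₁ e₂ e₃ e₄ f f' f'').hom ▹ T =
      F.map (S.φ e₄ w) ◃ rep (mapSq F (S.ν e₂ f).hom) _ ≫
        rep (mapSq F (S.ζ e₁ e₂ e₃ e₄ w).hom) _ ≫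
        F.map (S.φ e₃ w) ◃ (F.map ((S.functor k).map (S.φ e₁ w)) ◃
          merge₂ (S.functor k) F _ _ _ ≫ merge₂ (S.functor k) F _ _ _) ≫
        F.map (S.φ e₃ w) ◃ merge F ((S.functor k).map (S.comp e₁ f' f)) f'' T ≫
        merge F (S.φ e₃ w) _ T := by
  have h1 := congrArg (fun q => F.map (S.φ e₄ w) ◃ q)
    (merge_rep F (S.ν e₂ f).hom ((S.functor k).map f' ≫ f'') T)
  have h2 := merge_rep F (S.ζ e₁ e₂ e₃ e₄ w).hom
    ((S.functor k).map ((S.functor h).map f) ≫ (S.functor k).map f' ≫ f'') T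
  have h3 : _ ◃ merge F _ _ T ≫ merge F _ _ T ≫
      F.map₂ (merge (S.functor k) ((S.functor h).map f) f' f'') ▹ T =
      merge₂ (S.functor k) F _ _ _ ≫ merge F _ _ T :=
    merge_con F ((S.functor k).mapComp ((S.functor h).map f) f').inv f'' T
  have h3 := congrArg (fun q => F.map (S.φ e₃ w) ◃ F.map ((S.functor k).map (S.φ e₁ w)) ◃ q) h3
  have h4 : _ ◃ merge F _ _ T ≫ merge F _ _ T ≫
      F.map₂ (merge (S.functor k) (S.φ e₁ w) ((S.functor h).map f ≫ f') f'') ▹ T =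
      merge₂ (S.functor k) F _ _ _ ≫ merge F _ _ T :=
    merge_con F ((S.functor k).mapComp (S.φ e₁ w) ((S.functor h).map f ≫ f')).inv f'' T
  have h4 := congrArg (fun q => F.map (S.φ e₃ w) ◃ q) h4
  simp only [assoc_hom, F.map₂_comp, Bicategory.comp_whiskerRight,
    sq_assoc (merge_whiskerLeft _ _ _ _), merge_whiskerLeft]
  simp only [Bicategory.whiskerLeft_comp, Category.assoc] at h1 h2 h3 h4 ⊢
  rw [sq_assoc₃ h1]
  simp only [Category.assoc]
  rw [whiskerLeft_rep_natural_assoc, sq_assoc₃ h2]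
  simp only [Category.assoc]
  rw [rep_natural_assoc, rep_natural_assoc]
  simp only [F.map₂_comp, Bicategory.comp_whiskerRight,
    sq_assoc (merge_whiskerLeft _ _ _ _), merge_whiskerLeft]
  have h5 := congrArg (fun q => F.map (S.φ e₃ w) ◃ q) (merge_whiskerLeft F
    ((S.functor k).map (S.φ e₁ w)) (merge (S.functor k) ((S.functor h).map f) f' f'') T)
  simp only [Bicategory.whiskerLeft_comp, Category.assoc] at h5
  rw [sq_assoc h5, sq_assoc₃ h3]
  simp only [Category.assoc]
  rw [sq_assoc₃ h4]
  simp only [Category.assoc]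

end

lemma pentagon {g h k l gh hk kl ghk hkl ghkl : G} (e_gh : g * h = gh) (e_hk : h * k = hk)
    (e_kl : k * l = kl) (e_gh_k : gh * k = ghk) (e_g_hk : g * hk = ghk) (e_hk_l : hk * l = hkl)
    (e_h_kl : h * kl = hkl) (e_ghk_l : ghk * l = ghkl) (e_gh_kl : gh * kl = ghkl)
    (e_g_hkl : g * hkl = ghkl) {v w x y z : C} (a : (S.functor g).obj v ⟶ w)
    (b : (S.functor h).obj w ⟶ x) (c : (S.functor k).obj x ⟶ y) (d : (S.functor l).obj y ⟶ z) :
    (S.assoc e_gh e_h_kl e_gh_kl e_g_hkl a b (S.comp e_kl d c)).hom ≫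
      (S.assoc e_gh_k e_kl e_ghk_l e_gh_kl (S.comp e_gh b a) c d).hom =
    S.φ e_g_hkl v ◃ (S.functor hkl).map a ◃ (S.assoc e_hk e_kl e_hk_l e_h_kl b c d).hom ≫
      (S.assoc e_g_hk e_hk_l e_ghk_l e_g_hkl a (S.comp e_hk c b) d).hom ≫
      S.φ e_ghk_l v ◃ ((S.functor l).map₂ (S.assoc e_gh e_hk e_gh_k e_g_hk a b c).hom ▹ d) := by
  have l1 := congrArg (fun q => S.φ e_gh_kl v ◃ q)
    (S.rep_ν_comp e_kl (S.φ e_gh v) ((S.functor h).map a ≫ b) ((S.functor l).map c ≫ d))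
  have l2 := congrArg (fun q => S.φ e_gh_kl v ◃ (S.functor kl).map (S.φ e_gh v) ◃ q)
    (S.rep_ν_comp e_kl ((S.functor h).map a) b ((S.functor l).map c ≫ d))
  have r1 := congrArg (fun q => S.φ e_ghk_l v ◃ q)
    (S.map_assoc e_gh e_hk e_gh_k e_g_hk a b c (S.functor l) d)
  have r2 := congrArg (fun q => S.φ e_g_hkl v ◃ q)
    (S.rep_ζ_natural e_hk e_kl e_hk_l e_h_kl a
      ((S.functor l).map ((S.functor k).map b) ≫ (S.functor l).map c ≫ d))
  have r3 := S.rep_simplex e_gh e_hk e_kl e_gh_k e_g_hk e_hk_l e_h_kl e_ghk_l e_gh_kl e_g_hkl v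
    ((S.functor l).map ((S.functor k).map ((S.functor h).map a)) ≫
      (S.functor l).map ((S.functor k).map b) ≫ (S.functor l).map c ≫ d)
  rw [S.assoc_hom e_gh e_h_kl, S.assoc_hom e_gh_k e_kl, S.assoc_hom e_hk e_kl,
    S.assoc_hom e_g_hk e_hk_l]
  simp only [Bicategory.whiskerLeft_comp, Category.assoc] at l1 l2 r1 r2 ⊢
  rw [sq_assoc l1]
  simp only [Category.assoc]
  rw [sq_assoc l2]
  simp only [Category.assoc]
  rw [← rep_natural_assoc (S.ζ e_gh e_h_kl e_gh_kl e_g_hkl v).hom,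
    ← rep_natural_assoc (S.ζ e_gh e_h_kl e_gh_kl e_g_hkl v).hom,
    ← whiskerLeft_rep_natural_assoc _ (S.ν e_h_kl a).hom,
    whiskerLeft_rep_natural_assoc _ (S.ν e_kl (S.φ e_gh v)).hom,
    rep_natural_assoc (S.ζ e_gh_k e_kl e_ghk_l e_gh_kl v).hom,
    rep_natural_assoc (S.ζ e_gh_k e_kl e_ghk_l e_gh_kl v).hom]
  rw [whiskerLeft_rep_natural_assoc _ (S.ν e_hk_l a).hom,
    whiskerLeft_rep_natural_assoc _ (S.ν e_hk_l a).hom,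
    rep_natural_assoc (S.ζ e_g_hk e_hk_l e_ghk_l e_g_hkl v).hom,
    rep_natural_assoc (S.ζ e_g_hk e_hk_l e_ghk_l e_g_hkl v).hom]
  rw [r1]
  rw [← rep_natural_assoc (S.ζ e_g_hk e_hk_l e_ghk_l e_g_hkl v).hom, sq_assoc₃ r2]
  simp only [Category.assoc]
  rw [sq_assoc₃ r3]
  simp only [Category.assoc]

section

variable {g h k : G} {x y z : C}

/-- The left unitality constraint for the composition of twisted 1-cells. -/
def leftUnitor (a : (S.functor g).obj x ⟶ y) : S.comp (mul_one g) (S.ι y) a ≅ a :=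
  Bicategory.whiskerLeftIso _ (S.ν₁ a) ≪≫ delIso (S.ζl g x) a

lemma leftUnitor_hom (a : (S.functor g).obj x ⟶ y) :
    (S.leftUnitor a).hom = S.φ (mul_one g) x ◃ (S.ν₁ a).hom ≫ del (S.ζl g x).hom a := rfl

/-- The right unitality constraint for the composition of twisted 1-cells. -/
def rightUnitor (b : (S.functor h).obj y ⟶ z) : S.comp (one_mul h) b (S.ι y) ≅ b :=
  delIso (S.ζr h y) b

lemma rightUnitor_hom (b : (S.functor h).obj y ⟶ z) :
    (S.rightUnitor b).hom = del (S.ζr h y).hom b := rfl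

lemma leftUnitor_natural {a a' : (S.functor g).obj x ⟶ y} (η : a ⟶ a') :
    S.φ (mul_one g) x ◃ ((S.functor 1).map₂ η ▹ S.ι y) ≫ (S.leftUnitor a').hom =
      (S.leftUnitor a).hom ≫ η := by
  simp only [leftUnitor_hom, Category.assoc, ← del_natural]
  rw [← Bicategory.whiskerLeft_comp_assoc, ν₁_natural, Bicategory.whiskerLeft_comp_assoc]

lemma rightUnitor_natural {b b' : (S.functor h).obj y ⟶ z} (η : b ⟶ b') :
    S.φ (one_mul h) y ◃ (S.functor h).map (S.ι y) ◃ η ≫ (S.rightUnitor b').hom =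
      (S.rightUnitor b).hom ≫ η :=
  del_natural _ _

lemma triangle (e : g * h = k) (a : (S.functor g).obj x ⟶ y) (b : (S.functor h).obj y ⟶ z) :
    (S.assoc (mul_one g) (one_mul h) e e a (S.ι y) b).hom ≫
        S.φ e x ◃ ((S.functor h).map₂ (S.leftUnitor a).hom ▹ b) =
      S.φ e x ◃ (S.functor h).map a ◃ (S.rightUnitor b).hom := by
  have h1 := congrArg (fun q => S.φ e x ◃ (S.functor h).map (S.φ (mul_one g) x) ◃ q)
    (merge_mapSq (S.functor h) (S.ν₁ a).hom b)
  have h2 := congrArg (fun q => S.φ e x ◃ q)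
    (merge_del (S.functor h) (S.ζl g x).hom a b)
  have h3 := congrArg (fun q => S.φ e x ◃ q) (S.rep_ζr_natural a b)
  have h4 := S.rep_ζ_unit e (x := x) ((S.functor h).map a ≫ b)
  have h5 := congrArg (fun q => S.φ e x ◃ q)
    (merge_whiskerLeft (S.functor h) (S.φ (mul_one g) x) (S.ν₁ a).hom b)
  simp only [assoc_hom, leftUnitor_hom, rightUnitor_hom, Bicategory.whiskerLeft_comp,
    Category.assoc, (S.functor h).map₂_comp, Bicategory.comp_whiskerRight] at h1 h2 h3 h4 h5 ⊢
  rw [sq_assoc h5, sq_assoc h1, h2, ← rep_natural_assoc, ← h4, h3]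

end

end WeakAction
end TwistedBicat

namespace TwistedBicat

attribute [-simp] MonoidalCategory.tensorHom_id MonoidalCategory.id_tensorHom
  MonoidalCategory.associator_conjugation
attribute [local simp] MonoidalCategory.id_tensorHom_id MonoidalCategory.tensorHom_comp_tensorHom
  MonoidalCategory.tensorHom_comp_tensorHom_assoc MonoidalCategory.associator_naturality
  MonoidalCategory.associator_naturality_assoc

local infixr:81 " ◃ " => Bicategory.whiskerLeft
local infixl:81 " ▹ " => Bicategory.whiskerRight

open MonoidalTwoCategory

open Elem

section Functors

variable {W : Type u} [Bicategory.{w, v} W] [Bicategory.Strict W] [MonoidalTwoCategory W]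

namespace Elem

variable {X Y : W}

/-- Postcomposition of an isomorphism of generalized elements with a 1-cell. -/
@[simps] def pushIso (f : X ⟶ Y) {a b : Elem X} (m : a ≅ b) : pushObj f a ≅ pushObj f b where
  hom := pushMap f m.hom
  inv := pushMap f m.inv
  hom_inv_id := by rw [← pushMap_comp, Iso.hom_inv_id, pushMap_id]
  inv_hom_id := by rw [← pushMap_comp, Iso.inv_hom_id, pushMap_id]

@[simp high] lemma boxMap_push_conj {X' Y' : W} {a a' : Elem X} {b b' : Elem Y} (m : a ⟶ a')
    (n : b ⟶ b') (f : X ⟶ X') (g : Y ⟶ Y') :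
    boxMap (pushMap f m) (pushMap g n) =
      st (box (pushObj f a) (pushObj g b)) (pushObj (f ⊗ₘ g) (box a b))
          (𝟙 (a.src ⊗ b.src)) (by simp) ≫ pushMap (f ⊗ₘ g) (boxMap m n) ≫
        st (pushObj (f ⊗ₘ g) (box a' b')) (box (pushObj f a') (pushObj g b'))
          (𝟙 (a'.src ⊗ b'.src)) (by simp) := by
  rw [← sq_assoc (boxMap_push m n f g), st_st, st_congr (Category.id_comp _)]
  exact (Category.comp_id _).symm

@[simp high] lemma boxMap_push_id_conj {X' Y' : W} {a a' : Elem X} (b : Elem Y) (m : a ⟶ a')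
    (f : X ⟶ X') (g : Y ⟶ Y') :
    boxMap (pushMap f m) (𝟙 (pushObj g b)) =
      st (box (pushObj f a) (pushObj g b)) (pushObj (f ⊗ₘ g) (box a b))
          (𝟙 (a.src ⊗ b.src)) (by simp) ≫ pushMap (f ⊗ₘ g) (boxMap m (𝟙 b)) ≫
        st (pushObj (f ⊗ₘ g) (box a' b)) (box (pushObj f a') (pushObj g b))
          (𝟙 (a'.src ⊗ b.src)) (by simp) := by
  rw [← boxMap_push_conj, pushMap_id]

@[simp high] lemma boxMap_id_push_conj {X' Y' : W} (a : Elem X) {b b' : Elem Y} (n : b ⟶ b')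
    (f : X ⟶ X') (g : Y ⟶ Y') :
    boxMap (𝟙 (pushObj f a)) (pushMap g n) =
      st (box (pushObj f a) (pushObj g b)) (pushObj (f ⊗ₘ g) (box a b))
          (𝟙 (a.src ⊗ b.src)) (by simp) ≫ pushMap (f ⊗ₘ g) (boxMap (𝟙 a) n) ≫
        st (pushObj (f ⊗ₘ g) (box a b')) (box (pushObj f a) (pushObj g b'))
          (𝟙 (a.src ⊗ b'.src)) (by simp) := by
  rw [← boxMap_push_conj, pushMap_id]

end Elem

namespace FunctorData

variable {O : Type s} {O' : Type t} {A : EnrichedData W O} {B : EnrichedData W O'}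
  (F : FunctorData A B)

/-- Preservation of identities, on generalized elements. -/
def elemMapId (x : O) : pushObj (F.map x x) (point (A.id x)) ≅ point (B.id (F.obj x)) :=
  stIso _ (pushObj (A.id x ≫ F.map x x) (univ (𝟙_ W))) (Iso.refl _) (by simp) ≪≫
    evIso (F.mapId x) (univ (𝟙_ W)) ≪≫ stIso _ _ (Iso.refl _) (by simp)

lemma elemMapId_hom (x : O) :
    (F.elemMapId x).hom =
      st (pushObj (F.map x x) (point (A.id x))) (pushObj (A.id x ≫ F.map x x) (univ (𝟙_ W)))
        (𝟙 _) (by simp) ≫ ev (F.mapId x).hom (univ (𝟙_ W)) ≫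
      st (pushObj (B.id (F.obj x)) (univ (𝟙_ W))) (point (B.id (F.obj x))) (𝟙 _) (by simp) := rfl

/-- Preservation of composition, on generalized elements. -/
def elemMapComp {x y z : O} (a : Elem (A.hom x y)) (b : Elem (A.hom y z)) :
    pushObj (B.comp _ _ _) (box (pushObj (F.map y z) b) (pushObj (F.map x y) a)) ≅
      pushObj (F.map x z) (pushObj (A.comp x y z) (box b a)) :=
  stIso _ (pushObj ((F.map y z ⊗ₘ F.map x y) ≫ B.comp _ _ _) (box b a)) (Iso.refl _) (by simp) ≪≫
    evIso (F.mapComp x y z) (box b a) ≪≫ stIso _ _ (Iso.refl _) (by simp)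

lemma elemMapComp_hom {x y z : O} (a : Elem (A.hom x y)) (b : Elem (A.hom y z)) :
    (F.elemMapComp a b).hom =
      st (pushObj (B.comp _ _ _) (box (pushObj (F.map y z) b) (pushObj (F.map x y) a)))
        (pushObj ((F.map y z ⊗ₘ F.map x y) ≫ B.comp _ _ _) (box b a)) (𝟙 _) (by simp) ≫
      ev (F.mapComp x y z).hom (box b a) ≫
      st (pushObj (A.comp x y z ≫ F.map x z) (box b a))
        (pushObj (F.map x z) (pushObj (A.comp x y z) (box b a))) (𝟙 _) (by simp) := rfl

lemma elemMapComp_natural {x y z : O} {a a' : Elem (A.hom x y)} {b b' : Elem (A.hom y z)}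
    (m : a ⟶ a') (n : b ⟶ b') :
    pushMap (B.comp _ _ _) (boxMap (pushMap (F.map y z) n) (pushMap (F.map x y) m)) ≫
        (F.elemMapComp a' b').hom =
      (F.elemMapComp a b).hom ≫ pushMap (F.map x z) (pushMap (A.comp x y z) (boxMap n m)) := by
  have h := ev_natural (F.mapComp x y z).hom (boxMap n m)
  rw [elemMapComp_hom, elemMapComp_hom]
  simp
  rw [sq_assoc h]

variable {F}

lemma IsLawful.elem_map_assoc (hF : F.IsLawful) {w x y z : O} (a : Elem (A.hom w x))
    (b : Elem (A.hom x y)) (c : Elem (A.hom y z)) :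
    pushMap (B.comp _ _ _) (boxMap (F.elemMapComp b c).hom (𝟙 (pushObj (F.map w x) a))) ≫
        (F.elemMapComp a (pushObj (A.comp x y z) (box c b))).hom ≫
        pushMap (F.map w z) (A.elemAssoc a b c).hom =
      (B.elemAssoc (pushObj (F.map w x) a) (pushObj (F.map x y) b) (pushObj (F.map y z) c)).hom ≫
        pushMap (B.comp _ _ _) (boxMap (𝟙 (pushObj (F.map y z) c)) (F.elemMapComp a b).hom) ≫
        (F.elemMapComp (pushObj (A.comp w x y) (box b a)) c).hom := by
  have h := congrArg (fun η => ev η (box (box c b) a)) (hF.map_assoc w x y z)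
  simp only [ev_comp, ev_eqToHom, ev_whiskerLeft, ev_whiskerRight] at h
  rw [ev_eq (tensor₂ (𝟙 (F.map y z)) (F.mapComp w x y).hom)
    (a := box c (box b a)) (b := pushObj _ (box (box c b) a))
    (α_ c.src b.src a.src).symm (by simp)] at h
  simp [ev_tensor₂, ev_id_tensor₂] at h
  have h' := st_conj h (pushObj (B.comp _ _ _) (box (pushObj (B.comp _ _ _)
      (box (pushObj (F.map y z) c) (pushObj (F.map x y) b))) (pushObj (F.map w x) a)))
      (pushObj (F.map w z) (pushObj (A.comp w y z) (box c (pushObj (A.comp w x y) (box b a)))))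
      (𝟙 _) (by simp) (α_ c.src b.src a.src).hom (by simp)
  simp only [EnrichedData.elemAssoc_hom, elemMapComp_hom]
  rw [ev_eq (F.mapComp w x z).hom
      (a := pushObj (A.comp x y z ⊗ₘ 𝟙 (A.hom w x)) (box (box c b) a))
      (b := box (pushObj (A.comp x y z) (box c b)) a) (Iso.refl _) (by simp),
    ev_eq (F.mapComp w y z).hom
      (a := pushObj ((α_ (A.hom y z) (A.hom x y) (A.hom w x)).hom ≫ (𝟙 (A.hom y z) ⊗ₘ A.comp w x y))
        (box (box c b) a))
      (b := box c (pushObj (A.comp w x y) (box b a))) (α_ c.src b.src a.src) (by simp),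
    ev_eq (B.assoc _ _ _ _).hom
      (a := pushObj ((F.map y z ⊗ₘ F.map x y) ⊗ₘ F.map w x) (box (box c b) a))
      (b := box (box (pushObj (F.map y z) c) (pushObj (F.map x y) b)) (pushObj (F.map w x) a))
      (Iso.refl _) (by simp)]
  simp at h' ⊢
  exact h'

lemma IsLawful.elem_map_leftUnitor (hF : F.IsLawful) {x y : O} (a : Elem (A.hom x y)) :
    (F.elemMapComp a (point (A.id y))).hom ≫ pushMap (F.map x y) (A.elemLeftUnitor a).hom =
      pushMap (B.comp _ _ _) (boxMap (F.elemMapId y).hom (𝟙 (pushObj (F.map x y) a))) ≫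
        (B.elemLeftUnitor (pushObj (F.map x y) a)).hom := by
  have h := congrArg (fun η => ev η (box (univ (𝟙_ W)) a)) (hF.map_leftUnitor x y)
  simp only [ev_comp, ev_eqToHom, ev_whiskerLeft, ev_whiskerRight] at h
  simp [ev_tensor₂, ev_id_tensor₂] at h
  have h' := st_conj h (pushObj (B.comp _ _ _) (box (pushObj (F.map y y) (point (A.id y)))
      (pushObj (F.map x y) a))) (pushObj (F.map x y) a)
      (𝟙 _) (by simp) (λ_ a.src).hom (by simp [reassoc_of% leftUnitor_natural' a.val])
  simp only [EnrichedData.elemLeftUnitor_hom, elemMapComp_hom, elemMapId_hom]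
  rw [ev_eq (F.mapComp x y y).hom
      (a := pushObj (A.id y ⊗ₘ 𝟙 (A.hom x y)) (box (univ _) a))
      (b := box (point (A.id y)) a) (Iso.refl _) (by simp),
    ev_eq (B.leftUnitor _ _).hom
      (a := pushObj (𝟙 _ ⊗ₘ F.map x y) (box (univ _) a))
      (b := box (univ _) (pushObj (F.map x y) a)) (Iso.refl _) (by simp)]
  simp at h' ⊢
  exact h'

lemma IsLawful.elem_map_rightUnitor (hF : F.IsLawful) {x y : O} (a : Elem (A.hom x y)) :
    (F.elemMapComp (point (A.id x)) a).hom ≫ pushMap (F.map x y) (A.elemRightUnitor a).hom =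
      pushMap (B.comp _ _ _) (boxMap (𝟙 (pushObj (F.map x y) a)) (F.elemMapId x).hom) ≫
        (B.elemRightUnitor (pushObj (F.map x y) a)).hom := by
  have h := congrArg (fun η => ev η (box a (univ (𝟙_ W)))) (hF.map_rightUnitor x y)
  simp only [ev_comp, ev_eqToHom, ev_whiskerLeft, ev_whiskerRight] at h
  simp [ev_tensor₂, ev_id_tensor₂] at h
  have h' := st_conj h (pushObj (B.comp _ _ _) (box (pushObj (F.map x y) a)
      (pushObj (F.map x x) (point (A.id x))))) (pushObj (F.map x y) a)
      (𝟙 _) (by simp) (ρ_ a.src).hom (by simp [reassoc_of% rightUnitor_natural' a.val])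
  simp only [EnrichedData.elemRightUnitor_hom, elemMapComp_hom, elemMapId_hom]
  rw [ev_eq (F.mapComp x x y).hom
      (a := pushObj (𝟙 (A.hom x y) ⊗ₘ A.id x) (box a (univ _)))
      (b := box a (point (A.id x))) (Iso.refl _) (by simp),
    ev_eq (B.rightUnitor _ _).hom
      (a := pushObj (F.map x y ⊗ₘ 𝟙 _) (box a (univ _)))
      (b := box (pushObj (F.map x y) a) (univ _)) (Iso.refl _) (by simp)]
  simp at h' ⊢
  exact h'

end FunctorData
end Functors
end TwistedBicat

namespace TwistedBicat

attribute [-simp] MonoidalCategory.tensorHom_id MonoidalCategory.id_tensorHom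
  MonoidalCategory.associator_conjugation
attribute [local simp] MonoidalCategory.id_tensorHom_id MonoidalCategory.tensorHom_comp_tensorHom
  MonoidalCategory.tensorHom_comp_tensorHom_assoc MonoidalCategory.associator_naturality
  MonoidalCategory.associator_naturality_assoc

local infixr:81 " ◃ " => Bicategory.whiskerLeft
local infixl:81 " ▹ " => Bicategory.whiskerRight

open MonoidalTwoCategory

open Elem TwistingAction Functor.LaxMonoidal Functor.OplaxMonoidal

section Actions

variable {G : Type t} [Group G] {W : Type u} [Bicategory.{w, v} W] [Bicategory.Strict W]
  [MonoidalTwoCategory W] [TwistingAction G W]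

namespace Elem

variable {X Y : W}

@[simp] lemma actMap_pushMap_conj (g : G) (f : X ⟶ Y) {a b : Elem X} (m : a ⟶ b) :
    actMap g (pushMap f m) =
      st (actObj g (pushObj f a)) (pushObj ((act g).map f) (actObj g a)) (𝟙 _) (by simp) ≫
        pushMap ((act g).map f) (actMap g m) ≫
        st (pushObj ((act g).map f) (actObj g b)) (actObj g (pushObj f b)) (𝟙 _) (by simp) := by
  rw [← sq_assoc (actMap_pushMap g f m), st_st, st_congr (Category.id_comp _)]
  exact (Category.comp_id _).symm

/-- The tensor product of isomorphisms of generalized elements. -/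
@[simps] def boxIso {a a' : Elem X} {b b' : Elem Y} (m : a ≅ a') (n : b ≅ b') :
    box a b ≅ box a' b' where
  hom := boxMap m.hom n.hom
  inv := boxMap m.inv n.inv
  hom_inv_id := by rw [← boxMap_comp, Iso.hom_inv_id, Iso.hom_inv_id, boxMap_id]
  inv_hom_id := by rw [← boxMap_comp, Iso.inv_hom_id, Iso.inv_hom_id, boxMap_id]

/-- The action of `g` on isomorphisms of generalized elements. -/
@[simps] def actIso (g : G) {a b : Elem X} (m : a ≅ b) : actObj g a ≅ actObj g b where
  hom := actMap g m.hom
  inv := actMap g m.inv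
  hom_inv_id := by rw [← actMap_comp, Iso.hom_inv_id, actMap_id]
  inv_hom_id := by rw [← actMap_comp, Iso.inv_hom_id, actMap_id]

end Elem

lemma actIso₂_hom (g : G) {X Y : W} {f f' : X ⟶ Y} (η : f ≅ f') :
    (actIso₂ g η).hom = act₂ g η.hom := rfl

namespace EnrichedData

variable {O : Type s} (A : EnrichedData W O) (g : G)

/-- The action of `g` on the composite of two generalized elements. -/
def elemActComp {x y z : O} (a : Elem (A.hom x y)) (b : Elem (A.hom y z)) :
    pushObj ((A.base g).comp x y z) (box (actObj g b) (actObj g a)) ≅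
      actObj g (pushObj (A.comp x y z) (box b a)) :=
  stIso _ _ (Functor.Monoidal.μIso (act g) b.src a.src) (by simp)

lemma elemActComp_hom {x y z : O} (a : Elem (A.hom x y)) (b : Elem (A.hom y z)) :
    (A.elemActComp g a b).hom =
      st (pushObj ((A.base g).comp x y z) (box (actObj g b) (actObj g a)))
        (actObj g (pushObj (A.comp x y z) (box b a))) (μ (act g) b.src a.src) (by simp) := rfl

/-- The action of `g` on the identity, regarded as a generalized element. -/
def elemActId (x : O) : point ((A.base g).id x) ≅ actObj g (point (A.id x)) :=
  stIso _ _ (Functor.Monoidal.εIso (act g)) (by simp)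

lemma elemActId_hom (x : O) :
    (A.elemActId g x).hom =
      st (point ((A.base g).id x)) (actObj g (point (A.id x))) (ε (act g)) (by simp) := rfl

lemma elemActId_inv (x : O) :
    (A.elemActId g x).inv =
      st (actObj g (point (A.id x))) (point ((A.base g).id x)) (η (act g))
        (by simp [elemActId]) := rfl

lemma elemActComp_natural {x y z : O} {a a' : Elem (A.hom x y)} {b b' : Elem (A.hom y z)}
    (m : a ⟶ a') (n : b ⟶ b') :
    pushMap ((A.base g).comp x y z) (boxMap (actMap g n) (actMap g m)) ≫
        (A.elemActComp g a' b').hom =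
      (A.elemActComp g a b).hom ≫ actMap g (pushMap (A.comp x y z) (boxMap n m)) := by
  have h := congrArg (pushMap ((act g).map (A.comp x y z))) (actMap_boxMap g n m)
  simp at h
  have h' := st_conj h (pushObj ((A.base g).comp x y z) (box (actObj g b) (actObj g a)))
    (actObj g (pushObj (A.comp x y z) (box b' a'))) (𝟙 _) (by simp) (𝟙 _) (by simp)
  rw [elemActComp_hom, elemActComp_hom]
  simp at h' ⊢
  exact h'

lemma elemAct_assoc {w x y z : O} (a : Elem (A.hom w x)) (b : Elem (A.hom x y))
    (c : Elem (A.hom y z)) :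
    pushMap ((A.base g).comp w x z) (boxMap (A.elemActComp g b c).hom (𝟙 (actObj g a))) ≫
        (A.elemActComp g a (pushObj (A.comp x y z) (box c b))).hom ≫
        actMap g (A.elemAssoc a b c).hom =
      ((A.base g).elemAssoc (actObj g a) (actObj g b) (actObj g c)).hom ≫
        pushMap ((A.base g).comp w y z) (boxMap (𝟙 (actObj g c)) (A.elemActComp g a b).hom) ≫
        (A.elemActComp g (pushObj (A.comp w x y) (box b a)) c).hom := by
  simp only [elemAssoc_hom, elemActComp_hom, Iso.trans_hom, eqToIso.hom,
    Bicategory.whiskerLeftIso_hom, actIso₂_hom, ev_comp, ev_eqToHom, ev_whiskerLeft]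
  rw [ev_eq (act₂ g (A.assoc w x y z).hom) (a := actObj g (box (box c b) a))
    (b := pushObj _ (box (box (actObj g c) (actObj g b)) (actObj g a)))
    (MonoidalCategory.tensorIso (Functor.Monoidal.μIso (act g) _ _) (Iso.refl _) ≪≫
        Functor.Monoidal.μIso (act g) _ _).symm (by simp)]
  have hp : δ (act g) (c.src ⊗ b.src) a.src ≫ (δ (act g) c.src b.src ⊗ₘ 𝟙 ((act g).obj a.src)) ≫
      (α_ ((act g).obj c.src) ((act g).obj b.src) ((act g).obj a.src)).hom ≫
      (𝟙 ((act g).obj c.src) ⊗ₘ μ (act g) b.src a.src) ≫ μ (act g) c.src (b.src ⊗ a.src) =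
      (act g).map (α_ c.src b.src a.src).hom := by
    rw [MonoidalCategory.tensorHom_id, MonoidalCategory.id_tensorHom,
      Functor.Monoidal.map_associator]
  simp [ev_act₂, hp]

lemma elemAct_leftUnitor {x y : O} (a : Elem (A.hom x y)) :
    (A.elemActComp g a (point (A.id y))).hom ≫ actMap g (A.elemLeftUnitor a).hom =
      pushMap ((A.base g).comp x y y) (boxMap (A.elemActId g y).inv (𝟙 (actObj g a))) ≫
        ((A.base g).elemLeftUnitor (actObj g a)).hom := by
  simp only [elemLeftUnitor_hom, elemActComp_hom, Iso.trans_hom, eqToIso.hom,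
    Bicategory.whiskerLeftIso_hom, actIso₂_hom, ev_comp, ev_eqToHom, ev_whiskerLeft]
  rw [ev_eq (act₂ g (A.leftUnitor x y).hom) (a := actObj g (box (univ (𝟙_ W)) a))
    (b := pushObj _ (box (univ (𝟙_ W)) (actObj g a)))
    (MonoidalCategory.tensorIso (Functor.Monoidal.εIso (act g)) (Iso.refl _) ≪≫
        Functor.Monoidal.μIso (act g) _ _).symm
      (by simp [Functor.Monoidal.map_tensor])]
  have hp : δ (act g) (𝟙_ W) a.src ≫ (η (act g) ⊗ₘ 𝟙 ((act g).obj a.src)) ≫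
      (λ_ ((act g).obj a.src)).hom = (act g).map (λ_ a.src).hom := by
    rw [MonoidalCategory.tensorHom_id, Functor.Monoidal.map_leftUnitor]
  simp [ev_act₂, elemActId_inv, hp, -Functor.LaxMonoidal.left_unitality]

lemma elemAct_rightUnitor {x y : O} (a : Elem (A.hom x y)) :
    (A.elemActComp g (point (A.id x)) a).hom ≫ actMap g (A.elemRightUnitor a).hom =
      pushMap ((A.base g).comp x x y) (boxMap (𝟙 (actObj g a)) (A.elemActId g x).inv) ≫
        ((A.base g).elemRightUnitor (actObj g a)).hom := by
  simp only [elemRightUnitor_hom, elemActComp_hom, Iso.trans_hom, eqToIso.hom,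
    Bicategory.whiskerLeftIso_hom, actIso₂_hom, ev_comp, ev_eqToHom, ev_whiskerLeft]
  rw [ev_eq (act₂ g (A.rightUnitor x y).hom) (a := actObj g (box a (univ (𝟙_ W))))
    (b := pushObj _ (box (actObj g a) (univ (𝟙_ W))))
    (MonoidalCategory.tensorIso (Iso.refl _) (Functor.Monoidal.εIso (act g)) ≪≫
        Functor.Monoidal.μIso (act g) _ _).symm
      (by simp [Functor.Monoidal.map_tensor])]
  have hp : δ (act g) a.src (𝟙_ W) ≫ (𝟙 ((act g).obj a.src) ⊗ₘ η (act g)) ≫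
      (ρ_ ((act g).obj a.src)).hom = (act g).map (ρ_ a.src).hom := by
    rw [MonoidalCategory.id_tensorHom, Functor.Monoidal.map_rightUnitor]
  simp [ev_act₂, elemActId_inv, hp, -Functor.LaxMonoidal.right_unitality]

end EnrichedData

namespace FunctorData

variable {O : Type s} {O' : Type r} {A : EnrichedData W O} {B : EnrichedData W O'} {g : G}
  (F : FunctorData (A.base g) B)

/-- Preservation of composition by the action of a functor `ᵍA ⟶ B` on generalized elements. -/
def elemOnComp {x y z : O} (a : Elem (A.hom x y)) (b : Elem (A.hom y z)) :
    pushObj (B.comp _ _ _) (box (pushObj (F.map y z) (actObj g b))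
        (pushObj (F.map x y) (actObj g a))) ≅
      pushObj (F.map x z) (actObj g (pushObj (A.comp x y z) (box b a))) :=
  F.elemMapComp (actObj g a) (actObj g b) ≪≫ pushIso (F.map x z) (A.elemActComp g a b)

/-- Preservation of identities by the action of a functor `ᵍA ⟶ B` on generalized elements. -/
def elemOnId (x : O) :
    pushObj (F.map x x) (actObj g (point (A.id x))) ≅ point (B.id (F.obj x)) :=
  pushIso (F.map x x) (A.elemActId g x).symm ≪≫ F.elemMapId x

lemma elemOnComp_hom {x y z : O} (a : Elem (A.hom x y)) (b : Elem (A.hom y z)) :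
    (F.elemOnComp a b).hom = (F.elemMapComp (actObj g a) (actObj g b)).hom ≫
      pushMap (F.map x z) (A.elemActComp g a b).hom := rfl

lemma elemOnId_hom (x : O) :
    (F.elemOnId x).hom = pushMap (F.map x x) (A.elemActId g x).inv ≫ (F.elemMapId x).hom := rfl

lemma elemOnComp_natural {x y z : O} {a a' : Elem (A.hom x y)} {b b' : Elem (A.hom y z)}
    (m : a ⟶ a') (n : b ⟶ b') :
    pushMap (B.comp _ _ _) (boxMap (pushMap (F.map y z) (actMap g n))
        (pushMap (F.map x y) (actMap g m))) ≫ (F.elemOnComp a' b').hom =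
      (F.elemOnComp a b).hom ≫
        pushMap (F.map x z) (actMap g (pushMap (A.comp x y z) (boxMap n m))) := by
  rw [elemOnComp_hom, elemOnComp_hom, sq_assoc (F.elemMapComp_natural _ _), ← pushMap_comp,
    A.elemActComp_natural, pushMap_comp, Category.assoc]

variable {F}

lemma IsLawful.elemOn_assoc (hF : F.IsLawful) {w x y z : O} (a : Elem (A.hom w x))
    (b : Elem (A.hom x y)) (c : Elem (A.hom y z)) :
    pushMap (B.comp _ _ _) (boxMap (F.elemOnComp b c).hom (𝟙 (pushObj (F.map w x) (actObj g a)))) ≫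
        (F.elemOnComp a (pushObj (A.comp x y z) (box c b))).hom ≫
        pushMap (F.map w z) (actMap g (A.elemAssoc a b c).hom) =
      (B.elemAssoc _ _ _).hom ≫
        pushMap (B.comp _ _ _) (boxMap (𝟙 (pushObj (F.map y z) (actObj g c)))
          (F.elemOnComp a b).hom) ≫
        (F.elemOnComp (pushObj (A.comp w x y) (box b a)) c).hom := by
  have h1 := F.elemMapComp_natural (𝟙 (actObj g a)) (A.elemActComp g b c).hom
  have h2 := F.elemMapComp_natural (A.elemActComp g a b).hom (𝟙 (actObj g c))
  have h3 := congrArg (pushMap (F.map w z)) (A.elemAct_assoc g a b c)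
  have h4 := hF.elem_map_assoc (actObj g a) (actObj g b) (actObj g c)
  rw [pushMap_id] at h1 h2
  simp only [pushMap_comp] at h3
  simp only [elemOnComp_hom, boxMap_comp_id, boxMap_id_comp, pushMap_comp, Category.assoc]
  rw [sq_assoc h1, h3, sq_assoc₃ h4, sq_assoc h2]
  simp only [Category.assoc]

lemma IsLawful.elemOn_leftUnitor (hF : F.IsLawful) {x y : O} (a : Elem (A.hom x y)) :
    (F.elemOnComp a (point (A.id y))).hom ≫
        pushMap (F.map x y) (actMap g (A.elemLeftUnitor a).hom) =
      pushMap (B.comp _ _ _) (boxMap (F.elemOnId y).hom (𝟙 (pushObj (F.map x y) (actObj g a)))) ≫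
        (B.elemLeftUnitor (pushObj (F.map x y) (actObj g a))).hom := by
  have h1 := F.elemMapComp_natural (𝟙 (actObj g a)) (A.elemActId g y).inv
  have h3 := congrArg (pushMap (F.map x y)) (A.elemAct_leftUnitor g a)
  have h4 := hF.elem_map_leftUnitor (actObj g a)
  rw [pushMap_id] at h1
  simp only [pushMap_comp] at h3
  simp only [elemOnComp_hom, elemOnId_hom, boxMap_comp_id, pushMap_comp, Category.assoc]
  rw [h3, ← sq_assoc h1, h4]

lemma IsLawful.elemOn_rightUnitor (hF : F.IsLawful) {x y : O} (a : Elem (A.hom x y)) :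
    (F.elemOnComp (point (A.id x)) a).hom ≫
        pushMap (F.map x y) (actMap g (A.elemRightUnitor a).hom) =
      pushMap (B.comp _ _ _) (boxMap (𝟙 (pushObj (F.map x y) (actObj g a))) (F.elemOnId x).hom) ≫
        (B.elemRightUnitor (pushObj (F.map x y) (actObj g a))).hom := by
  have h1 := F.elemMapComp_natural (A.elemActId g x).inv (𝟙 (actObj g a))
  have h3 := congrArg (pushMap (F.map x y)) (A.elemAct_rightUnitor g a)
  have h4 := hF.elem_map_rightUnitor (actObj g a)
  rw [pushMap_id] at h1
  simp only [pushMap_comp] at h3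
  simp only [elemOnComp_hom, elemOnId_hom, boxMap_id_comp, pushMap_comp, Category.assoc]
  rw [h3, ← sq_assoc h1, h4]

end FunctorData

namespace EnrichedBicategory

variable {O : Type s} {A : EnrichedBicategory W O} {g : G}

lemma elemOn_associator {F : FunctorData (A.base g) A.toEnrichedData} (hF : F.IsLawful)
    {w x y z : O} (a : Elem (A.hom w x)) (b : Elem (A.hom x y)) (c : Elem (A.hom y z)) :
    pushMap (F.map w z) (actMap g (A.elemAssoc a b c).inv) =
      (F.elemOnComp (pushObj (A.comp w x y) (box b a)) c).inv ≫
        pushMap (A.comp _ _ _) (boxMap (𝟙 (pushObj (F.map y z) (actObj g c)))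
          (F.elemOnComp a b).inv) ≫ (A.elemAssoc _ _ _).inv ≫
        pushMap (A.comp _ _ _) (boxMap (F.elemOnComp b c).hom
          (𝟙 (pushObj (F.map w x) (actObj g a)))) ≫
        (F.elemOnComp a (pushObj (A.comp x y z) (box c b))).hom := by
  let e := pushIso (A.comp _ _ _)
    (boxIso (Iso.refl (pushObj (F.map y z) (actObj g c))) (F.elemOnComp a b))
  refine (Iso.eq_inv_comp _).2 (((Iso.eq_inv_comp e).2 ((Iso.eq_inv_comp (A.elemAssoc _ _ _)).2 ?_)))
  have h : pushMap (F.map w z) (actMap g (A.elemAssoc a b c).hom) ≫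
      pushMap (F.map w z) (actMap g (A.elemAssoc a b c).inv) = 𝟙 _ := by
    rw [← pushMap_comp, ← actMap_comp, Iso.hom_inv_id, actMap_id, pushMap_id]
  have h1 := congrArg (fun q => q ≫ pushMap (F.map w z) (actMap g (A.elemAssoc a b c).inv))
    (hF.elemOn_assoc a b c)
  simp only [Category.assoc, h, Category.comp_id] at h1
  exact h1.symm

end EnrichedBicategory

namespace FunctorData.IsLawful

variable {O : Type s} {A : EnrichedBicategory W O} {g : G}
  {F : FunctorData (A.base g) A.toEnrichedData} (hF : F.IsLawful)

/-- The pseudofunctor on generalized elements induced by a functor `ᵍA ⟶ A`. -/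
def pseudofunctor : Pseudofunctor A.Generalized A.Generalized where
  obj x := F.obj x
  map {x y} a := pushObj (F.map x y) (actObj g a)
  map₂ {x y _ _} m := pushMap (F.map x y) (actMap g m)
  map₂_id {x y} a := (congrArg (pushMap _) (actMap_id g a)).trans (pushMap_id _ _)
  map₂_comp {x y _ _ _} m n := (congrArg (pushMap _) (actMap_comp g m n)).trans (pushMap_comp _ _ _)
  mapId x := F.elemOnId x
  mapComp a b := (F.elemOnComp a b).symm
  map₂_whisker_left {x y z} a b c m := by
    refine ((Iso.eq_inv_comp (F.elemOnComp a b)).2 ((F.elemOnComp_natural (𝟙 a) m).symm.trans ?_))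
    exact congrArg (fun q => pushMap (A.comp _ _ _) (boxMap (pushMap (F.map y z) (actMap g m)) q) ≫
      (F.elemOnComp a c).hom) ((congrArg (pushMap _) (actMap_id g a)).trans (pushMap_id _ _))
  map₂_whisker_right {x y z} a b m c := by
    refine ((Iso.eq_inv_comp (F.elemOnComp a c)).2 ((F.elemOnComp_natural m (𝟙 c)).symm.trans ?_))
    exact congrArg (fun q => pushMap (A.comp _ _ _) (boxMap q (pushMap (F.map x y) (actMap g m))) ≫
      (F.elemOnComp b c).hom) ((congrArg (pushMap _) (actMap_id g c)).trans (pushMap_id _ _))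
  map₂_associator a b c := EnrichedBicategory.elemOn_associator hF a b c
  map₂_left_unitor {x y} a := (Iso.eq_inv_comp (F.elemOnComp (point (A.id x)) a)).2
    (hF.elemOn_rightUnitor a)
  map₂_right_unitor {x y} a := (Iso.eq_inv_comp (F.elemOnComp a (point (A.id y)))).2
    (hF.elemOn_leftUnitor a)

end FunctorData.IsLawful

end Actions
end TwistedBicat

namespace TwistedBicat

attribute [-simp] MonoidalCategory.tensorHom_id MonoidalCategory.id_tensorHom
  MonoidalCategory.associator_conjugation
attribute [local simp] MonoidalCategory.id_tensorHom_id MonoidalCategory.tensorHom_comp_tensorHom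
  MonoidalCategory.tensorHom_comp_tensorHom_assoc MonoidalCategory.associator_naturality
  MonoidalCategory.associator_naturality_assoc

local infixr:81 " ◃ " => Bicategory.whiskerLeft
local infixl:81 " ▹ " => Bicategory.whiskerRight

open MonoidalTwoCategory

open Elem

section Transformations

variable {W : Type u} [Bicategory.{w, v} W] [Bicategory.Strict W] [MonoidalTwoCategory W]

namespace EnrichedData
variable {O : Type s} {A : EnrichedData W O}

lemma elemAssoc_inv {w x y z : O} (a : Elem (A.hom w x)) (b : Elem (A.hom x y))
    (c : Elem (A.hom y z)) :
    (A.elemAssoc a b c).inv =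
      st (pushObj (A.comp w y z) (box c (pushObj (A.comp w x y) (box b a))))
        (pushObj ((α_ (A.hom y z) (A.hom x y) (A.hom w x)).hom ≫
          (𝟙 (A.hom y z) ⊗ₘ A.comp w x y) ≫ A.comp w y z) (box (box c b) a))
        (α_ c.src b.src a.src).inv (by simp) ≫ ev (A.assoc w x y z).inv (box (box c b) a) ≫
      st (pushObj ((A.comp x y z ⊗ₘ 𝟙 (A.hom w x)) ≫ A.comp w x z) (box (box c b) a))
        (pushObj (A.comp w x z) (box (pushObj (A.comp x y z) (box c b)) a)) (𝟙 _)
        (by simp) :=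
  Category.assoc _ _ _

lemma val_post {w x y : O} (f : A.El x y) (a : Elem (A.hom w x)) :
    (pushObj (post f w) a).val =
      (λ_ a.src).inv ≫ (pushObj (A.comp w x y) (box (point f) a)).val := by
  simp [post, reassoc_of% leftUnitor_inv_point f a.val]

lemma val_comp_point_left {w x y : O} (f : A.El x y) (a : Elem (A.hom w x)) :
    (pushObj (A.comp w x y) (box (point f) a)).val =
      (λ_ a.src).hom ≫ (pushObj (post f w) a).val := by
  rw [val_post, Iso.hom_inv_id_assoc]

lemma val_pre {x y z : O} (f : A.El x y) (a : Elem (A.hom y z)) :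
    (pushObj (pre f z) a).val =
      (ρ_ a.src).inv ≫ (pushObj (A.comp x y z) (box a (point f))).val := by
  simp [pre, reassoc_of% rightUnitor_inv_point f a.val]

lemma val_comp_point_right {x y z : O} (f : A.El x y) (a : Elem (A.hom y z)) :
    (pushObj (A.comp x y z) (box a (point f))).val =
      (ρ_ a.src).hom ≫ (pushObj (pre f z) a).val := by
  rw [val_pre, Iso.hom_inv_id_assoc]

/-- Postcomposition with `f`, on generalized elements. -/
def elemPost {w x y : O} (f : A.El x y) (a : Elem (A.hom w x)) :
    pushObj (post f w) a ≅ pushObj (A.comp w x y) (box (point f) a) :=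
  stIso _ _ (λ_ a.src).symm (val_post f a)

lemma elemPost_hom {w x y : O} (f : A.El x y) (a : Elem (A.hom w x)) :
    (elemPost f a).hom =
      st (pushObj (post f w) a) (pushObj (A.comp w x y) (box (point f) a)) (λ_ a.src).inv
        (val_post f a) := rfl

lemma elemPost_inv {w x y : O} (f : A.El x y) (a : Elem (A.hom w x)) :
    (elemPost f a).inv =
      st (pushObj (A.comp w x y) (box (point f) a)) (pushObj (post f w) a) (λ_ a.src).hom
        (val_comp_point_left f a) := rfl

/-- Precomposition with `f`, on generalized elements. -/
def elemPre {x y z : O} (f : A.El x y) (a : Elem (A.hom y z)) :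
    pushObj (pre f z) a ≅ pushObj (A.comp x y z) (box a (point f)) :=
  stIso _ _ (ρ_ a.src).symm (val_pre f a)

lemma elemPre_hom {x y z : O} (f : A.El x y) (a : Elem (A.hom y z)) :
    (elemPre f a).hom =
      st (pushObj (pre f z) a) (pushObj (A.comp x y z) (box a (point f))) (ρ_ a.src).inv
        (val_pre f a) := rfl

lemma elemPre_inv {x y z : O} (f : A.El x y) (a : Elem (A.hom y z)) :
    (elemPre f a).inv =
      st (pushObj (A.comp x y z) (box a (point f))) (pushObj (pre f z) a) (ρ_ a.src).hom
        (val_comp_point_right f a) := rfl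

lemma elemPost_natural {w x y : O} (f : A.El x y) {a a' : Elem (A.hom w x)} (m : a ⟶ a') :
    pushMap (post f w) m ≫ (elemPost f a').hom =
      (elemPost f a).hom ≫ pushMap (A.comp w x y) (boxMap (𝟙 (point f)) m) := by
  have h := pushMap_congr
    (show post f w = (λ_ (A.hom w x)).inv ≫ (f ⊗ₘ 𝟙 (A.hom w x)) ≫ A.comp w x y by rw [post]) m
  rw [elemPost_hom, elemPost_hom, h]
  simp

lemma elemPre_natural {x y z : O} (f : A.El x y) {a a' : Elem (A.hom y z)} (m : a ⟶ a') :
    pushMap (pre f z) m ≫ (elemPre f a').hom =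
      (elemPre f a).hom ≫ pushMap (A.comp x y z) (boxMap m (𝟙 (point f))) := by
  have h := pushMap_congr
    (show pre f z = (ρ_ (A.hom y z)).inv ≫ (𝟙 (A.hom y z) ⊗ₘ f) ≫ A.comp x y z by rw [pre]) m
  rw [elemPre_hom, elemPre_hom, h]
  simp

lemma ev_postComp {v w x y : O} (f : A.El x y) (a : Elem (A.hom v w)) (b : Elem (A.hom w x)) :
    ev (postComp f v w).hom (box b a) =
      st (pushObj (A.comp v w x ≫ post f v) (box b a)) (pushObj (post f v) (pushObj (A.comp v w x) (box b a)))
        (𝟙 _) (by simp) ≫ (elemPost f (pushObj (A.comp v w x) (box b a))).hom ≫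
      (A.elemAssoc a b (point f)).inv ≫
      pushMap (A.comp v w y) (boxMap (elemPost f b).inv (𝟙 a)) ≫
      st (pushObj (A.comp v w y) (box (pushObj (post f w) b) a))
        (pushObj ((post f w ⊗ₘ 𝟙 (A.hom v w)) ≫ A.comp v w y) (box b a)) (𝟙 _) (by simp) := by
  simp only [postComp, elemAssoc_inv, elemPost_hom, elemPost_inv, Iso.trans_hom, eqToIso.hom,
    Bicategory.whiskerLeftIso_hom, Iso.symm_hom, ev_comp, ev_eqToHom, ev_whiskerLeft]
  rw [ev_eq (A.assoc v w x y).inv (a := box (box (point f) b) a)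
    (b := pushObj _ (box b a))
    (MonoidalCategory.tensorIso (λ_ b.src) (Iso.refl a.src)) (by simp [leftUnitor_inv_point])]
  have hp : (λ_ (b.src ⊗ a.src)).inv ≫ (α_ (𝟙_ W) b.src a.src).inv = (λ_ b.src).inv ⊗ₘ 𝟙 a.src := by
    rw [MonoidalCategory.tensorHom_id]; simp
  simp [hp]

lemma ev_preComp {x y z t : O} (f : A.El x y) (a : Elem (A.hom y z)) (b : Elem (A.hom z t)) :
    ev (preComp f z t).hom (box b a) =
      st (pushObj ((𝟙 (A.hom z t) ⊗ₘ pre f z) ≫ A.comp x z t) (box b a))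
        (pushObj (A.comp x z t) (box b (pushObj (pre f z) a))) (𝟙 _) (by simp) ≫
      pushMap (A.comp x z t) (boxMap (𝟙 b) (elemPre f a).hom) ≫
      (A.elemAssoc (point f) a b).inv ≫ (elemPre f (pushObj (A.comp y z t) (box b a))).inv ≫
      st (pushObj (pre f t) (pushObj (A.comp y z t) (box b a)))
        (pushObj (A.comp y z t ≫ pre f t) (box b a)) (𝟙 _) (by simp) := by
  simp only [preComp, elemAssoc_inv, elemPre_hom, elemPre_inv, Iso.trans_hom, eqToIso.hom,
    Bicategory.whiskerLeftIso_hom, Iso.symm_hom, ev_comp, ev_eqToHom, ev_whiskerLeft]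
  rw [ev_eq (A.assoc x y z t).inv (a := box (box b a) (point f))
    (b := pushObj _ (box b a))
    (ρ_ (b.src ⊗ a.src)) (by simp [rightUnitor_inv_point])]
  have hp : (𝟙 b.src ⊗ₘ (ρ_ a.src).inv) ≫ (α_ b.src a.src (𝟙_ W)).inv = (ρ_ (b.src ⊗ a.src)).inv := by
    rw [MonoidalCategory.id_tensorHom]; simp
  simp [hp]

lemma ev_midComp {w x y z : O} (f : A.El x y) (a : Elem (A.hom w x)) (b : Elem (A.hom y z)) :
    ev (midComp f w z).hom (box b a) =
      st (pushObj ((pre f z ⊗ₘ 𝟙 (A.hom w x)) ≫ A.comp w x z) (box b a))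
        (pushObj (A.comp w x z) (box (pushObj (pre f z) b) a)) (𝟙 _) (by simp) ≫
      pushMap (A.comp w x z) (boxMap (elemPre f b).hom (𝟙 a)) ≫
      (A.elemAssoc a (point f) b).hom ≫
      pushMap (A.comp w y z) (boxMap (𝟙 b) (elemPost f a).inv) ≫
      st (pushObj (A.comp w y z) (box b (pushObj (post f w) a)))
        (pushObj ((𝟙 (A.hom y z) ⊗ₘ post f w) ≫ A.comp w y z) (box b a)) (𝟙 _) (by simp) := by
  simp only [midComp, elemAssoc_hom, elemPre_hom, elemPost_inv, Iso.trans_hom, eqToIso.hom,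
    Bicategory.whiskerLeftIso_hom, Iso.symm_hom, ev_comp, ev_eqToHom, ev_whiskerLeft]
  rw [ev_eq (A.assoc w x y z).hom (a := box (box b (point f)) a)
    (b := pushObj _ (box b a))
    (MonoidalCategory.tensorIso (ρ_ b.src) (Iso.refl a.src)) (by simp [rightUnitor_inv_point])]
  have hp : (α_ b.src (𝟙_ W) a.src).hom ≫ (𝟙 b.src ⊗ₘ (λ_ a.src).hom) = (ρ_ b.src).hom ⊗ₘ 𝟙 a.src := by
    rw [MonoidalCategory.id_tensorHom, MonoidalCategory.tensorHom_id]; simp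
  simp [hp]

lemma val_gcomp {x y z : O} (f : A.El x y) (g : A.El y z) :
    (point (gcomp f g)).val =
      (λ_ (𝟙_ W)).inv ≫ (pushObj (A.comp x y z) (box (point g) (point f))).val :=
  val_post g (point f)

lemma val_comp_point_point {x y z : O} (f : A.El x y) (g : A.El y z) :
    (pushObj (A.comp x y z) (box (point g) (point f))).val =
      (λ_ (𝟙_ W)).hom ≫ (point (gcomp f g)).val :=
  val_comp_point_left g (point f)

/-- The composite of points, as a composite of generalized elements. -/
def elemGcomp {x y z : O} (f : A.El x y) (g : A.El y z) :
    point (gcomp f g) ≅ pushObj (A.comp x y z) (box (point g) (point f)) :=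
  stIso _ _ (λ_ (𝟙_ W)).symm (val_gcomp f g)

lemma elemGcomp_hom {x y z : O} (f : A.El x y) (g : A.El y z) :
    (elemGcomp f g).hom = st (point (gcomp f g)) (pushObj (A.comp x y z) (box (point g) (point f)))
      (λ_ (𝟙_ W)).inv (val_gcomp f g) := rfl

lemma elemGcomp_inv {x y z : O} (f : A.El x y) (g : A.El y z) :
    (elemGcomp f g).inv = st (pushObj (A.comp x y z) (box (point g) (point f))) (point (gcomp f g))
      (λ_ (𝟙_ W)).hom (val_comp_point_point f g) := rfl

lemma ev_postGcomp {w x y z : O} (f : A.El x y) (g : A.El y z) (a : Elem (A.hom w x)) :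
    ev (postGcomp f g w).hom a =
      (elemPost (gcomp f g) a).hom ≫
      pushMap (A.comp w x z) (boxMap (elemGcomp f g).hom (𝟙 a)) ≫
      (A.elemAssoc a (point f) (point g)).hom ≫
      pushMap (A.comp w y z) (boxMap (𝟙 (point g)) (elemPost f a).inv) ≫
      (elemPost g (pushObj (post f w) a)).inv ≫
      st (pushObj (post g w) (pushObj (post f w) a)) (pushObj (post f w ≫ post g w) a) (𝟙 _)
        (by simp) := by
  simp only [postGcomp, Iso.trans_hom, eqToIso.hom,
    Bicategory.whiskerLeftIso_hom, Iso.symm_hom, ev_comp, ev_eqToHom, ev_whiskerLeft]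
  simp only [postComp, elemAssoc_hom, elemPost_hom, elemPost_inv, elemGcomp_hom, Iso.trans_hom,
    Iso.trans_inv, eqToIso.hom, eqToIso.inv, Bicategory.whiskerLeftIso_inv,
    Bicategory.whiskerLeftIso_hom, Iso.symm_hom, Iso.symm_inv, ev_comp, ev_eqToHom, ev_whiskerLeft]
  rw [ev_eq (A.assoc w x y z).hom (a := box (box (point g) (point f)) a)
    (b := pushObj _ (pushObj _ a))
    (MonoidalCategory.tensorIso (λ_ _) (Iso.refl a.src) ≪≫ λ_ _)
    (by simp [leftUnitor_inv_point])]
  have hp : (α_ (𝟙_ W) (𝟙_ W) a.src).hom ≫ (𝟙 (𝟙_ W) ⊗ₘ (λ_ a.src).hom) ≫ (λ_ a.src).hom =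
      ((λ_ (𝟙_ W)).hom ⊗ₘ 𝟙 a.src) ≫ (λ_ a.src).hom := by
    rw [MonoidalCategory.id_tensorHom, MonoidalCategory.tensorHom_id]; monoidal
  simp [hp]

lemma ev_prePost {x' x y y' : O} (f : A.El x' x) (g : A.El y y') (a : Elem (A.hom x y)) :
    ev (prePost f g).hom a =
      st (pushObj (pre f y ≫ post g x') a) (pushObj (post g x') (pushObj (pre f y) a)) (𝟙 _)
        (by simp) ≫ (elemPost g (pushObj (pre f y) a)).hom ≫
      pushMap (A.comp x' y y') (boxMap (𝟙 (point g)) (elemPre f a).hom) ≫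
      (A.elemAssoc (point f) a (point g)).inv ≫
      pushMap (A.comp x' x y') (boxMap (elemPost g a).inv (𝟙 (point f))) ≫
      (elemPre f (pushObj (post g x) a)).inv ≫
      st (pushObj (pre f y') (pushObj (post g x) a)) (pushObj (post g x ≫ pre f y') a) (𝟙 _)
        (by simp) := by
  simp only [prePost, Iso.trans_hom, eqToIso.hom,
    Bicategory.whiskerLeftIso_hom, Iso.symm_hom, ev_comp, ev_eqToHom, ev_whiskerLeft]
  rw [ev_eq (postComp g x' x).hom (a := box a (point f))
    (b := pushObj _ a)
    (ρ_ _) (by simp [rightUnitor_inv_point]), ev_postComp]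
  have hp : (λ_ a.src).inv ≫ (𝟙 (𝟙_ W) ⊗ₘ (ρ_ a.src).inv) =
      (ρ_ a.src).inv ≫ (λ_ (a.src ⊗ 𝟙_ W)).inv := by
    rw [MonoidalCategory.id_tensorHom]; monoidal
  simp [elemPost_hom, elemPre_hom, elemPre_inv, elemPost_inv, hp]

lemma ev_preGcomp {x y z t : O} (f : A.El x y) (g : A.El y z) (a : Elem (A.hom z t)) :
    ev (preGcomp f g t).hom a =
      (elemPre (gcomp f g) a).hom ≫
      pushMap (A.comp x z t) (boxMap (𝟙 a) (elemGcomp f g).hom) ≫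
      (A.elemAssoc (point f) (point g) a).inv ≫
      pushMap (A.comp x y t) (boxMap (elemPre g a).inv (𝟙 (point f))) ≫
      (elemPre f (pushObj (pre g t) a)).inv ≫
      st (pushObj (pre f t) (pushObj (pre g t) a)) (pushObj (pre g t ≫ pre f t) a) (𝟙 _)
        (by simp) := by
  simp only [preGcomp, Iso.trans_hom, eqToIso.hom,
    Bicategory.whiskerLeftIso_hom, Iso.symm_hom, ev_comp, ev_eqToHom, ev_whiskerLeft]
  simp only [midComp, elemAssoc_inv, elemPre_hom, elemPre_inv, elemGcomp_hom, Iso.trans_hom,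
    Iso.trans_inv, eqToIso.hom, eqToIso.inv, Bicategory.whiskerLeftIso_inv,
    Bicategory.whiskerLeftIso_hom, Iso.symm_hom, Iso.symm_inv, ev_comp, ev_eqToHom, ev_whiskerLeft]
  rw [ev_eq (A.assoc x y z t).inv (a := box (box a (point g)) (point f))
    (b := pushObj _ (pushObj _ a))
    (MonoidalCategory.tensorIso (ρ_ _) (Iso.refl _) ≪≫ ρ_ _)
    (by simp [rightUnitor_inv_point])]
  have hp : (ρ_ a.src).inv ≫ (𝟙 a.src ⊗ₘ (λ_ (𝟙_ W)).inv) ≫ (α_ a.src (𝟙_ W) (𝟙_ W)).inv =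
      (ρ_ a.src).inv ≫ ((ρ_ a.src).inv ⊗ₘ 𝟙 (𝟙_ W)) := by
    rw [MonoidalCategory.id_tensorHom, MonoidalCategory.tensorHom_id]; monoidal
  have hp' : (ρ_ (a.src ⊗ 𝟙_ W)).hom ≫ (ρ_ a.src).hom =
      ((ρ_ a.src).hom ⊗ₘ 𝟙 (𝟙_ W)) ≫ (ρ_ a.src).hom := by
    rw [MonoidalCategory.tensorHom_id]; monoidal
  simp [hp, hp']

end EnrichedData

namespace FunctorData

open EnrichedData

variable {O : Type s} {O' : Type t} {A : EnrichedData W O} {B : EnrichedData W O'}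
  (F : FunctorData A B)

lemma val_mapEl {x y : O} (f : A.El x y) :
    (point (F.mapEl f)).val = 𝟙 (𝟙_ W) ≫ (pushObj (F.map x y) (point f)).val :=
  (Category.id_comp _).symm

lemma val_map_point {x y : O} (f : A.El x y) :
    (pushObj (F.map x y) (point f)).val = 𝟙 (𝟙_ W) ≫ (point (F.mapEl f)).val :=
  (Category.id_comp _).symm

/-- The image of a 1-cell, as the image of a generalized element. -/
def elemMapEl {x y : O} (f : A.El x y) : point (F.mapEl f) ≅ pushObj (F.map x y) (point f) :=
  stIso _ _ (Iso.refl _) (F.val_mapEl f)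

lemma elemMapEl_hom {x y : O} (f : A.El x y) :
    (F.elemMapEl f).hom =
      st (point (F.mapEl f)) (pushObj (F.map x y) (point f)) (𝟙 _) (F.val_mapEl f) := rfl

lemma elemMapEl_inv {x y : O} (f : A.El x y) :
    (F.elemMapEl f).inv =
      st (pushObj (F.map x y) (point f)) (point (F.mapEl f)) (𝟙 _) (F.val_map_point f) := rfl

lemma ev_mapPost {w x y : O} (f : A.El x y) (a : Elem (A.hom w x)) :
    ev (F.mapPost f w).hom a =
      st (pushObj (F.map w x ≫ post (F.mapEl f) (F.obj w)) a)
        (pushObj (post (F.mapEl f) (F.obj w)) (pushObj (F.map w x) a)) (𝟙 _) (by simp) ≫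
      (elemPost (F.mapEl f) (pushObj (F.map w x) a)).hom ≫
      pushMap (B.comp _ _ _) (boxMap (F.elemMapEl f).hom (𝟙 (pushObj (F.map w x) a))) ≫
      (F.elemMapComp a (point f)).hom ≫ pushMap (F.map w y) (elemPost f a).inv ≫
      st (pushObj (F.map w y) (pushObj (post f w) a)) (pushObj (post f w ≫ F.map w y) a) (𝟙 _)
        (by simp) := by
  simp only [mapPost, Iso.trans_hom, eqToIso.hom,
    Bicategory.whiskerLeftIso_hom, Iso.symm_hom, ev_comp, ev_eqToHom, ev_whiskerLeft]
  rw [ev_eq (F.mapComp w x y).hom (a := box (point f) a)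
    (b := pushObj _ a)
    (λ_ _) (by simp [leftUnitor_inv_point])]
  simp [elemPost_hom, elemPost_inv, elemMapComp_hom, elemMapEl_hom]

lemma ev_mapPre {x y z : O} (f : A.El x y) (a : Elem (A.hom y z)) :
    ev (F.mapPre f z).hom a =
      st (pushObj (F.map y z ≫ pre (F.mapEl f) (F.obj z)) a)
        (pushObj (pre (F.mapEl f) (F.obj z)) (pushObj (F.map y z) a)) (𝟙 _) (by simp) ≫
      (elemPre (F.mapEl f) (pushObj (F.map y z) a)).hom ≫
      pushMap (B.comp _ _ _) (boxMap (𝟙 (pushObj (F.map y z) a)) (F.elemMapEl f).hom) ≫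
      (F.elemMapComp (point f) a).hom ≫ pushMap (F.map x z) (elemPre f a).inv ≫
      st (pushObj (F.map x z) (pushObj (pre f z) a)) (pushObj (pre f z ≫ F.map x z) a) (𝟙 _)
        (by simp) := by
  simp only [mapPre, Iso.trans_hom, eqToIso.hom,
    Bicategory.whiskerLeftIso_hom, Iso.symm_hom, ev_comp, ev_eqToHom, ev_whiskerLeft]
  rw [ev_eq (F.mapComp x y z).hom (a := box a (point f))
    (b := pushObj _ a)
    (ρ_ _) (by simp [rightUnitor_inv_point])]
  simp [elemPre_hom, elemPre_inv, elemMapComp_hom, elemMapEl_hom]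

end FunctorData
end Transformations
end TwistedBicat

namespace TwistedBicat

attribute [-simp] MonoidalCategory.tensorHom_id MonoidalCategory.id_tensorHom
  MonoidalCategory.associator_conjugation
attribute [local simp] MonoidalCategory.id_tensorHom_id MonoidalCategory.tensorHom_comp_tensorHom
  MonoidalCategory.tensorHom_comp_tensorHom_assoc MonoidalCategory.associator_naturality
  MonoidalCategory.associator_naturality_assoc

local infixr:81 " ◃ " => Bicategory.whiskerLeft
local infixl:81 " ▹ " => Bicategory.whiskerRight

open MonoidalTwoCategory

open Elem EnrichedData

set_option linter.unusedSectionVars false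

section Transformations

variable {W : Type u} [Bicategory.{w, v} W] [Bicategory.Strict W] [MonoidalTwoCategory W]

namespace Elem

variable {X Y : W}

@[simp] lemma pushMap_hom_inv_assoc (f : X ⟶ Y) {a b : Elem X} (e : a ≅ b) {c : Elem Y}
    (m : pushObj f a ⟶ c) : pushMap f e.hom ≫ pushMap f e.inv ≫ m = m :=
  (pushIso f e).hom_inv_id_assoc m

@[simp] lemma pushMap_inv_hom_assoc (f : X ⟶ Y) {a b : Elem X} (e : a ≅ b) {c : Elem Y}
    (m : pushObj f b ⟶ c) : pushMap f e.inv ≫ pushMap f e.hom ≫ m = m :=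
  (pushIso f e).inv_hom_id_assoc m

lemma st_cancel {a b c d : Elem X} {m n : b ⟶ c} {p : a.src ≅ b.src} {h : a.val = p.hom ≫ b.val}
    {q : c.src ≅ d.src} {h' : c.val = q.hom ≫ d.val}
    (w : st a b p.hom h ≫ m ≫ st c d q.hom h' = st a b p.hom h ≫ n ≫ st c d q.hom h') : m = n :=
  (cancel_mono (stIso c d q h').hom).1 ((cancel_epi (stIso a b p h).hom).1 w)

variable {Z : W}

@[simp] lemma pushMap_box_hom_inv_assoc (f : X ⊗ Y ⟶ Z) {a b : Elem X} (e : a ≅ b) (c : Elem Y)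
    {d : Elem Z} (m : pushObj f (box a c) ⟶ d) :
    pushMap f (boxMap e.hom (𝟙 c)) ≫ pushMap f (boxMap e.inv (𝟙 c)) ≫ m = m :=
  (pushIso f (boxIso e (Iso.refl c))).hom_inv_id_assoc m

@[simp] lemma pushMap_box_inv_hom_assoc (f : X ⊗ Y ⟶ Z) {a b : Elem X} (e : a ≅ b) (c : Elem Y)
    {d : Elem Z} (m : pushObj f (box b c) ⟶ d) :
    pushMap f (boxMap e.inv (𝟙 c)) ≫ pushMap f (boxMap e.hom (𝟙 c)) ≫ m = m :=
  (pushIso f (boxIso e (Iso.refl c))).inv_hom_id_assoc m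

@[simp] lemma pushMap_box_hom_inv_assoc' (f : X ⊗ Y ⟶ Z) (c : Elem X) {a b : Elem Y} (e : a ≅ b)
    {d : Elem Z} (m : pushObj f (box c a) ⟶ d) :
    pushMap f (boxMap (𝟙 c) e.hom) ≫ pushMap f (boxMap (𝟙 c) e.inv) ≫ m = m :=
  (pushIso f (boxIso (Iso.refl c) e)).hom_inv_id_assoc m

@[simp] lemma pushMap_box_inv_hom_assoc' (f : X ⊗ Y ⟶ Z) (c : Elem X) {a b : Elem Y} (e : a ≅ b)
    {d : Elem Z} (m : pushObj f (box c b) ⟶ d) :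
    pushMap f (boxMap (𝟙 c) e.inv) ≫ pushMap f (boxMap (𝟙 c) e.hom) ≫ m = m :=
  (pushIso f (boxIso (Iso.refl c) e)).inv_hom_id_assoc m

end Elem

namespace EnrichedData
variable {O : Type s} {A : EnrichedData W O}

lemma pushMap_post {w x y : O} (f : A.El x y) {a a' : Elem (A.hom w x)} (m : a ⟶ a') :
    pushMap (post f w) m =
      (elemPost f a).hom ≫ pushMap (A.comp w x y) (boxMap (𝟙 (point f)) m) ≫
        (elemPost f a').inv := by
  rw [← sq_assoc (elemPost_natural f m), Iso.hom_inv_id, Category.comp_id]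

lemma pushMap_pre {x y z : O} (f : A.El x y) {a a' : Elem (A.hom y z)} (m : a ⟶ a') :
    pushMap (pre f z) m =
      (elemPre f a).hom ≫ pushMap (A.comp x y z) (boxMap m (𝟙 (point f))) ≫
        (elemPre f a').inv := by
  rw [← sq_assoc (elemPre_natural f m), Iso.hom_inv_id, Category.comp_id]

lemma ev_preGcomp_inv {x y z t : O} (f : A.El x y) (g : A.El y z) (a : Elem (A.hom z t)) :
    ev (preGcomp f g t).inv a =
      st (pushObj (pre g t ≫ pre f t) a) (pushObj (pre f t) (pushObj (pre g t) a)) (𝟙 _)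
        (by simp) ≫
      (elemPre f (pushObj (pre g t) a)).hom ≫
      pushMap (A.comp x y t) (boxMap (elemPre g a).hom (𝟙 (point f))) ≫
      (A.elemAssoc (point f) (point g) a).hom ≫
      pushMap (A.comp x z t) (boxMap (𝟙 a) (elemGcomp f g).inv) ≫
      (elemPre (gcomp f g) a).inv := by
  let e := elemPre (gcomp f g) a ≪≫
    pushIso (A.comp x z t) (boxIso (Iso.refl a) (elemGcomp f g)) ≪≫
      (A.elemAssoc (point f) (point g) a).symm ≪≫
      pushIso (A.comp x y t) (boxIso (elemPre g a).symm (Iso.refl (point f))) ≪≫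
      (elemPre f (pushObj (pre g t) a)).symm ≪≫
      stIso (pushObj (pre f t) (pushObj (pre g t) a)) (pushObj (pre g t ≫ pre f t) a) (Iso.refl _)
        (by simp)
  have h : evIso (preGcomp f g t) a = e := Iso.ext (ev_preGcomp f g a)
  refine (congrArg Iso.inv h).trans ?_
  simp only [e, Iso.trans_inv, Iso.symm_inv, Category.assoc]
  rfl

end EnrichedData

namespace FunctorData

variable {O : Type s} {O' : Type t} {A : EnrichedData W O} {B : EnrichedData W O'}
  (F : FunctorData A B)

lemma ev_mapComp {x y z : O} (a : Elem (A.hom x y)) (b : Elem (A.hom y z)) :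
    ev (F.mapComp x y z).hom (box b a) =
      st (pushObj ((F.map y z ⊗ₘ F.map x y) ≫ B.comp _ _ _) (box b a))
        (pushObj (B.comp _ _ _) (box (pushObj (F.map y z) b) (pushObj (F.map x y) a))) (𝟙 _)
        (by simp) ≫ (F.elemMapComp a b).hom ≫
      st (pushObj (F.map x z) (pushObj (A.comp x y z) (box b a)))
        (pushObj (A.comp x y z ≫ F.map x z) (box b a)) (𝟙 _) (by simp) := by
  simp [elemMapComp_hom]

lemma boxMap_elemMapEl_hom_st {Y : W} {x y : O} (f : A.El x y) {b b' : Elem Y}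
    (p : b.src ⟶ b'.src) (h : b.val = p ≫ b'.val) :
    boxMap (F.elemMapEl f).hom (st b b' p h) =
      st (box (point (F.mapEl f)) b) (box (pushObj (F.map x y) (point f)) b') (𝟙 (𝟙_ W) ⊗ₘ p)
        (by simp [h, mapEl]) :=
  boxMap_st (a := point (F.mapEl f)) (a' := pushObj (F.map x y) (point f)) (𝟙 (𝟙_ W))
    (by simp [mapEl]) p h

lemma boxMap_elemMapEl_hom_id {Y : W} {x y : O} (f : A.El x y) (b : Elem Y) :
    boxMap (F.elemMapEl f).hom (𝟙 b) =
      st (box (point (F.mapEl f)) b) (box (pushObj (F.map x y) (point f)) b) (𝟙 _)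
        (by simp [mapEl]) := by
  rw [← st_id b (by simp), boxMap_elemMapEl_hom_st]
  exact st_congr (by simp) _

lemma pushMap_boxMap_elemMapEl_hom_id {Y Z : W} {x y : O} (f : A.El x y) (b : Elem Y)
    (k : B.hom (F.obj x) (F.obj y) ⊗ Y ⟶ Z) :
    pushMap k (boxMap (F.elemMapEl f).hom (𝟙 b)) =
      st (pushObj k (box (point (F.mapEl f)) b)) (pushObj k (box (pushObj (F.map x y) (point f)) b))
        (𝟙 _) (by simp [mapEl]) := by
  rw [boxMap_elemMapEl_hom_id]
  exact pushMap_st (a := box (point (F.mapEl f)) b) (b := box (pushObj (F.map x y) (point f)) b)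
    k (𝟙 _) (by simp [mapEl])

lemma ev_mapPre_inv {x y z : O} (f : A.El x y) (a : Elem (A.hom y z)) :
    ev (F.mapPre f z).inv a =
      st (pushObj (pre f z ≫ F.map x z) a) (pushObj (F.map x z) (pushObj (pre f z) a)) (𝟙 _)
        (by simp) ≫ pushMap (F.map x z) (elemPre f a).hom ≫
      (F.elemMapComp (point f) a).inv ≫
      pushMap (B.comp _ _ _) (boxMap (𝟙 (pushObj (F.map y z) a)) (F.elemMapEl f).inv) ≫
      (elemPre (F.mapEl f) (pushObj (F.map y z) a)).inv ≫
      st (pushObj (pre (F.mapEl f) (F.obj z)) (pushObj (F.map y z) a))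
        (pushObj (F.map y z ≫ pre (F.mapEl f) (F.obj z)) a) (𝟙 _) (by simp) := by
  let e := stIso (pushObj (F.map y z ≫ pre (F.mapEl f) (F.obj z)) a)
        (pushObj (pre (F.mapEl f) (F.obj z)) (pushObj (F.map y z) a)) (Iso.refl _) (by simp) ≪≫
      elemPre (F.mapEl f) (pushObj (F.map y z) a) ≪≫
      pushIso (B.comp _ _ _) (boxIso (Iso.refl (pushObj (F.map y z) a)) (F.elemMapEl f)) ≪≫
      F.elemMapComp (point f) a ≪≫ pushIso (F.map x z) (elemPre f a).symm ≪≫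
      stIso (pushObj (F.map x z) (pushObj (pre f z) a)) (pushObj (pre f z ≫ F.map x z) a)
        (Iso.refl _) (by simp)
  have h : evIso (F.mapPre f z) a = e := Iso.ext (F.ev_mapPre f a)
  refine (congrArg Iso.inv h).trans ?_
  simp only [e, Iso.trans_inv, Iso.symm_inv, Category.assoc]
  rfl

end FunctorData

namespace TransData

variable {O : Type s} {O' : Type t} {A : EnrichedData W O} {B : EnrichedData W O'}
  {F H K : FunctorData A B} (φ : TransData F H)

/-- The naturality constraint of a transformation at a generalized element. -/
def elemNaturality {x y : O} (a : Elem (A.hom x y)) :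
    pushObj (B.comp _ _ _) (box (point (φ.app y)) (pushObj (F.map x y) a)) ≅
      pushObj (B.comp _ _ _) (box (pushObj (H.map x y) a) (point (φ.app x))) :=
  (elemPost (φ.app y) (pushObj (F.map x y) a)).symm ≪≫
    stIso _ (pushObj (F.map x y ≫ post (φ.app y) (F.obj x)) a) (Iso.refl _) (by simp) ≪≫
    evIso (φ.naturality x y) a ≪≫
    stIso _ (pushObj (pre (φ.app x) (H.obj y)) (pushObj (H.map x y) a)) (Iso.refl _) (by simp) ≪≫
    elemPre (φ.app x) (pushObj (H.map x y) a)

lemma elemNaturality_hom {x y : O} (a : Elem (A.hom x y)) :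
    (φ.elemNaturality a).hom = (elemPost (φ.app y) (pushObj (F.map x y) a)).inv ≫
      st (pushObj (post (φ.app y) (F.obj x)) (pushObj (F.map x y) a))
        (pushObj (F.map x y ≫ post (φ.app y) (F.obj x)) a) (𝟙 _) (by simp) ≫
      ev (φ.naturality x y).hom a ≫
      st (pushObj (H.map x y ≫ pre (φ.app x) (H.obj y)) a)
        (pushObj (pre (φ.app x) (H.obj y)) (pushObj (H.map x y) a)) (𝟙 _) (by simp) ≫
      (elemPre (φ.app x) (pushObj (H.map x y) a)).hom := rfl

lemma ev_naturality {x y : O} (a : Elem (A.hom x y)) :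
    ev (φ.naturality x y).hom a =
      st (pushObj (F.map x y ≫ post (φ.app y) (F.obj x)) a)
        (pushObj (post (φ.app y) (F.obj x)) (pushObj (F.map x y) a)) (𝟙 _) (by simp) ≫
      (elemPost (φ.app y) (pushObj (F.map x y) a)).hom ≫ (φ.elemNaturality a).hom ≫
      (elemPre (φ.app x) (pushObj (H.map x y) a)).inv ≫
      st (pushObj (pre (φ.app x) (H.obj y)) (pushObj (H.map x y) a))
        (pushObj (H.map x y ≫ pre (φ.app x) (H.obj y)) a) (𝟙 _) (by simp) := by
  simp [elemNaturality_hom]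

lemma elemNaturality_natural {x y : O} {a a' : Elem (A.hom x y)} (m : a ⟶ a') :
    pushMap (B.comp _ _ _) (boxMap (𝟙 (point (φ.app y))) (pushMap (F.map x y) m)) ≫
        (φ.elemNaturality a').hom =
      (φ.elemNaturality a).hom ≫
        pushMap (B.comp _ _ _) (boxMap (pushMap (H.map x y) m) (𝟙 (point (φ.app x)))) := by
  have h := ev_natural (φ.naturality x y).hom m
  have h1 : pushMap (B.comp _ _ _) (boxMap (𝟙 (point (φ.app y))) (pushMap (F.map x y) m)) ≫
      (elemPost (φ.app y) (pushObj (F.map x y) a')).inv =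
      (elemPost (φ.app y) (pushObj (F.map x y) a)).inv ≫
        pushMap (post (φ.app y) (F.obj x)) (pushMap (F.map x y) m) := by
    rw [Iso.eq_inv_comp, pushMap_post]
  have h2 : pushMap (pre (φ.app x) (H.obj y)) (pushMap (H.map x y) m) ≫
      (elemPre (φ.app x) (pushObj (H.map x y) a')).hom =
      (elemPre (φ.app x) (pushObj (H.map x y) a)).hom ≫
        pushMap (B.comp _ _ _) (boxMap (pushMap (H.map x y) m) (𝟙 (point (φ.app x)))) :=
    elemPre_natural _ _
  rw [elemNaturality_hom, elemNaturality_hom, sq_assoc h1]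
  simp only [Category.assoc]
  rw [← h2, pushMap_pushMap_conj, pushMap_pushMap_conj]
  simp only [Category.assoc, st_st_assoc]
  congr 1
  simp [sq_assoc h]

lemma vcomp_elemNaturality (ψ : TransData H K) {x y : O} (a : Elem (A.hom x y)) :
    ((vcomp φ ψ).elemNaturality a).hom =
      pushMap (B.comp _ _ _) (boxMap (elemGcomp (φ.app y) (ψ.app y)).hom
        (𝟙 (pushObj (F.map x y) a))) ≫
      (B.elemAssoc (pushObj (F.map x y) a) (point (φ.app y)) (point (ψ.app y))).hom ≫
      pushMap (B.comp _ _ _) (boxMap (𝟙 (point (ψ.app y))) (φ.elemNaturality a).hom) ≫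
      (B.elemAssoc (point (φ.app x)) (pushObj (H.map x y) a) (point (ψ.app y))).inv ≫
      pushMap (B.comp _ _ _) (boxMap (ψ.elemNaturality a).hom (𝟙 (point (φ.app x)))) ≫
      (B.elemAssoc (point (φ.app x)) (point (ψ.app x)) (pushObj (K.map x y) a)).hom ≫
      pushMap (B.comp _ _ _) (boxMap (𝟙 (pushObj (K.map x y) a))
        (elemGcomp (φ.app x) (ψ.app x)).inv) := by
  rw [elemNaturality_hom]
  simp only [Iso.trans_hom, eqToIso.hom, Iso.symm_hom, Bicategory.whiskerLeftIso_hom,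
    Bicategory.whiskerRightIso_hom, ev_comp, ev_eqToHom, ev_whiskerLeft, ev_whiskerRight,
    ev_postGcomp, ev_prePost, ev_preGcomp_inv, ev_naturality, pushMap_comp, pushMap_st,
    Category.assoc, st_st_assoc]
  simp only [pushMap_pre _ (Iso.hom _), pushMap_post _ (Iso.hom _), pushMap_pre _ (Iso.inv _),
    pushMap_post _ (Iso.inv _)]
  simp

end TransData

namespace TransData

variable {O : Type s} {O' : Type t} {O'' : Type r} {A : EnrichedData W O} {B : EnrichedData W O'}
  {C : EnrichedData W O''}

lemma whiskerLeft_elemNaturality (K : FunctorData A B) {F H : FunctorData B C} (φ : TransData F H)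
    {x y : O} (a : Elem (A.hom x y)) :
    ((whiskerLeft K φ).elemNaturality a).hom =
      pushMap (C.comp _ _ _) (boxMap (𝟙 (point (φ.app (K.obj y))))
        (st (pushObj ((K.comp F).map x y) a) (pushObj (F.map _ _) (pushObj (K.map x y) a)) (𝟙 _)
          (by simp))) ≫
      (φ.elemNaturality (pushObj (K.map x y) a)).hom ≫
      pushMap (C.comp _ _ _) (boxMap (st (pushObj (H.map _ _) (pushObj (K.map x y) a))
        (pushObj ((K.comp H).map x y) a) (𝟙 _) (by simp)) (𝟙 (point (φ.app (K.obj x))))) := by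
  rw [elemNaturality_hom, elemNaturality_hom]
  simp only [Iso.trans_hom, eqToIso.hom, Iso.symm_hom, Bicategory.whiskerLeftIso_hom,
    Bicategory.whiskerRightIso_hom, ev_comp, ev_eqToHom, ev_whiskerLeft, ev_whiskerRight,
    pushMap_comp, pushMap_st,
    Category.assoc, st_st_assoc]
  simp [elemPost_inv, elemPre_hom]

lemma whiskerRight_elemNaturality {F H : FunctorData A B} (φ : TransData F H) (K : FunctorData B C)
    {x y : O} (a : Elem (A.hom x y)) :
    ((whiskerRight φ K).elemNaturality a).hom =
      pushMap (C.comp _ _ _) (boxMap (K.elemMapEl (φ.app y)).hom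
        (st (pushObj ((F.comp K).map x y) a) (pushObj (K.map _ _) (pushObj (F.map x y) a)) (𝟙 _)
          (by simp))) ≫
      (K.elemMapComp (pushObj (F.map x y) a) (point (φ.app y))).hom ≫
      pushMap (K.map _ _) (φ.elemNaturality a).hom ≫
      (K.elemMapComp (point (φ.app x)) (pushObj (H.map x y) a)).inv ≫
      pushMap (C.comp _ _ _) (boxMap (st (pushObj (K.map _ _) (pushObj (H.map x y) a))
        (pushObj ((H.comp K).map x y) a) (𝟙 _) (by simp)) (K.elemMapEl (φ.app x)).inv) := by
  rw [elemNaturality_hom, elemNaturality_hom]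
  simp only [Iso.trans_hom, eqToIso.hom, Iso.symm_hom, Bicategory.whiskerLeftIso_hom,
    Bicategory.whiskerRightIso_hom, ev_comp, ev_eqToHom, ev_whiskerLeft, ev_whiskerRight,
    FunctorData.ev_mapPost, FunctorData.ev_mapPre_inv, ev_naturality, pushMap_comp, pushMap_st,
    Category.assoc, st_st_assoc]
  simp [elemPost_inv, elemPost_hom, elemPre_hom, elemPre_inv,
    FunctorData.boxMap_elemMapEl_hom_st, FunctorData.pushMap_boxMap_elemMapEl_hom_id,
    FunctorData.elemMapEl_inv]
  refine (st_st_assoc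
    (a := pushObj (C.comp _ _ _) (box (point (K.mapEl (φ.app y)))
      (pushObj (F.map x y ≫ K.map (F.obj x) (F.obj y)) a)))
    (b := pushObj (C.comp _ _ _) (box (point (K.mapEl (φ.app y)))
      (pushObj (K.map (F.obj x) (F.obj y)) (pushObj (F.map x y) a))))
    (c := pushObj (C.comp _ _ _) (box (pushObj (K.map (F.obj y) (H.obj y)) (point (φ.app y)))
      (pushObj (K.map (F.obj x) (F.obj y)) (pushObj (F.map x y) a))))
    (𝟙 (𝟙_ W ⊗ a.src)) (by simp) (𝟙 (𝟙_ W ⊗ a.src)) (by simp [FunctorData.mapEl]) _).trans ?_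
  simp

end TransData

namespace TransData.IsLawful

variable {O : Type s} {O' : Type t} {A : EnrichedData W O} {B : EnrichedData W O'}
  {F H : FunctorData A B} {φ : TransData F H}

lemma elem_naturality_comp (hφ : φ.IsLawful) {x y z : O} (a : Elem (A.hom x y))
    (b : Elem (A.hom y z)) :
    pushMap (B.comp _ _ _) (boxMap (𝟙 (point (φ.app z))) (F.elemMapComp a b).hom) ≫
        (φ.elemNaturality (pushObj (A.comp x y z) (box b a))).hom =
      (B.elemAssoc (pushObj (F.map x y) a) (pushObj (F.map y z) b) (point (φ.app z))).inv ≫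
        pushMap (B.comp _ _ _) (boxMap (φ.elemNaturality b).hom (𝟙 (pushObj (F.map x y) a))) ≫
        (B.elemAssoc (pushObj (F.map x y) a) (point (φ.app y)) (pushObj (H.map y z) b)).hom ≫
        pushMap (B.comp _ _ _) (boxMap (𝟙 (pushObj (H.map y z) b)) (φ.elemNaturality a).hom) ≫
        (B.elemAssoc (point (φ.app x)) (pushObj (H.map x y) a) (pushObj (H.map y z) b)).inv ≫
        pushMap (B.comp _ _ _) (boxMap (H.elemMapComp a b).hom (𝟙 (point (φ.app x)))) := by
  have h := congrArg (fun η => ev η (box b a)) (hφ.naturality_comp x y z)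
  simp only [ev_comp, ev_eqToHom, ev_whiskerLeft, ev_whiskerRight] at h
  rw [ev_eq (postComp _ _ _).hom (a := box (pushObj (F.map y z) b) (pushObj (F.map x y) a))
      (b := pushObj _ (box b a)) (Iso.refl _) (by simp),
    ev_eq (midComp _ _ _).hom (a := box (pushObj (H.map y z) b) (pushObj (F.map x y) a))
      (b := pushObj _ (box b a)) (Iso.refl _) (by simp),
    ev_eq (preComp _ _ _).hom (a := box (pushObj (H.map y z) b) (pushObj (H.map x y) a))
      (b := pushObj _ (box b a)) (Iso.refl _) (by simp)] at h
  simp only [ev_postComp, ev_midComp, ev_preComp, ev_tensor₂, pushMap_comp, pushMap_st,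
    boxMap_comp_id, boxMap_id_comp, ev_naturality, Category.assoc, st_st_assoc, ev_id,
    FunctorData.ev_mapComp] at h
  simp only [pushMap_pre _ (Iso.hom _), pushMap_post _ (Iso.hom _), boxMap_st_id, boxMap_id_st,
    pushMap_st, Category.assoc, st_st_assoc, Category.comp_id, Category.id_comp, Iso.refl_hom,
    Iso.refl_inv, st_self, MonoidalCategory.id_tensorHom_id, pushMap_box_hom_inv_assoc, pushMap_box_inv_hom_assoc, pushMap_box_hom_inv_assoc', pushMap_box_inv_hom_assoc', st_st, cancel_epi, Iso.inv_hom_id_assoc] at h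
  refine (cancel_mono (elemPre (φ.app x)
    (pushObj (H.map x z) (pushObj (A.comp x y z) (box b a)))).inv).1 ((cancel_epi (elemPost (φ.app z)
      (pushObj (B.comp _ _ _) (box (pushObj (F.map y z) b) (pushObj (F.map x y) a)))).hom).1
    (st_cancel
      (a := pushObj (((F.map y z ⊗ₘ F.map x y) ≫ B.comp _ _ _) ≫ post (φ.app z) (F.obj x)) (box b a))
      (d := pushObj (A.comp x y z ≫ H.map x z ≫ pre (φ.app x) (H.obj z)) (box b a))
      (p := Iso.refl (b.src ⊗ a.src)) (q := Iso.refl (b.src ⊗ a.src))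
      (h := by simp) (h' := by simp) ?_))
  simp only [Category.assoc]
  exact h

end TransData.IsLawful
end Transformations
end TwistedBicat

namespace TwistedBicat

attribute [-simp] MonoidalCategory.tensorHom_id MonoidalCategory.id_tensorHom
  MonoidalCategory.associator_conjugation
attribute [local simp] MonoidalCategory.id_tensorHom_id MonoidalCategory.tensorHom_comp_tensorHom
  MonoidalCategory.tensorHom_comp_tensorHom_assoc MonoidalCategory.associator_naturality
  MonoidalCategory.associator_naturality_assoc

local infixr:81 " ◃ " => Bicategory.whiskerLeft
local infixl:81 " ▹ " => Bicategory.whiskerRight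

open MonoidalTwoCategory

open Elem EnrichedData TwistingAction Functor.LaxMonoidal Functor.OplaxMonoidal

section Twisted

variable {G : Type t} [Group G] {W : Type u} [Bicategory.{w, v} W] [Bicategory.Strict W]
  [MonoidalTwoCategory W] [TwistingAction G W]

namespace EnrichedData
variable {O : Type s} {A : EnrichedData W O}

lemma val_baseEl (g : G) {x y : O} (f : A.El x y) :
    (point (baseEl g f)).val = ε (act g) ≫ (actObj g (point f)).val := rfl

lemma val_act_point (g : G) {x y : O} (f : A.El x y) :
    (actObj g (point f)).val = η (act g) ≫ (point (baseEl g f)).val := by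
  simp [baseEl]

/-- The action of `g` on a 1-cell, regarded as a generalized element. -/
def elemBaseEl (g : G) {x y : O} (f : A.El x y) : point (baseEl g f) ≅ actObj g (point f) :=
  stIso _ _ (Functor.Monoidal.εIso (act g)) (val_baseEl g f)

lemma elemBaseEl_hom (g : G) {x y : O} (f : A.El x y) :
    (elemBaseEl g f).hom = st (point (baseEl g f)) (actObj g (point f)) (ε (act g))
      (val_baseEl g f) := rfl

lemma elemBaseEl_inv (g : G) {x y : O} (f : A.El x y) :
    (elemBaseEl g f).inv = st (actObj g (point f)) (point (baseEl g f)) (η (act g))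
      (val_act_point g f) := rfl

lemma val_act_comp (g : G) {x y z : O} (a : Elem (A.hom x y)) (b : Elem (A.hom y z)) :
    (actObj g (pushObj (A.comp x y z) (box b a))).val = δ (act g) b.src a.src ≫
      (pushObj ((A.base g).comp x y z) (box (actObj g b) (actObj g a))).val :=
  (Iso.eq_inv_comp (Functor.Monoidal.μIso (act g) b.src a.src)).2 (by simp)

lemma elemActComp_inv (g : G) {x y z : O} (a : Elem (A.hom x y)) (b : Elem (A.hom y z)) :
    (A.elemActComp g a b).inv =
      st (actObj g (pushObj (A.comp x y z) (box b a)))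
        (pushObj ((A.base g).comp x y z) (box (actObj g b) (actObj g a))) (δ (act g) b.src a.src)
        (val_act_comp g a b) := rfl

end EnrichedData

namespace TransData

variable {O : Type s} {O' : Type r} {A : EnrichedData W O} {B : EnrichedData W O'}
  {F H : FunctorData A B} (φ : TransData F H)

lemma base_elemNaturality (g : G) {x y : O} (a : Elem (A.hom x y)) :
    ((φ.base g).elemNaturality (actObj g a)).hom =
      pushMap ((B.base g).comp _ _ _) (boxMap (elemBaseEl g (φ.app y)).hom
        (st (pushObj ((F.base g).map x y) (actObj g a)) (actObj g (pushObj (F.map x y) a)) (𝟙 _)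
          (by simp))) ≫
      (B.elemActComp g (pushObj (F.map x y) a) (point (φ.app y))).hom ≫
      actMap g (φ.elemNaturality a).hom ≫
      (B.elemActComp g (point (φ.app x)) (pushObj (H.map x y) a)).inv ≫
      pushMap ((B.base g).comp _ _ _) (boxMap (st (actObj g (pushObj (H.map x y) a))
        (pushObj ((H.base g).map x y) (actObj g a)) (𝟙 _) (by simp))
        (elemBaseEl g (φ.app x)).inv) := by
  rw [elemNaturality_hom, elemNaturality_hom]
  simp only [Iso.trans_hom, eqToIso.hom, Iso.symm_hom, actIso₂_hom, ev_comp, ev_eqToHom, ev_act₂,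
    pushMap_comp, pushMap_st, Category.assoc, st_st_assoc]
  have h1 : (λ_ ((act g).obj a.src)).hom = (ε (act g) ⊗ₘ 𝟙 ((act g).obj a.src)) ≫
    μ (act g) _ _ ≫ (act g).map (λ_ a.src).hom := by
    rw [MonoidalCategory.tensorHom_id, Functor.LaxMonoidal.left_unitality]
  have h2 : (ρ_ ((act g).obj a.src)).inv = (act g).map (ρ_ a.src).inv ≫ δ (act g) _ _ ≫
    (𝟙 ((act g).obj a.src) ⊗ₘ η (act g)) := by
    rw [MonoidalCategory.id_tensorHom, Functor.Monoidal.map_rightUnitor_inv]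
    simp
  simp [elemPost_inv, elemPost_hom, elemPre_hom, elemPre_inv, elemBaseEl_hom, elemBaseEl_inv,
    elemActComp_hom, elemActComp_inv, h1, h2]

end TransData

namespace FunctorData

variable {O : Type s} {O' : Type r} {A : EnrichedData W O} {B : EnrichedData W O'}

/-- The action of a functor `F : ᵍA ⟶ B` on 1-cells, as an action on generalized elements. -/
def elemOnEl {g : G} (F : FunctorData (A.base g) A) {x y : O} (f : A.El x y) :
    point (F.onEl f) ≅ pushObj (F.map x y) (actObj g (point f)) :=
  F.elemMapEl (baseEl g f) ≪≫ pushIso (F.map x y) (elemBaseEl g f)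

lemma mulIso_inv_natural {g h k : G} (e : g * h = k) {X Y : W} (f : X ⟶ Y) :
    (act k).map f ≫ (mulIso e).inv.app Y = (mulIso e).inv.app X ≫ (act h).map ((act g).map f) :=
  (mulIso e).inv.naturality f

lemma actMap_mulInv {g h k : G} (e : g * h = k) {X : W} {a b : Elem X} (m : a ⟶ b) :
    pushMap ((mulIso e).inv.app X) (actMap k m) =
      st (pushObj ((mulIso e).inv.app X) (actObj k a)) (actObj h (actObj g a))
        ((mulIso e).inv.app a.src) (mulIso_inv_natural e a.val) ≫ actMap h (actMap g m) ≫
      st (actObj h (actObj g b)) (pushObj ((mulIso e).inv.app X) (actObj k b))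
        ((mulIso e).hom.app b.src) (by simp [mulIso_inv_natural]) := by
  have w := eq_of_pushMap ((mulIso e).app X) (m := actMap h (actMap g m)) (n := actMap k m)
    (p := (mulIso e).hom.app a.src) (p' := (mulIso e).app b.src)
    (h := (mulIso e).hom.naturality a.val) (h' := (mulIso e).hom.naturality b.val)
    (actMap_mul e m)
  rw [w]
  simp

variable {g h k : G} (e : g * h = k) (F : FunctorData (A.base g) A) (H : FunctorData (A.base h) A)

lemma val_baseComp {x y : O} (a : Elem (A.hom x y)) :
    (pushObj ((baseComp e F H).map x y) (actObj k a)).val = (mulIso e).inv.app a.src ≫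
      (pushObj (H.map _ _) (actObj h (pushObj (F.map x y) (actObj g a)))).val := by
  simp [reassoc_of% mulIso_inv_natural e a.val]

/-- The functor `baseComp e F H`, on generalized elements. -/
def elemBaseComp {x y : O} (a : Elem (A.hom x y)) :
    pushObj ((baseComp e F H).map x y) (actObj k a) ≅
      pushObj (H.map _ _) (actObj h (pushObj (F.map x y) (actObj g a))) :=
  stIso _ _ ((mulIso e).symm.app a.src) (val_baseComp e F H a)


lemma elemBaseComp_hom {x y : O} (a : Elem (A.hom x y)) :
    (elemBaseComp e F H a).hom = st (pushObj ((baseComp e F H).map x y) (actObj k a))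
      (pushObj (H.map _ _) (actObj h (pushObj (F.map x y) (actObj g a)))) ((mulIso e).inv.app a.src)
      (val_baseComp e F H a) := rfl

lemma val_baseComp_inv {x y : O} (a : Elem (A.hom x y)) :
    (pushObj (H.map _ _) (actObj h (pushObj (F.map x y) (actObj g a)))).val =
      (mulIso e).hom.app a.src ≫ (pushObj ((baseComp e F H).map x y) (actObj k a)).val :=
  (Iso.eq_inv_comp ((mulIso e).symm.app a.src)).2 (val_baseComp e F H a).symm

lemma elemBaseComp_inv {x y : O} (a : Elem (A.hom x y)) :
    (elemBaseComp e F H a).inv = st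
      (pushObj (H.map _ _) (actObj h (pushObj (F.map x y) (actObj g a))))
      (pushObj ((baseComp e F H).map x y) (actObj k a)) ((mulIso e).hom.app a.src)
      (val_baseComp_inv e F H a) := rfl

lemma elemBaseComp_natural {x y : O} {a a' : Elem (A.hom x y)} (m : a ⟶ a') :
    pushMap ((baseComp e F H).map x y) (actMap k m) ≫ (elemBaseComp e F H a').hom =
      (elemBaseComp e F H a).hom ≫ pushMap (H.map _ _) (actMap h (pushMap (F.map x y) (actMap g m))) := by
  have h := congrArg (pushMap ((act h).map (F.map x y) ≫ H.map _ _)) (actMap_mulInv e m)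
  simp at h
  have h' := st_conj h (pushObj ((baseComp e F H).map x y) (actObj k a))
    (pushObj (H.map _ _) (actObj _ (pushObj (F.map x y) (actObj g a')))) (𝟙 _) (by simp)
    ((mulIso e).inv.app a'.src) (by simp [reassoc_of% mulIso_inv_natural e a'.val])
  rw [elemBaseComp_hom, elemBaseComp_hom]
  simp at h' ⊢
  exact h'

lemma elemBaseComp_comp {x y z : O} (a : Elem (A.hom x y)) (b : Elem (A.hom y z)) :
    pushMap (A.comp _ _ _) (boxMap (elemBaseComp e F H b).hom (elemBaseComp e F H a).hom) ≫
        (H.elemOnComp (pushObj (F.map x y) (actObj g a)) (pushObj (F.map y z) (actObj g b))).hom ≫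
        pushMap (H.map _ _) (actMap h (F.elemOnComp a b).hom) =
      ((baseComp e F H).elemMapComp (actObj k a) (actObj k b)).hom ≫
        pushMap ((baseComp e F H).map x z) (A.elemActComp k a b).hom ≫
        (elemBaseComp e F H (pushObj (A.comp x y z) (box b a))).hom := by
  rw [elemMapComp_hom (baseComp e F H)]
  simp only [Iso.trans_hom, eqToIso.hom, Bicategory.whiskerLeftIso_hom,
    Bicategory.whiskerRightIso_hom, actIso₂_hom, ev_comp, ev_eqToHom, ev_whiskerLeft,
    ev_whiskerRight]
  rw [ev_eq (H.mapComp _ _ _).hom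
      (a := box (actObj h (pushObj (F.map y z) (actObj g b)))
        (actObj h (pushObj (F.map x y) (actObj g a))))
      (b := pushObj _ (pushObj _ (box (actObj k b) (actObj k a))))
      (MonoidalCategory.tensorIso ((mulIso e).app b.src) ((mulIso e).app a.src)) (by simp [mulIso_inv_natural]),
    ev_eq (act₂ h (F.mapComp x y z).hom)
      (a := actObj h (box (actObj g b) (actObj g a)))
      (b := pushObj _ (pushObj _ (box (actObj k b) (actObj k a))))
      ((Functor.Monoidal.μIso (act h) _ _).symm ≪≫
        MonoidalCategory.tensorIso ((mulIso e).app b.src) ((mulIso e).app a.src)) (by simp [mulIso_inv_natural]),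
    ev_act₂]
  simp [elemBaseComp_hom, elemOnComp_hom, elemMapComp_hom, elemActComp_hom]

end FunctorData

end Twisted
end TwistedBicat

namespace TwistedBicat

attribute [-simp] MonoidalCategory.tensorHom_id MonoidalCategory.id_tensorHom
  MonoidalCategory.associator_conjugation
attribute [local simp] MonoidalCategory.id_tensorHom_id MonoidalCategory.tensorHom_comp_tensorHom
  MonoidalCategory.tensorHom_comp_tensorHom_assoc MonoidalCategory.associator_naturality
  MonoidalCategory.associator_naturality_assoc

local infixr:81 " ◃ " => Bicategory.whiskerLeft
local infixl:81 " ▹ " => Bicategory.whiskerRight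

open MonoidalTwoCategory


open Elem EnrichedData

section Points

variable {W : Type u} [Bicategory.{w, v} W] [Bicategory.Strict W] [MonoidalTwoCategory W]
  {X Y : W}

namespace Elem

/-- A 2-cell between points, as a morphism of generalized elements. -/
def pointIso {f f' : 𝟙_ W ⟶ X} (η : f ≅ f') : point f ≅ point f' :=
  stIso (point f) (pushObj f (univ (𝟙_ W))) (Iso.refl _) (by simp) ≪≫ evIso η (univ (𝟙_ W)) ≪≫
    stIso (pushObj f' (univ (𝟙_ W))) (point f') (Iso.refl _) (by simp)

lemma pointIso_hom {f f' : 𝟙_ W ⟶ X} (η : f ≅ f') :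
    (pointIso η).hom = st (point f) (pushObj f (univ (𝟙_ W))) (𝟙 _) (by simp) ≫
      ev η.hom (univ (𝟙_ W)) ≫ st (pushObj f' (univ (𝟙_ W))) (point f') (𝟙 _) (by simp) := rfl

lemma pointIso_trans {f f' f'' : 𝟙_ W ⟶ X} (η : f ≅ f') (θ : f' ≅ f'') :
    pointIso (η ≪≫ θ) = pointIso η ≪≫ pointIso θ :=
  Iso.ext (by simp [pointIso_hom, ev_comp])

lemma pointIso_symm {f f' : 𝟙_ W ⟶ X} (η : f ≅ f') : pointIso η.symm = (pointIso η).symm :=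
  Iso.ext (Category.assoc _ _ _).symm

lemma pointIso_refl (f : 𝟙_ W ⟶ X) : pointIso (Iso.refl f) = Iso.refl _ :=
  Iso.ext (by simp [pointIso_hom])

lemma pointIso_eqToIso {f f' : 𝟙_ W ⟶ X} (h : f = f') :
    (pointIso (eqToIso h)).hom = st (point f) (point f') (𝟙 _) (by simp [h]) := by
  simp [pointIso_hom, ev_eqToHom]

lemma pointIso_whiskerLeft (f : 𝟙_ W ⟶ X) {g g' : X ⟶ Y} (η : g ≅ g') :
    (pointIso (Bicategory.whiskerLeftIso f η)).hom =
      st (point (f ≫ g)) (pushObj g (point f)) (𝟙 _) (by simp) ≫ ev η.hom (point f) ≫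
        st (pushObj g' (point f)) (point (f ≫ g')) (𝟙 _) (by simp) := by
  rw [pointIso_hom, Bicategory.whiskerLeftIso_hom, ev_whiskerLeft,
    ev_eq η.hom (a := point f) (b := pushObj f (univ _)) (Iso.refl _) (by simp)]
  simp

lemma pointIso_whiskerRight {f f' : 𝟙_ W ⟶ X} (η : f ≅ f') (g : X ⟶ Y) :
    (pointIso (Bicategory.whiskerRightIso η g)).hom =
      st (point (f ≫ g)) (pushObj g (point f)) (𝟙 _) (by simp) ≫ pushMap g (pointIso η).hom ≫
        st (pushObj g (point f')) (point (f' ≫ g)) (𝟙 _) (by simp) := by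
  rw [pointIso_hom, pointIso_hom, Bicategory.whiskerRightIso_hom, ev_whiskerRight]
  simp

lemma ev_whisker_point_left {Z : W} {f f' : 𝟙_ W ⟶ X} (η : f ≅ f') (k : X ⊗ Y ⟶ Z) (a : Elem Y) :
    ev ((λ_ Y).inv ◃ (tensor₂ η.hom (𝟙 (𝟙 Y)) ▹ k)) a =
      st (pushObj ((λ_ Y).inv ≫ (f ⊗ₘ 𝟙 Y) ≫ k) a) (pushObj k (box (point f) a)) (λ_ a.src).inv
        (by simp [reassoc_of% leftUnitor_inv_point f a.val]) ≫
      pushMap k (boxMap (pointIso η).hom (𝟙 a)) ≫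
      st (pushObj k (box (point f') a)) (pushObj ((λ_ Y).inv ≫ (f' ⊗ₘ 𝟙 Y) ≫ k) a) (λ_ a.src).hom
        (by simp [reassoc_of% leftUnitor_inv_point f' a.val]) := by
  rw [ev_whiskerLeft, ev_whiskerRight,
    ev_eq (tensor₂ η.hom (𝟙 (𝟙 Y))) (a := box (univ _) a) (b := pushObj _ a) (λ_ _)
    (by simp [MonoidalCategory.id_tensorHom]), ev_tensor₂, pointIso_hom]
  have h : boxMap (ev η.hom (univ _)) (𝟙 (pushObj (𝟙 Y) a)) =
      boxMap (𝟙 _) (st (pushObj (𝟙 Y) a) a (𝟙 _) (by simp)) ≫ boxMap (ev η.hom (univ _)) (𝟙 a) ≫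
        boxMap (𝟙 _) (st a (pushObj (𝟙 Y) a) (𝟙 _) (by simp)) := by
    rw [← boxMap_comp, ← boxMap_comp]; simp
  simp [h]

lemma ev_whisker_point_right {Z : W} {f f' : 𝟙_ W ⟶ X} (η : f ≅ f') (k : Y ⊗ X ⟶ Z) (a : Elem Y) :
    ev ((ρ_ Y).inv ◃ (tensor₂ (𝟙 (𝟙 Y)) η.hom ▹ k)) a =
      st (pushObj ((ρ_ Y).inv ≫ (𝟙 Y ⊗ₘ f) ≫ k) a) (pushObj k (box a (point f))) (ρ_ a.src).inv
        (by simp [reassoc_of% rightUnitor_inv_point f a.val]) ≫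
      pushMap k (boxMap (𝟙 a) (pointIso η).hom) ≫
      st (pushObj k (box a (point f'))) (pushObj ((ρ_ Y).inv ≫ (𝟙 Y ⊗ₘ f') ≫ k) a) (ρ_ a.src).hom
        (by simp [reassoc_of% rightUnitor_inv_point f' a.val]) := by
  rw [ev_whiskerLeft, ev_whiskerRight,
    ev_eq (tensor₂ (𝟙 (𝟙 Y)) η.hom) (a := box a (univ _)) (b := pushObj _ a) (ρ_ _)
    (by simp [MonoidalCategory.tensorHom_id]), ev_tensor₂, pointIso_hom]
  have h : boxMap (𝟙 (pushObj (𝟙 Y) a)) (ev η.hom (univ _)) =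
      boxMap (st (pushObj (𝟙 Y) a) a (𝟙 _) (by simp)) (𝟙 _) ≫ boxMap (𝟙 a) (ev η.hom (univ _)) ≫
        boxMap (st a (pushObj (𝟙 Y) a) (𝟙 _) (by simp)) (𝟙 _) := by
    rw [← boxMap_comp, ← boxMap_comp]; simp
  simp [h]

end Elem

namespace EnrichedData
variable {O : Type s} {A : EnrichedData W O}

lemma ev_postIso₂ {x y : O} {f f' : A.El x y} (η : f ≅ f') {w : O} (a : Elem (A.hom w x)) :
    ev (postIso₂ η w).hom a = (elemPost f a).hom ≫
      pushMap (A.comp w x y) (boxMap (pointIso η).hom (𝟙 a)) ≫ (elemPost f' a).inv :=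
  ev_whisker_point_left η (A.comp w x y) a

lemma ev_preIso₂ {x y : O} {f f' : A.El x y} (η : f ≅ f') {z : O} (a : Elem (A.hom y z)) :
    ev (preIso₂ η z).hom a = (elemPre f a).hom ≫
      pushMap (A.comp x y z) (boxMap (𝟙 a) (pointIso η).hom) ≫ (elemPre f' a).inv :=
  ev_whisker_point_right η (A.comp x y z) a

lemma val_gcomp_post {x y z : O} (f : A.El x y) (g : A.El y z) :
    (point (gcomp f g)).val = 𝟙 (𝟙_ W) ≫ (pushObj (post g x) (point f)).val :=
  (Category.id_comp _).symm

lemma val_post_point {x y z : O} (f : A.El x y) (g : A.El y z) :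
    (pushObj (post g x) (point f)).val = 𝟙 (𝟙_ W) ≫ (point (gcomp f g)).val :=
  (Category.id_comp _).symm

lemma ev_postGcomp_inv {w x y z : O} (f : A.El x y) (g : A.El y z) (a : Elem (A.hom w x)) :
    ev (postGcomp f g w).inv a =
      st (pushObj (post f w ≫ post g w) a) (pushObj (post g w) (pushObj (post f w) a)) (𝟙 _)
        (by simp) ≫
      (elemPost g (pushObj (post f w) a)).hom ≫
      pushMap (A.comp w y z) (boxMap (𝟙 (point g)) (elemPost f a).hom) ≫
      (A.elemAssoc a (point f) (point g)).inv ≫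
      pushMap (A.comp w x z) (boxMap (elemGcomp f g).inv (𝟙 a)) ≫
      (elemPost (gcomp f g) a).inv := by
  let e := elemPost (gcomp f g) a ≪≫
    pushIso (A.comp w x z) (boxIso (elemGcomp f g) (Iso.refl a)) ≪≫
      A.elemAssoc a (point f) (point g) ≪≫
      pushIso (A.comp w y z) (boxIso (Iso.refl (point g)) (elemPost f a).symm) ≪≫
      (elemPost g (pushObj (post f w) a)).symm ≪≫
      stIso (pushObj (post g w) (pushObj (post f w) a)) (pushObj (post f w ≫ post g w) a)
        (Iso.refl _) (by simp)
  have h : evIso (postGcomp f g w) a = e := Iso.ext (ev_postGcomp f g a)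
  refine (congrArg Iso.inv h).trans ?_
  simp only [e, Iso.trans_inv, Iso.symm_inv, Category.assoc]
  rfl

lemma pointIso_gcompIso₂ {x y z : O} {f f' : A.El x y} {g g' : A.El y z} (η : f ≅ f')
    (θ : g ≅ g') :
    (pointIso (gcompIso₂ η θ)).hom = (elemGcomp f g).hom ≫
      pushMap (A.comp x y z) (boxMap (pointIso θ).hom (pointIso η).hom) ≫ (elemGcomp f' g').inv := by
  have h : (pointIso (gcompIso₂ η θ)).hom =
      (st (point (gcomp f g)) (pushObj (post g x) (point f)) (𝟙 _) (val_gcomp_post f g) ≫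
        pushMap (post g x) (pointIso η).hom ≫
        st (pushObj (post g x) (point f')) (point (gcomp f' g)) (𝟙 _) (val_post_point f' g)) ≫
      st (point (gcomp f' g)) (pushObj (post g x) (point f')) (𝟙 _) (val_gcomp_post f' g) ≫
        ev (postIso₂ θ x).hom (point f') ≫
        st (pushObj (post g' x) (point f')) (point (gcomp f' g')) (𝟙 _) (val_post_point f' g') :=
    (congrArg Iso.hom (pointIso_trans (Bicategory.whiskerRightIso η (post g x))
      (Bicategory.whiskerLeftIso f' (postIso₂ θ x)))).trans
      (congrArg₂ (· ≫ ·) (pointIso_whiskerRight η (post g x)) (pointIso_whiskerLeft f' (postIso₂ θ x)))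
  have h' : boxMap (pointIso θ).hom (pointIso η).hom =
      boxMap (𝟙 (point g)) (pointIso η).hom ≫ boxMap (pointIso θ).hom (𝟙 (point f')) := by
    rw [← boxMap_comp, Category.id_comp, Category.comp_id]
  rw [h, ev_postIso₂, pushMap_post, h', pushMap_comp]
  simp [elemPost_hom, elemPost_inv, elemGcomp_hom, elemGcomp_inv, -boxMap_point_left,
    -boxMap_point_right]

lemma pointIso_gcompAssoc {w x y z : O} (f : A.El w x) (g : A.El x y) (h : A.El y z) :
    (pointIso (gcompAssoc f g h)).hom = (elemGcomp (gcomp f g) h).hom ≫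
      pushMap (A.comp w y z) (boxMap (𝟙 (point h)) (elemGcomp f g).hom) ≫
      (A.elemAssoc (point f) (point g) (point h)).inv ≫
      pushMap (A.comp w x z) (boxMap (elemGcomp g h).inv (𝟙 (point f))) ≫
      (elemGcomp f (gcomp g h)).inv := by
  have e : gcomp (gcomp f g) h = f ≫ post g w ≫ post h w := by simp [gcomp]
  have h : (pointIso (gcompAssoc f g h)).hom =
      st (point (gcomp (gcomp f g) h)) (point (f ≫ post g w ≫ post h w)) (𝟙 _) (by simp [e]) ≫
      st (point (f ≫ post g w ≫ post h w)) (pushObj (post g w ≫ post h w) (point f)) (𝟙 _) (by simp) ≫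
        ev (postGcomp g h w).inv (point f) ≫
        st (pushObj (post (gcomp g h) w) (point f)) (point (gcomp f (gcomp g h))) (𝟙 _)
          (val_post_point f (gcomp g h)) :=
    (congrArg Iso.hom (pointIso_trans (eqToIso e)
      (Bicategory.whiskerLeftIso f (postGcomp g h w).symm))).trans
      (congrArg₂ (· ≫ ·) (pointIso_eqToIso e) (pointIso_whiskerLeft f (postGcomp g h w).symm))
  rw [h, ev_postGcomp_inv]
  simp [elemPost_hom, elemPost_inv, elemGcomp_hom, elemGcomp_inv]

end EnrichedData

namespace TransData
variable {O : Type s} {O' : Type t} {A : EnrichedData W O} {B : EnrichedData W O'}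
  {F H : FunctorData A B} (φ : TransData F H)

lemma pointIso_naturalityEl {x y : O} (f : A.El x y) :
    (pointIso (φ.naturalityEl f)).hom = (elemGcomp (F.mapEl f) (φ.app y)).hom ≫
      pushMap (B.comp _ _ _) (boxMap (𝟙 (point (φ.app y))) (F.elemMapEl f).hom) ≫
      (φ.elemNaturality (point f)).hom ≫
      pushMap (B.comp _ _ _) (boxMap (H.elemMapEl f).inv (𝟙 (point (φ.app x)))) ≫
      (elemGcomp (φ.app x) (H.mapEl f)).inv := by
  have e : gcomp (F.mapEl f) (φ.app y) = f ≫ F.map x y ≫ post (φ.app y) (F.obj x) := by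
    simp [gcomp, FunctorData.mapEl]
  have e' : f ≫ H.map x y ≫ pre (φ.app x) (H.obj y) = gcomp (φ.app x) (H.mapEl f) := by
    simp [gcomp_eq, FunctorData.mapEl]
  have h : (pointIso (φ.naturalityEl f)).hom =
      st (point (gcomp (F.mapEl f) (φ.app y))) (point (f ≫ F.map x y ≫ post (φ.app y) (F.obj x)))
        (𝟙 _) (by simp [e]) ≫
      (st (point (f ≫ F.map x y ≫ post (φ.app y) (F.obj x)))
        (pushObj (F.map x y ≫ post (φ.app y) (F.obj x)) (point f)) (𝟙 _) (by simp) ≫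
        ev (φ.naturality x y).hom (point f) ≫
        st (pushObj (H.map x y ≫ pre (φ.app x) (H.obj y)) (point f))
          (point (f ≫ H.map x y ≫ pre (φ.app x) (H.obj y))) (𝟙 _) (by simp)) ≫
      st (point (f ≫ H.map x y ≫ pre (φ.app x) (H.obj y))) (point (gcomp (φ.app x) (H.mapEl f)))
        (𝟙 _) (by simp [← e']) := by
    have h' : φ.naturalityEl f = eqToIso e ≪≫ Bicategory.whiskerLeftIso f (φ.naturality x y) ≪≫
      eqToIso e' := rfl
    rw [h', pointIso_trans, pointIso_trans, Iso.trans_hom, Iso.trans_hom, pointIso_eqToIso,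
      pointIso_eqToIso, pointIso_whiskerLeft]
  rw [h, ev_naturality]
  simp [MonoidalCategory.unitors_equal, elemPost_hom, elemPost_inv, elemPre_hom, elemPre_inv, elemGcomp_hom, elemGcomp_inv,
    FunctorData.elemMapEl_hom, FunctorData.elemMapEl_inv]

end TransData

namespace FunctorData
variable {O : Type s} {O' : Type t} {A : EnrichedData W O} {B : EnrichedData W O'}
  (F : FunctorData A B)

lemma pointIso_mapElIso₂ {x y : O} {f f' : A.El x y} (η : f ≅ f') :
    (pointIso (F.mapElIso₂ η)).hom = (F.elemMapEl f).hom ≫ pushMap (F.map x y) (pointIso η).hom ≫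
      (F.elemMapEl f').inv :=
  pointIso_whiskerRight η (F.map x y)

lemma pointIso_mapGcomp {x y z : O} (f : A.El x y) (g : A.El y z) :
    (pointIso (F.mapGcomp f g)).hom = (elemGcomp (F.mapEl f) (F.mapEl g)).hom ≫
      pushMap (B.comp _ _ _) (boxMap (F.elemMapEl g).hom (F.elemMapEl f).hom) ≫
      (F.elemMapComp (point f) (point g)).hom ≫ pushMap (F.map x z) (elemGcomp f g).inv ≫
      (F.elemMapEl (gcomp f g)).inv := by
  have e : gcomp (F.mapEl f) (F.mapEl g) = f ≫ F.map x y ≫ post (F.mapEl g) (F.obj x) := by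
    simp [gcomp, mapEl]
  have e' : f ≫ post g x ≫ F.map x z = F.mapEl (gcomp f g) := by
    simp [gcomp, FunctorData.mapEl]
  have h : (pointIso (F.mapGcomp f g)).hom =
      st (point (gcomp (F.mapEl f) (F.mapEl g)))
        (point (f ≫ F.map x y ≫ post (F.mapEl g) (F.obj x))) (𝟙 _) (by simp [e]) ≫
      (st (point (f ≫ F.map x y ≫ post (F.mapEl g) (F.obj x)))
        (pushObj (F.map x y ≫ post (F.mapEl g) (F.obj x)) (point f)) (𝟙 _) (by simp) ≫
        ev (F.mapPost g x).hom (point f) ≫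
        st (pushObj (post g x ≫ F.map x z) (point f)) (point (f ≫ post g x ≫ F.map x z)) (𝟙 _)
          (by simp)) ≫
      st (point (f ≫ post g x ≫ F.map x z)) (point (F.mapEl (gcomp f g))) (𝟙 _)
        (by simp [← e']) := by
    have h' : F.mapGcomp f g = eqToIso e ≪≫ Bicategory.whiskerLeftIso f (F.mapPost g x) ≪≫
      eqToIso e' := rfl
    rw [h', pointIso_trans, pointIso_trans, Iso.trans_hom, Iso.trans_hom, pointIso_eqToIso,
      pointIso_eqToIso, pointIso_whiskerLeft]
  rw [h, ev_mapPost]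
  simp [elemPost_hom, elemPost_inv, elemGcomp_hom, elemGcomp_inv, elemMapEl_hom, elemMapEl_inv]

end FunctorData

variable {G : Type t} [Group G] [TwistingAction G W]

open TwistingAction Functor.LaxMonoidal Functor.OplaxMonoidal

namespace FunctorData
variable {O : Type s} {A : EnrichedData W O} {g : G} (F : FunctorData (A.base g) A)

lemma val_baseEl_map (g : G) {x y : O} (f : A.El x y) :
    (point (baseEl g f)).val = 𝟙 (𝟙_ W) ≫ (pushObj ((act g).map f) (point (ε (act g)))).val :=
  (Category.id_comp _).symm

lemma val_map_point_ε (g : G) {x y : O} (f : A.El x y) :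
    (pushObj ((act g).map f) (point (ε (act g)))).val = 𝟙 (𝟙_ W) ≫ (point (baseEl g f)).val :=
  (Category.id_comp _).symm

lemma elemOnEl_hom {x y : O} (f : A.El x y) :
    (F.elemOnEl f).hom = (F.elemMapEl (baseEl g f)).hom ≫
      pushMap (F.map x y) (elemBaseEl g f).hom := rfl

lemma elemOnEl_inv {x y : O} (f : A.El x y) :
    (F.elemOnEl f).inv = pushMap (F.map x y) (elemBaseEl g f).inv ≫
      (F.elemMapEl (baseEl g f)).inv := rfl

lemma pointIso_onElIso₂ {x y : O} {f f' : A.El x y} (η : f ≅ f') :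
    (pointIso (F.onElIso₂ η)).hom = (F.elemOnEl f).hom ≫
      pushMap (F.map x y) (actMap g (pointIso η).hom) ≫ (F.elemOnEl f').inv := by
  have h : (pointIso (baseElIso₂ g η)).hom = (elemBaseEl g f).hom ≫ actMap g (pointIso η).hom ≫
      (elemBaseEl g f').inv := by
    have h' : (pointIso (baseElIso₂ g η)).hom =
        st (point (baseEl g f)) (pushObj ((act g).map f) (point (ε (act g)))) (𝟙 _)
          (val_baseEl_map g f) ≫ ev (act₂ g η.hom) (point (ε (act g))) ≫
        st (pushObj ((act g).map f') (point (ε (act g)))) (point (baseEl g f')) (𝟙 _)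
          (val_map_point_ε g f') :=
      pointIso_whiskerLeft (ε (act g)) (actIso₂ g η)
    rw [h', pointIso_hom, ev_eq (act₂ g η.hom) (a := actObj g (univ _)) (b := point (ε (act g)))
      (Functor.Monoidal.εIso (act g)).symm (by simp), ev_act₂]
    simp [elemBaseEl_hom, elemBaseEl_inv]
  have h' : (pointIso (F.onElIso₂ η)).hom = (F.elemMapEl (baseEl g f)).hom ≫
      pushMap (F.map x y) (pointIso (baseElIso₂ g η)).hom ≫ (F.elemMapEl (baseEl g f')).inv :=
    F.pointIso_mapElIso₂ (baseElIso₂ g η)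
  rw [h', h, elemOnEl_hom, elemOnEl_inv, pushMap_comp, pushMap_comp, Category.assoc, Category.assoc]
  exact (Category.assoc _ _ _).symm

lemma pointIso_onElComp {x y z : O} (f : A.El x y) (k : A.El y z) :
    (pointIso (F.onElComp f k)).hom = (elemGcomp (F.onEl f) (F.onEl k)).hom ≫
      pushMap (A.comp _ _ _) (boxMap (F.elemOnEl k).hom (F.elemOnEl f).hom) ≫
      (F.elemOnComp (point f) (point k)).hom ≫
      pushMap (F.map x z) (actMap g (elemGcomp f k).inv) ≫ (F.elemOnEl (gcomp f k)).inv := by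
  have e : F.mapEl (gcomp (baseEl g f) (baseEl g k)) = F.onEl (gcomp f k) := by
    rw [base_gcomp]; rfl
  have h : (pointIso (F.onElComp f k)).hom =
      ((elemGcomp (F.onEl f) (F.onEl k)).hom ≫
      pushMap (A.comp _ _ _) (boxMap (F.elemMapEl (baseEl g k)).hom (F.elemMapEl (baseEl g f)).hom) ≫
      (F.elemMapComp (point (baseEl g f)) (point (baseEl g k))).hom ≫
      pushMap (F.map x z) (elemGcomp (baseEl g f) (baseEl g k)).inv ≫
      (F.elemMapEl (gcomp (baseEl g f) (baseEl g k))).inv) ≫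
      st (point (F.mapEl (gcomp (baseEl g f) (baseEl g k)))) (point (F.onEl (gcomp f k))) (𝟙 _)
        (by simp [e]) :=
    (congrArg Iso.hom (pointIso_trans (F.mapGcomp (baseEl g f) (baseEl g k)) (eqToIso e))).trans
      (congrArg₂ (· ≫ ·) (F.pointIso_mapGcomp _ _) (pointIso_eqToIso e))
  have h2 := F.elemMapComp_natural (elemBaseEl g f).hom (elemBaseEl g k).hom
  have hp : (ε (act (W := W) g) ⊗ₘ ε (act g)) ≫ μ (act g) (𝟙_ W) (𝟙_ W) ≫
      (act g).map (λ_ (𝟙_ W)).hom ≫ η (act g) = (λ_ (𝟙_ W)).hom := by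
    have h := Functor.LaxMonoidal.left_unitality (act (W := W) g) (𝟙_ W)
    rw [← cancel_mono (ε (act g)), MonoidalCategory.tensorHom_def']
    simp only [Category.assoc, Functor.Monoidal.η_ε, Category.comp_id]
    rw [← h, MonoidalCategory.leftUnitor_naturality]
  have h3 : pushMap ((A.base g).comp x y z) (boxMap (elemBaseEl g k).hom (elemBaseEl g f).hom) ≫
      (A.elemActComp g (point f) (point k)).hom ≫ actMap g (elemGcomp f k).inv ≫
      (elemBaseEl g (gcomp f k)).inv = (elemGcomp (baseEl g f) (baseEl g k)).inv ≫
      st (point (gcomp (baseEl g f) (baseEl g k))) (point (baseEl g (gcomp f k))) (𝟙 _)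
        (by rw [base_gcomp]; simp) := by
    simp [elemBaseEl_hom, elemBaseEl_inv, elemActComp_hom, elemGcomp_inv, hp]
  have h4 := congrArg (pushMap (F.map x z)) h3
  simp only [pushMap_comp, Category.assoc] at h4
  have h5 : pushMap (A.comp _ _ _) (boxMap (F.elemOnEl k).hom (F.elemOnEl f).hom) =
      pushMap (A.comp _ _ _) (boxMap (F.elemMapEl (baseEl g k)).hom (F.elemMapEl (baseEl g f)).hom) ≫
      pushMap (A.comp _ _ _) (boxMap (pushMap (F.map y z) (elemBaseEl g k).hom)
        (pushMap (F.map x y) (elemBaseEl g f).hom)) :=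
    (congrArg (pushMap (A.comp _ _ _)) (boxMap_comp (F.elemMapEl (baseEl g k)).hom
      (pushMap (F.map y z) (elemBaseEl g k).hom) (F.elemMapEl (baseEl g f)).hom
        (pushMap (F.map x y) (elemBaseEl g f).hom))).trans (pushMap_comp _ _ _)
  have h6 : pushMap (F.map x z) (st (point (gcomp (baseEl g f) (baseEl g k)))
        (point (baseEl g (gcomp f k))) (𝟙 _) (by rw [base_gcomp]; simp)) ≫
      (F.elemMapEl (baseEl g (gcomp f k))).inv =
      (F.elemMapEl (gcomp (baseEl g f) (baseEl g k))).inv ≫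
      st (point (F.mapEl (gcomp (baseEl g f) (baseEl g k))))
        (point (F.mapEl (baseEl g (gcomp f k)))) (𝟙 _) (by rw [base_gcomp]; simp) := by
    rw [pushMap_st, elemMapEl_inv, elemMapEl_inv]
    refine (st_st _ _ _ _).trans (Eq.trans ?_ (st_st
      (a := pushObj (F.map x z) (point (gcomp (baseEl g f) (baseEl g k))))
      (b := point (F.mapEl (gcomp (baseEl g f) (baseEl g k))))
      (c := point (F.mapEl (baseEl g (gcomp f k))))
      (𝟙 (𝟙_ W)) (F.val_map_point _) (𝟙 (𝟙_ W)) (by rw [base_gcomp]; simp)).symm)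
    rfl
  rw [h, elemOnEl_inv, h5, elemOnComp_hom]
  simp only [Category.assoc]
  refine congrArg ((elemGcomp (F.onEl f) (F.onEl k)).hom ≫ ·) ?_
  refine Eq.trans ?_ (Category.assoc _ _ _).symm
  refine congrArg (pushMap (A.comp _ _ _) (boxMap (F.elemMapEl (baseEl g k)).hom
    (F.elemMapEl (baseEl g f)).hom) ≫ ·) ?_
  refine Eq.trans ?_ (sq_assoc h2 _).symm
  refine congrArg ((F.elemMapComp (point (baseEl g f)) (point (baseEl g k))).hom ≫ ·) ?_
  have h7 := congrArg (· ≫ (F.elemMapEl (baseEl g (gcomp f k))).inv) h4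
  simp only [Category.assoc, h6] at h7
  exact h7.symm

end FunctorData

end Points
end TwistedBicat

namespace TwistedBicat

local infixr:81 " ◃ " => Bicategory.whiskerLeft
local infixl:81 " ▹ " => Bicategory.whiskerRight
local notation "𝒶" => Bicategory.associator

section Conjugation

variable {C : Type u} [Bicategory.{w, v} C]

lemma conj_naturality_comp {x₁ x₂ x₃ y₁ y₂ y₃ : C} {fa : x₁ ⟶ x₂} {fb : x₂ ⟶ x₃} {fab : x₁ ⟶ x₃}
    {px : x₁ ⟶ y₁} {py : x₂ ⟶ y₂} {pz : x₃ ⟶ y₃} {ha ha' : y₁ ⟶ y₂} {hb hb' : y₂ ⟶ y₃}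
    {hab hab' : y₁ ⟶ y₃} {na : fa ≫ py ⟶ px ≫ ha} {nb : fb ≫ pz ⟶ py ≫ hb}
    {nab : fab ≫ pz ⟶ px ≫ hab} {mF : fa ≫ fb ⟶ fab} {mH : ha ≫ hb ⟶ hab}
    (w : mF ▹ pz ≫ nab = (𝒶 _ _ _).hom ≫ fa ◃ nb ≫ (𝒶 _ _ _).inv ≫ na ▹ hb ≫ (𝒶 _ _ _).hom ≫
      px ◃ mH)
    {βa : ha ⟶ ha'} {βb : hb ⟶ hb'} {βab : hab ⟶ hab'} {mH' : ha' ≫ hb' ⟶ hab'}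
    (w' : βa ▹ hb ≫ ha' ◃ βb ≫ mH' = mH ≫ βab) :
    mF ▹ pz ≫ nab ≫ px ◃ βab = (𝒶 _ _ _).hom ≫ fa ◃ (nb ≫ py ◃ βb) ≫ (𝒶 _ _ _).inv ≫
      (na ≫ px ◃ βa) ▹ hb' ≫ (𝒶 _ _ _).hom ≫ px ◃ mH' := by
  have w₁ := reassoc_of% w
  have e₁ : fa ◃ py ◃ βb ≫ (𝒶 _ _ _).inv ≫ na ▹ hb' ≫ (𝒶 _ _ _).hom ≫ px ◃ βa ▹ hb' =
      (𝒶 _ _ _).inv ≫ na ▹ hb ≫ (𝒶 _ _ _).hom ≫ px ◃ (βa ▹ hb ≫ ha' ◃ βb) := by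
    rw [← Bicategory.whisker_exchange, Bicategory.associator_inv_naturality_right_assoc,
      Bicategory.whisker_exchange_assoc]
    simp
  rw [w₁, ← Bicategory.whiskerLeft_comp, ← w']
  have e₂ := reassoc_of% e₁
  simp [e₂]

lemma conj_modification {x x₁ x₂ x₃ y y₁ y₂ y₃ : C} {fc : x ⟶ y}
    {p4 : x ⟶ x₁} {p4' : y ⟶ y₁} {p2 : x₁ ⟶ x₂} {p2' : y₁ ⟶ y₂} {p3 : x ⟶ x₃} {p3' : y ⟶ y₃}
    {r s : x₃ ⟶ x₂} {r' s' : y₃ ⟶ y₂} {u₀ u : x₁ ⟶ y₁} {t₀ t : x₃ ⟶ y₃}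
    {v₀₀ v₀ v w₀₀ w₀ : x₂ ⟶ y₂} {q1 q2 : x ⟶ x₂} {q1' q2' : y ⟶ y₂}
    {n4 : fc ≫ p4' ⟶ p4 ≫ u₀} {β4 : u₀ ⟶ u} {n2 : u ≫ p2' ⟶ p2 ≫ v₀} {β2 : v₀ ⟶ v}
    {β4' : v₀₀ ≅ v₀} {γ1 : q1 ≅ p4 ≫ p2} {γ1' : q1' ≅ p4' ≫ p2'}
    {n3 : fc ≫ p3' ⟶ p3 ≫ t₀} {β3 : t₀ ⟶ t} {ε : r ≅ s} {ε' : r' ≅ s'}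
    {M : t ≫ s' ⟶ s ≫ w₀} {β3' : w₀₀ ≅ w₀} {γ2 : q2 ≅ p3 ≫ r} {γ2' : q2' ≅ p3' ≫ r'}
    {z : q1 ⟶ q2} {z' : q1' ⟶ q2'} {σ : v₀₀ ⟶ w₀₀} {β1 : w₀ ⟶ v}
    {N1 : fc ≫ q1' ⟶ q1 ≫ v₀₀} {N2 : fc ≫ q2' ⟶ q2 ≫ w₀₀}
    (hN1 : N1 = fc ◃ γ1'.hom ≫ (𝒶 _ _ _).inv ≫ n4 ▹ p2' ≫ (𝒶 _ _ _).hom ≫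
      p4 ◃ (β4 ▹ p2' ≫ n2 ≫ p2 ◃ β4'.inv) ≫ (𝒶 _ _ _).inv ≫ γ1.inv ▹ v₀₀)
    (hN2 : N2 = fc ◃ γ2'.hom ≫ (𝒶 _ _ _).inv ≫ n3 ▹ r' ≫ (𝒶 _ _ _).hom ≫
      p3 ◃ (β3 ▹ r' ≫ t ◃ ε'.hom ≫ M ≫ ε.inv ▹ w₀ ≫ r ◃ β3'.inv) ≫ (𝒶 _ _ _).inv ≫
      γ2.inv ▹ w₀₀)
    (hz : N1 ≫ z ▹ v₀₀ ≫ q2 ◃ σ = fc ◃ z' ≫ N2) (hβ : β4'.hom ≫ β2 = σ ≫ β3'.hom ≫ β1) :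
    fc ◃ (γ1'.inv ≫ z' ≫ γ2'.hom ≫ p3' ◃ ε'.hom) ≫ (𝒶 _ _ _).inv ≫ (n3 ≫ p3 ◃ β3) ▹ s' ≫
        (𝒶 _ _ _).hom ≫ p3 ◃ (M ≫ s ◃ β1) ≫ (𝒶 _ _ _).inv =
      (𝒶 _ _ _).inv ≫ (n4 ≫ p4 ◃ β4) ▹ p2' ≫ (𝒶 _ _ _).hom ≫ p4 ◃ (n2 ≫ p2 ◃ β2) ≫
        (𝒶 _ _ _).inv ≫ (γ1.inv ≫ z ≫ γ2.hom ≫ p3 ◃ ε.hom) ▹ v := by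
  have h2 : ∀ {a b : x ⟶ x₂} (m : a ⟶ b) {k l : x₂ ⟶ y₂} (n : k ⟶ l) {c : x ⟶ y₂} (q : b ≫ l ⟶ c),
      m ▹ k ≫ b ◃ n ≫ q = a ◃ n ≫ m ▹ l ≫ q := fun m _ _ n _ q =>
    (Bicategory.whisker_exchange_assoc m n q).symm
  have h1 : (𝒶 _ _ _).inv ≫ (n4 ≫ p4 ◃ β4) ▹ p2' ≫ (𝒶 _ _ _).hom ≫ p4 ◃ (n2 ≫ p2 ◃ β2) ≫
      (𝒶 _ _ _).inv ≫ (γ1.inv ≫ z ≫ γ2.hom ≫ p3 ◃ ε.hom) ▹ v =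
      fc ◃ γ1'.inv ≫ (N1 ≫ z ▹ v₀₀ ≫ q2 ◃ σ) ≫ γ2.hom ▹ w₀₀ ≫ (p3 ◃ ε.hom) ▹ w₀₀ ≫
        (p3 ≫ s) ◃ (β3'.hom ≫ β1) := by
    have h3 : z ▹ v₀₀ ≫ q2 ◃ σ ≫ γ2.hom ▹ w₀₀ ≫ (p3 ◃ ε.hom) ▹ w₀₀ ≫ (p3 ≫ s) ◃ (β3'.hom ≫ β1) =
        q1 ◃ (σ ≫ β3'.hom ≫ β1) ≫ (z ≫ γ2.hom ≫ p3 ◃ ε.hom) ▹ v := by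
      rw [h2, ← Bicategory.whisker_exchange, h2, h2]
      simp only [Bicategory.whiskerLeft_comp, Bicategory.comp_whiskerRight, Category.assoc]
    simp only [Category.assoc]
    rw [h3, ← hβ, hN1]
    simp only [Category.assoc]
    rw [h2]
    simp
  have h4 : n3 ▹ r' ≫ (𝒶 _ _ _).hom ≫ p3 ◃ β3 ▹ r' ≫ p3 ◃ t ◃ ε'.hom =
      (fc ≫ p3') ◃ ε'.hom ≫ n3 ▹ s' ≫ (𝒶 _ _ _).hom ≫ p3 ◃ β3 ▹ s' := by
    rw [Bicategory.whisker_exchange_assoc, ← Bicategory.whiskerLeft_comp,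
      ← Bicategory.whisker_exchange]
    simp
  have h5 : r ◃ β3'.inv ≫ ε.hom ▹ w₀₀ = ε.hom ▹ w₀ ≫ s ◃ β3'.inv :=
    Bicategory.whisker_exchange _ _
  have h6 := congrArg (fun m => p3 ◃ m) h5
  simp only [Bicategory.whiskerLeft_comp] at h6
  rw [h1, hz, hN2]
  have h7 := reassoc_of% h4
  have h8 := reassoc_of% h6
  simp [h7, h8]

lemma conj_simplex {x₀ x₁ x₂ x₃ y₁ y₂ z₁ z₂ : C} {a : x₀ ⟶ x₁} {b : x₁ ⟶ x₂} {c : x₂ ⟶ x₃}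
    {d : x₀ ⟶ y₁} {m m' : y₁ ⟶ x₂} {e : y₁ ⟶ y₂} {n n' : y₂ ⟶ x₃} {f : x₀ ⟶ z₁} {p p' : z₁ ⟶ y₂}
    {g : x₁ ⟶ z₂} {q q' : z₂ ⟶ x₃} {r r' : z₁ ⟶ z₂} {εm : m' ≅ m} {κ : n' ≅ n} {εp : p' ≅ p}
    {εq : q' ≅ q} {εr : r' ≅ r} {ζ1 : a ≫ b ⟶ d ≫ m'} {ν : m ≫ c ⟶ e ≫ n}
    {N : m' ≫ c ⟶ e ≫ n'} {ζ2 : d ≫ e ⟶ f ≫ p'} {ζ3 : b ≫ c ⟶ g ≫ q'} {ζ4 : a ≫ g ⟶ f ≫ r'}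
    {M : r ≫ q ⟶ p ≫ n} {M' : r' ≫ q' ⟶ p' ≫ n'}
    (hN : N = εm.hom ▹ c ≫ ν ≫ e ◃ κ.inv)
    (hM : M' = εr.hom ▹ q' ≫ r ◃ εq.hom ≫ M ≫ p ◃ κ.inv ≫ εp.inv ▹ n')
    (H : ζ1 ▹ c ≫ (𝒶 _ _ _).hom ≫ d ◃ N ≫ (𝒶 _ _ _).inv ≫ ζ2 ▹ n' =
      (𝒶 _ _ _).hom ≫ a ◃ ζ3 ≫ (𝒶 _ _ _).inv ≫ ζ4 ▹ q' ≫ (𝒶 _ _ _).hom ≫ f ◃ M' ≫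
        (𝒶 _ _ _).inv) :
    (ζ1 ≫ d ◃ εm.hom) ▹ c ≫ (𝒶 _ _ _).hom ≫ d ◃ ν ≫ (𝒶 _ _ _).inv ≫ (ζ2 ≫ f ◃ εp.hom) ▹ n =
      (𝒶 _ _ _).hom ≫ a ◃ (ζ3 ≫ g ◃ εq.hom) ≫ (𝒶 _ _ _).inv ≫ (ζ4 ≫ f ◃ εr.hom) ▹ q ≫
        (𝒶 _ _ _).hom ≫ f ◃ M ≫ (𝒶 _ _ _).inv := by
  have h := congrArg (fun t => t ≫ (f ≫ p') ◃ κ.hom ≫ (f ◃ εp.hom) ▹ n) H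
  simp only [Category.assoc] at h
  have h1 : ζ2 ▹ n' ≫ (f ≫ p') ◃ κ.hom = (d ≫ e) ◃ κ.hom ≫ ζ2 ▹ n :=
    (Bicategory.whisker_exchange _ _).symm
  have h2 : ζ4 ▹ q' ≫ (f ≫ r') ◃ εq.hom = (a ≫ g) ◃ εq.hom ≫ ζ4 ▹ q :=
    (Bicategory.whisker_exchange _ _).symm
  have h3 : εr.hom ▹ q' ≫ r ◃ εq.hom = r' ◃ εq.hom ≫ εr.hom ▹ q :=
    (Bicategory.whisker_exchange _ _).symm
  have h4 : εp.inv ▹ n' ≫ p' ◃ κ.hom = p ◃ κ.hom ≫ εp.inv ▹ n :=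
    (Bicategory.whisker_exchange _ _).symm
  have h5 := congrArg (fun t => f ◃ t) h4
  have h6 := congrArg (fun t => f ◃ t) h3
  simp only [Bicategory.whiskerLeft_comp] at h5 h6
  rw [reassoc_of% h1, hN, hM] at h
  simp only [Bicategory.comp_whiskerLeft, Category.assoc, Iso.inv_hom_id_assoc,
    Bicategory.whiskerLeft_comp] at h
  rw [reassoc_of% h5] at h
  simp only [Bicategory.comp_whiskerLeft, Category.assoc, Iso.inv_hom_id_assoc,
    Bicategory.whiskerLeft_comp] at h h2
  simp [reassoc_of% h6] at h
  simp [h]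
  have h7 := congrArg (fun t => t ≫ (𝒶 _ _ _).hom) h2
  simp at h7
  simp [reassoc_of% h7]

end Conjugation
end TwistedBicat

namespace TwistedBicat

attribute [-simp] MonoidalCategory.tensorHom_id MonoidalCategory.id_tensorHom
  MonoidalCategory.associator_conjugation
attribute [local simp] MonoidalCategory.id_tensorHom_id MonoidalCategory.tensorHom_comp_tensorHom
  MonoidalCategory.tensorHom_comp_tensorHom_assoc MonoidalCategory.associator_naturality
  MonoidalCategory.associator_naturality_assoc

local infixr:81 " ◃ " => Bicategory.whiskerLeft
local infixl:81 " ▹ " => Bicategory.whiskerRight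

open MonoidalTwoCategory


open Elem EnrichedData

section Modifications

variable {W : Type u} [Bicategory.{w, v} W] [Bicategory.Strict W] [MonoidalTwoCategory W]
  {X Y : W}

lemma comp₃_reassoc {C : Type*} [Category* C] {a b c d e : C} {f : a ⟶ b} {g : b ⟶ c} {h : c ⟶ d}
    {k : a ⟶ d} (w : f ≫ g ≫ h = k) (z : d ⟶ e) : f ≫ g ≫ h ≫ z = k ≫ z := by
  rw [← w]
  simp

lemma comp_assoc₆ {C : Type*} [Category* C] {a b c d e f i : C} (m₁ : a ⟶ b) (m₂ : b ⟶ c) (m₃ : c ⟶ d)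
    (m₄ : d ⟶ e) (m₅ : e ⟶ f) (m₆ : f ⟶ i) :
    (m₁ ≫ m₂) ≫ m₃ ≫ (m₄ ≫ m₅) ≫ m₆ = m₁ ≫ m₂ ≫ m₃ ≫ m₄ ≫ m₅ ≫ m₆ := by
  simp

lemma boxMap_fold_comp {U V Z : W} {u₁ u₂ u₃ u₄ u₅ : Elem U} {v : Elem V} (c : U ⊗ V ⟶ Z)
    {s₁ : u₁ ⟶ u₂} {s₂ : u₂ ⟶ u₃} {s₃ : u₃ ⟶ u₄} {r₁ : u₁ ⟶ u₅} {r₂ : u₅ ⟶ u₄}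
    (h : s₁ ≫ s₂ ≫ s₃ = r₁ ≫ r₂) :
    pushMap c (boxMap s₁ (𝟙 v)) ≫ pushMap c (boxMap s₂ (𝟙 v)) ≫ pushMap c (boxMap s₃ (𝟙 v)) =
      pushMap c (boxMap r₁ (𝟙 v)) ≫ pushMap c (boxMap r₂ (𝟙 v)) := by
  simp only [← pushMap_comp, ← boxMap_comp_id, h]

lemma pushMap_box_id_comp {U V Z : W} {u : Elem U} {v₁ v₂ v₃ : Elem V} (c : U ⊗ V ⟶ Z)
    (m : v₁ ⟶ v₂) (n : v₂ ⟶ v₃) :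
    pushMap c (boxMap (𝟙 u) (m ≫ n)) = pushMap c (boxMap (𝟙 u) m) ≫ pushMap c (boxMap (𝟙 u) n) := by
  rw [boxMap_id_comp, pushMap_comp]

lemma boxMap_fold_left {U V Z : W} {u₁ u₂ u₃ : Elem U} {v₁ v₂ v₃ v₄ v₅ : Elem V} (c : U ⊗ V ⟶ Z)
    {m : u₁ ⟶ u₂} {b : u₂ ⟶ u₃} {M : u₁ ⟶ u₃} {s₁ : v₁ ⟶ v₂} {s₂ : v₂ ⟶ v₃} {s₃ : v₃ ⟶ v₄}
    {s₄ : v₄ ⟶ v₅} {S : v₁ ⟶ v₅} (hm : m ≫ b = M) (hs : s₁ ≫ s₂ ≫ s₃ ≫ s₄ = S) {d : Elem Z}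
    (z : pushObj c (box u₃ v₅) ⟶ d) :
    pushMap c (boxMap (𝟙 u₁) s₁) ≫ pushMap c (boxMap (𝟙 u₁) s₂) ≫ pushMap c (boxMap m s₃) ≫
        pushMap c (boxMap b s₄) ≫ z =
      pushMap c (boxMap (𝟙 u₁) S) ≫ pushMap c (boxMap M (𝟙 v₅)) ≫ z := by
  rw [← hm, ← hs]
  simp only [← pushMap_comp, ← boxMap_comp, ← Category.assoc, Category.id_comp, Category.comp_id]

lemma boxMap_fold_right {U V Z : W} {u₁ u₂ u₃ u₄ u₅ : Elem U} {v₁ v₂ v₃ : Elem V} (c : U ⊗ V ⟶ Z)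
    {m : v₁ ⟶ v₂} {b : v₂ ⟶ v₃} {M : v₁ ⟶ v₃} {s₁ : u₁ ⟶ u₂} {s₂ : u₂ ⟶ u₃} {s₃ : u₃ ⟶ u₄}
    {s₄ : u₄ ⟶ u₅} {S : u₁ ⟶ u₅} (hm : m ≫ b = M) (hs : s₁ ≫ s₂ ≫ s₃ ≫ s₄ = S) :
    pushMap c (boxMap s₁ m) ≫ pushMap c (boxMap s₂ b) ≫ pushMap c (boxMap s₃ (𝟙 v₃)) ≫
        pushMap c (boxMap s₄ (𝟙 v₃)) =
      pushMap c (boxMap (𝟙 u₁) M) ≫ pushMap c (boxMap S (𝟙 v₃)) := by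
  rw [← hm, ← hs]
  simp only [← pushMap_comp, ← boxMap_comp, ← Category.assoc, Category.id_comp, Category.comp_id]

namespace EnrichedData

variable {O : Type s} {A : EnrichedData W O}

/-- A 2-cell between the composites of points, as a morphism of generalized elements. -/
def elemGcompIso {x y y' z : O} {f : A.El x y} {g : A.El y z} {f' : A.El x y'} {g' : A.El y' z}
    (η : gcomp f g ≅ gcomp f' g') :
    pushObj (A.comp x y z) (box (point g) (point f)) ≅
      pushObj (A.comp x y' z) (box (point g') (point f')) :=
  (elemGcomp f g).symm ≪≫ pointIso η ≪≫ elemGcomp f' g'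

lemma elemGcompIso_hom {x y y' z : O} {f : A.El x y} {g : A.El y z} {f' : A.El x y'}
    {g' : A.El y' z} (η : gcomp f g ≅ gcomp f' g') :
    (elemGcompIso η).hom = (elemGcomp f g).inv ≫ (pointIso η).hom ≫ (elemGcomp f' g').hom := rfl

lemma pointIso_eq_elemGcompIso {x y y' z : O} {f : A.El x y} {g : A.El y z} {f' : A.El x y'}
    {g' : A.El y' z} (η : gcomp f g ≅ gcomp f' g') :
    (pointIso η).hom = (elemGcomp f g).hom ≫ (elemGcompIso η).hom ≫ (elemGcomp f' g').inv := by
  simp [elemGcompIso_hom]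

lemma pointIso_gcompIso₂_refl {w x y y' z : O} {f : A.El w x} {g : A.El x y} {f' : A.El w y'}
    {g' : A.El y' y} (η : gcomp f g ≅ gcomp f' g') (h : A.El y z) :
    (pointIso (gcompIso₂ η (Iso.refl h))).hom = (elemGcomp (gcomp f g) h).hom ≫
      pushMap (A.comp w y z) (boxMap (𝟙 (point h)) (elemGcomp f g).hom) ≫
      pushMap (A.comp w y z) (boxMap (𝟙 (point h)) (elemGcompIso η).hom) ≫
      pushMap (A.comp w y z) (boxMap (𝟙 (point h)) (elemGcomp f' g').inv) ≫
      (elemGcomp (gcomp f' g') h).inv := by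
  rw [pointIso_gcompIso₂, pointIso_refl, Iso.refl_hom, pointIso_eq_elemGcompIso]
  simp only [boxMap_id_comp, pushMap_comp, Category.assoc]

lemma pointIso_refl_gcompIso₂ {w x y y' z : O} {f : A.El x y} {g : A.El y z} {f' : A.El x y'}
    {g' : A.El y' z} (h : A.El w x) (η : gcomp f g ≅ gcomp f' g') :
    (pointIso (gcompIso₂ (Iso.refl h) η)).hom = (elemGcomp h (gcomp f g)).hom ≫
      pushMap (A.comp w x z) (boxMap (elemGcomp f g).hom (𝟙 (point h))) ≫
      pushMap (A.comp w x z) (boxMap (elemGcompIso η).hom (𝟙 (point h))) ≫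
      pushMap (A.comp w x z) (boxMap (elemGcomp f' g').inv (𝟙 (point h))) ≫
      (elemGcomp h (gcomp f' g')).inv := by
  rw [pointIso_gcompIso₂, pointIso_refl, Iso.refl_hom, pointIso_eq_elemGcompIso]
  simp only [boxMap_comp_id, pushMap_comp, Category.assoc]

lemma pointIso_gcompAssoc_inv {w x y z : O} (f : A.El w x) (g : A.El x y) (h : A.El y z) :
    (pointIso (gcompAssoc f g h)).inv = (elemGcomp f (gcomp g h)).hom ≫
      pushMap (A.comp w x z) (boxMap (elemGcomp g h).hom (𝟙 (point f))) ≫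
      (A.elemAssoc (point f) (point g) (point h)).hom ≫
      pushMap (A.comp w y z) (boxMap (𝟙 (point h)) (elemGcomp f g).inv) ≫
      (elemGcomp (gcomp f g) h).inv := by
  have e : pointIso (gcompAssoc f g h) = elemGcomp (gcomp f g) h ≪≫
      pushIso (A.comp w y z) (boxIso (Iso.refl (point h)) (elemGcomp f g)) ≪≫
      (A.elemAssoc (point f) (point g) (point h)).symm ≪≫
      pushIso (A.comp w x z) (boxIso (elemGcomp g h).symm (Iso.refl (point f))) ≪≫
      (elemGcomp f (gcomp g h)).symm := Iso.ext (pointIso_gcompAssoc f g h)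
  refine (congrArg Iso.inv e).trans ?_
  simp only [Iso.trans_inv, Iso.symm_inv, Category.assoc]
  rfl

lemma elemGcompIso_simplex {x₀ x₁ x₂ x₃ y₁ y₂ z₁ z₂ : O} {a : A.El x₀ x₁} {b : A.El x₁ x₂}
    {c : A.El x₂ x₃} {d : A.El x₀ y₁} {m : A.El y₁ x₂} {e : A.El y₁ y₂} {n : A.El y₂ x₃}
    {f : A.El x₀ z₁} {p : A.El z₁ y₂} {g : A.El x₁ z₂} {q : A.El z₂ x₃} {r : A.El z₁ z₂}
    (ζ₁ : gcomp a b ≅ gcomp d m) (N : gcomp m c ≅ gcomp e n) (ζ₂ : gcomp d e ≅ gcomp f p)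
    (ζ₃ : gcomp b c ≅ gcomp g q) (ζ₄ : gcomp a g ≅ gcomp f r) (M : gcomp r q ≅ gcomp p n)
    (h : (gcompIso₂ ζ₁ (Iso.refl c)).hom ≫ (gcompAssoc _ _ _).hom ≫
        (gcompIso₂ (Iso.refl d) N).hom ≫ (gcompAssoc _ _ _).inv ≫
        (gcompIso₂ ζ₂ (Iso.refl n)).hom =
      (gcompAssoc _ _ _).hom ≫ (gcompIso₂ (Iso.refl a) ζ₃).hom ≫ (gcompAssoc _ _ _).inv ≫
        (gcompIso₂ ζ₄ (Iso.refl q)).hom ≫ (gcompAssoc _ _ _).hom ≫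
        (gcompIso₂ (Iso.refl f) M).hom ≫ (gcompAssoc _ _ _).inv) :
    pushMap (A.comp _ _ _) (boxMap (𝟙 (point c)) (elemGcompIso ζ₁).hom) ≫
        (A.elemAssoc (point d) (point m) (point c)).inv ≫
        pushMap (A.comp _ _ _) (boxMap (elemGcompIso N).hom (𝟙 (point d))) ≫
        (A.elemAssoc (point d) (point e) (point n)).hom ≫
        pushMap (A.comp _ _ _) (boxMap (𝟙 (point n)) (elemGcompIso ζ₂).hom) =
      (A.elemAssoc (point a) (point b) (point c)).inv ≫
        pushMap (A.comp _ _ _) (boxMap (elemGcompIso ζ₃).hom (𝟙 (point a))) ≫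
        (A.elemAssoc (point a) (point g) (point q)).hom ≫
        pushMap (A.comp _ _ _) (boxMap (𝟙 (point q)) (elemGcompIso ζ₄).hom) ≫
        (A.elemAssoc (point f) (point r) (point q)).inv ≫
        pushMap (A.comp _ _ _) (boxMap (elemGcompIso M).hom (𝟙 (point f))) ≫
        (A.elemAssoc (point f) (point p) (point n)).hom := by
  have h' : gcompIso₂ ζ₁ (Iso.refl c) ≪≫ gcompAssoc _ _ _ ≪≫ gcompIso₂ (Iso.refl d) N ≪≫
      (gcompAssoc _ _ _).symm ≪≫ gcompIso₂ ζ₂ (Iso.refl n) =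
      gcompAssoc _ _ _ ≪≫ gcompIso₂ (Iso.refl a) ζ₃ ≪≫ (gcompAssoc _ _ _).symm ≪≫
        gcompIso₂ ζ₄ (Iso.refl q) ≪≫ gcompAssoc _ _ _ ≪≫
        gcompIso₂ (Iso.refl f) M ≪≫ (gcompAssoc _ _ _).symm := Iso.ext h
  have h₁ := congrArg (fun η => (pointIso η).hom) h'
  simp only [pointIso_trans, Iso.trans_hom, pointIso_symm, Iso.symm_hom, pointIso_gcompIso₂_refl,
    pointIso_refl_gcompIso₂, pointIso_gcompAssoc, pointIso_gcompAssoc_inv, Category.assoc,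
    Iso.inv_hom_id_assoc, Iso.hom_inv_id_assoc, pushMap_box_hom_inv_assoc,
    pushMap_box_inv_hom_assoc, pushMap_box_hom_inv_assoc',
    pushMap_box_inv_hom_assoc'] at h₁
  refine (cancel_epi (elemGcomp (gcomp a b) c ≪≫
    pushIso (A.comp _ _ _) (boxIso (Iso.refl (point c)) (elemGcomp a b))).hom).1
    ((cancel_mono (pushIso (A.comp _ _ _) (boxIso (Iso.refl (point n)) (elemGcomp f p)).symm ≪≫
      (elemGcomp (gcomp f p) n).symm).hom).1 ?_)
  simp only [Iso.trans_hom, Category.assoc]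
  exact h₁

/-- A naturality square of 1-cells, evaluated at a generalized element. -/
def elemSq {x x' y y' : O} {f : X ⟶ A.hom x y} {p' : A.El y y'} {h : X ⟶ A.hom x' y'}
    {p : A.El x x'} (n : f ≫ post p' x ≅ h ≫ pre p y') (a : Elem X) :
    pushObj (A.comp x y y') (box (point p') (pushObj f a)) ≅
      pushObj (A.comp x x' y') (box (pushObj h a) (point p)) :=
  (elemPost p' (pushObj f a)).symm ≪≫
    stIso _ (pushObj (f ≫ post p' x) a) (Iso.refl _) (by simp) ≪≫ evIso n a ≪≫
    stIso _ (pushObj (pre p y') (pushObj h a)) (Iso.refl _) (by simp) ≪≫ elemPre p (pushObj h a)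

lemma elemSq_hom {x x' y y' : O} {f : X ⟶ A.hom x y} {p' : A.El y y'} {h : X ⟶ A.hom x' y'}
    {p : A.El x x'} (n : f ≫ post p' x ≅ h ≫ pre p y') (a : Elem X) :
    (elemSq n a).hom = (elemPost p' (pushObj f a)).inv ≫
      st (pushObj (post p' x) (pushObj f a)) (pushObj (f ≫ post p' x) a) (𝟙 _) (by simp) ≫
      ev n.hom a ≫
      st (pushObj (h ≫ pre p y') a) (pushObj (pre p y') (pushObj h a)) (𝟙 _) (by simp) ≫
      (elemPre p (pushObj h a)).hom := rfl

lemma ev_eq_elemSq {x x' y y' : O} {f : X ⟶ A.hom x y} {p' : A.El y y'} {h : X ⟶ A.hom x' y'}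
    {p : A.El x x'} (n : f ≫ post p' x ≅ h ≫ pre p y') (a : Elem X) :
    ev n.hom a = st (pushObj (f ≫ post p' x) a) (pushObj (post p' x) (pushObj f a)) (𝟙 _)
        (by simp) ≫ (elemPost p' (pushObj f a)).hom ≫ (elemSq n a).hom ≫
      (elemPre p (pushObj h a)).inv ≫
      st (pushObj (pre p y') (pushObj h a)) (pushObj (h ≫ pre p y') a) (𝟙 _) (by simp) := by
  simp [elemSq_hom]

lemma elemSq_modification {x x' y y' : O} {f : X ⟶ A.hom x y} {p' q' : A.El y y'}
    {h k : X ⟶ A.hom x' y'} {p q : A.El x x'} (n : f ≫ post p' x ≅ h ≫ pre p y')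
    (m : f ≫ post q' x ≅ k ≫ pre q y') (z : p ≅ q) (z' : p' ≅ q') (e : h = k)
    (w : n.hom ≫ Bicategory.whiskerLeft h (preIso₂ z y').hom ≫
      eqToHom (congrArg (· ≫ pre q y') e) = f ◃ (postIso₂ z' x).hom ≫ m.hom) (a : Elem X) :
    (elemSq n a).hom ≫
      pushMap (A.comp x x' y') (boxMap (𝟙 (pushObj h a)) (pointIso z).hom) ≫
      pushMap (A.comp x x' y') (boxMap (st (pushObj h a) (pushObj k a) (𝟙 _) (by simp [e]))
        (𝟙 (point q))) =
      pushMap (A.comp x y y') (boxMap (pointIso z').hom (𝟙 (pushObj f a))) ≫ (elemSq m a).hom := by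
  subst e
  have h1 := congrArg (fun η => ev η a) w
  simp only [ev_comp, ev_eqToHom, ev_whiskerLeft, ev_preIso₂, ev_postIso₂, ev_eq_elemSq n,
    ev_eq_elemSq m] at h1
  simp at h1 ⊢
  refine (cancel_mono (elemPre q (pushObj h a)).inv).1 ((cancel_epi (elemPost p' (pushObj f a)).hom).1
    (st_cancel (a := pushObj (f ≫ post p' x) a) (d := pushObj (h ≫ pre q y') a)
      (p := Iso.refl a.src) (q := Iso.refl a.src) (h := by simp) (h' := by simp) ?_))
  simp only [Category.assoc]
  exact h1

end EnrichedData


variable {G : Type t} [Group G] [TwistingAction G W]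

open TwistingAction Functor.LaxMonoidal Functor.OplaxMonoidal

namespace TransData

variable {O : Type s} {A : EnrichedData W O} {g h k : G} (e : g * h = k)

lemma elemNaturality_iso {O' : Type s} {B : EnrichedData W O'} {F H : FunctorData B A}
    (ψ : TransData F H) {x y : O'} {a a' : Elem (B.hom x y)} (i : a ≅ a') :
    (ψ.elemNaturality a).hom =
      pushMap (A.comp _ _ _) (boxMap (𝟙 (point (ψ.app y))) (pushMap (F.map x y) i.hom)) ≫
        (ψ.elemNaturality a').hom ≫
        pushMap (A.comp _ _ _) (boxMap (pushMap (H.map x y) i.inv) (𝟙 (point (ψ.app x)))) := by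
  rw [sq_assoc (ψ.elemNaturality_natural i.hom), ← pushMap_comp, ← boxMap_comp_id, ← pushMap_comp,
    Iso.hom_inv_id, pushMap_id, boxMap_id, pushMap_id, Category.comp_id]

/-- Pseudonaturality of `ψ : F ⟶ baseComp e F' H`, on generalized elements of `A`. -/
def elemNat {F : FunctorData (A.base k) A} {F' : FunctorData (A.base g) A}
    {H : FunctorData (A.base h) A} (ψ : TransData F (FunctorData.baseComp e F' H)) {x y : O}
    (a : Elem (A.hom x y)) :
    pushObj (A.comp _ _ _) (box (point (ψ.app y)) (pushObj (F.map x y) (actObj k a))) ≅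
      pushObj (A.comp _ _ _) (box (pushObj (H.map _ _) (actObj h (pushObj (F'.map x y)
        (actObj g a)))) (point (ψ.app x))) :=
  ψ.elemNaturality (actObj k a) ≪≫
    pushIso (A.comp _ _ _) (boxIso (FunctorData.elemBaseComp e F' H a) (Iso.refl _))

lemma elemNat_hom {F : FunctorData (A.base k) A} {F' : FunctorData (A.base g) A}
    {H : FunctorData (A.base h) A} (ψ : TransData F (FunctorData.baseComp e F' H)) {x y : O}
    (a : Elem (A.hom x y)) :
    (ψ.elemNat e a).hom = (ψ.elemNaturality (actObj k a)).hom ≫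
      pushMap (A.comp _ _ _) (boxMap (FunctorData.elemBaseComp e F' H a).hom (𝟙 _)) := rfl

lemma elemNat_natural {F : FunctorData (A.base k) A} {F' : FunctorData (A.base g) A}
    {H : FunctorData (A.base h) A} (ψ : TransData F (FunctorData.baseComp e F' H)) {x y : O}
    {a a' : Elem (A.hom x y)} (m : a ⟶ a') :
    pushMap (A.comp _ _ _) (boxMap (𝟙 (point (ψ.app y))) (pushMap (F.map x y) (actMap k m))) ≫
        (ψ.elemNat e a').hom =
      (ψ.elemNat e a).hom ≫ pushMap (A.comp _ _ _) (boxMap (pushMap (H.map _ _) (actMap h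
        (pushMap (F'.map x y) (actMap g m)))) (𝟙 (point (ψ.app x)))) := by
  rw [elemNat_hom, elemNat_hom, sq_assoc (ψ.elemNaturality_natural (actMap k m)), ← pushMap_comp,
    ← boxMap_comp_id, FunctorData.elemBaseComp_natural, boxMap_comp_id, pushMap_comp, Category.assoc]

lemma whiskerLeft_base_elemNaturality (F : FunctorData (A.base g) A)
    {H H' : FunctorData (A.base h) A} (ψ : TransData H H') {x y : O} (a : Elem (A.hom x y)) :
    ((whiskerLeft (FunctorData.baseMul _ e) (whiskerLeft (F.base h) ψ)).elemNaturality
        (actObj k a)).hom =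
      pushMap (A.comp _ _ _) (boxMap (𝟙 _) (FunctorData.elemBaseComp e F H a).hom) ≫
      (ψ.elemNaturality (actObj h (pushObj (F.map x y) (actObj g a)))).hom ≫
      pushMap (A.comp _ _ _) (boxMap (FunctorData.elemBaseComp e F H' a).inv (𝟙 _)) := by
  have hi : (pushObj ((F.base h).map x y) (pushObj ((FunctorData.baseMul A e).map x y)
      (actObj k a))).val = ((mulIso e).symm.app a.src).hom ≫
        (actObj h (pushObj (F.map x y) (actObj g a))).val := by
    simp [reassoc_of% FunctorData.mulIso_inv_natural e a.val]
  have hn := ψ.elemNaturality_iso (stIso (pushObj ((F.base h).map x y)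
    (pushObj ((FunctorData.baseMul A e).map x y) (actObj k a)))
    (actObj h (pushObj (F.map x y) (actObj g a))) ((mulIso e).symm.app a.src) hi)
  rw [whiskerLeft_elemNaturality, whiskerLeft_elemNaturality, hn]
  simp [stIso, FunctorData.elemBaseComp_hom, FunctorData.elemBaseComp_inv]

lemma whiskerLeft_whiskerRight_elemNaturality {F F' : FunctorData (A.base g) A}
    (ψ : TransData F F') (H : FunctorData (A.base h) A) {x y : O} (a : Elem (A.hom x y)) :
    ((whiskerLeft (FunctorData.baseMul _ e) (whiskerRight (ψ.base h) H)).elemNaturality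
        (actObj k a)).hom =
      pushMap (A.comp _ _ _) (boxMap (𝟙 _) (FunctorData.elemBaseComp e F H a).hom) ≫
      pushMap (A.comp _ _ _) (boxMap (H.elemOnEl (ψ.app y)).hom (𝟙 _)) ≫
      (H.elemOnComp (pushObj (F.map x y) (actObj g a)) (point (ψ.app y))).hom ≫
      pushMap (H.map _ _) (actMap h (ψ.elemNaturality (actObj g a)).hom) ≫
      (H.elemOnComp (point (ψ.app x)) (pushObj (F'.map x y) (actObj g a))).inv ≫
      pushMap (A.comp _ _ _) (boxMap (𝟙 _) (H.elemOnEl (ψ.app x)).inv) ≫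
      pushMap (A.comp _ _ _) (boxMap (FunctorData.elemBaseComp e F' H a).inv (𝟙 _)) := by
  have hn := (whiskerRight (ψ.base h) H).elemNaturality_iso (stIso
    (pushObj ((FunctorData.baseMul A e).map x y) (actObj k a)) (actObj h (actObj g a))
    ((mulIso e).symm.app a.src) (FunctorData.mulIso_inv_natural e a.val))
  have h1 := H.elemMapComp_natural (st (pushObj ((F.base h).map x y) (actObj h (actObj g a)))
    (actObj h (pushObj (F.map x y) (actObj g a))) (𝟙 _) (by simp)) (elemBaseEl h (ψ.app y)).hom
  have h2 : pushMap (H.map _ _) (pushMap ((A.base h).comp _ _ _) (boxMap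
      (st (actObj h (pushObj (F'.map x y) (actObj g a)))
        (pushObj ((F'.base h).map x y) (actObj h (actObj g a))) (𝟙 _) (by simp))
      (elemBaseEl h (ψ.app x)).inv)) ≫
      (H.elemMapComp (point (baseEl h (ψ.app x)))
        (pushObj ((F'.base h).map x y) (actObj h (actObj g a)))).inv =
      (H.elemMapComp (actObj h (point (ψ.app x)))
        (actObj h (pushObj (F'.map x y) (actObj g a)))).inv ≫
      pushMap (A.comp _ _ _) (boxMap (pushMap (H.map _ _)
        (st (actObj h (pushObj (F'.map x y) (actObj g a)))
        (pushObj ((F'.base h).map x y) (actObj h (actObj g a))) (𝟙 _) (by simp)))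
        (pushMap (H.map _ _) (elemBaseEl h (ψ.app x)).inv)) := by
    rw [Iso.comp_inv_eq, Category.assoc, H.elemMapComp_natural, Iso.inv_hom_id_assoc]
  rw [whiskerLeft_elemNaturality, hn, whiskerRight_elemNaturality, base_elemNaturality]
  simp only [pushMap_comp, Category.assoc]
  rw [← sq_assoc h1, sq_assoc h2]
  refine (boxMap_fold_left (M := (H.elemOnEl (ψ.app y)).hom)
    (S := (FunctorData.elemBaseComp e F H a).hom) _ ?_ ?_ _).trans ?_
  · rfl
  · simp [stIso, FunctorData.elemBaseComp_hom]
  refine congrArg (_ ≫ ·) (congrArg (_ ≫ ·) ?_)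
  refine (congrArg (_ ≫ ·) (congrArg (_ ≫ ·) (congrArg (_ ≫ ·) (congrArg (_ ≫ ·)
    (congrArg (_ ≫ ·) (boxMap_fold_right (M := (H.elemOnEl (ψ.app x)).inv)
    (S := (FunctorData.elemBaseComp e F' H a).inv) _ ?_ ?_)))))).trans ?_
  · rfl
  · simp [stIso, FunctorData.elemBaseComp_inv]
  exact (comp_assoc₆ _ _ _ _ _ _).symm

end TransData

namespace FunctorData

variable {O : Type s} {A : EnrichedData W O} {g h k a b c : G}

lemma val_onEl (F : FunctorData (A.base g) A) {x y : O} (f : A.El x y) :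
    (pushObj (F.map x y) (actObj g (point f))).val = η (act g) ≫ (point (F.onEl f)).val := by
  simp [onEl, mapEl, baseEl]

lemma elemOnEl_inv_eq_st (F : FunctorData (A.base g) A) {x y : O} (f : A.El x y) :
    (F.elemOnEl f).inv = st (pushObj (F.map x y) (actObj g (point f))) (point (F.onEl f))
      (η (act g)) (F.val_onEl f) := by
  rw [elemOnEl_inv, elemMapEl_inv, elemBaseEl_inv, pushMap_st]
  exact (st_st ..).trans (st_congr (by simp) _)

lemma elemBaseComp_assoc (e₁ : g * h = a) (e₂ : h * k = b) (e₃ : a * k = c) (e₄ : g * b = c)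
    (F : FunctorData (A.base g) A) (H : FunctorData (A.base h) A) (K : FunctorData (A.base k) A)
    {x y : O} (f : Elem (A.hom x y)) :
    (elemBaseComp e₄ F (baseComp e₂ H K) f).hom ≫
        (elemBaseComp e₂ H K (pushObj (F.map x y) (actObj g f))).hom =
      st (pushObj ((baseComp e₄ F (baseComp e₂ H K)).map x y) (actObj c f))
          (pushObj ((baseComp e₃ (baseComp e₁ F H) K).map x y) (actObj c f)) (𝟙 _)
          (by rw [baseComp_assoc_map e₁ e₂ e₃ e₄]; exact (Category.id_comp _).symm) ≫
        (elemBaseComp e₃ (baseComp e₁ F H) K f).hom ≫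
        pushMap (K.map _ _) (actMap k (elemBaseComp e₁ F H f).hom) := by
  have hp : (mulIso e₄).inv.app f.src ≫ (mulIso e₂).inv.app ((act g).obj f.src) =
      (mulIso e₃).inv.app f.src ≫ (act k).map ((mulIso e₁).inv.app f.src) := mulInv_assoc e₁ e₂ e₃ e₄ f.src
  rw [elemBaseComp_hom, elemBaseComp_hom, elemBaseComp_hom, elemBaseComp_hom, actMap_st, pushMap_st,
    st_st, st_st, st_st]
  exact st_congr (hp.trans (Category.id_comp _).symm) _

end FunctorData

namespace TransData

variable {O : Type s} {A : EnrichedData W O} {g h k : G} (e : g * h = k)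

lemma elemGcompIso_naturalityEl {F : FunctorData (A.base k) A} {F' : FunctorData (A.base g) A}
    {H : FunctorData (A.base h) A} (ψ : TransData F (FunctorData.baseComp e F' H)) {x y : O}
    (f : A.El x y) :
    (elemGcompIso (ψ.naturalityEl (baseEl k f) ≪≫ gcompIso₂ (Iso.refl _) (eqToIso
      (FunctorData.baseComp_mapEl e F' H f)))).hom =
    pushMap (A.comp _ _ _) (boxMap (𝟙 _) (F.elemOnEl f).hom) ≫ (ψ.elemNat e (point f)).hom ≫
    pushMap (A.comp _ _ _) (boxMap (pushMap (H.map _ _) (actMap h (F'.elemOnEl f).inv) ≫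
      (H.elemOnEl (F'.onEl f)).inv) (𝟙 _)) := by
  have h1 := ψ.elemNaturality_iso (elemBaseEl k f)
  rw [elemGcompIso_hom, pointIso_trans, Iso.trans_hom, pointIso_naturalityEl, pointIso_gcompIso₂,
    pointIso_refl, Iso.refl_hom, pointIso_eqToIso, elemNat_hom, h1]
  have hp : η (act (W := W) k) = (mulIso e).inv.app (𝟙_ W) ≫ (act h).map (η (act g)) ≫ η (act h) := by
    have i1 : ε (act k) ≫ (mulIso e).inv.app (𝟙_ W) ≫ (act h).map (η (act g)) ≫ η (act (W := W) h) =
        𝟙 _ := by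
      rw [reassoc_of% ε_mulIso_inv (W := W) e, ← Functor.map_comp_assoc, Functor.Monoidal.ε_η,
        CategoryTheory.Functor.map_id, Category.id_comp, Functor.Monoidal.ε_η]
    rw [← Functor.Monoidal.η_ε_assoc (act (W := W) k) ((mulIso e).inv.app (𝟙_ W) ≫ (act h).map (η (act g)) ≫ η (act h)),
      i1, Category.comp_id]
  have h2 : pushMap ((FunctorData.baseComp e F' H).map x y) (elemBaseEl k f).inv ≫
      ((FunctorData.baseComp e F' H).elemMapEl (baseEl k f)).inv ≫
      st (point ((FunctorData.baseComp e F' H).mapEl (baseEl k f))) (point (H.onEl (F'.onEl f)))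
        (𝟙 _) (by simp [FunctorData.baseComp_mapEl e F' H f]) =
      (FunctorData.elemBaseComp e F' H (point f)).hom ≫ pushMap (H.map _ _) (actMap h (F'.elemOnEl f).inv) ≫
        (H.elemOnEl (F'.onEl f)).inv := by
    rw [FunctorData.elemOnEl_inv_eq_st, FunctorData.elemOnEl_inv_eq_st, FunctorData.elemMapEl_inv,
      elemBaseEl_inv, FunctorData.elemBaseComp_hom]
    simp only [pushMap_st, actMap_st, st_st]
    exact st_congr (by rw [hp, Category.comp_id, Category.comp_id]) _
  simp only [Category.assoc, Iso.inv_hom_id_assoc, Iso.inv_hom_id, Category.comp_id,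
    FunctorData.elemOnEl_hom, boxMap_id_comp, pushMap_comp]
  refine Eq.trans ?_ (congrArg (· ≫ _) (pushMap_box_id_comp (A.comp (F.obj x) (F.obj y) (H.obj (F'.obj y)))
    (F.elemMapEl (baseEl k f)).hom (pushMap (F.map x y) (elemBaseEl k f).hom))).symm
  refine Eq.trans ?_ (Category.assoc _ _ _).symm
  exact congrArg (_ ≫ ·) (congrArg (_ ≫ ·) (congrArg (_ ≫ ·) (boxMap_fold_comp _ h2)))

end TransData

namespace FunctorData

variable {O : Type s} {A : EnrichedData W O} {g : G}

lemma elemGcompIso_onEl (F : FunctorData (A.base g) A) {x y y' z : O} {f : A.El x y} {k : A.El y z}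
    {f' : A.El x y'} {k' : A.El y' z} (η : gcomp f k ≅ gcomp f' k') :
    (elemGcompIso (F.onElComp f k ≪≫ F.onElIso₂ η ≪≫ (F.onElComp f' k').symm)).hom =
      pushMap (A.comp _ _ _) (boxMap (F.elemOnEl k).hom (F.elemOnEl f).hom) ≫
      (F.elemOnComp (point f) (point k)).hom ≫
      pushMap (F.map x z) (actMap g (elemGcompIso η).hom) ≫
      (F.elemOnComp (point f') (point k')).inv ≫
      pushMap (A.comp _ _ _) (boxMap (F.elemOnEl k').inv (F.elemOnEl f').inv) := by
  have h : ∀ {y : O} (f : A.El x y) (k : A.El y z), pointIso (F.onElComp f k) =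
      elemGcomp (F.onEl f) (F.onEl k) ≪≫
      pushIso (A.comp _ _ _) (boxIso (F.elemOnEl k) (F.elemOnEl f)) ≪≫
      F.elemOnComp (point f) (point k) ≪≫
      pushIso (F.map x z) (actIso g (elemGcomp f k).symm) ≪≫ (F.elemOnEl (gcomp f k)).symm :=
    fun f k => Iso.ext (F.pointIso_onElComp f k)
  have h' : (pointIso (F.onElIso₂ η)) = F.elemOnEl _ ≪≫ pushIso (F.map x z) (actIso g (pointIso η)) ≪≫
      (F.elemOnEl _).symm := Iso.ext (F.pointIso_onElIso₂ η)
  have h3 : (pointIso η).hom = (elemGcomp f k ≪≫ elemGcompIso η ≪≫ (elemGcomp f' k').symm).hom :=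
    pointIso_eq_elemGcompIso η
  have h3' : actMap g (elemGcomp f k).inv ≫ actMap g (pointIso η).hom ≫ actMap g (elemGcomp f' k').hom =
      actMap g (elemGcompIso η).hom := by
    rw [h3, ← actMap_comp, ← actMap_comp]
    simp
  have h4 := congrArg (pushMap (F.map x z)) h3'
  rw [pushMap_comp, pushMap_comp] at h4
  rw [elemGcompIso, pointIso_trans, pointIso_trans, pointIso_symm, h, h, h']
  simp only [Iso.trans_hom, Iso.symm_hom, Iso.trans_inv, Iso.symm_inv, Category.assoc,
    Iso.inv_hom_id_assoc, Iso.hom_inv_id_assoc, Iso.inv_hom_id, Category.comp_id]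
  exact congrArg (_ ≫ ·) (congrArg (_ ≫ ·) (comp₃_reassoc h4 _))

end FunctorData

end Modifications
end TwistedBicat

namespace TwistedBicat

attribute [-simp] MonoidalCategory.tensorHom_id MonoidalCategory.id_tensorHom
  MonoidalCategory.associator_conjugation
attribute [local simp] MonoidalCategory.id_tensorHom_id MonoidalCategory.tensorHom_comp_tensorHom
  MonoidalCategory.tensorHom_comp_tensorHom_assoc MonoidalCategory.associator_naturality
  MonoidalCategory.associator_naturality_assoc

local infixr:81 " ◃ " => Bicategory.whiskerLeft
local infixl:81 " ▹ " => Bicategory.whiskerRight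

open MonoidalTwoCategory


open Elem EnrichedData

local notation "𝒶" => Bicategory.associator

section WeakActions

variable {W : Type u} [Bicategory.{w, v} W] [Bicategory.Strict W] [MonoidalTwoCategory W]
  {G : Type t} [Group G] [TwistingAction G W]

open TwistingAction Functor.LaxMonoidal Functor.OplaxMonoidal

variable {O : Type s}

lemma TransData.elemNaturality_onComp {A : EnrichedBicategory W O} {k : G}
    {F H : FunctorData (A.base k) A.toEnrichedData} {ψ : TransData F H} (hψ : ψ.IsLawful)
    {x y z : O} (a : Elem (A.hom x y)) (b : Elem (A.hom y z)) :
    pushMap (A.comp _ _ _) (boxMap (𝟙 (point (ψ.app z))) (F.elemOnComp a b).hom) ≫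
        (ψ.elemNaturality (actObj k (pushObj (A.comp x y z) (box b a)))).hom =
      (A.elemAssoc (pushObj (F.map x y) (actObj k a)) (pushObj (F.map y z) (actObj k b))
          (point (ψ.app z))).inv ≫
        pushMap (A.comp _ _ _) (boxMap (ψ.elemNaturality (actObj k b)).hom
          (𝟙 (pushObj (F.map x y) (actObj k a)))) ≫
        (A.elemAssoc (pushObj (F.map x y) (actObj k a)) (point (ψ.app y))
          (pushObj (H.map y z) (actObj k b))).hom ≫
        pushMap (A.comp _ _ _) (boxMap (𝟙 (pushObj (H.map y z) (actObj k b)))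
          (ψ.elemNaturality (actObj k a)).hom) ≫
        (A.elemAssoc (point (ψ.app x)) (pushObj (H.map x y) (actObj k a))
          (pushObj (H.map y z) (actObj k b))).inv ≫
        pushMap (A.comp _ _ _) (boxMap (H.elemOnComp a b).hom (𝟙 (point (ψ.app x)))) := by
  refine (congrArg (· ≫ _) (pushMap_box_id_comp (A.comp _ _ _) (F.elemMapComp (actObj k a) (actObj k b)).hom
    (pushMap (F.map x z) (A.elemActComp k a b).hom))).trans ?_
  refine (Category.assoc _ _ _).trans ?_
  refine (congrArg (_ ≫ ·) (ψ.elemNaturality_natural (A.elemActComp k a b).hom)).trans ?_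
  refine (Category.assoc _ _ _).symm.trans ?_
  refine (congrArg (· ≫ _) (hψ.elem_naturality_comp (actObj k a) (actObj k b))).trans ?_
  rw [FunctorData.elemOnComp_hom]
  simp only [Category.assoc]
  refine congrArg (_ ≫ ·) (congrArg (_ ≫ ·) (congrArg (_ ≫ ·) (congrArg (_ ≫ ·) (congrArg (_ ≫ ·) ?_))))
  exact ((congrArg (pushMap (A.comp _ _ _)) (boxMap_comp_id (H.elemMapComp (actObj k a) (actObj k b)).hom
    (pushMap (H.map x z) (A.elemActComp k a b).hom) (point (ψ.app x)))).trans (pushMap_comp _ _ _)).symm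

lemma TransData.vcomp_elemNaturality_of {O' : Type s} {A : EnrichedBicategory W O}
    {B : EnrichedData W O'} {F H K : FunctorData B A.toEnrichedData} {φ : TransData F H}
    {ψ : TransData H K} {x y : O'} {a : Elem (B.hom x y)}
    {q : pushObj (A.comp _ _ _) (box (point (ψ.app y)) (pushObj (H.map x y) a)) ⟶
      pushObj (A.comp _ _ _) (box (pushObj (K.map x y) a) (point (ψ.app x)))}
    (hq : (ψ.elemNaturality a).hom = q) :
    ((vcomp φ ψ).elemNaturality a).hom =
      pushMap (A.comp _ _ _) (boxMap (elemGcomp (φ.app y) (ψ.app y)).hom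
        (𝟙 (pushObj (F.map x y) a))) ≫
      (A.elemAssoc (pushObj (F.map x y) a) (point (φ.app y)) (point (ψ.app y))).hom ≫
      pushMap (A.comp _ _ _) (boxMap (𝟙 (point (ψ.app y))) (φ.elemNaturality a).hom) ≫
      (A.elemAssoc (point (φ.app x)) (pushObj (H.map x y) a) (point (ψ.app y))).inv ≫
      pushMap (A.comp _ _ _) (boxMap q (𝟙 (point (φ.app x)))) ≫
      (A.elemAssoc (point (φ.app x)) (point (ψ.app x)) (pushObj (K.map x y) a)).hom ≫
      pushMap (A.comp _ _ _) (boxMap (𝟙 (pushObj (K.map x y) a))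
        (elemGcomp (φ.app x) (ψ.app x)).inv) := by
  rw [← hq, vcomp_elemNaturality]

lemma mapSq_comp_whiskerLeft {B C : Type*} [Bicategory B] [Bicategory C] (F : Pseudofunctor C B)
    {x y y' z : C} {f : x ⟶ y} {g : y ⟶ z} {f' : x ⟶ y'} {g' g'' : y' ⟶ z} (η : f ≫ g ⟶ f' ≫ g')
    (β : g' ⟶ g'') : mapSq F (η ≫ f' ◃ β) = mapSq F η ≫ F.map f' ◃ F.map₂ β := by
  simp [mapSq]

lemma comp_whiskerLeft_cancel {C : Type*} [Bicategory C] {x y z : C} {m : x ⟶ z} {p : x ⟶ y}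
    {n₀ n n' : y ⟶ z} (M : m ⟶ p ≫ n₀) (β : n₀ ≅ n) (e : n₀ ⟶ n') {q : x ⟶ z} (E : p ≫ n' ⟶ q) :
    (M ≫ p ◃ β.hom) ≫ p ◃ (β.inv ≫ e) ≫ E = M ≫ p ◃ e ≫ E := by
  simp

lemma FunctorData.elemGcompIso_onEl_split {A : EnrichedData W O} {g : G}
    (F : FunctorData (A.base g) A) {x y y' z : O} {f : A.El x y} {k : A.El y z}
    {f' : A.El x y'} {k' : A.El y' z} (η : gcomp f k ≅ gcomp f' k') :
    (elemGcompIso (F.onElComp f k ≪≫ F.onElIso₂ η ≪≫ (F.onElComp f' k').symm)).hom =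
      pushMap (A.comp _ _ _) (boxMap (𝟙 _) (F.elemOnEl f).hom) ≫
      pushMap (A.comp _ _ _) (boxMap (F.elemOnEl k).hom (𝟙 _)) ≫
      ((F.elemOnComp (point f) (point k)).hom ≫
        pushMap (F.map x z) (actMap g (elemGcompIso η).hom) ≫
        (F.elemOnComp (point f') (point k')).inv) ≫
      pushMap (A.comp _ _ _) (boxMap (F.elemOnEl k').inv (𝟙 _)) ≫
      pushMap (A.comp _ _ _) (boxMap (𝟙 _) (F.elemOnEl f').inv) := by
  have h1 : pushMap (A.comp _ _ _) (boxMap (F.elemOnEl k).hom (F.elemOnEl f).hom) =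
      pushMap (A.comp _ _ _) (boxMap (𝟙 _) (F.elemOnEl f).hom) ≫
      pushMap (A.comp _ _ _) (boxMap (F.elemOnEl k).hom (𝟙 _)) := by
    rw [← pushMap_comp, ← boxMap_comp, Category.id_comp, Category.comp_id]
  have h2 : pushMap (A.comp _ _ _) (boxMap (F.elemOnEl k').inv (F.elemOnEl f').inv) =
      pushMap (A.comp _ _ _) (boxMap (F.elemOnEl k').inv (𝟙 _)) ≫
      pushMap (A.comp _ _ _) (boxMap (𝟙 _) (F.elemOnEl f').inv) := by
    rw [← pushMap_comp, ← boxMap_comp, Category.id_comp, Category.comp_id]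
  rw [elemGcompIso_onEl, h1, h2]
  simp only [Category.assoc]

lemma comp_assoc₇ {C : Type*} [Category* C] {a b c d e f i j : C} (m₁ : a ⟶ b) (m₂ : b ⟶ c)
    (m₃ : c ⟶ d) (m₄ : d ⟶ e) (m₅ : e ⟶ f) (m₆ : f ⟶ i) (m₇ : i ⟶ j) :
    m₁ ≫ m₂ ≫ m₃ ≫ m₄ ≫ m₅ ≫ m₆ ≫ m₇ = m₁ ≫ m₂ ≫ (m₃ ≫ m₄ ≫ m₅) ≫ m₆ ≫ m₇ := by
  simp

/-- The composite of two functors on points. -/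
def FunctorData.elemOnElOnEl {A : EnrichedBicategory W O} {k l : G}
    (F : FunctorData (A.base k) A.toEnrichedData) (H : FunctorData (A.base l) A.toEnrichedData)
    {x y : O} (f : A.El x y) :
    point (H.onEl (F.onEl f)) ≅
      pushObj (H.map _ _) (actObj l (pushObj (F.map x y) (actObj k (point f)))) :=
  H.elemOnEl (F.onEl f) ≪≫ pushIso (H.map _ _) (actIso l (F.elemOnEl f))

namespace TwistedAction

variable {A : EnrichedBicategory W O} (T : TwistedAction G A) {g h k l a b c : G}

/-- The modification `ζ`, on generalized elements. -/
def elemZeta (e₁ : g * h = a) (e₂ : h * k = b) (e₃ : a * k = c) (e₄ : g * b = c) (x : O) :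
    pushObj (A.comp _ _ _) (box (point ((T.φ e₂).app ((T.functor g).obj x)))
        (point ((T.φ e₄).app x))) ≅
      pushObj (A.comp _ _ _) (box (pushObj ((T.functor k).map _ _)
        (actObj k (point ((T.φ e₁).app x)))) (point ((T.φ e₃).app x))) :=
  elemGcompIso (T.ζ e₁ e₂ e₃ e₄ x) ≪≫ pushIso (A.comp _ _ _)
    (boxIso ((T.functor k).elemOnEl ((T.φ e₁).app x)) (Iso.refl (point ((T.φ e₃).app x))))

/-- The pseudofunctor underlying the action of `g`. -/
abbrev pseudofunctor (g : G) : Pseudofunctor A.Generalized A.Generalized :=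
  (T.functor_isLawful g).pseudofunctor

/-- The components of `φ`, as 1-cells of generalized elements. -/
abbrev phi (e : g * h = k) (x : A.Generalized) :
    (T.pseudofunctor k).obj x ⟶ (T.pseudofunctor h).obj ((T.pseudofunctor g).obj x) :=
  point ((T.φ e).app x)

/-- The pseudonaturality of `φ`, on generalized elements. -/
abbrev nu (e : g * h = k) {x y : A.Generalized} (a : x ⟶ y) :
    (T.pseudofunctor k).map a ≫ T.phi e y ≅
      T.phi e x ≫ (T.pseudofunctor h).map ((T.pseudofunctor g).map a) :=
  (T.φ e).elemNat e a

/-- The modification `ζ`, as a 2-cell of generalized elements. -/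
abbrev zeta (e₁ : g * h = a) (e₂ : h * k = b) (e₃ : a * k = c) (e₄ : g * b = c)
    (x : A.Generalized) :
    T.phi e₄ x ≫ T.phi e₂ ((T.pseudofunctor g).obj x) ≅
      T.phi e₃ x ≫ (T.pseudofunctor k).map (T.phi e₁ x) :=
  T.elemZeta e₁ e₂ e₃ e₄ x

lemma elemNat_comp (e : g * h = k) {x y z : A.Generalized} (a : x ⟶ y) (b : y ⟶ z) :
    ((T.pseudofunctor k).mapComp a b).inv ▹ T.phi e z ≫
        (T.nu e (a ≫ b)).hom =
      (𝒶 _ _ _).hom ≫ (T.pseudofunctor k).map a ◃ (T.nu e b).hom ≫ (𝒶 _ _ _).inv ≫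
        (T.nu e a).hom ▹ (T.pseudofunctor h).map ((T.pseudofunctor g).map b) ≫
        (𝒶 _ _ _).hom ≫ T.phi e x ◃
          (((T.pseudofunctor h).mapComp _ _).inv ≫
            (T.pseudofunctor h).map₂ ((T.pseudofunctor g).mapComp a b).inv) := by
  refine conj_naturality_comp (C := A.Generalized)
    (fa := (T.pseudofunctor k).map a) (fb := (T.pseudofunctor k).map b)
    (fab := (T.pseudofunctor k).map (a ≫ b))
    (px := T.phi e x) (py := T.phi e y) (pz := T.phi e z)
    (na := ((T.φ e).elemNaturality (actObj k a)).hom) (nb := ((T.φ e).elemNaturality (actObj k b)).hom)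
    (nab := ((T.φ e).elemNaturality (actObj k (pushObj (A.comp x y z) (box b a)))).hom)
    (mF := ((T.functor k).elemOnComp a b).hom)
    (mH := ((FunctorData.baseComp e (T.functor g) (T.functor h)).elemOnComp a b).hom)
    (TransData.elemNaturality_onComp (T.φ_isLawful e) a b)
    (βa := (FunctorData.elemBaseComp e (T.functor g) (T.functor h) a).hom)
    (βb := (FunctorData.elemBaseComp e (T.functor g) (T.functor h) b).hom)
    (βab := (FunctorData.elemBaseComp e (T.functor g) (T.functor h) _).hom) ?_
  have h1 := FunctorData.elemBaseComp_comp e (T.functor g) (T.functor h) a b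
  refine Eq.trans ?_ (h1.trans (Category.assoc _ _ _).symm)
  refine (Category.assoc _ _ _).symm.trans (congrArg (· ≫ _) ?_)
  refine ((pushMap_comp _ _ _).symm.trans (congrArg _ ((boxMap_comp _ _ _ _).symm.trans ?_)))
  exact congrArg₂ boxMap (Category.id_comp _) (Category.comp_id _)

lemma elemZeta_hom (e₁ : g * h = a) (e₂ : h * k = b) (e₃ : a * k = c) (e₄ : g * b = c) (x : O) :
    (T.elemZeta e₁ e₂ e₃ e₄ x).hom = (elemGcomp ((T.φ e₄).app x) ((T.φ e₂).app _)).inv ≫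
      (pointIso (T.ζ e₁ e₂ e₃ e₄ x)).hom ≫
      (elemGcomp ((T.φ e₃).app x) ((T.functor k).onEl ((T.φ e₁).app x))).hom ≫
      pushMap (A.comp _ _ _) (boxMap ((T.functor k).elemOnEl ((T.φ e₁).app x)).hom
        (𝟙 (point ((T.φ e₃).app x)))) :=
  (Category.assoc _ _ _).trans (congrArg (_ ≫ ·) (Category.assoc _ _ _))

lemma val_baseComp_assoc (e₁ : g * h = a) (e₂ : h * k = b) (e₃ : a * k = c) (e₄ : g * b = c)
    {x y : O} (f : Elem (A.hom x y)) :
    (pushObj ((FunctorData.baseComp e₄ (T.functor g) (FunctorData.baseComp e₂ (T.functor h)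
      (T.functor k))).map x y) (actObj c f)).val =
    𝟙 _ ≫ (pushObj ((FunctorData.baseComp e₃ (FunctorData.baseComp e₁ (T.functor g) (T.functor h))
      (T.functor k)).map x y) (actObj c f)).val := by
  rw [FunctorData.baseComp_assoc_map e₁ e₂ e₃ e₄]
  exact (Category.id_comp _).symm

lemma elemZeta_natural (e₁ : g * h = a) (e₂ : h * k = b) (e₃ : a * k = c) (e₄ : g * b = c)
    {x y : A.Generalized} (f : x ⟶ y) :
    (T.pseudofunctor c).map f ◃ (T.zeta e₁ e₂ e₃ e₄ y).hom ≫ (𝒶 _ _ _).inv ≫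
        (T.nu e₃ f).hom ▹ (T.pseudofunctor k).map (T.phi e₁ y) ≫
        (𝒶 _ _ _).hom ≫ T.phi e₃ x ◃
          mapSq (T.pseudofunctor k) (T.nu e₁ f).hom ≫ (𝒶 _ _ _).inv =
      (𝒶 _ _ _).inv ≫ (T.nu e₄ f).hom ▹ T.phi e₂ _ ≫
        (𝒶 _ _ _).hom ≫ T.phi e₄ x ◃
          (T.nu e₂ ((T.pseudofunctor g).map f)).hom ≫ (𝒶 _ _ _).inv ≫
        (T.zeta e₁ e₂ e₃ e₄ x).hom ▹
          (T.pseudofunctor k).map ((T.pseudofunctor h).map ((T.pseudofunctor g).map f)) := by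
  let t1 := TransData.vcomp (T.φ e₄) (TransData.whiskerLeft (FunctorData.baseMul _ e₄)
        (TransData.whiskerLeft ((T.functor g).base b) (T.φ e₂)))
  let t2 := TransData.vcomp (T.φ e₃) (TransData.whiskerLeft (FunctorData.baseMul _ e₃)
        (TransData.whiskerRight ((T.φ e₁).base k) (T.functor k)))
  have hsq : mapSq (T.pseudofunctor k) (T.nu e₁ f).hom =
      mapSq (T.pseudofunctor k) ((T.φ e₁).elemNaturality (actObj a f)).hom ≫
        (T.pseudofunctor k).map (T.phi e₁ x) ◃ (T.pseudofunctor k).map₂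
          (FunctorData.elemBaseComp e₁ (T.functor g) (T.functor h) f).hom :=
    mapSq_comp_whiskerLeft (T.pseudofunctor k) _ _
  have hz := T.elemZeta_hom e₁ e₂ e₃ e₄ x
  have hz' := T.elemZeta_hom e₁ e₂ e₃ e₄ y
  rw [hsq]
  refine (congrArg (fun q => (T.pseudofunctor c).map f ◃ q ≫ _) hz').trans (Eq.trans ?_
    (congrArg (fun q => _ ≫ _ ≫ _ ≫ _ ≫ _ ≫ q ▹ (T.pseudofunctor k).map
      ((T.pseudofunctor h).map ((T.pseudofunctor g).map f))) hz).symm)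
  exact conj_modification (C := A.Generalized)
    (γ1 := elemGcomp ((T.φ e₄).app x) ((T.φ e₂).app _))
    (γ1' := elemGcomp ((T.φ e₄).app y) ((T.φ e₂).app _))
    (γ2 := elemGcomp ((T.φ e₃).app x) ((T.functor k).onEl ((T.φ e₁).app x)))
    (γ2' := elemGcomp ((T.φ e₃).app y) ((T.functor k).onEl ((T.φ e₁).app y)))
    (ε := (T.functor k).elemOnEl ((T.φ e₁).app x)) (ε' := (T.functor k).elemOnEl ((T.φ e₁).app y))
    (n4 := ((T.φ e₄).elemNaturality (actObj c f)).hom)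
    (β4 := (FunctorData.elemBaseComp e₄ (T.functor g) (T.functor b) f).hom)
    (n2 := ((T.φ e₂).elemNaturality (actObj b ((T.pseudofunctor g).map f))).hom)
    (β2 := (FunctorData.elemBaseComp e₂ (T.functor h) (T.functor k) ((T.pseudofunctor g).map f)).hom)
    (β4' := FunctorData.elemBaseComp e₄ (T.functor g)
      (FunctorData.baseComp e₂ (T.functor h) (T.functor k)) f)
    (n3 := ((T.φ e₃).elemNaturality (actObj c f)).hom)
    (β3 := (FunctorData.elemBaseComp e₃ (T.functor a) (T.functor k) f).hom)
    (M := mapSq (T.pseudofunctor k) ((T.φ e₁).elemNaturality (actObj a f)).hom)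
    (β3' := FunctorData.elemBaseComp e₃ (FunctorData.baseComp e₁ (T.functor g) (T.functor h))
      (T.functor k) f)
    (β1 := (T.pseudofunctor k).map₂ (FunctorData.elemBaseComp e₁ (T.functor g) (T.functor h) f).hom)
    (N1 := (t1.elemNaturality (actObj c f)).hom) (N2 := (t2.elemNaturality (actObj c f)).hom)
    (σ := st _ _ (𝟙 _) (T.val_baseComp_assoc e₁ e₂ e₃ e₄ f))
    (TransData.vcomp_elemNaturality_of
      (TransData.whiskerLeft_base_elemNaturality e₄ (T.functor g) (T.φ e₂) f))
    (TransData.vcomp_elemNaturality_of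
      ((TransData.whiskerLeft_whiskerRight_elemNaturality e₃ (T.φ e₁) (T.functor k) f).trans
        (comp_assoc₇ _ _ _ _ _ _ _)))
    (elemSq_modification _ _ _ _ (FunctorData.baseComp_assoc_map e₁ e₂ e₃ e₄ (T.functor g)
      (T.functor h) (T.functor k) x y) (T.ζ_naturality e₁ e₂ e₃ e₄ x y) (actObj c f))
    (FunctorData.elemBaseComp_assoc e₁ e₂ e₃ e₄ (T.functor g) (T.functor h) (T.functor k) f)

lemma elemZeta_simplex {gh hk kl ghk hkl ghkl : G} (e_gh : g * h = gh) (e_hk : h * k = hk)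
    (e_kl : k * l = kl) (e_gh_k : gh * k = ghk) (e_g_hk : g * hk = ghk) (e_hk_l : hk * l = hkl)
    (e_h_kl : h * kl = hkl) (e_ghk_l : ghk * l = ghkl) (e_gh_kl : gh * kl = ghkl)
    (e_g_hkl : g * hkl = ghkl) (x : A.Generalized) :
    (T.zeta e_gh e_h_kl e_gh_kl e_g_hkl x).hom ▹ T.phi e_kl _ ≫ (𝒶 _ _ _).hom ≫
        T.phi e_gh_kl x ◃ (T.nu e_kl (T.phi e_gh x)).hom ≫ (𝒶 _ _ _).inv ≫
        (T.zeta e_gh_k e_kl e_ghk_l e_gh_kl x).hom ▹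
          (T.pseudofunctor l).map ((T.pseudofunctor k).map (T.phi e_gh x)) =
      (𝒶 _ _ _).hom ≫ T.phi e_g_hkl x ◃
          (T.zeta e_hk e_kl e_hk_l e_h_kl ((T.pseudofunctor g).obj x)).hom ≫
        (𝒶 _ _ _).inv ≫ (T.zeta e_g_hk e_hk_l e_ghk_l e_g_hkl x).hom ▹
          (T.pseudofunctor l).map (T.phi e_hk _) ≫
        (𝒶 _ _ _).hom ≫ T.phi e_ghk_l x ◃
          mapSq (T.pseudofunctor l) (T.zeta e_gh e_hk e_gh_k e_g_hk x).hom ≫ (𝒶 _ _ _).inv := by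
  refine conj_simplex (C := A.Generalized)
    (εm := (T.functor kl).elemOnEl ((T.φ e_gh).app x))
    (κ := FunctorData.elemOnElOnEl (T.functor k) (T.functor l) ((T.φ e_gh).app x))
    (εp := (T.functor l).elemOnEl ((T.φ e_gh_k).app x))
    (εq := (T.functor l).elemOnEl ((T.φ e_hk).app _))
    (εr := (T.functor l).elemOnEl ((T.φ e_g_hk).app x))
    (TransData.elemGcompIso_naturalityEl e_kl (T.φ e_kl) ((T.φ e_gh).app x)) ?_
    (elemGcompIso_simplex _ _ _ _ _ _ (T.ζ_simplex e_gh e_hk e_kl e_gh_k e_g_hk e_hk_l e_h_kl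
      e_ghk_l e_gh_kl e_g_hkl x))
  refine (FunctorData.elemGcompIso_onEl_split (T.functor l) (T.ζ e_gh e_hk e_gh_k e_g_hk x)).trans ?_
  refine congrArg (_ ≫ ·) (congrArg (_ ≫ ·) ?_)
  have h1 := mapSq_comp_whiskerLeft (T.pseudofunctor l) (f := T.phi e_g_hk x) (g := T.phi e_hk _)
    (f' := T.phi e_gh_k x)
    (elemGcompIso (T.ζ e_gh e_hk e_gh_k e_g_hk x)).hom ((T.functor k).elemOnEl ((T.φ e_gh).app x)).hom
  refine Eq.trans ?_ (congrArg (· ≫ _) h1).symm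
  exact (comp_whiskerLeft_cancel (C := A.Generalized) _ ((T.pseudofunctor l).map₂Iso
    ((T.functor k).elemOnEl ((T.φ e_gh).app x))) _ _).symm

end TwistedAction

end WeakActions
end TwistedBicat

namespace TwistedBicat

attribute [-simp] MonoidalCategory.tensorHom_id MonoidalCategory.id_tensorHom
  MonoidalCategory.associator_conjugation
attribute [local simp] MonoidalCategory.id_tensorHom_id MonoidalCategory.tensorHom_comp_tensorHom
  MonoidalCategory.tensorHom_comp_tensorHom_assoc MonoidalCategory.associator_naturality
  MonoidalCategory.associator_naturality_assoc

local infixr:81 " ◃ " => Bicategory.whiskerLeft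
local infixl:81 " ▹ " => Bicategory.whiskerRight

open MonoidalTwoCategory


open Elem EnrichedData

local notation "𝒶" => Bicategory.associator

section Units

variable {W : Type u} [Bicategory.{w, v} W] [Bicategory.Strict W] [MonoidalTwoCategory W]
  {O : Type s}

namespace EnrichedData

variable {A : EnrichedData W O}

lemma ev_postId (x w : O) (a : Elem (A.hom w x)) :
    ev (postId (A := A) x w).hom a = (elemPost (A.id x) a).hom ≫ (A.elemLeftUnitor a).hom ≫
      st a (pushObj (𝟙 _) a) (𝟙 _) (by simp) := by
  have h : ev (postId (A := A) x w).hom a = ev (f := (λ_ _).inv ≫ (A.id x ⊗ₘ 𝟙 (A.hom w x)) ≫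
      A.comp w x x) ((λ_ (A.hom w x)).inv ◃ (A.leftUnitor w x).hom ≫ eqToHom (by simp)) a := rfl
  rw [h, ev_comp, ev_eqToHom, ev_whiskerLeft, elemPost_hom, elemLeftUnitor_hom,
    ev_eq (A.leftUnitor w x).hom (a := box (univ (𝟙_ W)) a) (b := pushObj (λ_ _).inv a) (λ_ a.src)
      (by simp [MonoidalCategory.id_tensorHom])]
  simp
  rfl

lemma ev_preId_inv (x z : O) (a : Elem (A.hom x z)) :
    ev (preId (A := A) x z).inv a = st (pushObj (𝟙 _) a) a (𝟙 _) (by simp) ≫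
      (A.elemRightUnitor a).inv ≫ (elemPre (A.id x) a).inv := by
  have h : ev (preId (A := A) x z).hom a = (elemPre (A.id x) a).hom ≫ (A.elemRightUnitor a).hom ≫
      st a (pushObj (𝟙 _) a) (𝟙 _) (by simp) := by
    have h : ev (preId (A := A) x z).hom a = ev (f := (ρ_ _).inv ≫ (𝟙 (A.hom x z) ⊗ₘ A.id x) ≫
        A.comp x x z) ((ρ_ (A.hom x z)).inv ◃ (A.rightUnitor x z).hom ≫ eqToHom (by simp)) a := rfl
    rw [h, ev_comp, ev_eqToHom, ev_whiskerLeft, elemPre_hom, elemRightUnitor_hom,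
      ev_eq (A.rightUnitor x z).hom (a := box a (univ (𝟙_ W))) (b := pushObj (ρ_ _).inv a)
        (ρ_ a.src) (by simp [MonoidalCategory.tensorHom_id])]
    simp
    rfl
  have h' : evIso (preId (A := A) x z) a = elemPre (A.id x) a ≪≫ A.elemRightUnitor a ≪≫
      stIso a (pushObj (𝟙 _) a) (Iso.refl _) (by simp) := Iso.ext h
  refine (congrArg Iso.inv h').trans ?_
  simp only [Iso.trans_inv, Category.assoc]
  rfl

lemma elemSq_unit {X : W} {x y : O} (f f' : X ⟶ A.hom x y)
    (e : f ≫ 𝟙 (A.hom x y) = f' ≫ 𝟙 (A.hom x y)) (b : Elem X)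
    (hb : (pushObj f b).val = 𝟙 _ ≫ (pushObj f' b).val) :
    (elemSq (Bicategory.whiskerLeftIso f (postId y x) ≪≫ eqToIso e ≪≫
      Bicategory.whiskerLeftIso f' (preId x y).symm) b).hom =
    (A.elemLeftUnitor (pushObj f b)).hom ≫ st (pushObj f b) (pushObj f' b) (𝟙 _) hb ≫
      (A.elemRightUnitor (pushObj f' b)).inv := by
  rw [elemSq_hom]
  have h : ev (Bicategory.whiskerLeftIso f (postId y x) ≪≫ eqToIso e ≪≫
      Bicategory.whiskerLeftIso f' (preId x y).symm).hom b =
      ev (f ◃ (postId y x).hom ≫ eqToHom e ≫ f' ◃ (preId x y).inv) b := rfl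
  rw [h, ev_comp, ev_comp, ev_whiskerLeft, ev_whiskerLeft, ev_eqToHom, ev_postId, ev_preId_inv]
  simp

lemma elemGcompIso_refl_gcompIso₂ {x y z : O} (f : A.El x y) {g g' : A.El y z} (η : g ≅ g') :
    (elemGcompIso (gcompIso₂ (Iso.refl f) η)).hom =
      pushMap (A.comp _ _ _) (boxMap (pointIso η).hom (𝟙 (point f))) := by
  rw [elemGcompIso_hom, pointIso_gcompIso₂, pointIso_refl, Iso.refl_hom]
  simp only [Category.assoc, Iso.inv_hom_id, Category.comp_id, Iso.inv_hom_id_assoc]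

end EnrichedData

lemma FunctorData.pointIso_mapId {O' : Type r} {A : EnrichedData W O} {B : EnrichedData W O'}
    (F : FunctorData A B) (x : O) :
    (pointIso (F.mapId x)).hom = (F.elemMapEl (A.id x)).hom ≫ (F.elemMapId x).hom := by
  rw [pointIso_hom, elemMapId_hom, elemMapEl_hom]
  refine Eq.trans (congrArg (· ≫ _) (st_congr (Category.comp_id _).symm _)) ?_
  exact (st_st_assoc (a := point (F.mapEl (A.id x))) (b := pushObj (F.map x x) (point (A.id x)))
    (c := pushObj (A.id x ≫ F.map x x) (univ (𝟙_ W))) ..).symm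

variable {G : Type t} [Group G] [TwistingAction G W]

open TwistingAction Functor.LaxMonoidal Functor.OplaxMonoidal

lemma FunctorData.pointIso_mapId_base {A : EnrichedData W O} {g : G}
    (F : FunctorData (A.base g) A) (x : O) :
    (pointIso (F.mapId x)).hom = (F.elemOnEl (A.id x)).hom ≫ (F.elemOnId x).hom := by
  refine (F.pointIso_mapId x).trans (Eq.trans ?_
    (congrArg₂ (· ≫ ·) (elemOnEl_hom F (A.id x)) (elemOnId_hom F x)).symm)
  refine Eq.trans (congrArg (_ ≫ ·) ?_) (Category.assoc _ _ _).symm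
  exact (pushMap_hom_inv_assoc (F.map x x) (A.elemActId g x) _).symm

lemma FunctorData.val_leftUnit {A : EnrichedData W O} {h : G} (F : FunctorData (A.base h) A)
    {x y : O} (b : Elem ((A.base h).hom x y)) :
    (pushObj (F.map x y) b).val =
      𝟙 _ ≫ (pushObj ((baseComp (one_mul h) (baseOne G A) F).map x y) b).val := by
  change b.val ≫ F.map x y = 𝟙 _ ≫ b.val ≫ (mulIso (one_mul h)).inv.app (A.hom x y) ≫
    (act h).map (oneIso.hom.app (A.hom x y)) ≫ F.map x y
  rw [← mulIso_one_left, Iso.inv_hom_id_app_assoc]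
  exact (Category.id_comp _).symm

lemma TransData.leftUnit_elemNaturality {A : EnrichedData W O} {h : G}
    (F : FunctorData (A.base h) A) {x y : O} (b : Elem ((A.base h).hom x y)) :
    ((leftUnit F).elemNaturality b).hom = (A.elemLeftUnitor (pushObj (F.map x y) b)).hom ≫
      st (pushObj (F.map x y) b) (pushObj ((FunctorData.baseComp (one_mul h)
        (FunctorData.baseOne G A) F).map x y) b) (𝟙 _) (FunctorData.val_leftUnit F b) ≫
      (A.elemRightUnitor _).inv :=
  elemSq_unit (F.map x y) ((FunctorData.baseComp (one_mul h) (FunctorData.baseOne G A) F).map x y)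
    _ b (FunctorData.val_leftUnit F b)

lemma unit_natural {C : Type*} [Bicategory C] (F : Pseudofunctor C C) {x y : C} {a a₁ : x ⟶ y}
    (j : a₁ ≅ a) {n : F.map a ≫ 𝟙 _ ⟶ 𝟙 _ ≫ F.map a₁}
    (hn : n = (Bicategory.rightUnitor _).hom ≫ F.map₂ j.inv ≫ (Bicategory.leftUnitor _).inv) :
    F.map a ◃ (𝟙 _ ◃ (F.mapId y).hom ≫ (Bicategory.leftUnitor (𝟙 _)).hom) ≫
        (Bicategory.rightUnitor _).hom =
      (𝒶 _ _ _).inv ≫ n ▹ F.map (𝟙 y) ≫ (𝒶 _ _ _).hom ≫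
        𝟙 _ ◃ mapSq F ((Bicategory.rightUnitor a₁).hom ≫ j.hom ≫ (Bicategory.leftUnitor a).inv) ≫
        (𝒶 _ _ _).inv ≫ (𝟙 _ ◃ (F.mapId x).hom ≫ (Bicategory.leftUnitor (𝟙 _)).hom) ▹ F.map a ≫
        (Bicategory.leftUnitor _).hom := by
  subst hn
  have h1 : F.map₂ (Bicategory.rightUnitor a₁).hom = (F.mapComp _ _).hom ≫ F.map a₁ ◃ (F.mapId y).hom ≫
      (Bicategory.rightUnitor _).hom := F.map₂_right_unitor a₁
  have h2 : F.map₂ (Bicategory.leftUnitor a).inv = (Bicategory.leftUnitor _).inv ≫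
      (F.mapId x).inv ▹ F.map a ≫ (F.mapComp _ _).inv := by
    rw [← cancel_mono (F.map₂ (Bicategory.leftUnitor a).hom), ← F.map₂_comp, Iso.inv_hom_id,
      F.map₂_id, F.map₂_left_unitor]
    simp
  have h3 : (Bicategory.leftUnitor (F.map a₁ ≫ 𝟙 (F.obj y))).inv ≫ (𝒶 _ _ _).inv ≫
      (Bicategory.rightUnitor (𝟙 (F.obj x) ≫ F.map a₁)).hom ≫ (Bicategory.leftUnitor _).hom =
      (Bicategory.rightUnitor (F.map a₁)).hom := by
    bicategory
  simp only [mapSq, F.map₂_comp, h1, h2]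
  simp
  rw [reassoc_of% h3, ← Bicategory.whisker_exchange_assoc]
  simp

lemma unit_nu_natural {C : Type*} [Bicategory C] {x y : C} {a a' b b' : x ⟶ y} {m : b ⟶ b'}
    {n : a ⟶ a'} {j : b ⟶ a} {j' : b' ⟶ a'} (h : m ≫ j' = j ≫ n) :
    m ▹ 𝟙 y ≫ (Bicategory.rightUnitor _).hom ≫ j' ≫ (Bicategory.leftUnitor _).inv =
      ((Bicategory.rightUnitor _).hom ≫ j ≫ (Bicategory.leftUnitor _).inv) ≫ 𝟙 x ◃ n := by
  simp [reassoc_of% h]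

lemma unit_hn {C : Type*} [Bicategory C] {x y : C} {a b b' : x ⟶ y} {m : a ⟶ b} {n : b ⟶ b'}
    {j : a ⟶ b'} (h : m ≫ n = j) :
    ((Bicategory.rightUnitor _).hom ≫ m ≫ (Bicategory.leftUnitor _).inv) ≫ 𝟙 x ◃ n =
      (Bicategory.rightUnitor a).hom ≫ j ≫ (Bicategory.leftUnitor b').inv := by
  simp [← h]

lemma unit_assoc {C : Type*} [Bicategory C] (F : Pseudofunctor C C) {x y : C} (p : y ⟶ F.obj x) :
    p ◃ (𝟙 _ ◃ (F.mapId x).hom ≫ (Bicategory.leftUnitor (𝟙 _)).hom) =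
      (𝒶 _ _ _).inv ≫ (p ◃ (F.mapId x).inv) ▹ F.map (𝟙 x) ≫ (𝒶 _ _ _).hom ≫
        p ◃ mapUnit F (Bicategory.leftUnitor (𝟙 x)).hom := by
  have h1 : F.map₂ (Bicategory.leftUnitor (𝟙 x)).hom = (F.mapComp _ _).hom ≫ (F.mapId x).hom ▹ _ ≫
      (Bicategory.leftUnitor _).hom := F.map₂_left_unitor (𝟙 x)
  simp only [mapUnit, h1]
  simp

section

variable {A : EnrichedBicategory W O} {g h : G}

/-- The unitality constraint of the action, on generalized elements. -/
def elemOne {X : W} (a : Elem X) : pushObj ((oneIso (G := G)).hom.app X) (actObj (1 : G) a) ≅ a :=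
  stIso _ _ ((oneIso (G := G)).app a.src) (oneIso.hom.naturality a.val)

variable {F₁ : FunctorData (A.base (1 : G)) A.toEnrichedData}
  (h₁ : F₁ = FunctorData.baseOne G A.toEnrichedData)

/-- The identity 1-cell from `¹x` to `x`. -/
abbrev oneEl (x : O) : A.El (F₁.obj x) x := eqTo (by rw [h₁])

def elemNuOne {x y : O} (a : Elem (A.hom x y)) :
    pushObj (A.comp _ _ _) (box (point (oneEl h₁ y)) (pushObj (F₁.map x y) (actObj (1 : G) a))) ≅
      pushObj (A.comp _ _ _) (box a (point (oneEl h₁ x))) := by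
  subst h₁
  exact A.elemLeftUnitor _ ≪≫ elemOne a ≪≫ (A.elemRightUnitor a).symm

lemma elemNuOne_natural {x y : O} {a a' : Elem (A.hom x y)} (m : a ⟶ a') :
    pushMap (A.comp _ _ _) (boxMap (𝟙 (point (oneEl h₁ y)))
        (pushMap (F₁.map x y) (actMap (1 : G) m))) ≫ (elemNuOne h₁ a').hom =
      (elemNuOne h₁ a).hom ≫ pushMap (A.comp _ _ _) (boxMap m (𝟙 (point (oneEl h₁ x)))) := by
  subst h₁
  exact unit_nu_natural (C := A.Generalized) (actMap_one m)

/-- The left unitality constraint of a twisted action, on generalized elements. -/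
def elemZetaL {F : FunctorData (A.base g) A.toEnrichedData}
    {φ : TransData F (FunctorData.baseComp (mul_one g) F F₁)}
    (hφ : HEq φ (TransData.rightUnit F)) (x : O) :
    pushObj (A.comp _ _ _) (box (point (oneEl h₁ (F.obj x))) (point (φ.app x))) ≅
      point (A.id (F.obj x)) := by
  subst h₁
  obtain rfl := eq_of_heq hφ
  exact A.elemRightUnitor (point (A.id _))

/-- The right unitality constraint of a twisted action, on generalized elements. -/
def elemZetaR {F : FunctorData (A.base h) A.toEnrichedData}
    {φ : TransData F (FunctorData.baseComp (one_mul h) F₁ F)}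
    (hφ : HEq φ (TransData.leftUnit F)) (x : O) :
    pushObj (A.comp _ _ _) (box (pushObj (F.map _ _) (actObj h (point (oneEl h₁ x))))
      (point (φ.app x))) ≅ point (A.id (F.obj x)) := by
  subst h₁
  obtain rfl := eq_of_heq hφ
  exact pushIso (A.comp _ _ _) (boxIso (F.elemOnId x) (Iso.refl _)) ≪≫
    A.elemRightUnitor (point (A.id _))

lemma elemZetaR_natural {F : FunctorData (A.base h) A.toEnrichedData} (hF : F.IsLawful)
    {φ : TransData F (FunctorData.baseComp (one_mul h) F₁ F)}
    (hφ : HEq φ (TransData.leftUnit F)) {x y : O} (a : Elem (A.hom x y)) :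
    pushMap (A.comp _ _ _) (boxMap (elemZetaR h₁ hφ y).hom (𝟙 (pushObj (F.map x y) (actObj h a)))) ≫
        (A.elemLeftUnitor _).hom =
      (A.elemAssoc _ _ _).hom ≫ pushMap (A.comp _ _ _) (boxMap (𝟙 _)
          (φ.elemNat (one_mul h) a).hom) ≫ (A.elemAssoc _ _ _).inv ≫
        pushMap (A.comp _ _ _) (boxMap ((F.elemOnComp _ _).hom ≫
          pushMap (F.map _ _) (actMap h (elemNuOne h₁ a).hom) ≫ (F.elemOnComp _ _).inv) (𝟙 _)) ≫
        (A.elemAssoc _ _ _).hom ≫ pushMap (A.comp _ _ _) (boxMap (𝟙 _) (elemZetaR h₁ hφ x).hom) ≫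
        (A.elemRightUnitor _).hom := by
  subst h₁
  obtain rfl := eq_of_heq hφ
  refine unit_natural (C := A.Generalized) hF.pseudofunctor (elemOne (G := G) a) ?_
  refine (TransData.elemNat_hom (one_mul h) (TransData.leftUnit F) a).trans ?_
  refine (congrArg (· ≫ _) (TransData.leftUnit_elemNaturality F (actObj h a))).trans ?_
  refine unit_hn (C := A.Generalized) (?_ : _ = pushMap (F.map x y) (actMap h (elemOne (G := G) a).inv))
  rw [FunctorData.elemBaseComp_hom, st_st]
  have h2 : (elemOne (G := G) a).inv = st _ _ ((oneIso (G := G)).inv.app a.src) (by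
    simp [← cancel_epi ((oneIso (G := G)).hom.app a.src)]) := rfl
  rw [h2, actMap_st, pushMap_st]
  refine st_congr ?_ _
  refine (Category.id_comp _).trans ?_
  rw [← cancel_mono ((act h).map ((oneIso (G := G)).hom.app a.src)), ← Functor.map_comp,
    Iso.inv_hom_id_app, ← mulIso_one_left, Iso.inv_hom_id_app]
  exact (CategoryTheory.Functor.map_id _ _).symm

lemma elemZeta_unit {k : G} (e : g * h = k) {Fg : FunctorData (A.base g) A.toEnrichedData}
    {Fh : FunctorData (A.base h) A.toEnrichedData} {Fk : FunctorData (A.base k) A.toEnrichedData}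
    (hF : Fh.IsLawful) {φ : TransData Fk (FunctorData.baseComp e Fg Fh)}
    {φg : TransData Fg (FunctorData.baseComp (mul_one g) Fg F₁)}
    (hφg : HEq φg (TransData.rightUnit Fg))
    {φh : TransData Fh (FunctorData.baseComp (one_mul h) F₁ Fh)}
    (hφh : HEq φh (TransData.leftUnit Fh))
    {ζ : ∀ x, gcomp (φ.app x) (φh.app (Fg.obj x)) ≅ gcomp (φ.app x) (Fh.onEl (φg.app x))}
    (hζ : HEq ζ (fun x => gcompIso₂ (Iso.refl (φ.app x)) (Fh.mapId (Fg.obj x)).symm)) (x : O) :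
    pushMap (A.comp _ _ _) (boxMap (elemZetaR h₁ hφh (Fg.obj x)).hom (𝟙 (point (φ.app x)))) =
      (A.elemAssoc _ _ _).hom ≫ pushMap (A.comp _ _ _) (boxMap (𝟙 _)
          (elemGcompIso (ζ x) ≪≫ pushIso (A.comp _ _ _) (boxIso (Fh.elemOnEl (φg.app x))
            (Iso.refl (point (φ.app x))))).hom) ≫ (A.elemAssoc _ _ _).inv ≫
        pushMap (A.comp _ _ _) (boxMap ((Fh.elemOnComp _ _).hom ≫
          pushMap (Fh.map _ _) (actMap h (elemZetaL h₁ hφg x).hom) ≫ (Fh.elemOnId _).hom)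
          (𝟙 (point (φ.app x)))) := by
  subst h₁
  obtain rfl := eq_of_heq hφg
  obtain rfl := eq_of_heq hφh
  have hζ' : ζ = fun x => gcompIso₂ (Iso.refl (φ.app x)) (Fh.mapId (Fg.obj x)).symm := eq_of_heq hζ
  subst hζ'
  have hm : pointIso (Fh.mapId (Fg.obj x)) = Fh.elemOnEl (A.id (Fg.obj x)) ≪≫
      Fh.elemOnId (Fg.obj x) := Iso.ext (Fh.pointIso_mapId_base (Fg.obj x))
  have hm' : (pointIso (Fh.mapId (Fg.obj x)).symm).hom ≫ (Fh.elemOnEl (A.id (Fg.obj x))).hom =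
      (Fh.elemOnId (Fg.obj x)).inv := by
    rw [pointIso_symm, hm]
    exact (Category.assoc _ _ _).trans ((congrArg (_ ≫ ·) (Iso.inv_hom_id _)).trans
      (Category.comp_id _))
  have key : pushMap (A.comp _ _ _) (boxMap (Fh.elemOnId (Fg.obj x)).inv (𝟙 (point (φ.app x)))) =
      (elemGcompIso (gcompIso₂ (Iso.refl (φ.app x)) (Fh.mapId (Fg.obj x)).symm)).hom ≫
        pushMap (A.comp _ _ _) (boxMap (Fh.elemOnEl (A.id (Fg.obj x))).hom (𝟙 _)) := by
    rw [elemGcompIso_refl_gcompIso₂, ← hm']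
    exact (congrArg (pushMap _) (boxMap_comp_id _ _ _)).trans (pushMap_comp _ _ _)
  let i := point (A.id (Fg.obj x))
  let j := pushObj (Fh.map _ _) (actObj h i)
  exact (unit_assoc (C := A.Generalized) hF.pseudofunctor (point (φ.app x))).trans (congrArg
    (fun q : pushObj (A.comp (Fk.obj x) (Fh.obj (Fg.obj x)) (Fh.obj (Fg.obj x)))
        (box (point (A.id _)) (point (φ.app x))) ⟶ pushObj (A.comp _ _ _) (box j (point (φ.app x))) =>
      (A.elemAssoc (point (φ.app x)) (point (A.id _)) j).hom ≫
        pushMap (A.comp _ _ _) (boxMap (𝟙 j) q) ≫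
        (A.elemAssoc (point (φ.app x)) j j).inv ≫
        pushMap (A.comp _ _ _) (boxMap ((Fh.elemOnComp i i).hom ≫
          pushMap (Fh.map _ _) (actMap h (A.elemRightUnitor i).hom) ≫ (Fh.elemOnId _).hom)
          (𝟙 (point (φ.app x))))) key)

end

/-- The weak action on generalized elements determined by a twisted action. -/
def TwistedAction.weakAction {A : EnrichedBicategory W O} (T : TwistedAction G A) :
    WeakAction G A.Generalized where
  functor g := T.pseudofunctor g
  φ e x := T.phi e x
  ν e _ _ a := T.nu e a
  ν_natural e _ _ _ _ η := TransData.elemNat_natural e (T.φ e) η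
  ν_comp e _ _ _ a b := T.elemNat_comp e a b
  ζ e₁ e₂ e₃ e₄ x := T.zeta e₁ e₂ e₃ e₄ x
  ζ_natural e₁ e₂ e₃ e₄ _ _ f := T.elemZeta_natural e₁ e₂ e₃ e₄ f
  simplex e_gh e_hk e_kl e_gh_k e_g_hk e_hk_l e_h_kl e_ghk_l e_gh_kl e_g_hkl x :=
    T.elemZeta_simplex e_gh e_hk e_kl e_gh_k e_g_hk e_hk_l e_h_kl e_ghk_l e_gh_kl e_g_hkl x
  ι x := point (oneEl T.functor_one x)
  ν₁ a := elemNuOne T.functor_one a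
  ν₁_natural η := elemNuOne_natural T.functor_one η
  ζl g x := elemZetaL T.functor_one (T.φ_one_right g) x
  ζr g x := elemZetaR T.functor_one (T.φ_one_left g) x
  ζr_natural g _ _ a := elemZetaR_natural T.functor_one (T.functor_isLawful g) (T.φ_one_left g) a
  ζ_unit {g h _} e x := elemZeta_unit T.functor_one e (T.functor_isLawful h) (T.φ_one_right g)
    (T.φ_one_left h) (T.ζ_one_middle e) x

end Units
end TwistedBicat

namespace TwistedBicat

local infixr:81 " ◃ " => Bicategory.whiskerLeft
local infixl:81 " ▹ " => Bicategory.whiskerRight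
local notation "𝒶" => Bicategory.associator
local notation "𝓁" => Bicategory.leftUnitor
local notation "𝓇" => Bicategory.rightUnitor


namespace WeakAction

variable {G : Type t} [Group G] {C : Type u} [Bicategory.{w, v} C] (S : WeakAction G C)

section

variable {g h k : G} {x y z : C}

/-- The action of the composition of twisted 1-cells on 2-cells. -/
def map (e : g * h = k) {b b' : (S.functor h).obj y ⟶ z} {a a' : (S.functor g).obj x ⟶ y}
    (n : b ⟶ b') (m : a ⟶ a') : S.comp e b a ⟶ S.comp e b' a' :=
  S.φ e x ◃ ((S.functor h).map₂ m ▹ b ≫ (S.functor h).map a' ◃ n)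

lemma map_id (e : g * h = k) (b : (S.functor h).obj y ⟶ z) (a : (S.functor g).obj x ⟶ y) :
    S.map e (𝟙 b) (𝟙 a) = 𝟙 _ := by
  simp [map, comp]

lemma map_comp (e : g * h = k) {b b' b'' : (S.functor h).obj y ⟶ z}
    {a a' a'' : (S.functor g).obj x ⟶ y} (n : b ⟶ b') (n' : b' ⟶ b'') (m : a ⟶ a')
    (m' : a' ⟶ a'') : S.map e (n ≫ n') (m ≫ m') = S.map e n m ≫ S.map e n' m' := by
  have := Bicategory.whisker_exchange ((S.functor h).map₂ m') n
  simp only [map, ← Bicategory.whiskerLeft_comp, PrelaxFunctor.map₂_comp,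
    Bicategory.comp_whiskerRight, Category.assoc]
  rw [reassoc_of% this, ← Bicategory.whiskerLeft_comp]

lemma map_id_comp (e : g * h = k) (b : (S.functor h).obj y ⟶ z)
    {a a' a'' : (S.functor g).obj x ⟶ y} (m : a ⟶ a') (m' : a' ⟶ a'') :
    S.map e (𝟙 b) (m ≫ m') = S.map e (𝟙 b) m ≫ S.map e (𝟙 b) m' := by
  rw [← map_comp, Category.comp_id]

lemma map_comp_id (e : g * h = k) {b b' b'' : (S.functor h).obj y ⟶ z}
    (a : (S.functor g).obj x ⟶ y) (m : b ⟶ b') (m' : b' ⟶ b'') :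
    S.map e (m ≫ m') (𝟙 a) = S.map e m (𝟙 a) ≫ S.map e m' (𝟙 a) := by
  rw [← map_comp, Category.comp_id]

end

/-- A family of 1-cells isomorphic to the composites of twisted 1-cells. -/
structure Composition where
  comp {g h k : G} (e : g * h = k) {x y z : C} (b : (S.functor h).obj y ⟶ z)
    (a : (S.functor g).obj x ⟶ y) : (S.functor k).obj x ⟶ z
  iso {g h k : G} (e : g * h = k) {x y z : C} (b : (S.functor h).obj y ⟶ z)
    (a : (S.functor g).obj x ⟶ y) : comp e b a ≅ S.comp e b a

/-- The composition of twisted 1-cells. -/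
@[simps] def composition : S.Composition where
  comp e _ _ _ b a := S.comp e b a
  iso _ _ _ _ _ _ := Iso.refl _

namespace Composition

variable {S} (K : S.Composition)

section

variable {g h k : G} {x y z : C}

/-- The action of the composition on 2-cells. -/
def map (e : g * h = k) {b b' : (S.functor h).obj y ⟶ z} {a a' : (S.functor g).obj x ⟶ y}
    (n : b ⟶ b') (m : a ⟶ a') : K.comp e b a ⟶ K.comp e b' a' :=
  (K.iso e b a).hom ≫ S.map e n m ≫ (K.iso e b' a').inv

lemma map_id (e : g * h = k) (b : (S.functor h).obj y ⟶ z) (a : (S.functor g).obj x ⟶ y) :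
    K.map e (𝟙 b) (𝟙 a) = 𝟙 _ := by
  simp [map, S.map_id]

lemma map_comp (e : g * h = k) {b b' b'' : (S.functor h).obj y ⟶ z}
    {a a' a'' : (S.functor g).obj x ⟶ y} (n : b ⟶ b') (n' : b' ⟶ b'') (m : a ⟶ a')
    (m' : a' ⟶ a'') : K.map e (n ≫ n') (m ≫ m') = K.map e n m ≫ K.map e n' m' := by
  simp [map, S.map_comp]

/-- The composition of isomorphisms. -/
@[simps] def mapIso (e : g * h = k) {b b' : (S.functor h).obj y ⟶ z}
    {a a' : (S.functor g).obj x ⟶ y} (n : b ≅ b') (m : a ≅ a') :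
    K.comp e b a ≅ K.comp e b' a' where
  hom := K.map e n.hom m.hom
  inv := K.map e n.inv m.inv
  hom_inv_id := by rw [← K.map_comp, Iso.hom_inv_id, Iso.hom_inv_id, K.map_id]
  inv_hom_id := by rw [← K.map_comp, Iso.inv_hom_id, Iso.inv_hom_id, K.map_id]

/-- The left unitality constraint. -/
def leftUnitor (a : (S.functor g).obj x ⟶ y) : K.comp (mul_one g) (S.ι y) a ≅ a :=
  K.iso _ _ _ ≪≫ S.leftUnitor a

/-- The right unitality constraint. -/
def rightUnitor (b : (S.functor h).obj y ⟶ z) : K.comp (one_mul h) b (S.ι y) ≅ b :=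
  K.iso _ _ _ ≪≫ S.rightUnitor b

lemma leftUnitor_natural {a a' : (S.functor g).obj x ⟶ y} (m : a ⟶ a') :
    K.map (mul_one g) (𝟙 (S.ι y)) m ≫ (K.leftUnitor a').hom = (K.leftUnitor a).hom ≫ m := by
  have := S.leftUnitor_natural m
  simp only [map, leftUnitor, WeakAction.map, Iso.trans_hom, Category.assoc, Iso.inv_hom_id_assoc,
    Bicategory.whiskerLeft_id, Category.comp_id]
  rw [this]

lemma rightUnitor_natural {b b' : (S.functor h).obj y ⟶ z} (n : b ⟶ b') :
    K.map (one_mul h) n (𝟙 (S.ι y)) ≫ (K.rightUnitor b').hom = (K.rightUnitor b).hom ≫ n := by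
  have := S.rightUnitor_natural n
  simp only [map, rightUnitor, WeakAction.map, Iso.trans_hom, Category.assoc,
    Iso.inv_hom_id_assoc, PrelaxFunctor.map₂_id, Bicategory.id_whiskerRight, Category.id_comp]
  rw [this]

end

section

variable {g h k a b c : G} (e₁ : g * h = a) (e₂ : h * k = b) (e₃ : a * k = c) (e₄ : g * b = c)
  {w x y z : C}

/-- The associativity constraint. -/
def assoc (f : (S.functor g).obj w ⟶ x) (f' : (S.functor h).obj x ⟶ y)
    (f'' : (S.functor k).obj y ⟶ z) :
    K.comp e₄ (K.comp e₂ f'' f') f ≅ K.comp e₃ f'' (K.comp e₁ f' f) :=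
  K.mapIso e₄ (K.iso e₂ f'' f') (Iso.refl f) ≪≫ K.iso _ _ _ ≪≫ S.assoc e₁ e₂ e₃ e₄ f f' f'' ≪≫
    (K.iso _ _ _).symm ≪≫ K.mapIso e₃ (Iso.refl f'') (K.iso e₁ f' f).symm

lemma assoc_hom (f : (S.functor g).obj w ⟶ x) (f' : (S.functor h).obj x ⟶ y)
    (f'' : (S.functor k).obj y ⟶ z) :
    (K.assoc e₁ e₂ e₃ e₄ f f' f'').hom = (K.iso _ _ _).hom ≫
      S.map e₄ (K.iso e₂ f'' f').hom (𝟙 f) ≫ (S.assoc e₁ e₂ e₃ e₄ f f' f'').hom ≫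
      S.map e₃ (𝟙 f'') (K.iso e₁ f' f).inv ≫ (K.iso _ _ _).inv := by
  simp [assoc, map]

lemma assoc_natural {f f₁ : (S.functor g).obj w ⟶ x} (m : f ⟶ f₁)
    {f' f₁' : (S.functor h).obj x ⟶ y} (m' : f' ⟶ f₁')
    {f'' f₁'' : (S.functor k).obj y ⟶ z} (m'' : f'' ⟶ f₁'') :
    K.map e₄ (K.map e₂ m'' m') m ≫ (K.assoc e₁ e₂ e₃ e₄ f₁ f₁' f₁'').hom =
      (K.assoc e₁ e₂ e₃ e₄ f f' f'').hom ≫ K.map e₃ m'' (K.map e₁ m' m) := by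
  have h : S.map e₄ (S.map e₂ m'' m') m ≫ (S.assoc e₁ e₂ e₃ e₄ f₁ f₁' f₁'').hom =
      (S.assoc e₁ e₂ e₃ e₄ f f' f'').hom ≫ S.map e₃ m'' (S.map e₁ m' m) :=
    S.assoc_natural e₁ e₂ e₃ e₄ m m' m''
  have h1 : S.map e₄ (K.map e₂ m'' m') m ≫ S.map e₄ (K.iso e₂ f₁'' f₁').hom (𝟙 f₁) =
      S.map e₄ (K.iso e₂ f'' f').hom (𝟙 f) ≫ S.map e₄ (S.map e₂ m'' m') m := by
    rw [← S.map_comp, ← S.map_comp]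
    simp [map]
  have h2 : S.map e₃ (𝟙 f'') (K.iso e₁ f' f).inv ≫ S.map e₃ m'' (K.map e₁ m' m) =
      S.map e₃ m'' (S.map e₁ m' m) ≫ S.map e₃ (𝟙 f₁'') (K.iso e₁ f₁' f₁).inv := by
    rw [← S.map_comp, ← S.map_comp]
    simp [map]
  simp only [assoc_hom]
  simp only [map, Category.assoc, Iso.inv_hom_id_assoc] at h1 h2 ⊢
  rw [reassoc_of% h1, reassoc_of% h, ← reassoc_of% h2]

end

lemma pentagon {g h k l gh hk kl ghk hkl ghkl : G} (e_gh : g * h = gh) (e_hk : h * k = hk)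
    (e_kl : k * l = kl) (e_gh_k : gh * k = ghk) (e_g_hk : g * hk = ghk) (e_hk_l : hk * l = hkl)
    (e_h_kl : h * kl = hkl) (e_ghk_l : ghk * l = ghkl) (e_gh_kl : gh * kl = ghkl)
    (e_g_hkl : g * hkl = ghkl) {v w x y z : C} (a : (S.functor g).obj v ⟶ w)
    (b : (S.functor h).obj w ⟶ x) (c : (S.functor k).obj x ⟶ y) (d : (S.functor l).obj y ⟶ z) :
    (K.assoc e_gh e_h_kl e_gh_kl e_g_hkl a b (K.comp e_kl d c)).hom ≫
        (K.assoc e_gh_k e_kl e_ghk_l e_gh_kl (K.comp e_gh b a) c d).hom =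
      K.map e_g_hkl (K.assoc e_hk e_kl e_hk_l e_h_kl b c d).hom (𝟙 a) ≫
        (K.assoc e_g_hk e_hk_l e_ghk_l e_g_hkl a (K.comp e_hk c b) d).hom ≫
        K.map e_ghk_l (𝟙 d) (K.assoc e_gh e_hk e_gh_k e_g_hk a b c).hom := by
  have h : (S.assoc e_gh e_h_kl e_gh_kl e_g_hkl a b (S.comp e_kl d c)).hom ≫
        (S.assoc e_gh_k e_kl e_ghk_l e_gh_kl (S.comp e_gh b a) c d).hom =
      S.map e_g_hkl (S.assoc e_hk e_kl e_hk_l e_h_kl b c d).hom (𝟙 a) ≫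
        (S.assoc e_g_hk e_hk_l e_ghk_l e_g_hkl a (S.comp e_hk c b) d).hom ≫
        S.map e_ghk_l (𝟙 d) (S.assoc e_gh e_hk e_gh_k e_g_hk a b c).hom := by
    simpa [WeakAction.map, comp] using
      S.pentagon e_gh e_hk e_kl e_gh_k e_g_hk e_hk_l e_h_kl e_ghk_l e_gh_kl e_g_hkl a b c d
  have n : ∀ {g h k a b c : G} (e₁ : g * h = a) (e₂ : h * k = b) (e₃ : a * k = c)
      (e₄ : g * b = c) {w x y z : C} {f f₁ : (S.functor g).obj w ⟶ x} (m : f ⟶ f₁)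
      {f' f₁' : (S.functor h).obj x ⟶ y} (m' : f' ⟶ f₁')
      {f'' f₁'' : (S.functor k).obj y ⟶ z} (m'' : f'' ⟶ f₁''),
      S.map e₄ (S.map e₂ m'' m') m ≫ (S.assoc e₁ e₂ e₃ e₄ f₁ f₁' f₁'').hom =
      (S.assoc e₁ e₂ e₃ e₄ f f' f'').hom ≫ S.map e₃ m'' (S.map e₁ m' m) :=
    fun e₁ e₂ e₃ e₄ _ _ _ _ _ _ m _ _ m' _ _ m'' => S.assoc_natural e₁ e₂ e₃ e₄ m m' m''
  have n₁ := n e_gh e_h_kl e_gh_kl e_g_hkl (𝟙 a) (𝟙 b) (K.iso e_kl d c).hom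
  have n₂ := n e_gh_k e_kl e_ghk_l e_gh_kl (K.iso e_gh b a).inv (𝟙 c) (𝟙 d)
  have n₃ := n e_g_hk e_hk_l e_ghk_l e_g_hkl (𝟙 a) (K.iso e_hk c b).inv (𝟙 d)
  have q : ∀ {g h k : G} {x y z : C} (e : g * h = k) (b : (S.functor h).obj y ⟶ z)
      {a a' : (S.functor g).obj x ⟶ y} (m : a ≅ a'),
      S.map e (𝟙 b) m.hom ≫ S.map e (𝟙 b) m.inv = 𝟙 _ := fun e b _ _ m => by
    rw [← S.map_comp, Iso.hom_inv_id, Category.comp_id, S.map_id]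
  have q' : ∀ {g h k : G} {x y z : C} (e : g * h = k) (b : (S.functor h).obj y ⟶ z)
      {a a' : (S.functor g).obj x ⟶ y} (m : a ≅ a') {t : (S.functor k).obj x ⟶ z}
      (r : S.comp e b a' ⟶ t),
      S.map e (𝟙 b) m.inv ≫ S.map e (𝟙 b) m.hom ≫ r = r := fun e b _ _ m _ r => by
    rw [← Category.assoc, ← S.map_comp, Iso.inv_hom_id, Category.comp_id, S.map_id,
      Category.id_comp]
  have q'' : ∀ {g h k : G} {x y z : C} (e : g * h = k) {b b' : (S.functor h).obj y ⟶ z}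
      (a : (S.functor g).obj x ⟶ y) (m : b ≅ b') {t : (S.functor k).obj x ⟶ z}
      (r : S.comp e b' a ⟶ t),
      S.map e m.inv (𝟙 a) ≫ S.map e m.hom (𝟙 a) ≫ r = r := fun e _ _ a m _ r => by
    rw [← Category.assoc, ← S.map_comp, Iso.inv_hom_id, Category.comp_id, S.map_id,
      Category.id_comp]
  have x₁ : S.map e_gh_kl (𝟙 (K.comp e_kl d c)) (K.iso e_gh b a).inv ≫
      S.map e_gh_kl (K.iso e_kl d c).hom (𝟙 (K.comp e_gh b a)) =
      S.map e_gh_kl (K.iso e_kl d c).hom (𝟙 _) ≫ S.map e_gh_kl (𝟙 _) (K.iso e_gh b a).inv := by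
    rw [← S.map_comp, ← S.map_comp]
    simp
  have x₃ : ∀ {t : (S.functor ghkl).obj v ⟶ z} (r : S.comp e_ghk_l d (S.comp e_g_hk
      (S.comp e_hk c b) a) ⟶ t), S.map e_ghk_l (𝟙 d) (S.map e_g_hk (K.iso e_hk c b).inv (𝟙 a)) ≫
      S.map e_ghk_l (𝟙 d) (S.map e_g_hk (K.iso e_hk c b).hom (𝟙 a)) ≫ r = r := fun r => by
    rw [← Category.assoc, ← S.map_id_comp, ← S.map_comp_id, Iso.inv_hom_id, S.map_id, S.map_id,
      Category.id_comp]
  simp only [S.map_id] at n₁ n₂ n₃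
  simp only [assoc_hom, map, S.map_id_comp, S.map_comp_id, Category.assoc, Iso.inv_hom_id_assoc]
  rw [reassoc_of% x₁, ← reassoc_of% n₁, reassoc_of% n₂, reassoc_of% h, q'', reassoc_of% n₃, q',
    x₃]

lemma triangle {g h k : G} (e : g * h = k) {x y z : C} (a : (S.functor g).obj x ⟶ y)
    (b : (S.functor h).obj y ⟶ z) :
    (K.assoc (mul_one g) (one_mul h) e e a (S.ι y) b).hom ≫ K.map e (𝟙 b) (K.leftUnitor a).hom =
      K.map e (K.rightUnitor b).hom (𝟙 a) := by
  have h' : (S.assoc (mul_one g) (one_mul h) e e a (S.ι y) b).hom ≫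
      S.map e (𝟙 b) (S.leftUnitor a).hom = S.map e (S.rightUnitor b).hom (𝟙 a) := by
    simpa [WeakAction.map, comp] using S.triangle e a b
  have q' : S.map e (𝟙 b) (K.iso (mul_one g) (S.ι y) a).inv ≫
      S.map e (𝟙 b) (K.leftUnitor a).hom = S.map e (𝟙 b) (S.leftUnitor a).hom := by
    rw [← S.map_comp]
    simp [leftUnitor]
  simp only [assoc_hom, map, Category.assoc, Iso.inv_hom_id_assoc]
  rw [reassoc_of% q', reassoc_of% h', ← Category.assoc (S.map _ _ _), ← S.map_comp]
  simp [rightUnitor]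

end Composition

end WeakAction
end TwistedBicat

namespace TwistedBicat

attribute [-simp] MonoidalCategory.tensorHom_id MonoidalCategory.id_tensorHom
  MonoidalCategory.associator_conjugation
attribute [local simp] MonoidalCategory.id_tensorHom_id MonoidalCategory.tensorHom_comp_tensorHom
  MonoidalCategory.tensorHom_comp_tensorHom_assoc MonoidalCategory.associator_naturality
  MonoidalCategory.associator_naturality_assoc

local infixr:81 " ◃ " => Bicategory.whiskerLeft
local infixl:81 " ▹ " => Bicategory.whiskerRight

open MonoidalTwoCategory


open Elem EnrichedData TwistingAction Functor.LaxMonoidal Functor.OplaxMonoidal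

section Evaluation

variable {W : Type u} [Bicategory.{w, v} W] [Bicategory.Strict W]

namespace Elem

variable {X Y : W}

lemma ev_injective {f g : X ⟶ Y} {η θ : f ⟶ g} (a : Elem X) (i : X ≅ a.src)
    (hi : 𝟙 X = i.hom ≫ a.val) (h : ev η a = ev θ a) : η = θ := by
  apply ev_univ_injective
  rw [ev_eq η (a := a) (b := univ X) i.symm
      (by rw [Iso.symm_hom, Iso.eq_inv_comp]; exact hi.symm), h,
    ← ev_eq θ (a := a) (b := univ X) i.symm
      (by rw [Iso.symm_hom, Iso.eq_inv_comp]; exact hi.symm)]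

lemma exists_evIso_univ {f g : X ⟶ Y} (m : pushObj f (univ X) ≅ pushObj g (univ X))
    (h : m.hom.base = 𝟙 X) : ∃ η : f ≅ g, ev η.hom (univ X) = m.hom := by
  have h' : m.inv.base = 𝟙 X := by
    have := congrArg Hom.base m.hom_inv_id
    rw [comp_base, h] at this
    exact (Category.id_comp _).symm.trans this
  obtain ⟨η, hη⟩ := exists_ev_univ m.hom h
  obtain ⟨θ, hθ⟩ := exists_ev_univ m.inv h'
  refine ⟨⟨η, θ, ev_univ_injective ?_, ev_univ_injective ?_⟩, hη⟩
  · rw [ev_comp, hη, hθ, ev_id, Iso.hom_inv_id]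
  · rw [ev_comp, hη, hθ, ev_id, Iso.inv_hom_id]

lemma st_square {x y y' x' a a' b b' : Elem X} {p : a.src ⟶ b.src} {h : a.val = p ≫ b.val}
    {p' : a'.src ⟶ b'.src} {h' : a'.val = p' ≫ b'.val} {i : b ⟶ b'} {j : a ⟶ a'}
    (n : st a b p h ≫ i = j ≫ st a' b' p' h') {q : x.src ⟶ y.src} {hq : x.val = q ≫ y.val}
    {s : y.src ⟶ b.src} {hs : y.val = s ≫ b.val} {t : b'.src ⟶ y'.src}
    {ht : b'.val = t ≫ y'.val} {u : x.src ⟶ a.src} {hu : x.val = u ≫ a.val}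
    {t' : a'.src ⟶ x'.src} {ht' : a'.val = t' ≫ x'.val} {q' : x'.src ⟶ y'.src}
    {hq' : x'.val = q' ≫ y'.val} (w : q ≫ s = u ≫ p) (w' : t' ≫ q' = p' ≫ t) :
    st x y q hq ≫ st y b s hs ≫ i ≫ st b' y' t ht =
      (st x a u hu ≫ j ≫ st a' x' t' ht') ≫ st x' y' q' hq' := by
  simp only [Category.assoc, st_st_assoc, st_st]
  rw [st_congr w, ← st_st_assoc (a := x) (b := a) (c := b) u hu p h, ← Category.assoc (st a b p h),
    n, Category.assoc, st_st, st_congr w'.symm]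

end Elem

end Evaluation

section Elementwise

variable {G : Type t} [Group G] {W : Type u} [Bicategory.{w, v} W] [Bicategory.Strict W]
  [MonoidalTwoCategory W] [TwistingAction G W]

/-- The isomorphism underlying `twistedAssoc`. -/
def twistedAssocIso {h k b : G} (e : h * k = b) (X Y Z : W) :
    (X ⊗ (act k).obj Y) ⊗ (act b).obj Z ≅ X ⊗ (act k).obj (Y ⊗ (act h).obj Z) :=
  MonoidalCategory.tensorIso (Iso.refl _) ((mulIso e).symm.app Z) ≪≫
    (α_ X ((act k).obj Y) ((act k).obj ((act h).obj Z))) ≪≫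
    MonoidalCategory.tensorIso (Iso.refl X) (Functor.Monoidal.μIso (act k) Y ((act h).obj Z))

lemma twistedAssocIso_eq {h k b : G} (e : h * k = b) (X Y Z : W) :
    (twistedAssocIso e X Y Z).hom = twistedAssoc e X Y Z := rfl

lemma twistedAssoc_inv {h k b : G} (e : h * k = b) (X Y Z : W) :
    twistedAssoc e X Y Z ≫ (twistedAssocIso e X Y Z).inv = 𝟙 _ :=
  (twistedAssocIso e X Y Z).hom_inv_id

lemma inv_twistedAssoc {h k b : G} (e : h * k = b) (X Y Z : W) :
    (twistedAssocIso e X Y Z).inv ≫ twistedAssoc e X Y Z = 𝟙 _ :=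
  (twistedAssocIso e X Y Z).inv_hom_id

lemma inv_twistedAssoc_assoc {h k b : G} (e : h * k = b) (X Y Z : W) {T : W}
    (f : X ⊗ (act k).obj (Y ⊗ (act h).obj Z) ⟶ T) :
    (twistedAssocIso e X Y Z).inv ≫ twistedAssoc e X Y Z ≫ f = f :=
  (twistedAssocIso e X Y Z).inv_hom_id_assoc f

lemma twistedAssoc_pentagon_inv {h k l hk kl hkl : G} (e_hk : h * k = hk) (e_kl : k * l = kl)
    (e_hk_l : hk * l = hkl) (e_h_kl : h * kl = hkl) (X Y Z V : W) :
    (𝟙 X ⊗ₘ (act l).map (twistedAssocIso e_hk Y Z V).inv) ≫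
        (twistedAssocIso e_hk_l X (Y ⊗ (act k).obj Z) V).inv ≫
        ((twistedAssocIso e_kl X Y Z).inv ⊗ₘ 𝟙 ((act hkl).obj V)) =
      (twistedAssocIso e_kl X Y (Z ⊗ (act h).obj V)).inv ≫
        (twistedAssocIso e_h_kl (X ⊗ (act l).obj Y) Z V).inv := by
  have h1 : MonoidalCategory.tensorIso (twistedAssocIso e_kl X Y Z) (Iso.refl ((act hkl).obj V)) ≪≫
      twistedAssocIso e_hk_l X (Y ⊗ (act k).obj Z) V ≪≫
      MonoidalCategory.tensorIso (Iso.refl X) ((act l).mapIso (twistedAssocIso e_hk Y Z V)) =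
      twistedAssocIso e_h_kl (X ⊗ (act l).obj Y) Z V ≪≫
        twistedAssocIso e_kl X Y (Z ⊗ (act h).obj V) :=
    Iso.ext (twistedAssoc_pentagon e_hk e_kl e_hk_l e_h_kl X Y Z V)
  have h2 := congrArg Iso.inv h1
  simp only [Iso.trans_inv, MonoidalCategory.tensorIso_inv, Iso.refl_inv, Functor.mapIso_inv,
    Category.assoc] at h2
  exact h2

lemma twistedAssoc_triangle_inv (h : G) (X Z : W) :
    (𝟙 X ⊗ₘ (act h).map ((oneIso (G := G)).inv.app Z) ≫ (act h).map (λ_ _).inv) ≫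
        (twistedAssocIso (one_mul h) X (𝟙_ W) Z).inv ≫
        ((𝟙 X ⊗ₘ η (act h)) ⊗ₘ 𝟙 ((act h).obj Z)) =
      (ρ_ X).inv ⊗ₘ 𝟙 ((act h).obj Z) := by
  have h1 : MonoidalCategory.tensorIso (MonoidalCategory.tensorIso (Iso.refl X)
      (Functor.Monoidal.εIso (act h))) (Iso.refl ((act h).obj Z)) ≪≫
      twistedAssocIso (one_mul h) X (𝟙_ W) Z ≪≫ MonoidalCategory.tensorIso (Iso.refl X)
        ((act h).mapIso (λ_ _ ≪≫ (oneIso (G := G)).app Z)) =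
      MonoidalCategory.tensorIso (ρ_ X) (Iso.refl ((act h).obj Z)) :=
    Iso.ext (twistedAssoc_triangle h X Z)
  have h2 := congrArg Iso.inv h1
  simp only [Iso.trans_inv, MonoidalCategory.tensorIso_inv, Iso.refl_inv, Functor.mapIso_inv,
    Category.assoc, Functor.map_comp, Iso.app_inv] at h2
  exact h2

attribute [-simp] Functor.LaxMonoidal.left_unitality Functor.LaxMonoidal.right_unitality
  Functor.OplaxMonoidal.left_unitality Functor.OplaxMonoidal.right_unitality
attribute [local simp] twistedAssocIso_eq twistedAssoc_inv inv_twistedAssoc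
  inv_twistedAssoc_assoc twistedAssoc_pentagon_inv twistedAssoc_triangle_inv

namespace VariantData

variable {O : Type s} (P : VariantData G W O)

/-- The composite of generalized elements of the homs of `P`. -/
abbrev cmp {g h k : G} (e : g * h = k) {x y z : O} (b : Elem (P.hom h y z))
    (a : Elem (P.hom g x y)) : Elem (P.hom k x z) :=
  pushObj (P.comp e x y z) (box b (actObj h a))

abbrev cmpMap {g h k : G} (e : g * h = k) {x y z : O} {b b' : Elem (P.hom h y z)}
    {a a' : Elem (P.hom g x y)} (n : b ⟶ b') (m : a ⟶ a') : P.cmp e b a ⟶ P.cmp e b' a' :=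
  pushMap (P.comp e x y z) (boxMap n (actMap h m))

abbrev assocSrc {g h k b c : G} (e₂ : h * k = b) (e₄ : g * b = c) (w x y z : O) :
    (P.hom k y z ⊗ (act k).obj (P.hom h x y)) ⊗ (act b).obj (P.hom g w x) ⟶ P.hom c w z :=
  (P.comp e₂ x y z ⊗ₘ 𝟙 ((act b).obj (P.hom g w x))) ≫ P.comp e₄ w x z

abbrev assocTgt {g h k a b c : G} (e₁ : g * h = a) (e₂ : h * k = b) (e₃ : a * k = c)
    (w x y z : O) :
    (P.hom k y z ⊗ (act k).obj (P.hom h x y)) ⊗ (act b).obj (P.hom g w x) ⟶ P.hom c w z :=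
  twistedAssoc e₂ (P.hom k y z) (P.hom h x y) (P.hom g w x) ≫
    (𝟙 (P.hom k y z) ⊗ₘ (act k).map (P.comp e₁ w x y)) ≫ P.comp e₃ w y z

abbrev leftSrc (g : G) (x y : O) : 𝟙_ W ⊗ (act (1 : G)).obj (P.hom g x y) ⟶ P.hom g x y :=
  (P.id y ⊗ₘ 𝟙 ((act 1).obj (P.hom g x y))) ≫ P.comp (mul_one g) x y y

abbrev leftTgt (g : G) (x y : O) : 𝟙_ W ⊗ (act (1 : G)).obj (P.hom g x y) ⟶ P.hom g x y :=
  (λ_ ((act 1).obj (P.hom g x y))).hom ≫ oneIso.hom.app (P.hom g x y)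

abbrev rightSrc (g : G) (x y : O) : P.hom g x y ⊗ 𝟙_ W ⟶ P.hom g x y :=
  (𝟙 (P.hom g x y) ⊗ₘ (ε (act g) ≫ (act g).map (P.id x))) ≫ P.comp (one_mul g) x x y

lemma cmpMap_st {g h k : G} (e : g * h = k) {x y z : O} {b b' : Elem (P.hom h y z)}
    {a a' : Elem (P.hom g x y)} (p : b.src ⟶ b'.src) (hp : b.val = p ≫ b'.val)
    (q : a.src ⟶ a'.src) (hq : a.val = q ≫ a'.val) :
    P.cmpMap e (st b b' p hp) (st a a' q hq) =
      st (P.cmp e b a) (P.cmp e b' a') (p ⊗ₘ (act h).map q) (by simp [hp, hq]) := by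
  simp [cmpMap]

/-- Associativity and unitality constraints for the composition of generalized elements. -/
structure ElementStructure where
  assoc {g h k a b c : G} (e₁ : g * h = a) (e₂ : h * k = b) (e₃ : a * k = c) (e₄ : g * b = c)
    {w x y z : O} (p : Elem (P.hom g w x)) (q : Elem (P.hom h x y)) (r : Elem (P.hom k y z)) :
    P.cmp e₄ (P.cmp e₂ r q) p ≅ P.cmp e₃ r (P.cmp e₁ q p)
  assoc_base {g h k a b c : G} (e₁ : g * h = a) (e₂ : h * k = b) (e₃ : a * k = c)
    (e₄ : g * b = c) {w x y z : O} (p : Elem (P.hom g w x)) (q : Elem (P.hom h x y))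
    (r : Elem (P.hom k y z)) :
    (assoc e₁ e₂ e₃ e₄ p q r).hom.base = twistedAssoc e₂ r.src q.src p.src
  assoc_natural {g h k a b c : G} (e₁ : g * h = a) (e₂ : h * k = b) (e₃ : a * k = c)
    (e₄ : g * b = c) {w x y z : O} {p p' : Elem (P.hom g w x)} (m : p ⟶ p')
    {q q' : Elem (P.hom h x y)} (n : q ⟶ q') {r r' : Elem (P.hom k y z)} (o : r ⟶ r') :
    P.cmpMap e₄ (P.cmpMap e₂ o n) m ≫ (assoc e₁ e₂ e₃ e₄ p' q' r').hom =
      (assoc e₁ e₂ e₃ e₄ p q r).hom ≫ P.cmpMap e₃ o (P.cmpMap e₁ n m)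
  leftUnitor {g : G} {x y : O} (a : Elem (P.hom g x y)) :
    P.cmp (mul_one g) (point (P.id y)) a ≅ a
  leftUnitor_base {g : G} {x y : O} (a : Elem (P.hom g x y)) :
    (leftUnitor a).hom.base = (λ_ _).hom ≫ oneIso.hom.app a.src
  leftUnitor_natural {g : G} {x y : O} {a a' : Elem (P.hom g x y)} (m : a ⟶ a') :
    P.cmpMap (mul_one g) (𝟙 (point (P.id y))) m ≫ (leftUnitor a').hom = (leftUnitor a).hom ≫ m
  rightUnitor {g : G} {x y : O} (a : Elem (P.hom g x y)) :
    P.cmp (one_mul g) a (point (P.id x)) ≅ a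
  rightUnitor_base {g : G} {x y : O} (a : Elem (P.hom g x y)) :
    (rightUnitor a).hom.base = (𝟙 a.src ⊗ₘ η (act g)) ≫ (ρ_ a.src).hom
  rightUnitor_natural {g : G} {x y : O} {a a' : Elem (P.hom g x y)} (m : a ⟶ a') :
    P.cmpMap (one_mul g) m (𝟙 (point (P.id x))) ≫ (rightUnitor a').hom = (rightUnitor a).hom ≫ m
  pentagon {g h k l gh hk kl ghk hkl ghkl : G} (e_gh : g * h = gh) (e_hk : h * k = hk)
    (e_kl : k * l = kl) (e_gh_k : gh * k = ghk) (e_g_hk : g * hk = ghk) (e_hk_l : hk * l = hkl)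
    (e_h_kl : h * kl = hkl) (e_ghk_l : ghk * l = ghkl) (e_gh_kl : gh * kl = ghkl)
    (e_g_hkl : g * hkl = ghkl) {v w x y z : O} (a : Elem (P.hom g v w)) (b : Elem (P.hom h w x))
    (c : Elem (P.hom k x y)) (d : Elem (P.hom l y z)) :
    (assoc e_gh e_h_kl e_gh_kl e_g_hkl a b (P.cmp e_kl d c)).hom ≫
        (assoc e_gh_k e_kl e_ghk_l e_gh_kl (P.cmp e_gh b a) c d).hom =
      P.cmpMap e_g_hkl (assoc e_hk e_kl e_hk_l e_h_kl b c d).hom (𝟙 a) ≫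
        (assoc e_g_hk e_hk_l e_ghk_l e_g_hkl a (P.cmp e_hk c b) d).hom ≫
        P.cmpMap e_ghk_l (𝟙 d) (assoc e_gh e_hk e_gh_k e_g_hk a b c).hom
  triangle {g h k : G} (e : g * h = k) {x y z : O} (a : Elem (P.hom g x y))
    (b : Elem (P.hom h y z)) :
    (assoc (mul_one g) (one_mul h) e e a (point (P.id y)) b).hom ≫
        P.cmpMap e (𝟙 b) (leftUnitor a).hom =
      P.cmpMap e (rightUnitor b).hom (𝟙 a)

namespace ElementStructure

variable {P} (E : P.ElementStructure)

section

variable {g h k a b c : G} (e₁ : g * h = a) (e₂ : h * k = b) (e₃ : a * k = c) (e₄ : g * b = c)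

lemma exists_assoc (w x y z : O) :
    ∃ α : P.assocSrc e₂ e₄ w x y z ≅ P.assocTgt e₁ e₂ e₃ w x y z,
      ∀ (p : Elem (P.hom g w x)) (q : Elem (P.hom h x y)) (r : Elem (P.hom k y z)),
        ev α.hom (box (box r (actObj k q)) (actObj b p)) =
          st (pushObj (P.assocSrc e₂ e₄ w x y z) (box (box r (actObj k q)) (actObj b p)))
            (P.cmp e₄ (P.cmp e₂ r q) p) (𝟙 _) (by simp) ≫ (E.assoc e₁ e₂ e₃ e₄ p q r).hom ≫
            st (P.cmp e₃ r (P.cmp e₁ q p)) (pushObj (P.assocTgt e₁ e₂ e₃ w x y z)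
              (box (box r (actObj k q)) (actObj b p))) (twistedAssocIso e₂ r.src q.src p.src).inv (by
              rw [Iso.eq_inv_comp]
              simp [reassoc_of% twistedAssoc_naturality]) := by
  let i := E.assoc e₁ e₂ e₃ e₄ (univ (P.hom g w x)) (univ (P.hom h x y)) (univ (P.hom k y z))
  have hi := E.assoc_base e₁ e₂ e₃ e₄ (univ (P.hom g w x)) (univ (P.hom h x y))
    (univ (P.hom k y z))
  obtain ⟨α, hα⟩ := exists_evIso_univ
    (f := P.assocSrc e₂ e₄ w x y z) (g := P.assocTgt e₁ e₂ e₃ w x y z)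
    (stIso _ (P.cmp e₄ (P.cmp e₂ (univ _) (univ _)) (univ _)) (Iso.refl _) (by simp) ≪≫ i ≪≫
      stIso _ _ (twistedAssocIso e₂ _ _ _).symm (by
        rw [Iso.symm_hom, Iso.eq_inv_comp]
        simp))
    (by simp [i, hi])
  refine ⟨α, fun p q r => ?_⟩
  have n := ev_natural α.hom (st (box (box r (actObj k q)) (actObj b p)) (univ _)
    ((r.val ⊗ₘ (act k).map q.val) ⊗ₘ (act b).map p.val) (by simp))
  have n' := E.assoc_natural e₁ e₂ e₃ e₄ (st p (univ _) p.val (by simp))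
    (st q (univ _) q.val (by simp)) (st r (univ _) r.val (by simp))
  rw [hα] at n
  refine hom_ext_st (c := pushObj (P.assocTgt e₁ e₂ e₃ w x y z) (univ _)) ((r.val ⊗ₘ (act k).map q.val) ⊗ₘ (act b).map p.val)
    (by simp) (by simp [E.assoc_base]) ?_
  simp only [pushMap_st] at n
  refine n.symm.trans ?_
  simp only [cmpMap_st] at n'
  refine st_square n' (by simp) ?_
  rw [Iso.inv_comp_eq, ← Category.assoc]
  exact (Iso.eq_comp_inv _).2 (twistedAssoc_naturality _ _ _ _)

end

section

variable (g : G) (x y : O)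

lemma exists_leftUnitor :
    ∃ α : P.leftSrc g x y ≅
        P.leftTgt g x y,
      ∀ a : Elem (P.hom g x y), ev α.hom (box (univ (𝟙_ W)) (actObj 1 a)) =
        st (pushObj (P.leftSrc g x y) (box (univ (𝟙_ W)) (actObj 1 a)))
          (P.cmp (mul_one g) (point (P.id y)) a) (𝟙 _) (by simp) ≫ (E.leftUnitor a).hom ≫
          st a (pushObj (P.leftTgt g x y)
            (box (univ (𝟙_ W)) (actObj 1 a))) (oneIso.inv.app a.src ≫ (λ_ _).inv) (by
            simp only [Category.assoc, reassoc_of% leftUnitor_natural', Iso.inv_hom_id_assoc,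
              NatTrans.naturality, Iso.inv_hom_id_app_assoc, Functor.id_map]) := by
  have hi := E.leftUnitor_base (univ (P.hom g x y))
  obtain ⟨α, hα⟩ := exists_evIso_univ
    (f := P.leftSrc g x y)
    (g := P.leftTgt g x y)
    (stIso _ (P.cmp (mul_one g) (point (P.id y)) (univ _)) (Iso.refl _) (by simp) ≪≫
      E.leftUnitor (univ _) ≪≫
      stIso _ _ (oneIso.symm.app _ ≪≫ (λ_ _).symm) (by simp))
    (by simp [hi])
  refine ⟨α, fun a => ?_⟩
  have n := ev_natural α.hom (st (box (univ (𝟙_ W)) (actObj 1 a)) (univ _)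
    (𝟙 _ ⊗ₘ (act 1).map a.val) (by simp))
  have n' := E.leftUnitor_natural (st a (univ _) a.val (by simp))
  rw [hα] at n
  refine hom_ext_st (c := pushObj (P.leftTgt g x y) (univ _)) (𝟙 _ ⊗ₘ (act 1).map a.val)
    (by simp) (by simp [E.leftUnitor_base]) ?_
  simp only [pushMap_st] at n
  refine n.symm.trans ?_
  rw [← st_id (point (P.id y)) (by simp), cmpMap_st] at n'
  refine st_square n' (by simp) ?_
  rw [Category.assoc, ← leftUnitor_inv_natural', ← Category.assoc]
  exact (congrArg (· ≫ (λ_ _).inv) (oneIso.inv.naturality a.val).symm).trans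
    (Category.assoc _ _ _)

lemma exists_rightUnitor :
    ∃ α : P.rightSrc g x y ≅
        (ρ_ (P.hom g x y)).hom,
      ∀ a : Elem (P.hom g x y), ev α.hom (box a (univ (𝟙_ W))) =
        st (pushObj (P.rightSrc g x y) (box a (univ (𝟙_ W))))
          (P.cmp (one_mul g) a (point (P.id x))) (𝟙 _ ⊗ₘ ε (act g)) (by simp) ≫
          (E.rightUnitor a).hom ≫
          st a (pushObj (ρ_ (P.hom g x y)).hom (box a (univ (𝟙_ W)))) (ρ_ _).inv (by simp [rightUnitor_natural']) := by
  have hi := E.rightUnitor_base (univ (P.hom g x y))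
  obtain ⟨α, hα⟩ := exists_evIso_univ
    (f := P.rightSrc g x y)
    (g := (ρ_ (P.hom g x y)).hom)
    (stIso _ (P.cmp (one_mul g) (univ _) (point (P.id x)))
      (MonoidalCategory.tensorIso (Iso.refl _) (Functor.Monoidal.εIso (act g))) (by simp) ≪≫
      E.rightUnitor (univ _) ≪≫
      stIso _ _ (ρ_ _).symm (by simp))
    (by simp [hi])
  refine ⟨α, fun a => ?_⟩
  have n := ev_natural α.hom (st (box a (univ (𝟙_ W))) (univ _) (a.val ⊗ₘ 𝟙 _) (by simp))
  have n' := E.rightUnitor_natural (st a (univ _) a.val (by simp))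
  rw [hα] at n
  refine hom_ext_st (c := pushObj (ρ_ (P.hom g x y)).hom (univ _)) (a.val ⊗ₘ 𝟙 _)
    (by simp) (by simp [E.rightUnitor_base]) ?_
  simp only [pushMap_st] at n
  refine n.symm.trans ?_
  rw [← st_id (point (P.id x)) (by simp), cmpMap_st] at n'
  refine st_square n' (by simp) ?_
  simp [rightUnitor_inv_natural']

end

theorem exists_variantBicategory (E : P.ElementStructure) :
    ∃ B : VariantBicategory G W O, B.toVariantData = P := by
  choose α hα using @exists_assoc.{w, v, u, t, s} G _ W _ _ _ _ O P E
  choose l hl using @exists_leftUnitor.{w, v, u, t, s} G _ W _ _ _ _ O P E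
  choose r hr using @exists_rightUnitor.{w, v, u, t, s} G _ W _ _ _ _ O P E
  refine ⟨VariantBicategory.mk P (fun e₁ e₂ e₃ e₄ => α e₁ e₂ e₃ e₄) (fun g x y => l g x y)
    (fun g x y => r g x y) ?_ ?_, rfl⟩
  · intro g h k l gh hk kl ghk hkl ghkl e_gh e_hk e_kl e_gh_k e_g_hk e_hk_l e_h_kl e_ghk_l
      e_gh_kl e_g_hkl v w x y z
    let a := univ (P.hom g v w)
    let b := univ (P.hom h w x)
    let c := univ (P.hom k x y)
    let d := univ (P.hom l y z)
    refine ev_injective (box (box (box d (actObj l c)) (actObj kl b)) (actObj hkl a))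
      (Iso.refl _) (by simp [a, b, c, d]) ?_
    have law := E.pentagon e_gh e_hk e_kl e_gh_k e_g_hk e_hk_l e_h_kl e_ghk_l e_gh_kl e_g_hkl
      a b c d
    generalize a = a, b = b, c = c, d = d at law ⊢
    simp only [ev_comp, ev_eqToHom, ev_whiskerLeft, ev_whiskerRight]
    rw [ev_eq (α e_gh e_h_kl e_gh_kl e_g_hkl v w x z).hom
        (a := box (box (P.cmp e_kl d c) (actObj kl b)) (actObj hkl a))
        (b := pushObj _ (box (box (box d (actObj l c)) (actObj kl b)) (actObj hkl a)))
        (Iso.refl _) (by simp),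
      ev_eq (α e_gh_k e_kl e_ghk_l e_gh_kl v x y z).hom
        (a := box (box d (actObj l c)) (actObj kl (P.cmp e_gh b a)))
        (b := pushObj _ (box (box (box d (actObj l c)) (actObj kl b)) (actObj hkl a)))
        (twistedAssocIso e_h_kl _ _ _).symm (by
          rw [Iso.symm_hom, Iso.eq_inv_comp]
          simp [reassoc_of% twistedAssoc_naturality]),
      ev_eq (α e_g_hk e_hk_l e_ghk_l e_g_hkl v w y z).hom
        (a := box (box d (actObj l (P.cmp e_hk c b))) (actObj hkl a))
        (b := pushObj _ (box (box (box d (actObj l c)) (actObj kl b)) (actObj hkl a)))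
        (MonoidalCategory.tensorIso (twistedAssocIso e_kl _ _ _) (Iso.refl _)).symm (by
          rw [Iso.symm_hom, Iso.eq_inv_comp]
          simp [reassoc_of% twistedAssoc_naturality, twistedAssoc_naturality]),
      ev_eq (tensor₂ (𝟙 (𝟙 (P.hom l y z))) (act₂ l (α e_gh e_hk e_gh_k e_g_hk v w x y).hom))
        (a := box d (actObj l (box (box c (actObj k b)) (actObj hk a))))
        (b := pushObj _ (box (box (box d (actObj l c)) (actObj kl b)) (actObj hkl a)))
        (MonoidalCategory.tensorIso (twistedAssocIso e_kl _ _ _) (Iso.refl _) ≪≫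
          twistedAssocIso e_hk_l _ _ _).symm (by
          rw [Iso.symm_hom, Iso.eq_inv_comp]
          simp [reassoc_of% twistedAssoc_naturality, twistedAssoc_naturality]
          rw [← twistedAssoc_naturality]
          simp)]
    simp only [ev_tensor₂_id, ev_id_tensor₂, ev_act₂, hα]
    have law' := st_conj law (pushObj (((P.comp e_kl x y z ⊗ₘ 𝟙 ((act kl).obj (P.hom h w x))) ⊗ₘ
          𝟙 ((act hkl).obj (P.hom g v w))) ≫ P.assocSrc e_h_kl e_g_hkl v w x z)
        (box (box (box d (actObj l c)) (actObj kl b)) (actObj hkl a))) (pushObj ((twistedAssoc e_h_kl (P.hom l y z ⊗ (act l).obj (P.hom k x y))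
          (P.hom h w x) (P.hom g v w) ≫ (𝟙 (P.hom l y z ⊗ (act l).obj (P.hom k x y)) ⊗ₘ
            (act kl).map (P.comp e_gh v w x))) ≫ P.assocTgt e_gh_k e_kl e_ghk_l v x y z)
        (box (box (box d (actObj l c)) (actObj kl b)) (actObj hkl a))) (𝟙 _) (by simp)
      ((twistedAssocIso e_kl d.src c.src (b.src ⊗ (act h).obj a.src)).inv ≫
        (twistedAssocIso e_h_kl (d.src ⊗ (act l).obj c.src) b.src a.src).inv) (by
          rw [Category.assoc, Iso.eq_inv_comp, Iso.eq_inv_comp]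
          simp [assocTgt, -Functor.map_comp, ← Functor.map_comp,
            reassoc_of% twistedAssoc_naturality])
    simp [cmpMap] at law' ⊢
    exact law'.trans (congrArg (fun q => _ ≫ _ ≫ _ ≫ _ ≫ q)
      (st_congr (twistedAssoc_pentagon_inv e_hk e_kl e_hk_l e_h_kl _ _ _ _).symm _))
  · intro g h k e x y z
    let a := univ (P.hom g x y)
    let b := univ (P.hom h y z)
    refine ev_injective (box (box b (univ (𝟙_ W))) (actObj h a))
      (Iso.refl _) (by simp [a, b]) ?_
    have law := E.triangle e a b
    generalize a = a, b = b at law ⊢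
    simp only [ev_comp, ev_eqToHom, ev_whiskerLeft, ev_whiskerRight]
    rw [ev_eq (α (mul_one g) (one_mul h) e e x y y z).hom
        (a := box (box b (actObj h (point (P.id y)))) (actObj h a))
        (b := pushObj _ (box (box b (univ (𝟙_ W))) (actObj h a)))
        (MonoidalCategory.tensorIso (MonoidalCategory.tensorIso (Iso.refl _)
          (Functor.Monoidal.εIso (act h))) (Iso.refl _)).symm (by
          rw [Iso.symm_hom, Iso.eq_inv_comp]
          simp),
      ev_eq (tensor₂ (𝟙 (𝟙 (P.hom h y z))) (act₂ h (l g x y).hom))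
        (a := box b (actObj h (box (univ (𝟙_ W)) (actObj 1 a))))
        (b := pushObj _ (box (box b (univ (𝟙_ W))) (actObj h a)))
        (MonoidalCategory.tensorIso (MonoidalCategory.tensorIso (Iso.refl _)
          (Functor.Monoidal.εIso (act h))) (Iso.refl _) ≪≫
          twistedAssocIso (one_mul h) _ _ _).symm (by
          rw [Iso.symm_hom, Iso.eq_inv_comp]
          simp [reassoc_of% twistedAssoc_naturality, twistedAssoc_naturality]
          rw [← twistedAssoc_naturality]
          simp)]
    simp only [ev_tensor₂_id, ev_id_tensor₂, ev_act₂, hα, hl, hr]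
    have law' := st_conj law (pushObj (((𝟙 (P.hom h y z) ⊗ₘ (ε (act h) ≫ (act h).map (P.id y))) ⊗ₘ
          𝟙 ((act h).obj (P.hom g x y))) ≫ P.assocSrc (one_mul h) e x y y z)
        (box (box b (univ (𝟙_ W))) (actObj h a)))
      (pushObj ((((𝟙 (P.hom h y z) ⊗ₘ ε (act h)) ⊗ₘ 𝟙 ((act h).obj (P.hom g x y))) ≫
          twistedAssoc (one_mul h) (P.hom h y z) (𝟙_ W) (P.hom g x y)) ≫
          (𝟙 (P.hom h y z) ⊗ₘ (act h).map (P.leftTgt g x y)) ≫ P.comp e x y z)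
        (box (box b (univ (𝟙_ W))) (actObj h a)))
      ((𝟙 _ ⊗ₘ ε (act h)) ⊗ₘ 𝟙 _) (by simp)
      ((ρ_ b.src).inv ⊗ₘ 𝟙 _) (by
        change (b.val ⊗ₘ (act h).map a.val) ≫ P.comp e x y z = ((ρ_ b.src).inv ⊗ₘ 𝟙 _) ≫
          ((b.val ⊗ₘ 𝟙 _) ⊗ₘ (act h).map a.val) ≫ _
        rw [Category.assoc, reassoc_of% twistedAssoc_triangle]
        simp [rightUnitor_natural'])
    simp [cmpMap] at law' ⊢
    exact law'

end ElementStructure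
end VariantData

end Elementwise
end TwistedBicat

namespace TwistedBicat

attribute [-simp] MonoidalCategory.tensorHom_id MonoidalCategory.id_tensorHom
  MonoidalCategory.associator_conjugation
attribute [-simp] Functor.LaxMonoidal.left_unitality Functor.LaxMonoidal.right_unitality
  Functor.OplaxMonoidal.left_unitality Functor.OplaxMonoidal.right_unitality
  Functor.OplaxMonoidal.left_unitality_hom Functor.OplaxMonoidal.right_unitality_hom
attribute [local simp] MonoidalCategory.id_tensorHom_id MonoidalCategory.tensorHom_comp_tensorHom
  MonoidalCategory.tensorHom_comp_tensorHom_assoc MonoidalCategory.associator_naturality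
  MonoidalCategory.associator_naturality_assoc

local infixr:81 " ◃ " => Bicategory.whiskerLeft
local infixl:81 " ▹ " => Bicategory.whiskerRight

open MonoidalTwoCategory


open Elem EnrichedData TwistingAction Functor.LaxMonoidal Functor.OplaxMonoidal

section

variable {W : Type u} [Bicategory.{w, v} W] [Bicategory.Strict W] [MonoidalTwoCategory W]
  {O : Type s}

lemma twistedAssoc_conj {M : Type*} [Category* M] [MonoidalCategory M] (F : M ⥤ M)
    [F.LaxMonoidal] {P Q R Y : M} (m : Y ⟶ F.obj R) (m₁ : Y ⟶ Y) (hm₁ : m₁ = 𝟙 Y) :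
    (ρ_ ((P ⊗ F.obj Q) ⊗ Y)).inv ≫
      (((𝟙 (P ⊗ F.obj Q) ⊗ₘ m₁) ≫ ((ρ_ (P ⊗ F.obj Q)).inv ⊗ₘ 𝟙 Y)) ⊗ₘ 𝟙 (𝟙_ M)) ≫
      ((((α_ (P ⊗ F.obj Q) (𝟙_ M) Y).hom ≫ (𝟙 (P ⊗ F.obj Q) ⊗ₘ
        ((λ_ Y).hom ≫ m ≫ (ρ_ (F.obj R)).inv)) ≫ (α_ (P ⊗ F.obj Q) (F.obj R) (𝟙_ M)).inv) ⊗ₘ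
          𝟙 (𝟙_ M)) ≫
        ((α_ _ _ _).hom ≫ (𝟙 _ ⊗ₘ (ε F ⊗ₘ 𝟙 (𝟙_ M))) ≫ (α_ _ _ _).inv) ≫
        (((((α_ _ _ _).hom ≫ (𝟙 P ⊗ₘ μ F Q R)) ⊗ₘ 𝟙 (F.obj (𝟙_ M))) ≫
          (α_ _ _ _).hom ≫ (𝟙 P ⊗ₘ μ F (Q ⊗ R) (𝟙_ M))) ⊗ₘ 𝟙 (𝟙_ M))) ≫
      (((𝟙 P ⊗ₘ F.map (ρ_ (Q ⊗ R)).hom) ≫ (𝟙 P ⊗ₘ 𝟙 (F.obj (Q ⊗ R)))) ⊗ₘ 𝟙 (𝟙_ M)) ≫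
      (ρ_ (P ⊗ F.obj (Q ⊗ R))).hom =
    (𝟙 (P ⊗ F.obj Q) ⊗ₘ m) ≫ (α_ P (F.obj Q) (F.obj R)).hom ≫ (𝟙 P ⊗ₘ μ F Q R) := by
  subst hm₁
  have key := right_unitality F (Q ⊗ R)
  have hx := MonoidalCategory.whisker_exchange ((α_ P (F.obj Q) (F.obj R)).hom ≫ P ◁ μ F Q R) (ε F)
  have e₁ : ∀ {X Y Z : M} (p : Y ⟶ Z), (𝟙 X ⊗ₘ (p ⊗ₘ 𝟙 (𝟙_ M))) ≫ (α_ _ _ _).inv =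
      (α_ X Y (𝟙_ M)).inv ≫ (X ◁ p) ▷ 𝟙_ M := by
    intros
    simp [MonoidalCategory.id_tensorHom, MonoidalCategory.tensorHom_id]
  simp only [CategoryTheory.Functor.map_id, MonoidalCategory.id_tensorHom_id, Category.id_comp,
    Category.comp_id, Category.assoc]
  rw [reassoc_of% e₁]
  simp only [MonoidalCategory.id_tensorHom, MonoidalCategory.tensorHom_id] at hx ⊢
  rw [← MonoidalCategory.comp_whiskerRight_assoc, ← MonoidalCategory.comp_whiskerRight_assoc,
    reassoc_of% hx]
  trans (P ⊗ F.obj Q) ◁ m ≫ (α_ _ _ _).hom ≫ P ◁ (μ F Q R ≫ (ρ_ _).inv ≫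
    F.obj (Q ⊗ R) ◁ ε F ≫ μ F (Q ⊗ R) (𝟙_ M) ≫ F.map (ρ_ (Q ⊗ R)).hom)
  · monoidal
  · rw [← key, Iso.inv_hom_id, Category.comp_id]

lemma leftUnitor_conj {M : Type*} [Category* M] [MonoidalCategory M] {X Y : M} (m : X ⟶ Y) :
    (ρ_ (𝟙_ M ⊗ X)).inv ≫ (((λ_ X).hom ≫ m ≫ (ρ_ Y).inv) ⊗ₘ 𝟙 (𝟙_ M)) ≫
      (α_ Y (𝟙_ M) (𝟙_ M)).hom ≫ (𝟙 Y ⊗ₘ (ρ_ (𝟙_ M)).hom) ≫ (ρ_ Y).hom = (λ_ X).hom ≫ m := by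
  simp only [MonoidalCategory.id_tensorHom, MonoidalCategory.tensorHom_id]
  monoidal

lemma rightUnitor_conj {M : Type*} [Category* M] [MonoidalCategory M] (X : M) {Y : M}
    (m : Y ⟶ 𝟙_ M) :
    (ρ_ (X ⊗ Y)).inv ≫ (α_ X Y (𝟙_ M)).hom ≫ (𝟙 X ⊗ₘ ((m ⊗ₘ 𝟙 (𝟙_ M)) ≫ (ρ_ (𝟙_ M)).hom)) ≫
      (ρ_ X).hom = (𝟙 X ⊗ₘ m) ≫ (ρ_ X).hom := by
  simp only [MonoidalCategory.id_tensorHom, MonoidalCategory.tensorHom_id]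
  monoidal

namespace EnrichedData

variable {A : EnrichedBicategory W O}

lemma elemAssoc_hom_base {w x y z : O} (a : Elem (A.hom w x)) (b : Elem (A.hom x y))
    (c : Elem (A.hom y z)) : (A.elemAssoc a b c).hom.base = (α_ c.src b.src a.src).hom := by
  simp [elemAssoc_hom]

lemma elemAssoc_inv_base {w x y z : O} (a : Elem (A.hom w x)) (b : Elem (A.hom x y))
    (c : Elem (A.hom y z)) : (A.elemAssoc a b c).inv.base = (α_ c.src b.src a.src).inv := by
  simp [elemAssoc_inv]

lemma elemRightUnitor_hom_base {x y : O} (a : Elem (A.hom x y)) :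
    (A.elemRightUnitor a).hom.base = (ρ_ a.src).hom := by
  simp [elemRightUnitor_hom]

lemma elemLeftUnitor_hom_base {x y : O} (a : Elem (A.hom x y)) :
    (A.elemLeftUnitor a).hom.base = (λ_ a.src).hom := by
  simp [elemLeftUnitor_hom]

end EnrichedData

namespace EnrichedBicategory

variable {A : EnrichedBicategory W O} {x y z t : A.Generalized}

/-- The domain of a generalized element. -/
def gsrc (f : x ⟶ y) : W := Elem.src (X := A.hom x y) f

/-- The 1-cell underlying a morphism of generalized elements. -/
def gbase {f g : x ⟶ y} (η : f ⟶ g) : gsrc f ⟶ gsrc g := Elem.Hom.base (X := A.hom x y) η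

lemma gbase_id (f : x ⟶ y) : gbase (𝟙 f) = 𝟙 (gsrc f) := rfl

lemma gbase_comp {f g h : x ⟶ y} (η : f ⟶ g) (θ : g ⟶ h) : gbase (η ≫ θ) = gbase η ≫ gbase θ := rfl

lemma gbase_whiskerLeft (f : x ⟶ y) {g h : y ⟶ z} (η : g ⟶ h) :
    gbase (f ◃ η) = (gbase η ⊗ₘ 𝟙 (gsrc f) : gsrc g ⊗ gsrc f ⟶ gsrc h ⊗ gsrc f) := rfl

lemma gbase_whiskerRight {f g : x ⟶ y} (η : f ⟶ g) (h : y ⟶ z) :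
    gbase (η ▹ h) = (𝟙 (gsrc h) ⊗ₘ gbase η : gsrc h ⊗ gsrc f ⟶ gsrc h ⊗ gsrc g) := rfl

lemma gbase_associator_hom (f : x ⟶ y) (g : y ⟶ z) (h : z ⟶ t) :
    gbase (Bicategory.associator f g h).hom = (α_ (gsrc h) (gsrc g) (gsrc f)).inv :=
  EnrichedData.elemAssoc_inv_base (A := A) f g h

lemma gbase_associator_inv (f : x ⟶ y) (g : y ⟶ z) (h : z ⟶ t) :
    gbase (Bicategory.associator f g h).inv = (α_ (gsrc h) (gsrc g) (gsrc f)).hom :=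
  EnrichedData.elemAssoc_hom_base (A := A) f g h

lemma gbase_leftUnitor_hom (f : x ⟶ y) :
    gbase (Bicategory.leftUnitor f).hom = (ρ_ (gsrc f)).hom :=
  EnrichedData.elemRightUnitor_hom_base (A := A) f

lemma gbase_leftUnitor_inv (f : x ⟶ y) :
    gbase (Bicategory.leftUnitor f).inv = (ρ_ (gsrc f)).inv := by
  have h := gbase_leftUnitor_hom f
  have h' : gbase (Bicategory.leftUnitor f).inv ≫ gbase (Bicategory.leftUnitor f).hom = 𝟙 _ := by
    rw [← gbase_comp, Iso.inv_hom_id, gbase_id]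
  rw [h] at h'
  exact (Iso.comp_hom_eq_id _).1 h'

end EnrichedBicategory

namespace EnrichedData

variable {A : EnrichedData W O}

lemma elemPre_base {x y z : O} (f : A.El x y) (a : Elem (A.hom y z)) :
    (elemPre f a).hom.base = (ρ_ a.src).inv := rfl

lemma elemPre_inv_base {x y z : O} (f : A.El x y) (a : Elem (A.hom y z)) :
    (elemPre f a).inv.base = (ρ_ a.src).hom := rfl

lemma elemGcompIso_base {x y y' z : O} {f : A.El x y} {g : A.El y z} {f' : A.El x y'}
    {g' : A.El y' z} (η : gcomp f g ≅ gcomp f' g') :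
    (elemGcompIso η).hom.base = 𝟙 (𝟙_ W ⊗ 𝟙_ W) := by
  simp [elemGcompIso_hom, elemGcomp_hom, elemGcomp_inv, pointIso_hom]

end EnrichedData
end

section

variable {W : Type u} [Bicategory.{w, v} W] [Bicategory.Strict W] [MonoidalTwoCategory W]
  {G : Type t} [Group G] [TwistingAction G W] {O : Type s} {A : EnrichedBicategory W O}
  (T : TwistedAction G A)

namespace TwistedAction

open EnrichedBicategory

section

variable {g h k a b c : G}

lemma elemNat_base (e : g * h = k) {F : FunctorData (A.base k) A.toEnrichedData}
    {F' : FunctorData (A.base g) A.toEnrichedData} {H : FunctorData (A.base h) A.toEnrichedData}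
    (ψ : TransData F (FunctorData.baseComp e F' H)) {x y : O} (f : Elem (A.hom x y)) :
    (ψ.elemNat e f).hom.base =
      (λ_ _).hom ≫ mulInv e f.src ≫ (ρ_ _).inv := by
  simp [TransData.elemNat_hom, TransData.elemNaturality_hom, FunctorData.elemBaseComp_hom,
    elemPost_inv, elemPre_hom, mulInv]

lemma elemOnEl_base (F : FunctorData (A.base g) A.toEnrichedData) {x y : O} (f : A.El x y) :
    (F.elemOnEl f).hom.base = ε (act g) := by
  rw [FunctorData.elemOnEl_hom]
  exact Category.id_comp _

lemma elemZeta_base (e₁ : g * h = a) (e₂ : h * k = b) (e₃ : a * k = c) (e₄ : g * b = c)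
    (x : O) : (T.elemZeta e₁ e₂ e₃ e₄ x).hom.base = ε (act k) ⊗ₘ 𝟙 (𝟙_ W) := by
  refine (congrArg₂ (· ≫ ·) (elemGcompIso_base (T.ζ e₁ e₂ e₃ e₄ x)) (congrArg (· ⊗ₘ 𝟙 (𝟙_ W))
    (elemOnEl_base (T.functor k) ((T.φ e₁).app x)))).trans ?_
  exact Category.id_comp _

lemma elemOnComp_base (F : FunctorData (A.base g) A.toEnrichedData) {x y z : O}
    (a : Elem (A.hom x y)) (b : Elem (A.hom y z)) :
    (F.elemOnComp a b).hom.base = μ (act g) b.src a.src := by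
  simp [FunctorData.elemOnComp_hom, FunctorData.elemMapComp_hom, elemActComp_hom]

lemma gbase_nu (e : g * h = k) {x y : A.Generalized} (f : x ⟶ y) :
    gbase (T.nu e f).hom =
      ((λ_ _).hom ≫ mulInv e (gsrc f) ≫ (ρ_ _).inv :
        𝟙_ W ⊗ (act k).obj (gsrc f) ⟶ (act h).obj ((act g).obj (gsrc f)) ⊗ 𝟙_ W) :=
  elemNat_base e (T.φ e) f

lemma gbase_zeta (e₁ : g * h = a) (e₂ : h * k = b) (e₃ : a * k = c) (e₄ : g * b = c)
    (x : A.Generalized) :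
    gbase (T.zeta e₁ e₂ e₃ e₄ x).hom = (ε (act k) ⊗ₘ 𝟙 (𝟙_ W) :
      𝟙_ W ⊗ 𝟙_ W ⟶ (act k).obj (𝟙_ W) ⊗ 𝟙_ W) :=
  T.elemZeta_base e₁ e₂ e₃ e₄ x

lemma gbase_mapComp_inv (g : G) {x y z : A.Generalized} (a : x ⟶ y) (b : y ⟶ z) :
    gbase ((T.pseudofunctor g).mapComp a b).inv = (μ (act g) (gsrc b) (gsrc a) :) :=
  elemOnComp_base (T.functor g) a b

end

section

variable {g h k : G} (e : g * h = k) {x y z x' y' z' : O}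

lemma elemPre_comp_natural {X : W} (p : X ⟶ A.hom x' y') (f : A.El x x')
    {b b' : Elem (A.hom y' z)} {a a' : Elem X} (n : b ⟶ b') (m : a ⟶ a') :
    pushMap ((𝟙 (A.hom y' z) ⊗ₘ p) ≫ A.comp x' y' z ≫ pre f z) (boxMap n m) ≫
        st _ (pushObj (pre f z) (pushObj (A.comp _ _ _) (box b' (pushObj p a')))) (𝟙 _) (by simp) ≫
        (elemPre f _).hom =
      (st (pushObj ((𝟙 (A.hom y' z) ⊗ₘ p) ≫ A.comp x' y' z ≫ pre f z) (box b a))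
        (pushObj (pre f z) (pushObj (A.comp _ _ _) (box b (pushObj p a)))) (𝟙 _) (by simp) ≫
        (elemPre f _).hom) ≫ pushMap (A.comp _ _ _) (boxMap
          (pushMap (A.comp _ _ _) (boxMap (𝟙 b) (pushMap p m)) ≫
            pushMap (A.comp _ _ _) (boxMap n (𝟙 (pushObj p a')))) (𝟙 (point f))) := by
  have h : pushMap (A.comp x' y' z) (boxMap (𝟙 b) (pushMap p m)) ≫
      pushMap (A.comp x' y' z) (boxMap n (𝟙 (pushObj p a'))) =
      pushMap (A.comp x' y' z) (boxMap n (pushMap p m)) := by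
    rw [← pushMap_comp, ← boxMap_comp, Category.id_comp, Category.comp_id]
  rw [h]
  refine Eq.trans ?_ ((congrArg (_ ≫ ·) (elemPre_natural f _)).trans (Category.assoc _ _ _).symm)
  refine Eq.trans ?_ (Category.assoc _ _ _)
  refine (Category.assoc _ _ _).symm.trans (congrArg (· ≫ (elemPre f _).hom) ?_)
  simp

end

/-- The composition of the variant structure, on generalized elements. -/
def elemCmp {g h k : G} (e : g * h = k) {x y z : O} (b : Elem (A.hom ((T.functor h).obj y) z))
    (a : Elem (A.hom ((T.functor g).obj x) y)) :
    T.toVariantData.cmp e b a ≅ pushObj (A.comp _ _ _) (box (pushObj (A.comp _ _ _)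
      (box b (pushObj ((T.functor h).map _ _) (actObj h a)))) (point ((T.φ e).app x))) :=
  stIso (pushObj ((𝟙 (A.hom ((T.functor h).obj y) z) ⊗ₘ (T.functor h).map _ _) ≫
      A.comp _ _ _ ≫ pre ((T.φ e).app x) z) (box b (actObj h a)))
    (pushObj (pre ((T.φ e).app x) z) (pushObj (A.comp _ _ _)
      (box b (pushObj ((T.functor h).map _ _) (actObj h a))))) (Iso.refl _)
    (by simp) ≪≫ elemPre ((T.φ e).app x) _

lemma elemCmp_base {g h k : G} (e : g * h = k) {x y z : O}
    (b : Elem (A.hom ((T.functor h).obj y) z)) (a : Elem (A.hom ((T.functor g).obj x) y)) :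
    (T.elemCmp e b a).hom.base = (ρ_ (b.src ⊗ (act h).obj a.src)).inv :=
  Category.id_comp _

lemma elemCmp_inv_base {g h k : G} (e : g * h = k) {x y z : O}
    (b : Elem (A.hom ((T.functor h).obj y) z)) (a : Elem (A.hom ((T.functor g).obj x) y)) :
    (T.elemCmp e b a).inv.base = (ρ_ (b.src ⊗ (act h).obj a.src)).hom :=
  Category.comp_id _

lemma elemCmp_natural {g h k : G} (e : g * h = k) {x y z : O}
    {b b' : Elem (A.hom ((T.functor h).obj y) z)} {a a' : Elem (A.hom ((T.functor g).obj x) y)}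
    (n : b ⟶ b') (m : a ⟶ a') :
    pushMap (T.toVariantData.comp e x y z) (boxMap n (actMap h m)) ≫ (T.elemCmp e b' a').hom =
      (T.elemCmp e b a).hom ≫ pushMap (A.comp _ _ _) (boxMap
        (pushMap (A.comp _ _ _) (boxMap (𝟙 b) (pushMap ((T.functor h).map _ _) (actMap h m))) ≫
          pushMap (A.comp _ _ _) (boxMap n (𝟙 (pushObj ((T.functor h).map _ _) (actObj h a')))))
        (𝟙 (point ((T.φ e).app x)))) :=
  elemPre_comp_natural _ _ n (actMap h m)

section

variable {g h k a b c : G} (e₁ : g * h = a) (e₂ : h * k = b) (e₃ : a * k = c) (e₄ : g * b = c)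
  {w x y z : O}

lemma gbase_rep {x y y' z t : A.Generalized} {f : x ⟶ y} {g : y ⟶ z} {f' : x ⟶ y'} {g' : y' ⟶ z}
    (η : f ≫ g ⟶ f' ≫ g') (h : z ⟶ t) :
    gbase (rep η h) = ((α_ (gsrc h) (gsrc g) (gsrc f)).hom ≫ (𝟙 (gsrc h) ⊗ₘ gbase η) ≫
      (α_ (gsrc h) (gsrc g') (gsrc f')).inv :) :=
  congrArg₂ (· ≫ ·) (gbase_associator_inv f g h)
    (congrArg ((𝟙 (gsrc h) ⊗ₘ gbase η) ≫ ·) (gbase_associator_hom f' g' h))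

lemma gbase_del {x y t : A.Generalized} {f : x ⟶ y} {g : y ⟶ x} (θ : f ≫ g ⟶ 𝟙 x) (h : x ⟶ t) :
    gbase (del θ h) = ((α_ (gsrc h) (gsrc g) (gsrc f)).hom ≫ (𝟙 (gsrc h) ⊗ₘ gbase θ) ≫
      (ρ_ (gsrc h)).hom :) :=
  congrArg₂ (· ≫ ·) (gbase_associator_inv f g h)
    (congrArg ((𝟙 (gsrc h) ⊗ₘ gbase θ) ≫ ·) (gbase_leftUnitor_hom h))

lemma gbase_merge (k : G) {x y z t : A.Generalized} (f : x ⟶ y) (g : y ⟶ z)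
    (h : (T.pseudofunctor k).obj z ⟶ t) :
    gbase (merge (T.pseudofunctor k) f g h) =
      ((α_ (gsrc h) ((act k).obj (gsrc g)) ((act k).obj (gsrc f))).hom ≫
        (𝟙 (gsrc h) ⊗ₘ μ (act k) (gsrc g) (gsrc f)) :) :=
  congrArg₂ (· ≫ ·) (gbase_associator_inv _ _ h)
    (congrArg (𝟙 (gsrc h) ⊗ₘ ·) (T.gbase_mapComp_inv k f g))

end

/-- The composition of twisted 1-cells given by the variant structure. -/
def composition : T.weakAction.Composition where
  comp e _ _ _ b a := T.toVariantData.cmp e b a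
  iso e _ _ _ b a := T.elemCmp e b a

lemma cmpMap_eq {g h k : G} (e : g * h = k) {x y z : O}
    {b b' : Elem (A.hom ((T.functor h).obj y) z)} {a a' : Elem (A.hom ((T.functor g).obj x) y)}
    (n : b ⟶ b') (m : a ⟶ a') :
    T.toVariantData.cmpMap e n m = T.composition.map e (x := x) (y := y) (z := z) n m :=
  ((T.elemCmp e b' a').eq_comp_inv.2 (T.elemCmp_natural e n m)).trans (Category.assoc _ _ _)

lemma cmpMap_cmpMap_left {h k b g c : G} (e₂ : h * k = b) (e₄ : g * b = c) {w x y z : O}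
    {r r' : Elem (A.hom ((T.functor k).obj y) z)} (o : r ⟶ r')
    {q q' : Elem (A.hom ((T.functor h).obj x) y)} (n : q ⟶ q')
    {p p' : Elem (A.hom ((T.functor g).obj w) x)} (m : p ⟶ p') :
    T.toVariantData.cmpMap e₄ (T.toVariantData.cmpMap e₂ o n) m =
      T.composition.map e₄ (x := w) (y := x) (z := z)
        (T.composition.map e₂ (x := x) (y := y) (z := z) o n) m :=
  (T.cmpMap_eq e₄ _ m).trans
    (congrArg (fun q => T.composition.map e₄ (x := w) (y := x) (z := z) q m) (T.cmpMap_eq e₂ o n))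

lemma cmpMap_cmpMap_right {g h a k c : G} (e₁ : g * h = a) (e₃ : a * k = c) {w x y z : O}
    {r r' : Elem (A.hom ((T.functor k).obj y) z)} (o : r ⟶ r')
    {q q' : Elem (A.hom ((T.functor h).obj x) y)} (n : q ⟶ q')
    {p p' : Elem (A.hom ((T.functor g).obj w) x)} (m : p ⟶ p') :
    T.toVariantData.cmpMap e₃ o (T.toVariantData.cmpMap e₁ n m) =
      T.composition.map e₃ (x := w) (y := y) (z := z) o
        (T.composition.map e₁ (x := w) (y := x) (z := y) n m) :=
  (T.cmpMap_eq e₃ o _).trans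
    (congrArg (fun q => T.composition.map e₃ (x := w) (y := y) (z := z) o q) (T.cmpMap_eq e₁ n m))

lemma composition_assoc_base {g h k a b c : G} (e₁ : g * h = a) (e₂ : h * k = b)
    (e₃ : a * k = c) (e₄ : g * b = c) {w x y z : A.Generalized}
    (f : (T.weakAction.functor g).obj w ⟶ x) (f' : (T.weakAction.functor h).obj x ⟶ y)
    (f'' : (T.weakAction.functor k).obj y ⟶ z) :
    gbase (T.composition.assoc e₁ e₂ e₃ e₄ f f' f'').hom =
      twistedAssoc e₂ (gsrc f'') (gsrc f') (gsrc f) := by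
  refine Eq.trans ?_ (twistedAssoc_conj (act k) (P := (gsrc f'')) (Q := (gsrc f')) (mulInv e₂ (gsrc f))
    ((act b).map (𝟙 (gsrc f))) (CategoryTheory.Functor.map_id _ _))
  refine (congrArg gbase (T.composition.assoc_hom e₁ e₂ e₃ e₄ f f' f'')).trans ?_
  refine congrArg₂ (· ≫ ·) (T.elemCmp_base e₄ _ _) (congrArg₂ (· ≫ ·) ?_ (congrArg₂ (· ≫ ·) ?_
    (congrArg₂ (· ≫ ·) ?_ (T.elemCmp_inv_base e₃ _ _))))
  · exact congrArg (fun q => ((𝟙 (gsrc f'' ⊗ (act k).obj (gsrc f')) ⊗ₘ (act b).map (𝟙 (gsrc f))) ≫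
      (q ⊗ₘ 𝟙 ((act b).obj (gsrc f)))) ⊗ₘ 𝟙 (𝟙_ W)) (T.elemCmp_base e₂ f'' f')
  · refine congrArg₂ (· ≫ ·) (congrArg (· ⊗ₘ 𝟙 (𝟙_ W)) ((gbase_rep _ _).trans ?_))
      (congrArg₂ (· ≫ ·) ((gbase_rep _ _).trans ?_)
        (congrArg (· ⊗ₘ 𝟙 (𝟙_ W)) (congrArg₂ (· ≫ ·) (congrArg (· ⊗ₘ 𝟙 ((act k).obj (𝟙_ W)))
          (T.gbase_merge k _ _ _)) (T.gbase_merge k _ _ _))))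
    · exact congrArg (fun q => (α_ _ _ _).hom ≫ (𝟙 (gsrc f'' ⊗ (act k).obj (gsrc f')) ⊗ₘ q) ≫
        (α_ _ _ _).inv) (T.gbase_nu e₂ _)
    · exact congrArg (fun q => (α_ _ _ _).hom ≫ (𝟙 _ ⊗ₘ q) ≫ (α_ _ _ _).inv)
        (T.gbase_zeta e₁ e₂ e₃ e₄ w)
  · exact congrArg (fun q => ((𝟙 (gsrc f'') ⊗ₘ (act k).map q) ≫ (𝟙 (gsrc f'') ⊗ₘ 𝟙 _)) ⊗ₘ 𝟙 (𝟙_ W))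
      (T.elemCmp_inv_base e₁ f' f)

lemma elemNuOne_base {F₁ : FunctorData (A.base (1 : G)) A.toEnrichedData}
    (h₁ : F₁ = FunctorData.baseOne G A.toEnrichedData) {x y : O} (a : Elem (A.hom x y)) :
    (elemNuOne h₁ a).hom.base =
      (λ_ _).hom ≫ (oneIso (G := G)).hom.app a.src ≫ (ρ_ a.src).inv := by
  subst h₁
  refine congrArg₂ (· ≫ ·) (elemLeftUnitor_hom_base _) (congrArg (_ ≫ ·) ?_)
  exact gbase_leftUnitor_inv (A := A) a

lemma elemZetaL_base {F₁ : FunctorData (A.base (1 : G)) A.toEnrichedData}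
    (h₁ : F₁ = FunctorData.baseOne G A.toEnrichedData) {g : G}
    {F : FunctorData (A.base g) A.toEnrichedData}
    {φ : TransData F (FunctorData.baseComp (mul_one g) F F₁)}
    (hφ : HEq φ (TransData.rightUnit F)) (x : O) :
    (elemZetaL h₁ hφ x).hom.base = (ρ_ (𝟙_ W)).hom := by
  subst h₁
  obtain rfl := eq_of_heq hφ
  exact elemRightUnitor_hom_base _

lemma elemZetaR_base {F₁ : FunctorData (A.base (1 : G)) A.toEnrichedData}
    (h₁ : F₁ = FunctorData.baseOne G A.toEnrichedData) {h : G}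
    {F : FunctorData (A.base h) A.toEnrichedData}
    {φ : TransData F (FunctorData.baseComp (one_mul h) F₁ F)}
    (hφ : HEq φ (TransData.leftUnit F)) (x : O) :
    (elemZetaR h₁ hφ x).hom.base = (η (act h) ⊗ₘ 𝟙 (𝟙_ W)) ≫ (ρ_ (𝟙_ W)).hom := by
  subst h₁
  obtain rfl := eq_of_heq hφ
  refine congrArg₂ (· ≫ ·) (congrArg (· ⊗ₘ 𝟙 (𝟙_ W)) ?_) (elemRightUnitor_hom_base _)
  simp [FunctorData.elemOnId_hom, FunctorData.elemMapId_hom, elemActId_inv]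

lemma composition_leftUnitor_base {g : G} {x y : A.Generalized}
    (a : (T.weakAction.functor g).obj x ⟶ y) :
    gbase (T.composition.leftUnitor a).hom =
      (λ_ _).hom ≫ (oneIso (G := G)).hom.app (gsrc a) := by
  refine Eq.trans ?_ (leftUnitor_conj ((oneIso (G := G)).hom.app (gsrc a)))
  refine congrArg₂ (· ≫ ·) (T.elemCmp_base (mul_one g) _ _) (congrArg₂ (· ≫ ·)
    (congrArg (· ⊗ₘ 𝟙 (𝟙_ W)) (elemNuOne_base T.functor_one _))
    ((gbase_del _ _).trans ?_))
  exact congrArg (fun q => (α_ _ _ _).hom ≫ (𝟙 (gsrc a) ⊗ₘ q) ≫ (ρ_ _).hom)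
    (elemZetaL_base T.functor_one (T.φ_one_right g) x)

lemma composition_rightUnitor_base {h : G} {x y : A.Generalized}
    (a : (T.weakAction.functor h).obj x ⟶ y) :
    gbase (T.composition.rightUnitor a).hom =
      ((𝟙 (gsrc a) ⊗ₘ η (act h)) ≫ (ρ_ (gsrc a)).hom :) := by
  refine Eq.trans ?_ (rightUnitor_conj (gsrc a) (η (act h)))
  refine congrArg₂ (· ≫ ·) (T.elemCmp_base (one_mul h) _ _) ((gbase_del _ _).trans ?_)
  exact congrArg (fun q => (α_ _ _ _).hom ≫ (𝟙 (gsrc a) ⊗ₘ q) ≫ (ρ_ _).hom)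
    (elemZetaR_base T.functor_one (T.φ_one_left h) x)

section

variable {g h k a b c : G} (e₁ : g * h = a) (e₂ : h * k = b) (e₃ : a * k = c) (e₄ : g * b = c)
  {w x y z : O}

/-- The associativity constraint of the variant structure, on generalized elements. -/
abbrev cmpAssoc (p : Elem (A.hom ((T.functor g).obj w) x)) (q : Elem (A.hom ((T.functor h).obj x) y))
    (r : Elem (A.hom ((T.functor k).obj y) z)) :
    T.toVariantData.cmp e₄ (T.toVariantData.cmp e₂ r q) p ≅
      T.toVariantData.cmp e₃ r (T.toVariantData.cmp e₁ q p) :=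
  T.composition.assoc e₁ e₂ e₃ e₄ (w := w) (x := x) (y := y) (z := z) p q r

/-- The left unitality constraint of the variant structure, on generalized elements. -/
abbrev cmpLeftUnitor (a : Elem (A.hom ((T.functor g).obj x) y)) :
    T.toVariantData.cmp (mul_one g) (point (T.toVariantData.id y)) a ≅ a :=
  T.composition.leftUnitor (x := x) (y := y) a

/-- The right unitality constraint of the variant structure, on generalized elements. -/
abbrev cmpRightUnitor (a : Elem (A.hom ((T.functor g).obj x) y)) :
    T.toVariantData.cmp (one_mul g) a (point (T.toVariantData.id x)) ≅ a :=
  T.composition.rightUnitor (y := x) (z := y) a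

end

/-- The coherence of the variant structure determined by a twisted action. -/
def elementStructure : T.toVariantData.ElementStructure where
  assoc {_ _ _ _ _ _} e₁ e₂ e₃ e₄ {w x y z} p q r :=
    T.cmpAssoc e₁ e₂ e₃ e₄ p q r
  assoc_base {_ _ _ _ _ _} e₁ e₂ e₃ e₄ {w x y z} p q r :=
    T.composition_assoc_base e₁ e₂ e₃ e₄ (w := w) (x := x) (y := y) (z := z) p q r
  assoc_natural {_ _ _ _ _ _} e₁ e₂ e₃ e₄ {w x y z p p'} m {q q'} n {r r'} o :=
    (congrArg (· ≫ (T.cmpAssoc e₁ e₂ e₃ e₄ p' q' r').hom) (T.cmpMap_cmpMap_left e₂ e₄ o n m)).trans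
    ((T.composition.assoc_natural e₁ e₂ e₃ e₄ (w := w) (x := x) (y := y) (z := z) m n o).trans
    (congrArg ((T.cmpAssoc e₁ e₂ e₃ e₄ p q r).hom ≫ ·) (T.cmpMap_cmpMap_right e₁ e₃ o n m)).symm)
  leftUnitor {g x y} a := T.cmpLeftUnitor a
  leftUnitor_base {g x y} a := T.composition_leftUnitor_base (x := x) (y := y) a
  leftUnitor_natural {g x y a a'} m :=
    (congrArg (· ≫ (T.cmpLeftUnitor a').hom)
      (T.cmpMap_eq (mul_one g) (𝟙 _) m)).trans
    (T.composition.leftUnitor_natural (x := x) (y := y) m)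
  rightUnitor {g x y} a := T.cmpRightUnitor a
  rightUnitor_base {g x y} a := T.composition_rightUnitor_base (x := x) (y := y) a
  rightUnitor_natural {g x y a a'} m :=
    (congrArg (· ≫ (T.cmpRightUnitor a').hom)
      (T.cmpMap_eq (one_mul g) m (𝟙 _))).trans
    (T.composition.rightUnitor_natural (y := x) (z := y) m)
  pentagon {_ _ _ _ _ _ _ _ _ _} e₁ e₂ e₃ e₄ e₅ e₆ e₇ e₈ e₉ e₁₀ {v w x y z} a b c d :=
    (T.composition.pentagon e₁ e₂ e₃ e₄ e₅ e₆ e₇ e₈ e₉ e₁₀ (v := v) (w := w) (x := x) (y := y)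
      (z := z) a b c d).trans
    (congrArg₂ (· ≫ ·) (T.cmpMap_eq e₁₀ _ (𝟙 a)) (congrArg (_ ≫ ·)
      (T.cmpMap_eq e₈ (𝟙 d) _))).symm
  triangle {_ _ _} e {x y z} a b :=
    (congrArg (_ ≫ ·) (T.cmpMap_eq e (𝟙 b) _)).trans
    ((T.composition.triangle e (x := x) (y := y) (z := z) a b).trans
    (T.cmpMap_eq e _ (𝟙 a)).symm)

lemma exists_variantBicategory :
    ∃ P : VariantBicategory G W O, P.toVariantData = T.toVariantData :=
  T.elementStructure.exists_variantBicategory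

end TwistedAction
end
end TwistedBicat

namespace TwistedBicat

attribute [-simp] MonoidalCategory.tensorHom_id MonoidalCategory.id_tensorHom
  MonoidalCategory.associator_conjugation
attribute [-simp] Functor.LaxMonoidal.left_unitality Functor.LaxMonoidal.right_unitality
  Functor.OplaxMonoidal.left_unitality Functor.OplaxMonoidal.right_unitality
  Functor.OplaxMonoidal.left_unitality_hom Functor.OplaxMonoidal.right_unitality_hom
attribute [local simp] MonoidalCategory.id_tensorHom_id MonoidalCategory.tensorHom_comp_tensorHom
  MonoidalCategory.tensorHom_comp_tensorHom_assoc MonoidalCategory.associator_naturality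
  MonoidalCategory.associator_naturality_assoc

local infixr:81 " ◃ " => Bicategory.whiskerLeft
local infixl:81 " ▹ " => Bicategory.whiskerRight

open MonoidalTwoCategory


open Elem EnrichedData TwistingAction Functor.LaxMonoidal Functor.OplaxMonoidal

lemma exists_equivalence_hom_eq {B : Type u₁} [Bicategory.{w₁, v₁} B] {a b : B} {f f₀ : a ⟶ b}
    {g : b ⟶ a} (i : f₀ ≅ f) (η : 𝟙 a ≅ f ≫ g) (θ : g ≫ f ≅ 𝟙 b) :
    ∃ E : Bicategory.Equivalence a b, E.hom = f₀ :=
  ⟨Bicategory.Equivalence.mkOfAdjointifyCounit (f := f₀) (g := g)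
    (η ≪≫ Bicategory.whiskerRightIso i.symm g) (Bicategory.whiskerLeftIso g i ≪≫ θ), rfl⟩

section

variable {W : Type u} [Bicategory.{w, v} W] [Bicategory.Strict W] [MonoidalTwoCategory W]
  {G : Type t} [Group G] [TwistingAction G W] {O : Type s} {A : EnrichedBicategory W O}
  (T : TwistedAction G A)

namespace TwistedAction

lemma precomp_id_eq {g h k : G} (e : g * h = k) (x y : O) :
    T.toVariantData.precomp e (x' := (T.functor g).obj x) (A.id ((T.functor g).obj x)) y =
      pre ((T.functor h).onEl (A.id ((T.functor g).obj x))) y ≫ pre ((T.φ e).app x) y := by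
  change (ρ_ (A.hom _ y)).inv ≫ (𝟙 (A.hom _ y) ⊗ₘ (ε (act h) ≫ (act h).map (A.id _))) ≫
    (𝟙 (A.hom _ y) ⊗ₘ (T.functor h).map _ _) ≫ A.comp _ _ y ≫ pre ((T.φ e).app x) y = _
  conv_rhs => rw [pre]
  simp only [FunctorData.onEl, FunctorData.mapEl, baseEl, Category.assoc,
    MonoidalCategory.tensorHom_comp_tensorHom_assoc, Category.id_comp]

/-- `ᵍx`, with its identity, is a copower of `x` by the twisted unit `𝟙[g]`. -/
lemma isTwistedCopower (g : G) (x : O) :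
    T.toVariantData.IsTwistedCopower g x ((T.functor g).obj x) (A.id ((T.functor g).obj x)) := by
  intro h k e y
  obtain ⟨f, η, θ, -⟩ := T.φ_equivalence e x
  rw [precomp_id_eq]
  let i : (T.functor h).onEl (A.id ((T.functor g).obj x)) ≅ A.id _ :=
    (T.functor h).mapId ((T.functor g).obj x)
  exact exists_equivalence_hom_eq (f := pre ((T.φ e).app x) y) (g := pre f y)
    (Bicategory.whiskerRightIso (preIso₂ i y ≪≫ preId _ y) _ ≪≫ eqToIso (Category.id_comp _))
    ((preId _ y).symm ≪≫ preIso₂ θ.symm y ≪≫ preGcomp f ((T.φ e).app x) y)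
    ((preGcomp _ f y).symm ≪≫ preIso₂ η.symm y ≪≫ preId _ y)

lemma hasTwistedCopowers : T.toVariantData.HasTwistedCopowers :=
  fun g x => ⟨_, _, T.isTwistedCopower g x⟩

end TwistedAction
end
end TwistedBicat

namespace TwistedBicat

local infixr:81 " ◃ " => Bicategory.whiskerLeft
local infixl:81 " ▹ " => Bicategory.whiskerRight
local infixr:80 " ⊚ " => bicategoricalComp
local notation "𝒶" => Bicategory.associator
local notation "𝓁" => Bicategory.leftUnitor
local notation "𝓇" => Bicategory.rightUnitor

section

variable {B : Type u₁} [Bicategory.{w₁, v₁} B] {C : Type u} [Bicategory.{w, v} C]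
  (F : Pseudofunctor B C)

lemma map₂_leftUnitor_inv {x y : B} (f : x ⟶ y) : F.map₂ (𝓁 f).inv =
    (𝓁 (F.map f)).inv ≫ (F.mapId x).inv ▹ F.map f ≫ (F.mapComp (𝟙 x) f).inv := by
  rw [← cancel_epi (F.map₂ (𝓁 f).hom), ← PrelaxFunctor.map₂_comp, Iso.hom_inv_id,
    PrelaxFunctor.map₂_id, F.map₂_left_unitor]
  simp

lemma map₂_rightUnitor_inv {x y : B} (f : x ⟶ y) : F.map₂ (𝓇 f).inv =
    (𝓇 (F.map f)).inv ≫ F.map f ◃ (F.mapId y).inv ≫ (F.mapComp f (𝟙 y)).inv := by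
  rw [← cancel_epi (F.map₂ (𝓇 f).hom), ← PrelaxFunctor.map₂_comp, Iso.hom_inv_id,
    PrelaxFunctor.map₂_id, F.map₂_right_unitor]
  simp

/-- The naturality constraint of an identity transformation. -/
abbrev unitNat {x y : C} (f : x ⟶ y) : f ≫ 𝟙 y ≅ 𝟙 x ≫ f := 𝓇 f ≪≫ (𝓁 f).symm

lemma mapSq_unitNat {x y : B} (f : x ⟶ y) : mapSq F (unitNat f).hom =
    F.map f ◃ (F.mapId y).hom ≫ (unitNat (F.map f)).hom ≫ (F.mapId x).inv ▹ F.map f := by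
  simp [mapSq, map₂_leftUnitor_inv, F.map₂_right_unitor]

lemma unitNat_natural {x y : C} {f f' : x ⟶ y} (η : f ⟶ f') :
    η ▹ 𝟙 y ≫ (unitNat f').hom = (unitNat f).hom ≫ 𝟙 x ◃ η := by
  simp

lemma unitNat_comp {x y z : C} {f : x ⟶ y} {f' : y ⟶ z} {p : x ⟶ z} {m m' : f ≫ f' ⟶ p}
    (h : m' = m) : m ▹ 𝟙 z ≫ (unitNat p).hom =
      (𝒶 _ _ _).hom ≫ f ◃ (unitNat f').hom ≫ (𝒶 _ _ _).inv ≫ (unitNat f).hom ▹ f' ≫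
        (𝒶 _ _ _).hom ≫ 𝟙 x ◃ m' := by
  subst h
  simp

lemma modification_unit {x y x' y' : C} {f : x ⟶ y} {p : y ⟶ y'} {p' : x ⟶ x'} {k : x' ⟶ y'}
    (n : f ≫ p ≅ p' ≫ k) :
    f ◃ (unitNat p).hom ≫ (𝒶 _ _ _).inv ≫ (unitNat f).hom ▹ p ≫ (𝒶 _ _ _).hom ≫
        𝟙 x ◃ (𝟙 _ ≫ n.hom ≫ 𝟙 _) ≫ (𝒶 _ _ _).inv =
      (𝒶 _ _ _).inv ≫ n.hom ▹ 𝟙 y' ≫ (𝒶 _ _ _).hom ≫ p' ◃ (unitNat k).hom ≫ (𝒶 _ _ _).inv ≫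
        (unitNat p').hom ▹ k := by
  simp only [Category.id_comp, Category.comp_id]
  simp

lemma whiskerLeft_exchange {x y x' y' z : C} {f : x ⟶ y} {p : y ⟶ y'} {p' : x ⟶ x'}
    {k : x' ⟶ y'} (n : f ≫ p ⟶ p' ≫ k) {g g' : y' ⟶ z} (m : g ⟶ g') :
    f ◃ p ◃ m ≫ (𝒶 _ _ _).inv ≫ n ▹ g' =
      (𝒶 _ _ _).inv ≫ n ▹ g ≫ (𝒶 _ _ _).hom ≫ p' ◃ k ◃ m ≫ (𝒶 _ _ _).inv := by
  have h := Bicategory.whisker_exchange n m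
  simp only [Bicategory.comp_whiskerLeft, Category.assoc] at h
  rw [← cancel_epi (𝒶 f p g).hom, h]
  simp

lemma whiskerLeft_whiskerLeft_inv_hom {x y z t : C} (f : x ⟶ y) (g : y ⟶ z) {h k : z ⟶ t}
    (i : h ≅ k) {l : x ⟶ t} (r : f ≫ g ≫ k ⟶ l) : f ◃ g ◃ i.inv ≫ f ◃ g ◃ i.hom ≫ r = r := by
  rw [← Category.assoc, ← Bicategory.whiskerLeft_comp, ← Bicategory.whiskerLeft_comp,
    Iso.inv_hom_id]
  simp

lemma modification_mapId {x y : C} {x' y' : B} {f : x ⟶ y} {p : y ⟶ F.obj y'}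
    {p' : x ⟶ F.obj x'} {q : x' ⟶ y'} (n : f ≫ p ≅ p' ≫ F.map q) :
    f ◃ (Bicategory.whiskerLeftIso p (F.mapId y').symm).hom ≫ (𝒶 _ _ _).inv ≫
        n.hom ▹ F.map (𝟙 y') ≫ (𝒶 _ _ _).hom ≫ p' ◃ mapSq F (unitNat q).hom ≫
        (𝒶 _ _ _).inv =
      (𝒶 _ _ _).inv ≫ n.hom ▹ 𝟙 _ ≫ (𝒶 _ _ _).hom ≫ p' ◃ (unitNat (F.map q)).hom ≫
        (𝒶 _ _ _).inv ≫ (Bicategory.whiskerLeftIso p' (F.mapId x').symm).hom ▹ F.map q := by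
  rw [mapSq_unitNat]
  have h := whiskerLeft_exchange n.hom (F.mapId y').inv
  simp only [Bicategory.whiskerLeftIso_hom, Iso.symm_hom, Iso.trans_hom, Bicategory.whiskerLeft_comp,
    Category.assoc]
  rw [reassoc_of% h]
  simp only [Iso.inv_hom_id_assoc, whiskerLeft_whiskerLeft_inv_hom]
  bicategory

/-- The comparison of `p` with `p` whiskered by the image of an identity. -/
abbrev unitMap {x : C} {y : B} (p : x ⟶ F.obj y) : 𝟙 x ≫ p ≅ p ≫ F.map (𝟙 y) :=
  𝓁 p ≪≫ (𝓇 p).symm ≪≫ Bicategory.whiskerLeftIso p (F.mapId y).symm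

lemma modification_unitMap {x y : C} {x' y' : B} {f : x ⟶ y} {p : y ⟶ F.obj y'}
    {p' : x ⟶ F.obj x'} {q : x' ⟶ y'} (n : f ≫ p ≅ p' ≫ F.map q) :
    f ◃ (unitMap F p).hom ≫ (𝒶 _ _ _).inv ≫ n.hom ▹ F.map (𝟙 y') ≫ (𝒶 _ _ _).hom ≫
        p' ◃ mapSq F (unitNat q).hom ≫ (𝒶 _ _ _).inv =
      (𝒶 _ _ _).inv ≫ (unitNat f).hom ▹ p ≫ (𝒶 _ _ _).hom ≫ 𝟙 x ◃ n.hom ≫ (𝒶 _ _ _).inv ≫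
        (unitMap F p').hom ▹ F.map q := by
  rw [mapSq_unitNat]
  have h := whiskerLeft_exchange n.hom (F.mapId y').inv
  simp only [Bicategory.whiskerLeftIso_hom, Iso.symm_hom, Iso.trans_hom, Bicategory.whiskerLeft_comp,
    Category.assoc]
  rw [reassoc_of% h]
  simp only [Iso.inv_hom_id_assoc, whiskerLeft_whiskerLeft_inv_hom]
  bicategory

lemma unit_modification_natural {x y : B} (a : x ⟶ y) :
    F.map a ◃ (𝓁 (F.map (𝟙 y)) ≪≫ F.mapId y).hom ≫ (𝓇 _).hom =
      (𝒶 _ _ _).inv ≫ (unitNat (F.map a)).hom ▹ F.map (𝟙 y) ≫ (𝒶 _ _ _).hom ≫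
        𝟙 _ ◃ mapSq F (unitNat a).hom ≫ (𝒶 _ _ _).inv ≫
        (𝓁 (F.map (𝟙 x)) ≪≫ F.mapId x).hom ▹ F.map a ≫ (𝓁 _).hom := by
  rw [mapSq_unitNat]
  simp
  bicategory

lemma whiskerLeft_unit_id (x : C) :
    𝟙 x ◃ (𝓁 (𝟙 x) ≪≫ Iso.refl (𝟙 x)).hom =
      (𝒶 _ _ _).inv ≫ (unitNat (𝟙 x)).hom ▹ 𝟙 x ≫ (𝒶 _ _ _).hom ≫
        𝟙 x ◃ (𝟙 _ ≫ (𝓁 (𝟙 x)).hom ≫ 𝟙 _) := by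
  simp only [Category.id_comp, Category.comp_id]
  simp [Bicategory.unitors_equal]

lemma whiskerLeft_unit_map {x : C} {y : B} (p : x ⟶ F.obj y) :
    p ◃ (𝓁 (F.map (𝟙 y)) ≪≫ F.mapId y).hom =
      (𝒶 _ _ _).inv ≫ (Bicategory.whiskerLeftIso p (F.mapId y).symm).hom ▹ F.map (𝟙 y) ≫
        (𝒶 _ _ _).hom ≫ p ◃ mapUnit F (𝓁 (𝟙 y)).hom := by
  have h := Bicategory.whisker_exchange (F.mapId y).inv (F.mapId y).hom
  have h' : mapUnit F (𝓁 (𝟙 y)).hom = F.map (𝟙 y) ◃ (F.mapId y).hom ≫ (𝓇 _).hom ≫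
      (F.mapId y).hom := by
    rw [Bicategory.unitors_equal]
    simp [mapUnit, F.map₂_right_unitor]
  calc
    _ = 𝟙 _ ⊚ p ◃ (𝟙 _ ◃ (F.mapId y).hom ≫ (F.mapId y).inv ▹ 𝟙 _) ⊚ p ◃ (F.mapId y).hom := by
      simp
      bicategory
    _ = _ := by
      rw [h, h']
      simp only [Bicategory.whiskerLeftIso_hom, Iso.symm_hom]
      bicategory

lemma simplex_unit {x y y' z : C} {a : x ⟶ y} {b : y ⟶ z} {c : x ⟶ y'} {d : y' ⟶ z}
    (ζ : a ≫ b ≅ c ≫ d) :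
    ζ.hom ▹ 𝟙 z ≫ (𝒶 _ _ _).hom ≫ c ◃ (unitNat d).hom ≫ (𝒶 _ _ _).inv ≫
        (unitNat c).hom ▹ d =
      (𝒶 _ _ _).hom ≫ a ◃ (unitNat b).hom ≫ (𝒶 _ _ _).inv ≫ (unitNat a).hom ▹ b ≫
        (𝒶 _ _ _).hom ≫ 𝟙 x ◃ (𝟙 _ ≫ ζ.hom ≫ 𝟙 _) ≫ (𝒶 _ _ _).inv := by
  simp only [Category.id_comp, Category.comp_id]
  simp

lemma simplex_mapId {x y : C} {z z' : B} {a : x ⟶ y} {b : y ⟶ F.obj z} {c : x ⟶ F.obj z'}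
    {d : z' ⟶ z} (ζ : a ≫ b ≅ c ≫ F.map d) :
    ζ.hom ▹ 𝟙 _ ≫ (𝒶 _ _ _).hom ≫ c ◃ (unitNat (F.map d)).hom ≫ (𝒶 _ _ _).inv ≫
        (Bicategory.whiskerLeftIso c (F.mapId z').symm).hom ▹ F.map d =
      (𝒶 _ _ _).hom ≫ a ◃ (Bicategory.whiskerLeftIso b (F.mapId z).symm).hom ≫ (𝒶 _ _ _).inv ≫
        ζ.hom ▹ F.map (𝟙 z) ≫ (𝒶 _ _ _).hom ≫ c ◃ mapSq F (unitNat d).hom ≫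
        (𝒶 _ _ _).inv := by
  rw [mapSq_unitNat]
  have h := whiskerLeft_exchange ζ.hom (F.mapId z).inv
  simp only [Bicategory.whiskerLeftIso_hom, Iso.symm_hom, Iso.trans_hom, Bicategory.whiskerLeft_comp,
    Category.assoc]
  rw [reassoc_of% h]
  simp only [Iso.inv_hom_id_assoc, whiskerLeft_whiskerLeft_inv_hom]
  bicategory

end

/-- A pseudofunctor `E` with a pseudonatural transformation `Φ : 1 ⟶ E E` and a coherent
modification `Φ E ≅ E Φ`. -/
structure WeakInvolution (C : Type u) [Bicategory.{w, v} C] where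
  E : Pseudofunctor C C
  Φ (x : C) : x ⟶ E.obj (E.obj x)
  ν {x y : C} (f : x ⟶ y) : f ≫ Φ y ≅ Φ x ≫ E.map (E.map f)
  ν_natural {x y : C} {f f' : x ⟶ y} (η : f ⟶ f') :
    η ▹ Φ y ≫ (ν f').hom = (ν f).hom ≫ Φ x ◃ E.map₂ (E.map₂ η)
  ν_id (x : C) : (ν (𝟙 x)).hom =
    (𝓁 (Φ x)).hom ≫ (𝓇 (Φ x)).inv ≫ Φ x ◃ ((E.mapId _).inv ≫ E.map₂ (E.mapId x).inv)
  ν_comp {x y z : C} (f : x ⟶ y) (f' : y ⟶ z) : (ν (f ≫ f')).hom =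
    (𝒶 _ _ _).hom ≫ f ◃ (ν f').hom ≫ (𝒶 _ _ _).inv ≫ (ν f).hom ▹ E.map (E.map f') ≫
      (𝒶 _ _ _).hom ≫ Φ x ◃ ((E.mapComp _ _).inv ≫ E.map₂ (E.mapComp f f').inv)
  Z (x : C) : Φ (E.obj x) ≅ E.map (Φ x)
  Z_natural {x y : C} (f : x ⟶ y) :
    E.map f ◃ (Z y).hom ≫ (E.mapComp f (Φ y)).inv ≫ E.map₂ (ν f).hom ≫ (E.mapComp _ _).hom =
      (ν (E.map f)).hom ≫ (Z x).hom ▹ E.map (E.map (E.map f))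
  coherence (x : C) : Φ x ◃ (Z (E.obj x)).hom = (ν (Φ x)).hom ≫ Φ x ◃ E.map₂ (Z x).inv

namespace WeakInvolution

variable {C : Type u} [Bicategory.{w, v} C] (I : WeakInvolution C)

/-- The action of `{+, -}` on `C`. -/
def functor : Variance → Pseudofunctor C C
  | .pos => Pseudofunctor.id C
  | .neg => I.E

/-- The 1-cells from `ᵍʰx` to `ʰ(ᵍx)`. -/
def φ : ∀ {g h k : Variance} (_ : g * h = k) (x : C),
    (I.functor k).obj x ⟶ (I.functor h).obj ((I.functor g).obj x)
  | .pos, .pos, .pos, _, x => 𝟙 x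
  | .pos, .neg, .neg, _, x => 𝟙 (I.E.obj x)
  | .neg, .pos, .neg, _, x => 𝟙 (I.E.obj x)
  | .neg, .neg, .pos, _, x => I.Φ x

/-- The naturality constraints of `φ`. -/
def φNat : ∀ {g h k : Variance} (e : g * h = k) {x y : C} (f : x ⟶ y),
    (I.functor k).map f ≫ I.φ e y ≅ I.φ e x ≫ (I.functor h).map ((I.functor g).map f)
  | .pos, .pos, .pos, _, _, _, f => unitNat f
  | .pos, .neg, .neg, _, _, _, f => unitNat (I.E.map f)
  | .neg, .pos, .neg, _, _, _, f => unitNat (I.E.map f)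
  | .neg, .neg, .pos, _, _, _, f => I.ν f

/-- The modification relating the two ways of comparing `ᵍʰᵏx` and `ᵏ(ʰ(ᵍx))`. -/
def ζ : ∀ {g h k a b c : Variance} (e₁ : g * h = a) (e₂ : h * k = b) (e₃ : a * k = c)
    (e₄ : g * b = c) (x : C),
    I.φ e₄ x ≫ I.φ e₂ ((I.functor g).obj x) ≅ I.φ e₃ x ≫ (I.functor k).map (I.φ e₁ x)
  | .pos, .pos, .pos, .pos, .pos, .pos, _, _, _, _, x => unitNat (𝟙 x)
  | .neg, .pos, .pos, .neg, .pos, .neg, _, _, _, _, x => unitNat (𝟙 (I.E.obj x))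
  | .pos, .neg, .pos, .neg, .neg, .neg, _, _, _, _, x => unitNat (𝟙 (I.E.obj x))
  | .neg, .neg, .pos, .pos, .neg, .pos, _, _, _, _, x => unitNat (I.Φ x)
  | .pos, .pos, .neg, .pos, .neg, .neg, _, _, _, _, x =>
    Bicategory.whiskerLeftIso (𝟙 (I.E.obj x)) (I.E.mapId x).symm
  | .neg, .pos, .neg, .neg, .neg, .pos, _, _, _, _, x =>
    Bicategory.whiskerLeftIso (I.Φ x) (I.E.mapId (I.E.obj x)).symm
  | .pos, .neg, .neg, .neg, .pos, .pos, _, _, _, _, x => unitMap I.E (I.Φ x)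
  | .neg, .neg, .neg, .pos, .pos, .neg, _, _, _, _, x =>
    Bicategory.whiskerLeftIso (𝟙 (I.E.obj x)) (I.Z x)

/-- The right unitality constraint. -/
def ζr : ∀ (g : Variance) (e : .pos * g = g) (x : C),
    I.φ e x ≫ (I.functor g).map (𝟙 x) ≅ 𝟙 ((I.functor g).obj x)
  | .pos, _, x => 𝓁 (𝟙 x) ≪≫ Iso.refl (𝟙 x)
  | .neg, _, x => 𝓁 (I.E.map (𝟙 x)) ≪≫ I.E.mapId x

/-- The left unitality constraint. -/
def ζl : ∀ (g : Variance) (e : g * .pos = g) (x : C),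
    I.φ e x ≫ 𝟙 ((I.functor g).obj x) ≅ 𝟙 ((I.functor g).obj x)
  | .pos, _, x => 𝓁 (𝟙 x)
  | .neg, _, x => 𝓁 (𝟙 (I.E.obj x))

lemma simplex_ν_id {y w : C} {c : y ⟶ I.E.obj w} {d : w ⟶ I.E.obj y}
    (ζ : 𝟙 y ≫ I.Φ y ≅ c ≫ I.E.map d) :
    (unitNat (𝟙 y)).hom ▹ I.Φ y ≫ (𝒶 _ _ _).hom ≫ 𝟙 y ◃ (I.ν (𝟙 y)).hom ≫ (𝒶 _ _ _).inv ≫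
        ζ.hom ▹ I.E.map (I.E.map (𝟙 y)) =
      (𝒶 _ _ _).hom ≫ 𝟙 y ◃ (unitMap I.E (I.Φ y)).hom ≫ (𝒶 _ _ _).inv ≫
        ζ.hom ▹ I.E.map (𝟙 _) ≫ (𝒶 _ _ _).hom ≫
        c ◃ mapSq I.E (Bicategory.whiskerLeftIso d (I.E.mapId y).symm).hom ≫ (𝒶 _ _ _).inv := by
  have h₁ := whiskerLeft_exchange ζ.hom ((I.E.mapId _).inv ≫ I.E.map₂ (I.E.mapId y).inv)
  have h₂ := whiskerLeft_exchange ζ.hom (I.E.mapId (I.E.obj y)).inv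
  have h₃ : mapSq I.E (d ◃ (I.E.mapId y).inv) = I.E.map d ◃ I.E.map₂ (I.E.mapId y).inv := by
    simp [mapSq]
  rw [I.ν_id]
  simp only [Bicategory.whiskerLeftIso_hom, Iso.symm_hom, Iso.trans_hom, h₃,
    Bicategory.whiskerLeft_comp, Category.assoc] at h₁ ⊢
  rw [h₁, reassoc_of% h₂]
  bicategory

lemma simplex_Z (x : C) :
    (unitNat (𝟙 (I.E.obj x))).hom ▹ I.Φ (I.E.obj x) ≫ (𝒶 _ _ _).hom ≫
        𝟙 _ ◃ (I.ν (𝟙 (I.E.obj x))).hom ≫ (𝒶 _ _ _).inv ≫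
        (Bicategory.whiskerLeftIso (𝟙 _) (I.Z x)).hom ▹ I.E.map (I.E.map (𝟙 _)) =
      (𝒶 _ _ _).hom ≫ 𝟙 _ ◃ (Bicategory.whiskerLeftIso (𝟙 _) (I.Z x)).hom ≫ (𝒶 _ _ _).inv ≫
        (Bicategory.whiskerLeftIso (𝟙 _) (I.E.mapId x).symm).hom ▹ I.E.map (I.Φ x) ≫
        (𝒶 _ _ _).hom ≫ 𝟙 _ ◃ mapSq I.E (unitMap I.E (I.Φ x)).hom ≫ (𝒶 _ _ _).inv := by
  have h₁ := Bicategory.whisker_exchange (I.Z x).hom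
    ((I.E.mapId _).inv ≫ I.E.map₂ (I.E.mapId (I.E.obj x)).inv)
  have h₂ : mapSq I.E (unitMap I.E (I.Φ x)).hom = (I.E.mapId x).hom ▹ I.E.map (I.Φ x) ≫
      (𝓁 _).hom ≫ (𝓇 _).inv ≫ I.E.map (I.Φ x) ◃ ((I.E.mapId _).inv ≫
        I.E.map₂ (I.E.mapId (I.E.obj x)).inv) := by
    simp [mapSq, I.E.map₂_left_unitor, map₂_rightUnitor_inv]
  have h₃ : (I.E.mapId x).inv ▹ I.E.map (I.Φ x) ≫ (I.E.mapId x).hom ▹ I.E.map (I.Φ x) = 𝟙 _ := by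
    simp
  rw [I.ν_id, h₂]
  generalize (I.E.mapId _).inv ≫ I.E.map₂ (I.E.mapId (I.E.obj x)).inv = m at h₁ ⊢
  simp only [Bicategory.whiskerLeftIso_hom, Iso.symm_hom, Iso.trans_hom]
  calc
    _ = 𝟙 _ ⊚ (I.Φ (I.E.obj x) ◃ m ≫ (I.Z x).hom ▹ _) ⊚ 𝟙 _ := by bicategory
    _ = 𝟙 _ ⊚ (I.Z x).hom ⊚ 𝟙 _ ◃ ((I.E.mapId x).inv ▹ I.E.map (I.Φ x) ≫
        (I.E.mapId x).hom ▹ I.E.map (I.Φ x)) ⊚ I.E.map (I.Φ x) ◃ m ⊚ 𝟙 _ := by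
      rw [h₁, h₃]
      bicategory
    _ = _ := by bicategory

lemma simplex_coherence (x : C) :
    (unitNat (I.Φ x)).hom ▹ I.Φ _ ≫ (𝒶 _ _ _).hom ≫ 𝟙 x ◃ (I.ν (I.Φ x)).hom ≫
        (𝒶 _ _ _).inv ≫ (unitMap I.E (I.Φ x)).hom ▹ I.E.map (I.E.map (I.Φ x)) =
      (𝒶 _ _ _).hom ≫ I.Φ x ◃ (Bicategory.whiskerLeftIso (𝟙 _) (I.Z (I.E.obj x))).hom ≫
        (𝒶 _ _ _).inv ≫ (Bicategory.whiskerLeftIso (I.Φ x) (I.E.mapId _).symm).hom ▹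
          I.E.map (I.Φ (I.E.obj x)) ≫ (𝒶 _ _ _).hom ≫
        I.Φ x ◃ mapSq I.E (Bicategory.whiskerLeftIso (𝟙 _) (I.Z x)).hom ≫ (𝒶 _ _ _).inv := by
  have h₁ : mapSq I.E (𝟙 (I.E.obj x) ◃ (I.Z x).hom) = I.E.map (𝟙 _) ◃ I.E.map₂ (I.Z x).hom := by
    simp only [mapSq, I.E.map₂_whisker_left]
    simp
  have h₂ : (I.ν (I.Φ x)).hom = I.Φ x ◃ (I.Z (I.E.obj x)).hom ≫ I.Φ x ◃ I.E.map₂ (I.Z x).hom := by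
    rw [I.coherence, Category.assoc, ← Bicategory.whiskerLeft_comp, ← PrelaxFunctor.map₂_comp,
      Iso.inv_hom_id, PrelaxFunctor.map₂_id, Bicategory.whiskerLeft_id, Category.comp_id]
  have h₃ := Bicategory.whisker_exchange (I.E.mapId (I.E.obj x)).inv (I.E.map₂ (I.Z x).hom)
  simp only [Bicategory.whiskerLeftIso_hom, Iso.symm_hom, Iso.trans_hom, h₁, h₂]
  calc
    _ = 𝟙 _ ⊚ I.Φ x ◃ (I.Z (I.E.obj x)).hom ⊚ I.Φ x ◃ (𝟙 _ ◃ I.E.map₂ (I.Z x).hom ≫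
        (I.E.mapId (I.E.obj x)).inv ▹ _) ⊚ 𝟙 _ := by bicategory
    _ = _ := by
      rw [h₃]
      bicategory

lemma modification_Z {x y : C} (f : x ⟶ y) :
    I.E.map f ◃ (Bicategory.whiskerLeftIso (𝟙 _) (I.Z y)).hom ≫ (𝒶 _ _ _).inv ≫
        (unitNat (I.E.map f)).hom ▹ I.E.map (I.Φ y) ≫ (𝒶 _ _ _).hom ≫
        𝟙 _ ◃ mapSq I.E (I.ν f).hom ≫ (𝒶 _ _ _).inv =
      (𝒶 _ _ _).inv ≫ (unitNat (I.E.map f)).hom ▹ I.Φ _ ≫ (𝒶 _ _ _).hom ≫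
        𝟙 _ ◃ (I.ν (I.E.map f)).hom ≫ (𝒶 _ _ _).inv ≫
        (Bicategory.whiskerLeftIso (𝟙 _) (I.Z x)).hom ▹ I.E.map (I.E.map (I.E.map f)) := by
  have h : I.E.map f ◃ (I.Z y).hom ≫ mapSq I.E (I.ν f).hom = _ := I.Z_natural f
  simp only [Bicategory.whiskerLeftIso_hom, Iso.symm_hom, Iso.trans_hom]
  calc
    _ = 𝟙 _ ⊚ (I.E.map f ◃ (I.Z y).hom ≫ mapSq I.E (I.ν f).hom) ⊚ 𝟙 _ := by bicategory
    _ = _ := by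
      rw [h]
      bicategory

lemma φNat_natural {g h k : Variance} (e : g * h = k) {x y : C} {a a' : x ⟶ y} (η : a ⟶ a') :
    (I.functor k).map₂ η ▹ I.φ e y ≫ (I.φNat e a').hom =
      (I.φNat e a).hom ≫ I.φ e x ◃ (I.functor h).map₂ ((I.functor g).map₂ η) := by
  rcases g with _ | _ <;> rcases h with _ | _ <;> rcases k with _ | _ <;>
    first | (cases e; done) | exact I.ν_natural η | exact unitNat_natural _

lemma φNat_comp {g h k : Variance} (e : g * h = k) {x y z : C} (a : x ⟶ y) (b : y ⟶ z) :
    ((I.functor k).mapComp a b).inv ▹ I.φ e z ≫ (I.φNat e (a ≫ b)).hom =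
      (𝒶 _ _ _).hom ≫ (I.functor k).map a ◃ (I.φNat e b).hom ≫ (𝒶 _ _ _).inv ≫
        (I.φNat e a).hom ▹ (I.functor h).map ((I.functor g).map b) ≫ (𝒶 _ _ _).hom ≫
        I.φ e x ◃ (((I.functor h).mapComp _ _).inv ≫
          (I.functor h).map₂ ((I.functor g).mapComp a b).inv) := by
  rcases g with _ | _ <;> rcases h with _ | _ <;> rcases k with _ | _ <;>
    first
    | (cases e; done)
    | exact unitNat_comp (Category.comp_id _)
    | exact unitNat_comp ((congrArg (_ ≫ ·) (I.E.map₂_id _)).trans (Category.comp_id _))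
    | exact unitNat_comp (Category.id_comp _)
    | exact (congrArg (· ≫ _) (Bicategory.id_whiskerRight _ _)).trans
        ((Category.id_comp _).trans (I.ν_comp a b))

lemma ζ_natural {g h k a b c : Variance} (e₁ : g * h = a) (e₂ : h * k = b) (e₃ : a * k = c)
    (e₄ : g * b = c) {x y : C} (f : x ⟶ y) :
    (I.functor c).map f ◃ (I.ζ e₁ e₂ e₃ e₄ y).hom ≫ (𝒶 _ _ _).inv ≫
        (I.φNat e₃ f).hom ▹ (I.functor k).map (I.φ e₁ y) ≫ (𝒶 _ _ _).hom ≫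
        I.φ e₃ x ◃ mapSq (I.functor k) (I.φNat e₁ f).hom ≫ (𝒶 _ _ _).inv =
      (𝒶 _ _ _).inv ≫ (I.φNat e₄ f).hom ▹ I.φ e₂ _ ≫ (𝒶 _ _ _).hom ≫
        I.φ e₄ x ◃ (I.φNat e₂ ((I.functor g).map f)).hom ≫ (𝒶 _ _ _).inv ≫
        (I.ζ e₁ e₂ e₃ e₄ x).hom ▹ (I.functor k).map ((I.functor h).map ((I.functor g).map f)) := by
  rcases g with _ | _ <;> rcases h with _ | _ <;> rcases k with _ | _ <;> rcases a with _ | _ <;>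
    first | (cases e₁; done) | skip
  all_goals rcases b with _ | _ <;> first | (cases e₂; done) | skip
  all_goals rcases c with _ | _ <;> first | (cases e₃; done) | skip
  all_goals first
    | exact modification_unit (I.φNat e₁ f)
    | exact modification_mapId I.E (I.φNat e₃ f)
    | exact modification_unitMap I.E (I.ν f)
    | exact I.modification_Z f

lemma ζr_natural (g : Variance) (e : .pos * g = g) {x y : C} (a : x ⟶ y) :
    (I.functor g).map a ◃ (I.ζr g e y).hom ≫ (𝓇 _).hom =
      (𝒶 _ _ _).inv ≫ (I.φNat e a).hom ▹ (I.functor g).map (𝟙 y) ≫ (𝒶 _ _ _).hom ≫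
        I.φ e x ◃ mapSq (I.functor g) (unitNat a).hom ≫ (𝒶 _ _ _).inv ≫
        (I.ζr g e x).hom ▹ (I.functor g).map a ≫ (𝓁 _).hom := by
  rcases g with _ | _
  · exact unit_modification_natural (Pseudofunctor.id C) a
  · exact unit_modification_natural I.E a

lemma ζ_unit {g h k : Variance} (e : g * h = k) (eg : g * .pos = g) (eh : .pos * h = h) (x : C) :
    I.φ e x ◃ (I.ζr h eh ((I.functor g).obj x)).hom =
      (𝒶 _ _ _).inv ≫ (I.ζ eg eh e e x).hom ▹ (I.functor h).map (𝟙 _) ≫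
        (𝒶 _ _ _).hom ≫ I.φ e x ◃ mapUnit (I.functor h) (I.ζl g eg x).hom := by
  rcases g with _ | _ <;> rcases h with _ | _ <;> rcases k with _ | _ <;> first
    | (cases e; done)
    | exact whiskerLeft_unit_id _
    | exact whiskerLeft_unit_map I.E _

lemma simplex {g h k l gh hk kl ghk hkl ghkl : Variance} (e_gh : g * h = gh) (e_hk : h * k = hk)
    (e_kl : k * l = kl) (e_gh_k : gh * k = ghk) (e_g_hk : g * hk = ghk) (e_hk_l : hk * l = hkl)
    (e_h_kl : h * kl = hkl) (e_ghk_l : ghk * l = ghkl) (e_gh_kl : gh * kl = ghkl)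
    (e_g_hkl : g * hkl = ghkl) (x : C) :
    (I.ζ e_gh e_h_kl e_gh_kl e_g_hkl x).hom ▹ I.φ e_kl _ ≫ (𝒶 _ _ _).hom ≫
        I.φ e_gh_kl x ◃ (I.φNat e_kl (I.φ e_gh x)).hom ≫ (𝒶 _ _ _).inv ≫
        (I.ζ e_gh_k e_kl e_ghk_l e_gh_kl x).hom ▹
          (I.functor l).map ((I.functor k).map (I.φ e_gh x)) =
      (𝒶 _ _ _).hom ≫ I.φ e_g_hkl x ◃ (I.ζ e_hk e_kl e_hk_l e_h_kl ((I.functor g).obj x)).hom ≫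
        (𝒶 _ _ _).inv ≫ (I.ζ e_g_hk e_hk_l e_ghk_l e_g_hkl x).hom ▹
          (I.functor l).map (I.φ e_hk _) ≫ (𝒶 _ _ _).hom ≫
        I.φ e_ghk_l x ◃ mapSq (I.functor l) (I.ζ e_gh e_hk e_gh_k e_g_hk x).hom ≫
        (𝒶 _ _ _).inv := by
  rcases g with _ | _ <;> rcases h with _ | _ <;> rcases gh with _ | _ <;>
    first | (cases e_gh; done) | skip
  all_goals rcases k with _ | _ <;> rcases hk with _ | _ <;> first | (cases e_hk; done) | skip
  all_goals rcases ghk with _ | _ <;> first | (cases e_gh_k; done) | skip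
  all_goals rcases l with _ | _ <;> rcases kl with _ | _ <;> first | (cases e_kl; done) | skip
  all_goals rcases hkl with _ | _ <;> first | (cases e_hk_l; done) | skip
  all_goals rcases ghkl with _ | _ <;> first | (cases e_ghk_l; done) | skip
  all_goals first
    | exact simplex_unit (I.ζ e_gh e_hk e_gh_k e_g_hk x)
    | exact simplex_mapId I.E (I.ζ e_gh e_h_kl e_gh_kl e_g_hkl x)
    | exact I.simplex_ν_id (I.ζ e_gh_k e_kl e_ghk_l e_gh_kl x)
    | exact I.simplex_Z x
    | exact I.simplex_coherence x

/-- The weak action of `{+, -}` determined by a weak involution. -/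
def weakAction : WeakAction Variance C where
  functor := I.functor
  φ := I.φ
  ν := I.φNat
  ν_natural := I.φNat_natural
  ν_comp := I.φNat_comp
  ζ := I.ζ
  ζ_natural := I.ζ_natural
  simplex := I.simplex
  ι x := 𝟙 x
  ν₁ a := unitNat a
  ν₁_natural η := unitNat_natural η
  ζl g x := I.ζl g (mul_one g) x
  ζr g x := I.ζr g (one_mul g) x
  ζr_natural g _ _ a := I.ζr_natural g (one_mul g) a
  ζ_unit e x := I.ζ_unit e (mul_one _) (one_mul _) x

end WeakInvolution
namespace WeakDualityInvolution

variable {B : Type u₁} [Bicategory.{w₁, v₁} B] (D : WeakDualityInvolution B)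

/-- An invertible 2-cell, with 2-cells reversed. -/
abbrev coIso {x y : B} {f g : x ⟶ y} (e : f ≅ g) : Co.mkHom f ≅ Co.mkHom g := Co.isoMk e

open scoped Pseudofunctor.StrongTrans

lemma naturality_id_eq {G : Pseudofunctor B B} (η : Pseudofunctor.id B ⟶ G) (a : B) :
    (η.naturality (𝟙 a)).hom =
      ((𝓁 (η.app a)).hom ≫ (𝓇 (η.app a)).inv ≫ η.app a ◃ (G.mapId a).inv :) := by
  have h := (Iso.eq_comp_inv (Bicategory.whiskerLeftIso (η.app a) (G.mapId a))).2
    (η.naturality_id a)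
  refine h.trans ((congrArg (· ≫ _) ((congrArg (· ≫ _) (Bicategory.id_whiskerRight _ _)).trans
    (Category.id_comp _))).trans (Category.assoc _ _ _))

lemma naturality_comp_eq {G : Pseudofunctor B B} (η : Pseudofunctor.id B ⟶ G) {a b c : B}
    (f : a ⟶ b) (g : b ⟶ c) :
    (η.naturality (f ≫ g)).hom =
      ((𝒶 f g (η.app c)).hom ≫ f ◃ (η.naturality g).hom ≫ (𝒶 f (η.app b) (G.map g)).inv ≫
        (η.naturality f).hom ▹ G.map g ≫ (𝒶 (η.app a) (G.map f) (G.map g)).hom ≫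
          η.app a ◃ (G.mapComp f g).inv :) := by
  have h := (Iso.eq_comp_inv (Bicategory.whiskerLeftIso (η.app a) (G.mapComp f g))).2
    (η.naturality_comp f g)
  refine h.trans ((congrArg (· ≫ _) ((congrArg (· ≫ _) (Bicategory.id_whiskerRight _ _)).trans
    (Category.id_comp _))).trans ?_)
  exact (Category.assoc _ _ _).trans (congrArg (_ ≫ ·) ((Category.assoc _ _ _).trans
    (congrArg (_ ≫ ·) ((Category.assoc _ _ _).trans (congrArg (_ ≫ ·) (Category.assoc _ _ _))))))

/-- A weak duality involution, restricted to invertible 2-cells. -/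
def pith : Pseudofunctor (Bicategory.Pith B) (Bicategory.Pith B) where
  obj x := ⟨D.dual.obj ⟨x.as⟩⟩
  map f := ⟨D.dual.map (Co.mkHom f.of)⟩
  map₂ η := ⟨D.dual.map₂Iso (coIso η.iso)⟩
  mapId x := Core.isoMk (D.dual.mapId ⟨x.as⟩)
  mapComp f g := Core.isoMk (D.dual.mapComp (Co.mkHom f.of) (Co.mkHom g.of))
  map₂_id _ := Bicategory.Pith.hom₂_ext _ (D.dual.map₂_id _)
  map₂_comp η θ := Bicategory.Pith.hom₂_ext _
    (D.dual.map₂_comp (coIso η.iso).hom (coIso θ.iso).hom)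
  map₂_whisker_left f _ _ η := Bicategory.Pith.hom₂_ext _
    (D.dual.map₂_whisker_left (Co.mkHom f.of) (coIso η.iso).hom)
  map₂_whisker_right η h := Bicategory.Pith.hom₂_ext _
    (D.dual.map₂_whisker_right (coIso η.iso).hom (Co.mkHom h.of))
  map₂_associator f g h := Bicategory.Pith.hom₂_ext _
    (D.dual.map₂_associator (Co.mkHom f.of) (Co.mkHom g.of) (Co.mkHom h.of))
  map₂_left_unitor f := Bicategory.Pith.hom₂_ext _ (D.dual.map₂_left_unitor (Co.mkHom f.of))
  map₂_right_unitor f := Bicategory.Pith.hom₂_ext _ (D.dual.map₂_right_unitor (Co.mkHom f.of))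

/-- The weak involution on invertible 2-cells determined by a weak duality involution. -/
def weakInvolution : WeakInvolution (Bicategory.Pith B) where
  E := D.pith
  Φ x := ⟨D.φ.hom.app x.as⟩
  ν f := Core.isoMk (D.φ.hom.naturality f.of)
  ν_natural η := Bicategory.Pith.hom₂_ext _ (D.φ.hom.naturality_naturality η.iso.hom)
  ν_id x := Bicategory.Pith.hom₂_ext _ (naturality_id_eq D.φ.hom x.as)
  ν_comp f f' := Bicategory.Pith.hom₂_ext _ (naturality_comp_eq D.φ.hom f.of f'.of)
  Z x := Core.isoMk (D.ζ x.as)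
  Z_natural f := Bicategory.Pith.hom₂_ext _ (D.ζ_naturality f.of)
  coherence x := Bicategory.Pith.hom₂_ext _ (D.ζ_coherence x.as)

end WeakDualityInvolution
end TwistedBicat

namespace TwistedBicat

local infixr:81 " ◃ " => Bicategory.whiskerLeft
local infixl:81 " ▹ " => Bicategory.whiskerRight
local infixr:80 " ⊚ " => bicategoricalComp
local notation "𝒶" => Bicategory.associator
local notation "𝓁" => Bicategory.leftUnitor
local notation "𝓇" => Bicategory.rightUnitor


lemma id_natural {C : Type u} [Category.{v} C] {x y : C} (f : x ⟶ y) : f ≫ 𝟙 y = 𝟙 x ≫ f := by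
  simp

lemma intersperse_id {C : Type u} [Category.{v} C] {a b c d e : C} {p : a ⟶ b} {q : b ⟶ e}
    {r : a ⟶ c} {s : c ⟶ d} {t : d ⟶ e} (h : p ≫ q = r ≫ s ≫ t) :
    p ≫ 𝟙 b ≫ q = 𝟙 a ≫ r ≫ 𝟙 c ≫ s ≫ 𝟙 d ≫ t ≫ 𝟙 e := by
  simpa using h

lemma intersperse_id' {C : Type u} [Category.{v} C] {a b c : C} {p : a ⟶ b} {q : b ⟶ c}
    {r : a ⟶ c} (h : p ≫ q = r) : p ≫ 𝟙 b ≫ q = 𝟙 a ≫ r ≫ 𝟙 c := by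
  simpa using h

section

variable {B : Type u₁} [Bicategory.{w₁, v₁} B] {C : Type u} [Bicategory.{w, v} C]

lemma mapComp_inv_natural (F : Pseudofunctor B C) {x y z : B} {f f' : x ⟶ y} (α : f ⟶ f')
    {g g' : y ⟶ z} (β : g ⟶ g') :
    (F.map₂ α ▹ F.map g ≫ F.map f' ◃ F.map₂ β) ≫ (F.mapComp f' g').inv =
      (F.mapComp f g).inv ≫ F.map₂ (f ◃ β ≫ α ▹ g') := by
  simp [F.map₂_comp, F.map₂_whisker_left, F.map₂_whisker_right, Bicategory.whisker_exchange]

lemma whiskerLeft_mapComp_inv (F : Pseudofunctor B C) {x y z : B} (f : x ⟶ y) {g g' : y ⟶ z}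
    (β : g ⟶ g') : F.map f ◃ F.map₂ β ≫ (F.mapComp f g').inv =
      (F.mapComp f g).inv ≫ F.map₂ (f ◃ β) := by
  simp [F.map₂_whisker_left]

lemma rep_con_natural {x₀ x₁ x₂ y₁ y₂ z t : C} {p : x₀ ⟶ x₁} {r r' : x₁ ⟶ x₂} {φ : x₂ ⟶ z}
    {φ' : x₁ ⟶ y₁} {s s' : y₁ ⟶ z} {ν : r ≫ φ ⟶ φ' ≫ s} {ν' : r' ≫ φ ⟶ φ' ≫ s'}
    {ψ : x₀ ⟶ y₂} {j : y₂ ⟶ y₁} (ζ : p ≫ φ' ⟶ ψ ≫ j) {t₀ : C} {q q' : z ⟶ t₀}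
    {b b' : t₀ ⟶ t} {u u' : y₁ ⟶ t₀} {M : s ≫ q ⟶ u} {M' : s' ≫ q' ⟶ u'} {k k' : y₂ ⟶ t₀}
    {N : j ≫ u ⟶ k} {N' : j ≫ u' ⟶ k'} {n : r ⟶ r'} {σ : s ⟶ s'} {m : q ⟶ q'} (o : b ⟶ b')
    {μ : u ⟶ u'} {κ : k ⟶ k'} (h₁ : n ▹ φ ≫ ν' = ν ≫ φ' ◃ σ)
    (h₂ : (σ ▹ q ≫ s' ◃ m) ≫ M' = M ≫ μ) (h₃ : j ◃ μ ≫ N' = N ≫ κ) :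
    p ◃ (n ▹ (φ ≫ q ≫ b) ≫ r' ◃ φ ◃ (m ▹ b ≫ q' ◃ o)) ≫ p ◃ rep ν' (q' ≫ b') ≫
        rep ζ (s' ≫ q' ≫ b') ≫ ψ ◃ (j ◃ con M' b' ≫ con N' b') =
      (p ◃ rep ν (q ≫ b) ≫ rep ζ (s ≫ q ≫ b) ≫ ψ ◃ (j ◃ con M b ≫ con N b)) ≫
        ψ ◃ (κ ▹ b ≫ k' ◃ o) := by
  have e₁ (T : z ⟶ t) : p ◃ n ▹ (φ ≫ T) ≫ p ◃ rep ν' T = p ◃ rep ν T ≫ p ◃ φ' ◃ σ ▹ T := by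
    have w := congrArg (fun q' => q' ▹ T) h₁
    simp only [Bicategory.comp_whiskerRight] at w
    simp only [← Bicategory.whiskerLeft_comp]
    congr 1
    simp only [rep, Category.assoc]
    simp [reassoc_of% w]
  have e₂ : σ ▹ (q ≫ b) ≫ s' ◃ (m ▹ b ≫ q' ◃ o) ≫ con M' b' =
      con M b ≫ μ ▹ b ≫ u' ◃ o := by
    have w := congrArg (fun q' => q' ▹ b) h₂
    simp only [Bicategory.comp_whiskerRight, Category.assoc] at w
    rw [Bicategory.whiskerLeft_comp, Category.assoc, con_natural]
    simp only [con, Category.assoc]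
    rw [← reassoc_of% w]
    simp
  have e₃ : j ◃ (μ ▹ b ≫ u' ◃ o) ≫ con N' b' = con N b ≫ κ ▹ b ≫ k' ◃ o := by
    have w := congrArg (fun q' => q' ▹ b) h₃
    simp only [Bicategory.comp_whiskerRight] at w
    rw [Bicategory.whiskerLeft_comp, Category.assoc, con_natural]
    simp only [con, Category.assoc]
    rw [← reassoc_of% w]
    simp
  have e₄ : ψ ◃ j ◃ σ ▹ (q ≫ b) ≫ ψ ◃ j ◃ s' ◃ (m ▹ b ≫ q' ◃ o) ≫
      ψ ◃ (j ◃ con M' b' ≫ con N' b') =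
      ψ ◃ (j ◃ con M b ≫ con N b) ≫ ψ ◃ (κ ▹ b ≫ k' ◃ o) := by
    rw [← Bicategory.whiskerLeft_comp, ← Bicategory.whiskerLeft_comp,
      ← Bicategory.whiskerLeft_comp, Category.assoc, ← e₃, ← Bicategory.whiskerLeft_comp_assoc,
      ← Bicategory.whiskerLeft_comp_assoc, ← Bicategory.whiskerLeft_comp_assoc, Category.assoc, e₂]
  rw [Bicategory.whiskerLeft_comp, Category.assoc, whiskerLeft_rep_natural_assoc,
    sq_assoc (e₁ _), rep_natural_assoc, rep_natural_assoc, e₄]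
  simp only [Category.assoc]

lemma whiskerLeft_del_natural {x y z : C} {p : x ⟶ y} {i : y ⟶ x} {a a' : x ⟶ z} {f f' : y ⟶ z}
    {i' : z ⟶ z} {n : f ⟶ f'} {n' : a ⟶ a'} {ν : f ≫ i' ⟶ i ≫ a} {ν' : f' ≫ i' ⟶ i ≫ a'}
    (θ : p ≫ i ⟶ 𝟙 x) (h : n ▹ i' ≫ ν' = ν ≫ i ◃ n') :
    p ◃ (n ▹ i' ≫ f' ◃ 𝟙 i') ≫ p ◃ ν' ≫ del θ a' = (p ◃ ν ≫ del θ a) ≫ n' := by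
  rw [Category.assoc, ← del_natural, Bicategory.whiskerLeft_id, Category.comp_id,
    ← Bicategory.whiskerLeft_comp_assoc, h, Bicategory.whiskerLeft_comp_assoc]

lemma whiskerLeft_id_comp_del_natural {x y z : C} {p : x ⟶ y} {i : y ⟶ x} (θ : p ≫ i ⟶ 𝟙 x)
    {j : i ⟶ i} (hj : j = 𝟙 i) {b b' : x ⟶ z} (n : b ⟶ b') :
    p ◃ (j ▹ b ≫ i ◃ n) ≫ del θ b' = del θ b ≫ n := by
  rw [hj, Bicategory.id_whiskerRight, Category.id_comp, del_natural]

end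

namespace WeakAction

variable {G : Type t} [Group G] {C : Type u} [Bicategory.{w, v} C] (S : WeakAction G C)

lemma pentagon_map {g h k l gh hk kl ghk hkl ghkl : G} (e_gh : g * h = gh) (e_hk : h * k = hk)
    (e_kl : k * l = kl) (e_gh_k : gh * k = ghk) (e_g_hk : g * hk = ghk) (e_hk_l : hk * l = hkl)
    (e_h_kl : h * kl = hkl) (e_ghk_l : ghk * l = ghkl) (e_gh_kl : gh * kl = ghkl)
    (e_g_hkl : g * hkl = ghkl) {v w x y z : C} (a : (S.functor g).obj v ⟶ w)
    (b : (S.functor h).obj w ⟶ x) (c : (S.functor k).obj x ⟶ y) (d : (S.functor l).obj y ⟶ z) :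
    (S.assoc e_gh e_h_kl e_gh_kl e_g_hkl a b (S.comp e_kl d c)).hom ≫
        (S.assoc e_gh_k e_kl e_ghk_l e_gh_kl (S.comp e_gh b a) c d).hom =
      S.map e_g_hkl (S.assoc e_hk e_kl e_hk_l e_h_kl b c d).hom (𝟙 a) ≫
        (S.assoc e_g_hk e_hk_l e_ghk_l e_g_hkl a (S.comp e_hk c b) d).hom ≫
        S.map e_ghk_l (𝟙 d) (S.assoc e_gh e_hk e_gh_k e_g_hk a b c).hom := by
  simpa [WeakAction.map, comp] using
    S.pentagon e_gh e_hk e_kl e_gh_k e_g_hk e_hk_l e_h_kl e_ghk_l e_gh_kl e_g_hkl a b c d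

lemma triangle_map {g h k : G} (e : g * h = k) {x y z : C} (a : (S.functor g).obj x ⟶ y)
    (b : (S.functor h).obj y ⟶ z) :
    (S.assoc (mul_one g) (one_mul h) e e a (S.ι y) b).hom ≫ S.map e (𝟙 b) (S.leftUnitor a).hom =
      S.map e (S.rightUnitor b).hom (𝟙 a) := by
  simpa [WeakAction.map, comp] using S.triangle e a b

end WeakAction

namespace CatG

/-- An invertible 2-cell given by a natural isomorphism. -/
def natIso {X Y : Bicategory.Pith Cat.{w, v}} {F F' : X ⟶ Y}
    (app : ∀ p : X.as, F.of.toFunctor.obj p ≅ F'.of.toFunctor.obj p)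
    (nat : ∀ (p q : X.as) (t : p ⟶ q),
      F.of.toFunctor.map t ≫ (app q).hom = (app p).hom ≫ F'.of.toFunctor.map t) : F ≅ F' :=
  Core.isoMk (Cat.Hom.isoMk (NatIso.ofComponents app fun {p q} t => nat p q t))

/-- The underlying object of `C` of an object of `ᵍC`. -/
def un : ∀ (g : Variance) {X : Bicategory.Pith Cat.{w, v}}, ((act g).obj X).as → X.as
  | .pos, _, x => x
  | .neg, _, x => Opposite.unop x

end CatG

end TwistedBicat

namespace TwistedBicat

local infixr:81 " ◃ " => Bicategory.whiskerLeft
local infixl:81 " ▹ " => Bicategory.whiskerRight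
local infixr:80 " ⊚ " => bicategoricalComp
local notation "𝒶" => Bicategory.associator
local notation "𝓁" => Bicategory.leftUnitor
local notation "𝓇" => Bicategory.rightUnitor

namespace WeakDualityInvolution

variable {B : Type u₁} [Bicategory.{w₁, v₁} B] (D : WeakDualityInvolution B)

/-- The weak action on `B`, with its invertible 2-cells, of a weak duality involution. -/
abbrev action : WeakAction Variance (Bicategory.Pith B) := D.weakInvolution.weakAction

open scoped Pseudofunctor.StrongTrans

/-- The associativity constraint. -/
def assocIso : ∀ {g h k a b c : Variance} (e₁ : g * h = a) (e₂ : h * k = b) (e₃ : a * k = c)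
    (e₄ : g * b = c) (w x y z : B),
    (D.toVariantData.comp e₂ x y z ⊗ₘ 𝟙 ((CatG.act b).obj (D.toVariantData.hom g w x))) ≫
        D.toVariantData.comp e₄ w x z ≅
      twistedAssoc e₂ (D.toVariantData.hom k y z) (D.toVariantData.hom h x y)
          (D.toVariantData.hom g w x) ≫
        (𝟙 (D.toVariantData.hom k y z) ⊗ₘ (CatG.act k).map (D.toVariantData.comp e₁ w x y)) ≫
        D.toVariantData.comp e₃ w y z
  | .pos, .pos, .pos, .pos, .pos, .pos, e₁, e₂, e₃, e₄, w, x, y, z => CatG.natIso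
      (fun p : ((y ⟶ z) × (x ⟶ y)) × (w ⟶ x) =>
        (D.action.assoc e₁ e₂ e₃ e₄ (w := ⟨w⟩) (x := ⟨x⟩) (y := ⟨y⟩) (z := ⟨z⟩) ⟨p.2⟩ ⟨p.1.2⟩ ⟨p.1.1⟩).hom.iso)
      fun p q (t : @Quiver.Hom (((y ⟶ z) × (x ⟶ y)) × (w ⟶ x)) _ p q) => rep_con_natural _ t.1.1
        (unitNat_natural t.2) (id_natural _)
        (id_natural _)
  | .neg, .pos, .pos, .neg, .pos, .neg, e₁, e₂, e₃, e₄, w, x, y, z => CatG.natIso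
      (fun p : ((y ⟶ z) × (x ⟶ y)) × (D.dual.obj ⟨w⟩ ⟶ x) =>
        (D.action.assoc e₁ e₂ e₃ e₄ (w := ⟨w⟩) (x := ⟨x⟩) (y := ⟨y⟩) (z := ⟨z⟩) ⟨p.2⟩ ⟨p.1.2⟩ ⟨p.1.1⟩).hom.iso)
      fun p q (t : @Quiver.Hom (((y ⟶ z) × (x ⟶ y)) × (D.dual.obj ⟨w⟩ ⟶ x)) _ p q) => rep_con_natural _ t.1.1
        (unitNat_natural t.2) (id_natural _)
        (id_natural _)
  | .pos, .pos, .neg, .pos, .neg, .neg, e₁, e₂, e₃, e₄, w, x, y, z => CatG.natIso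
      (fun p : ((D.dual.obj ⟨y⟩ ⟶ z) × (x ⟶ y)ᵒᵖ) × (w ⟶ x)ᵒᵖ =>
        (D.action.assoc e₁ e₂ e₃ e₄ (w := ⟨w⟩) (x := ⟨x⟩) (y := ⟨y⟩) (z := ⟨z⟩) ⟨p.2.unop⟩ ⟨p.1.2.unop⟩ ⟨p.1.1⟩).hom.iso)
      fun p q (t : @Quiver.Hom (((D.dual.obj ⟨y⟩ ⟶ z) × (x ⟶ y)ᵒᵖ) × (w ⟶ x)ᵒᵖ) _ p q) => rep_con_natural _ t.1.1
        (unitNat_natural (D.dual.map₂ (Co.mkHom₂ t.2.unop))) (mapComp_inv_natural D.dual (Co.mkHom₂ t.2.unop) (Co.mkHom₂ t.1.2.unop))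
        (whiskerLeft_mapComp_inv D.dual _ _)
  | .neg, .pos, .neg, .neg, .neg, .pos, e₁, e₂, e₃, e₄, w, x, y, z => CatG.natIso
      (fun p : ((D.dual.obj ⟨y⟩ ⟶ z) × (x ⟶ y)ᵒᵖ) × (D.dual.obj ⟨w⟩ ⟶ x)ᵒᵖ =>
        (D.action.assoc e₁ e₂ e₃ e₄ (w := ⟨w⟩) (x := ⟨x⟩) (y := ⟨y⟩) (z := ⟨z⟩) ⟨p.2.unop⟩ ⟨p.1.2.unop⟩ ⟨p.1.1⟩).hom.iso)
      fun p q (t : @Quiver.Hom (((D.dual.obj ⟨y⟩ ⟶ z) × (x ⟶ y)ᵒᵖ) × (D.dual.obj ⟨w⟩ ⟶ x)ᵒᵖ) _ p q) => rep_con_natural _ t.1.1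
        (unitNat_natural (D.dual.map₂ (Co.mkHom₂ t.2.unop))) (mapComp_inv_natural D.dual (Co.mkHom₂ t.2.unop) (Co.mkHom₂ t.1.2.unop))
        (whiskerLeft_mapComp_inv D.dual _ _)
  | .pos, .neg, .pos, .neg, .neg, .neg, e₁, e₂, e₃, e₄, w, x, y, z => CatG.natIso
      (fun p : ((y ⟶ z) × (D.dual.obj ⟨x⟩ ⟶ y)) × (w ⟶ x)ᵒᵖ =>
        (D.action.assoc e₁ e₂ e₃ e₄ (w := ⟨w⟩) (x := ⟨x⟩) (y := ⟨y⟩) (z := ⟨z⟩) ⟨p.2.unop⟩ ⟨p.1.2⟩ ⟨p.1.1⟩).hom.iso)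
      fun p q (t : @Quiver.Hom (((y ⟶ z) × (D.dual.obj ⟨x⟩ ⟶ y)) × (w ⟶ x)ᵒᵖ) _ p q) => rep_con_natural _ t.1.1
        (unitNat_natural (D.dual.map₂ (Co.mkHom₂ t.2.unop))) (id_natural _)
        (id_natural _)
  | .neg, .neg, .pos, .pos, .neg, .pos, e₁, e₂, e₃, e₄, w, x, y, z => CatG.natIso
      (fun p : ((y ⟶ z) × (D.dual.obj ⟨x⟩ ⟶ y)) × (D.dual.obj ⟨w⟩ ⟶ x)ᵒᵖ =>
        (D.action.assoc e₁ e₂ e₃ e₄ (w := ⟨w⟩) (x := ⟨x⟩) (y := ⟨y⟩) (z := ⟨z⟩) ⟨p.2.unop⟩ ⟨p.1.2⟩ ⟨p.1.1⟩).hom.iso)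
      fun p q (t : @Quiver.Hom (((y ⟶ z) × (D.dual.obj ⟨x⟩ ⟶ y)) × (D.dual.obj ⟨w⟩ ⟶ x)ᵒᵖ) _ p q) => rep_con_natural _ t.1.1
        (unitNat_natural (D.dual.map₂ (Co.mkHom₂ t.2.unop))) (id_natural _)
        (id_natural _)
  | .pos, .neg, .neg, .neg, .pos, .pos, e₁, e₂, e₃, e₄, w, x, y, z => CatG.natIso
      (fun p : ((D.dual.obj ⟨y⟩ ⟶ z) × (D.dual.obj ⟨x⟩ ⟶ y)ᵒᵖ) × (w ⟶ x) =>
        (D.action.assoc e₁ e₂ e₃ e₄ (w := ⟨w⟩) (x := ⟨x⟩) (y := ⟨y⟩) (z := ⟨z⟩) ⟨p.2⟩ ⟨p.1.2.unop⟩ ⟨p.1.1⟩).hom.iso)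
      fun p q (t : @Quiver.Hom (((D.dual.obj ⟨y⟩ ⟶ z) × (D.dual.obj ⟨x⟩ ⟶ y)ᵒᵖ) × (w ⟶ x)) _ p q) => rep_con_natural _ t.1.1
        (D.φ.hom.naturality_naturality t.2) (mapComp_inv_natural D.dual (Co.mkHom₂ (D.dual.map₂ (Co.mkHom₂ t.2))) (Co.mkHom₂ t.1.2.unop))
        (whiskerLeft_mapComp_inv D.dual _ _)
  | .neg, .neg, .neg, .pos, .pos, .neg, e₁, e₂, e₃, e₄, w, x, y, z => CatG.natIso
      (fun p : ((D.dual.obj ⟨y⟩ ⟶ z) × (D.dual.obj ⟨x⟩ ⟶ y)ᵒᵖ) × (D.dual.obj ⟨w⟩ ⟶ x) =>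
        (D.action.assoc e₁ e₂ e₃ e₄ (w := ⟨w⟩) (x := ⟨x⟩) (y := ⟨y⟩) (z := ⟨z⟩) ⟨p.2⟩ ⟨p.1.2.unop⟩ ⟨p.1.1⟩).hom.iso)
      fun p q (t : @Quiver.Hom (((D.dual.obj ⟨y⟩ ⟶ z) × (D.dual.obj ⟨x⟩ ⟶ y)ᵒᵖ) × (D.dual.obj ⟨w⟩ ⟶ x)) _ p q) => rep_con_natural _ t.1.1
        (D.φ.hom.naturality_naturality t.2) (mapComp_inv_natural D.dual (Co.mkHom₂ (D.dual.map₂ (Co.mkHom₂ t.2))) (Co.mkHom₂ t.1.2.unop))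
        (whiskerLeft_mapComp_inv D.dual _ _)

/-- The left unitality constraint. -/
def leftUnitorIso (g : Variance) (x y : B) :
    (D.toVariantData.id y ⊗ₘ 𝟙 ((CatG.act 1).obj (D.toVariantData.hom g x y))) ≫
        D.toVariantData.comp (mul_one g) x y y ≅
      (λ_ ((CatG.act 1).obj (D.toVariantData.hom g x y))).hom ≫
        (TwistingAction.oneIso (G := Variance)).hom.app (D.toVariantData.hom g x y) :=
  match g with
  | .pos => CatG.natIso
      (fun p : (𝟙_ Cat.{w₁, v₁}) × (x ⟶ y) =>
        (D.action.leftUnitor (g := .pos) (x := ⟨x⟩) (y := ⟨y⟩) ⟨p.2⟩).hom.iso)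
      fun p q (t : @Quiver.Hom ((𝟙_ Cat.{w₁, v₁}) × (x ⟶ y)) _ p q) =>
        whiskerLeft_del_natural _ (unitNat_natural t.2)
  | .neg => CatG.natIso
      (fun p : (𝟙_ Cat.{w₁, v₁}) × (D.dual.obj ⟨x⟩ ⟶ y) =>
        (D.action.leftUnitor (g := .neg) (x := ⟨x⟩) (y := ⟨y⟩) ⟨p.2⟩).hom.iso)
      fun p q (t : @Quiver.Hom ((𝟙_ Cat.{w₁, v₁}) × (D.dual.obj ⟨x⟩ ⟶ y)) _ p q) =>
        whiskerLeft_del_natural _ (unitNat_natural t.2)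

/-- The right unitality constraint. -/
def rightUnitorIso (g : Variance) (x y : B) :
    (𝟙 (D.toVariantData.hom g x y) ⊗ₘ (Functor.LaxMonoidal.ε (CatG.act g) ≫
        (CatG.act g).map (D.toVariantData.id x))) ≫ D.toVariantData.comp (one_mul g) x x y ≅
      (ρ_ (D.toVariantData.hom g x y)).hom :=
  match g with
  | .pos => CatG.natIso
      (fun p : (x ⟶ y) × (𝟙_ Cat.{w₁, v₁}) =>
        (D.action.rightUnitor (h := .pos) (y := ⟨x⟩) (z := ⟨y⟩) ⟨p.1⟩).hom.iso)
      fun p q (t : @Quiver.Hom ((x ⟶ y) × (𝟙_ Cat.{w₁, v₁})) _ p q) =>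
        whiskerLeft_id_comp_del_natural _ rfl t.1
  | .neg => CatG.natIso
      (fun p : (D.dual.obj ⟨x⟩ ⟶ y) × (𝟙_ Cat.{w₁, v₁}) =>
        (D.action.rightUnitor (h := .neg) (y := ⟨x⟩) (z := ⟨y⟩) ⟨p.1⟩).hom.iso)
      fun p q (t : @Quiver.Hom ((D.dual.obj ⟨x⟩ ⟶ y) × (𝟙_ Cat.{w₁, v₁})) _ p q) =>
        whiskerLeft_id_comp_del_natural _ (D.dual.map₂_id _) t.1

set_option maxHeartbeats 8000000 in
theorem exists_variantBicategory :
    ∃ P : VariantBicategory Variance (Bicategory.Pith Cat.{w₁, v₁}) B,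
      P.toVariantData = D.toVariantData := by
  refine ⟨VariantBicategory.mk D.toVariantData D.assocIso D.leftUnitorIso D.rightUnitorIso
    ?_ ?_, rfl⟩
  · intro g h k l gh hk kl ghk hkl ghkl e_gh e_hk e_kl e_gh_k e_g_hk e_hk_l e_h_kl e_ghk_l e_gh_kl
      e_g_hkl v w x y z
    rcases g with _ | _ <;> rcases h with _ | _ <;> rcases k with _ | _ <;> rcases l with _ | _ <;>
    (first | obtain rfl : gh = .pos := e_gh.symm | obtain rfl : gh = .neg := e_gh.symm) <;>
    (first | obtain rfl : hk = .pos := e_hk.symm | obtain rfl : hk = .neg := e_hk.symm) <;>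
    (first | obtain rfl : kl = .pos := e_kl.symm | obtain rfl : kl = .neg := e_kl.symm) <;>
    (first | obtain rfl : ghk = .pos := e_gh_k.symm | obtain rfl : ghk = .neg := e_gh_k.symm) <;>
    (first | obtain rfl : hkl = .pos := e_hk_l.symm | obtain rfl : hkl = .neg := e_hk_l.symm) <;>
    (first | obtain rfl : ghkl = .pos := e_ghk_l.symm | obtain rfl : ghkl = .neg := e_ghk_l.symm) <;>
    exact CatG.hom₂_ext fun p => intersperse_id (congrArg (fun η => η.iso.hom)
      (D.action.pentagon_map e_gh e_hk e_kl e_gh_k e_g_hk e_hk_l e_h_kl e_ghk_l e_gh_kl e_g_hkl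
        (v := ⟨v⟩) (w := ⟨w⟩) (x := ⟨x⟩) (y := ⟨y⟩) (z := ⟨z⟩)
        ⟨CatG.un _ (Prod.snd p)⟩ ⟨CatG.un _ (Prod.snd (Prod.fst p))⟩
        ⟨CatG.un _ (Prod.snd (Prod.fst (Prod.fst p)))⟩ ⟨Prod.fst (Prod.fst (Prod.fst p))⟩))
  · intro g h k e x y z
    rcases g with _ | _ <;> rcases h with _ | _
    · obtain rfl : k = .pos := e.symm
      exact CatG.hom₂_ext fun (p : ((y ⟶ z) × (𝟙_ Cat.{w₁, v₁})) × (x ⟶ y)) =>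
        intersperse_id' (congrArg (fun η => η.iso.hom) (D.action.triangle_map (g := .pos) (h := .pos)
          e (x := ⟨x⟩) (y := ⟨y⟩) (z := ⟨z⟩) ⟨p.2⟩ ⟨p.1.1⟩))
    · obtain rfl : k = .neg := e.symm
      exact CatG.hom₂_ext fun (p : ((D.dual.obj ⟨y⟩ ⟶ z) × (𝟙_ Cat.{w₁, v₁})) × (x ⟶ y)ᵒᵖ) =>
        intersperse_id' (congrArg (fun η => η.iso.hom) (D.action.triangle_map (g := .pos) (h := .neg)
          e (x := ⟨x⟩) (y := ⟨y⟩) (z := ⟨z⟩) ⟨p.2.unop⟩ ⟨p.1.1⟩))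
    · obtain rfl : k = .neg := e.symm
      exact CatG.hom₂_ext fun (p : ((y ⟶ z) × (𝟙_ Cat.{w₁, v₁})) × (D.dual.obj ⟨x⟩ ⟶ y)) =>
        intersperse_id' (congrArg (fun η => η.iso.hom) (D.action.triangle_map (g := .neg) (h := .pos)
          e (x := ⟨x⟩) (y := ⟨y⟩) (z := ⟨z⟩) ⟨p.2⟩ ⟨p.1.1⟩))
    · obtain rfl : k = .pos := e.symm
      exact CatG.hom₂_ext fun (p : ((D.dual.obj ⟨y⟩ ⟶ z) × (𝟙_ Cat.{w₁, v₁})) × (D.dual.obj ⟨x⟩ ⟶ y)ᵒᵖ) =>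
        intersperse_id' (congrArg (fun η => η.iso.hom) (D.action.triangle_map (g := .neg) (h := .neg)
          e (x := ⟨x⟩) (y := ⟨y⟩) (z := ⟨z⟩) ⟨p.2.unop⟩ ⟨p.1.1⟩))

end WeakDualityInvolution
end TwistedBicat

namespace TwistedBicat

local infixr:81 " ◃ " => Bicategory.whiskerLeft
local infixl:81 " ▹ " => Bicategory.whiskerRight
local infixr:80 " ⊚ " => bicategoricalComp
local notation "𝒶" => Bicategory.associator
local notation "𝓁" => Bicategory.leftUnitor
local notation "𝓇" => Bicategory.rightUnitor



section

variable {B : Type u₁} [Bicategory.{w₁, v₁} B]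

lemma whiskerLeft_id_comp_natural {x y t : B} (p : x ⟶ y) {i : y ⟶ y} {l : i ⟶ i}
    (hl : l = 𝟙 i) (τ : i ⟶ 𝟙 y) {b b' : y ⟶ t} (n : b ⟶ b') :
    p ◃ (l ▹ b ≫ i ◃ n) ≫ p ◃ (τ ▹ b' ≫ (𝓁 b').hom) = p ◃ (τ ▹ b ≫ (𝓁 b).hom) ≫ p ◃ n := by
  rw [hl, Bicategory.id_whiskerRight, Category.id_comp, ← Bicategory.whiskerLeft_comp,
    Bicategory.whisker_exchange_assoc, Bicategory.leftUnitor_naturality,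
    ← Bicategory.whiskerLeft_comp, Category.assoc]

lemma exists_equivalence_hom_eq_of_precomp {x y z : B} {p : x ⟶ y} {q : y ⟶ x}
    (a : p ≫ q ≅ 𝟙 x) (b : q ≫ p ≅ 𝟙 y)
    {f : (⟨Cat.of (y ⟶ z)⟩ : Bicategory.Pith Cat.{w₁, v₁}) ⟶ ⟨Cat.of (x ⟶ z)⟩}
    (i : f ≅ ⟨(Bicategory.precomp z p).toCatHom⟩) :
    ∃ E : Bicategory.Equivalence _ _, E.hom = f :=
  exists_equivalence_hom_eq i (g := ⟨(Bicategory.precomp z q).toCatHom⟩)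
    (CatG.natIso (fun c : (y ⟶ z) => delIso b c)
      fun c d (t : @Quiver.Hom (y ⟶ z) _ c d) => del_natural b.hom t).symm
    (CatG.natIso (fun c : (x ⟶ z) => delIso a c)
      fun c d (t : @Quiver.Hom (x ⟶ z) _ c d) => del_natural a.hom t)

end

namespace WeakDualityInvolution

variable {B : Type u₁} [Bicategory.{w₁, v₁} B] (D : WeakDualityInvolution B)

open scoped Pseudofunctor.StrongTrans

/-- The component at an object of the unit of the equivalence `φ`. -/
def unitApp (x : B) : D.φ.hom.app x ≫ D.φ.inv.app x ≅ 𝟙 x where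
  hom := D.φ.unit.inv.as.app x
  inv := D.φ.unit.hom.as.app x
  hom_inv_id := congrArg (fun m => m.as.app x) D.φ.unit.inv_hom_id
  inv_hom_id := congrArg (fun m => m.as.app x) D.φ.unit.hom_inv_id

/-- The component at an object of the counit of the equivalence `φ`. -/
def counitApp (x : B) : D.φ.inv.app x ≫ D.φ.hom.app x ≅
    𝟙 (D.dual.obj ⟨D.dual.obj ⟨x⟩⟩) where
  hom := D.φ.counit.hom.as.app x
  inv := D.φ.counit.inv.as.app x
  hom_inv_id := congrArg (fun m => m.as.app x) D.φ.counit.hom_inv_id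
  inv_hom_id := congrArg (fun m => m.as.app x) D.φ.counit.inv_hom_id

/-- The object `x°` is the weak opposite of `x`. -/
theorem isTwistedCopower (x : B) :
    D.toVariantData.IsTwistedCopower .neg x (D.dual.obj ⟨x⟩) (D.χ x) := by
  intro h k e y
  rcases h with _ | _
  · obtain rfl : k = .neg := e.symm
    exact exists_equivalence_hom_eq_of_precomp (z := y) (p := 𝟙 (D.dual.obj ⟨x⟩)) (q := 𝟙 _)
      (𝓁 _) (𝓁 _) (CatG.natIso
        (fun c : (D.dual.obj ⟨x⟩ ⟶ y) => Bicategory.whiskerLeftIso (𝟙 (D.dual.obj ⟨x⟩))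
          (Bicategory.whiskerRightIso (Iso.refl (𝟙 (D.dual.obj ⟨x⟩))) c ≪≫ 𝓁 c))
        fun c d (t : @Quiver.Hom (D.dual.obj ⟨x⟩ ⟶ y) _ c d) =>
          whiskerLeft_id_comp_natural _ rfl (𝟙 _) t)
  · obtain rfl : k = .pos := e.symm
    exact exists_equivalence_hom_eq_of_precomp (z := y) (D.unitApp x) (D.counitApp x) (CatG.natIso
        (fun c : (D.dual.obj ⟨D.dual.obj ⟨x⟩⟩ ⟶ y) => Bicategory.whiskerLeftIso (D.φ.hom.app x)
          (Bicategory.whiskerRightIso (D.dual.mapId ⟨D.dual.obj ⟨x⟩⟩) c ≪≫ 𝓁 c))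
        fun c d (t : @Quiver.Hom (D.dual.obj ⟨D.dual.obj ⟨x⟩⟩ ⟶ y) _ c d) =>
          whiskerLeft_id_comp_natural _ (D.dual.map₂_id _) (D.dual.mapId _).hom t)

end WeakDualityInvolution

end TwistedBicat

theorem mainTheorem5 :
    (∀ (G : Type t) [Group G] (W : Type u) [CategoryTheory.Bicategory.{w, v} W]
        [CategoryTheory.Bicategory.Strict W] [TwistedBicat.MonoidalTwoCategory W]
        [TwistedBicat.TwistingAction G W] (O : Type s)
        (A : TwistedBicat.EnrichedBicategory W O) (T : TwistedBicat.TwistedAction G A),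
      ∃ P : TwistedBicat.VariantBicategory G W O,
        P.toVariantData = T.toVariantData ∧
        P.toVariantData.HasTwistedCopowers ∧
        ∀ (g : G) (x : O),
          T.toVariantData.IsTwistedCopower g x ((T.functor g).obj x)
            (A.id ((T.functor g).obj x))) ∧
    (∀ (B : Type u₁) [CategoryTheory.Bicategory.{w₁, v₁} B]
        (D : TwistedBicat.WeakDualityInvolution B),
      ∃ P : TwistedBicat.VariantBicategory TwistedBicat.Variance
          (CategoryTheory.Bicategory.Pith CategoryTheory.Cat.{w₁, v₁}) B,
        P.toVariantData = D.toVariantData ∧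
        ∀ x : B, D.toVariantData.IsTwistedCopower TwistedBicat.Variance.neg x
          (D.dual.obj ⟨x⟩) (D.χ x)) := by
  refine ⟨fun G _ W _ _ _ _ O A T => ?_, fun B _ D => ?_⟩
  · obtain ⟨P, hP⟩ := T.exists_variantBicategory
    exact ⟨P, hP, hP ▸ T.hasTwistedCopowers, T.isTwistedCopower⟩
  · obtain ⟨P, hP⟩ := D.exists_variantBicategory
    exact ⟨P, hP, D.isTwistedCopower⟩
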